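/- **Realisations and periods.** Let $k_{dR},\mathbb Q_B\subset\mathbb C$ be subfields. Let $\mathcal T$ be the Tannakian category of triples $V=(V_B,V_{dR},c)$, where $V_B$ (resp. $V_{dR}$) is a finite-dimensional vector space over $\mathbb Q_B$ (resp. $k_{dR}$) and $c:V_{dR}\otimes_{k_{dR}}\mathbb C\to V_B\otimes_{\mathbb Q_B}\mathbb C$ is a $\mathbb C$-linear isomorphism. A morphism is a pair of linear maps compatible with the comparison isomorphisms. Let $\omega_B,\omega_{dR}$ be the two fibre functors, $$\mathcal P^{\mathfrak m}=\mathcal O(\mathrm{Isom}^\otimes(\omega_{dR},\omega_B)),\qquad \mathcal P^{\mathfrak{dr}}=\mathcal O(\mathrm{Aut}^\otimes(\omega_{dR})),$$ which are algebras over $k_{dR}\otimes_{\mathbb Q}\mathbb Q_B$ and $k_{dR}$ respectively, with matrix coefficients $[V,\sigma,\omega]^{\mathfrak m}$ ($\sigma\in V_B^\vee$, $\omega\in V_{dR}$) and $[V,f,\omega]^{\mathfrak{dr}}$ ($f\in V_{dR}^\vee$, $\omega\in V_{dR}$). The coaction $\Delta:\mathcal P^{\mathfrak m}\to\mathcal P^{\mathfrak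 m}\otimes_{k_{dR}}\mathcal P^{\mathfrak{dr}}$ is the algebra homomorphism with $\Delta[V,\sigma,\omega]^{\mathfrak m}=\sum_i[V,\sigma,e_i]^{\mathfrak m}\otimes[V,e_i^\vee,\omega]^{\mathfrak{dr}}$ for any basis $(e_i)$ of $V_{dR}$. **Cohomology with coefficients.** Let $\Sigma=\{\sigma_0=0,\sigma_1,\dots,\sigma_n\}\subset k_{dR}$, let $X=\mathbb A^1_{k_{dR}}\setminus\Sigma$ and let $s=(s_0,\dots,s_n)\in k_{dR}^{n+1}$ with $e^{2\pi i s_j}\in\mathbb Q_B$. Put $\nabla_s=d+\sum_j s_j\frac{dx}{x-\sigma_j}$ and $H^1_{dR}(X,\nabla_s)=\Omega^1(X)/\nabla_s\mathcal O(X)$. Let $\mathcal L_s^\vee$ be the rank one $\mathbb Q_B$-local system on $\mathbb C\setminus\Sigma$ spanned by the branches of $x^{s_0}\prod_{k\ge1}(1-x\sigma_k^{-1})^{s_k}$ and $\mathcal L_s$ its dual. Set $$M_\Sigma(s)=\big(H^1(\mathbb C\setminus\Sigma,\mathcal L_s),\ H^1_{dR}(X,\nabla_s),\ \mathrm{comp}_{B,dR}\big),$$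 where the comparison is given by integration of forms along smooth cycles with coefficients in $\mathcal L_s^\vee$. When all $s_j$ and $\sum_j s_j$ are non-integral, forms of $M_\Sigma(-s)_{dR}$ are viewed as elements of $M_\Sigma(s)_{dR}^\vee$ through the de Rham intersection pairing $$\langle\nu,\omega\rangle^{dR}=\frac1{2\pi i}\iint_{\mathbb C\setminus\Sigma}\widetilde\nu\wedge\omega ,$$ with $\widetilde\nu$ a smooth compactly supported representative of the class of $\nu$. **Hypergeometric and beta periods.** Let $k\subset\mathbb C$ be a subfield, let $y\in k\setminus\{0,1\}$ with $y\notin(1,+\infty)$, and let $a,b,c\in\mathbb C$ with $a,b,c,c-a,c-b\notin\mathbb Z$. Take $k_{dR}=k(a,b,c)$ and $\mathbb Q_B=\mathbb Q(e^{2\pi ia},e^{2\pi ib},e^{2\pi ic})$. Put $$M_{a,b,c}(y)=M_{\{0,1,y^{-1}\}}(b,c-b,-a),\qquad M_{b,c-b}=M_{\{0,1\}}(b,c-b).$$ Write $\eta_1=\frac{dx}{x(1-x)}$ and $\eta_2=\frac{dx}{1-yx}$. Let $\varphi_1\in M_{a,b,c}(y)_B^\vee$ be the class of the open interval $(0,1)$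 with the principal branch of $x^b(1-x)^{c-b}(1-yx)^{-a}$, through the isomorphism of locally finite homology and homology. Let $\varphi\in M_{b,c-b,B}^\vee$ be the class of $(0,1)$ with the principal branch of $x^b(1-x)^{c-b}$. Define $$\beta^{\mathfrak m}(b,c-b)=[M_{b,c-b},\varphi,\eta_1]^{\mathfrak m},\qquad \beta^{\mathfrak{dr}}(b,c-b)=[M_{b,c-b},-\eta_1,\eta_1]^{\mathfrak{dr}},$$ $$\mathcal F^{\mathfrak m}(a,b,c;y)=[M_{a,b,c}(y),\varphi_1,\eta_1]^{\mathfrak m},\quad \mathcal F^{\mathfrak{dr}}(a,b,c;y)=[M_{a,b,c}(y),-\eta_1,\eta_1]^{\mathfrak{dr}},\quad \mathcal G^{\mathfrak{dr}}(a,b,c;y)=[M_{a,b,c}(y),-y\,\eta_2,\eta_1]^{\mathfrak{dr}},$$ $$F^{\bullet}(a,b,c;y)=\beta^{\bullet}(b,c-b)^{-1}\mathcal F^{\bullet}(a,b,c;y)\ \ (\bullet\in\{\mathfrak m,\mathfrak{dr}\}),\qquad G^{\mathfrak{dr}}(a,b,c;y)=\tfrac{a(c-a)}{c}\,\beta^{\mathfrak{dr}}(b,c-b)^{-1}\,\mathcal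 G^{\mathfrak{dr}}(a,b,c;y).$$ **Proposition.** All these data are well defined for $(a,b,c)$ and for $(1+a,1+b,2+c)$: the cohomology groups are finite-dimensional, and the comparison isomorphisms, the intersection pairings and the classes $\varphi_1,\varphi$ exist and are unique. In $\mathcal P^{\mathfrak m}\otimes_{k_{dR}}\mathcal P^{\mathfrak{dr}}$ one has $$\Delta\mathcal F^{\mathfrak m}(a,b,c;y)=\tfrac{b(c-b)}{c}\,\mathcal F^{\mathfrak m}(a,b,c;y)\otimes\mathcal F^{\mathfrak{dr}}(a,b,c;y)-y\,\tfrac{a(c-a)}{c}\,\mathcal F^{\mathfrak m}(1+a,1+b,2+c;y)\otimes\mathcal G^{\mathfrak{dr}}(a,b,c;y).$$ Moreover $\beta^{\mathfrak m}(b,c-b)$, $\beta^{\mathfrak{dr}}(b,c-b)$ and $\beta^{\mathfrak m}(1+b,1+c-b)$ are invertible, and $$\Delta F^{\mathfrak m}(a,b,c;y)=F^{\mathfrak m}(a,b,c;y)\otimes F^{\mathfrak{dr}}(a,b,c;y)-\tfrac{y}{1+c}\,F^{\mathfrak m}(1+a,1+b,2+c;y)\otimes G^{\mathfrak{dr}}(a,b,c;y).$$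 -/

import Mathlib

open TensorProduct

noncomputable section

namespace TwistedPeriods

/-! ### The category of Betti and de Rham realisations -/

/-- An object `(V_B, V_dR, c)` of the category `𝒯`: finite-dimensional vector spaces over the
subfields `Q` (Betti) and `K` (de Rham) of `ℂ`, with a comparison isomorphism over `ℂ`. -/
structure Obj (K Q : Type) [Field K] [Field Q] [Algebra K ℂ] [Algebra Q ℂ] : Type 1 where
  B : Type
  dR : Type
  [addCommGroupB : AddCommGroup B]
  [moduleB : Module Q B]
  [finiteB : FiniteDimensional Q B]
  [addCommGroupdR : AddCommGroup dR]
  [moduledR : Module K dR]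
  [finitedR : FiniteDimensional K dR]
  comp : ℂ ⊗[K] dR ≃ₗ[ℂ] ℂ ⊗[Q] B

attribute [instance] Obj.addCommGroupB Obj.moduleB Obj.finiteB
  Obj.addCommGroupdR Obj.moduledR Obj.finitedR

/-- A morphism of `𝒯`: a pair of linear maps compatible with the comparison isomorphisms. -/
@[ext]
structure Obj.Hom {K Q : Type} [Field K] [Field Q] [Algebra K ℂ] [Algebra Q ℂ] (V W : Obj K Q) : Type where
  B : V.B →ₗ[Q] W.B
  dR : V.dR →ₗ[K] W.dR
  comm : ∀ x : ℂ ⊗[K] V.dR,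
    W.comp (dR.baseChange ℂ x) = B.baseChange ℂ (V.comp x)

instance {K Q : Type} [Field K] [Field Q] [Algebra K ℂ] [Algebra Q ℂ] : CategoryTheory.Category (Obj K Q) where
  Hom := Obj.Hom
  id V := ⟨LinearMap.id, LinearMap.id, fun x => by simp [LinearMap.baseChange_id]⟩
  comp f g := ⟨g.B ∘ₗ f.B, g.dR ∘ₗ f.dR, fun x => by
    simp [LinearMap.baseChange_comp, f.comm, g.comm]⟩

/-- The tensor product of two objects of `𝒯`. -/
abbrev Obj.tensor {K Q : Type} [Field K] [Field Q] [Algebra K ℂ] [Algebra Q ℂ] (V W : Obj K Q) : Obj K Q where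
  B := V.B ⊗[Q] W.B
  dR := V.dR ⊗[K] W.dR
  comp := (AlgebraTensorModule.distribBaseChange K ℂ V.dR W.dR).trans
    ((TensorProduct.congr V.comp W.comp).trans
      (AlgebraTensorModule.distribBaseChange Q ℂ V.B W.B).symm)

/-- The unit object `(Q, K, id_ℂ)` of `𝒯`. -/
abbrev Obj.unit (K Q : Type) [Field K] [Field Q] [Algebra K ℂ] [Algebra Q ℂ] : Obj K Q where
  B := Q
  dR := K
  comp := (AlgebraTensorModule.rid K ℂ ℂ).trans (AlgebraTensorModule.rid Q ℂ ℂ).symm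

/-! ### Rings of motivic and de Rham periods

The affine scheme `Isom^⊗(ω_dR, ω_B)` over `K ⊗ Q` represents the functor that sends a
`(K ⊗ Q)`-algebra `R` to the set of families of `R`-linear maps `V_dR ⊗ R → V_B ⊗ R` that are natural
in `V` and compatible with tensor products and with the unit object (such families consist of
isomorphisms because `𝒯` is rigid). Such a family is the same as a family of elements
`[V, σ, ω] ∈ R`, bilinear in `(σ, ω)`, subject to the relations below; hence the coordinate
ring is the commutative `(K ⊗ Q)`-algebra with these generators and relations. In it every element
is a sum of matrix coefficients, and `[V, σ, ω] * [W, τ, η] = [V ⊗ W, σ ⊗ τ, ω ⊗ η]`.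
The same holds for `Aut^⊗(ω_dR)` over `K`. -/

/-- Triples `(V, σ, ω)` with `σ ∈ V_B^∨` and `ω ∈ V_dR`. -/
structure MotTriple (K Q : Type) [Field K] [Field Q] [Algebra K ℂ] [Algebra Q ℂ] : Type 1 where
  V : Obj K Q
  σ : Module.Dual Q V.B
  ω : V.dR

/-- Triples `(V, f, ω)` with `f ∈ V_dR^∨` and `ω ∈ V_dR`. -/
structure DRTriple (K Q : Type) [Field K] [Field Q] [Algebra K ℂ] [Algebra Q ℂ] : Type 1 where
  V : Obj K Q
  f : Module.Dual K V.dR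
  ω : V.dR

/-- Relations between matrix coefficients `[V, σ, ω]^𝔪`. -/
inductive MotRel (K Q : Type) [Field K] [Field Q] [Algebra K ℂ] [Algebra Q ℂ]
    [CharZero K] [CharZero Q] :
    MvPolynomial (MotTriple K Q) (K ⊗[ℚ] Q) → MvPolynomial (MotTriple K Q) (K ⊗[ℚ] Q) → Prop
  | add_left (V : Obj K Q) (σ τ : Module.Dual Q V.B) (ω : V.dR) :
      MotRel K Q (.X ⟨V, σ + τ, ω⟩) (.X ⟨V, σ, ω⟩ + .X ⟨V, τ, ω⟩)
  | smul_left (V : Obj K Q) (q : Q) (σ : Module.Dual Q V.B) (ω : V.dR) :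
      MotRel K Q (.X ⟨V, q • σ, ω⟩) (.C (1 ⊗ₜ q) * .X ⟨V, σ, ω⟩)
  | add_right (V : Obj K Q) (σ : Module.Dual Q V.B) (ω η : V.dR) :
      MotRel K Q (.X ⟨V, σ, ω + η⟩) (.X ⟨V, σ, ω⟩ + .X ⟨V, σ, η⟩)
  | smul_right (V : Obj K Q) (r : K) (σ : Module.Dual Q V.B) (ω : V.dR) :
      MotRel K Q (.X ⟨V, σ, r • ω⟩) (.C (r ⊗ₜ 1) * .X ⟨V, σ, ω⟩)
  | naturality (V W : Obj K Q) (φ : V ⟶ W) (σ : Module.Dual Q W.B) (ω : V.dR) :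
      MotRel K Q (.X ⟨V, σ ∘ₗ Obj.Hom.B φ, ω⟩) (.X ⟨W, σ, Obj.Hom.dR φ ω⟩)
  | tensor (V W : Obj K Q) (σ : Module.Dual Q V.B) (τ : Module.Dual Q W.B)
      (ω : V.dR) (η : W.dR) :
      MotRel K Q (.X ⟨V.tensor W, dualDistrib Q V.B W.B (σ ⊗ₜ τ), ω ⊗ₜ[K] η⟩)
        (.X ⟨V, σ, ω⟩ * .X ⟨W, τ, η⟩)
  | unit : MotRel K Q (.X ⟨Obj.unit K Q, (LinearMap.id : Q →ₗ[Q] Q), (1 : K)⟩) 1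

/-- Relations between matrix coefficients `[V, f, ω]^𝔡𝔯`. -/
inductive DRRel (K Q : Type) [Field K] [Field Q] [Algebra K ℂ] [Algebra Q ℂ]
    [CharZero K] [CharZero Q] :
    MvPolynomial (DRTriple K Q) K → MvPolynomial (DRTriple K Q) K → Prop
  | add_left (V : Obj K Q) (f g : Module.Dual K V.dR) (ω : V.dR) :
      DRRel K Q (.X ⟨V, f + g, ω⟩) (.X ⟨V, f, ω⟩ + .X ⟨V, g, ω⟩)
  | smul_left (V : Obj K Q) (r : K) (f : Module.Dual K V.dR) (ω : V.dR) :
      DRRel K Q (.X ⟨V, r • f, ω⟩) (.C r * .X ⟨V, f, ω⟩)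
  | add_right (V : Obj K Q) (f : Module.Dual K V.dR) (ω η : V.dR) :
      DRRel K Q (.X ⟨V, f, ω + η⟩) (.X ⟨V, f, ω⟩ + .X ⟨V, f, η⟩)
  | smul_right (V : Obj K Q) (r : K) (f : Module.Dual K V.dR) (ω : V.dR) :
      DRRel K Q (.X ⟨V, f, r • ω⟩) (.C r * .X ⟨V, f, ω⟩)
  | naturality (V W : Obj K Q) (φ : V ⟶ W) (f : Module.Dual K W.dR) (ω : V.dR) :
      DRRel K Q (.X ⟨V, f ∘ₗ Obj.Hom.dR φ, ω⟩) (.X ⟨W, f, Obj.Hom.dR φ ω⟩)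
  | tensor (V W : Obj K Q) (f : Module.Dual K V.dR) (g : Module.Dual K W.dR)
      (ω : V.dR) (η : W.dR) :
      DRRel K Q (.X ⟨V.tensor W, dualDistrib K V.dR W.dR (f ⊗ₜ g), ω ⊗ₜ[K] η⟩)
        (.X ⟨V, f, ω⟩ * .X ⟨W, g, η⟩)
  | unit : DRRel K Q (.X ⟨Obj.unit K Q, (LinearMap.id : K →ₗ[K] K), (1 : K)⟩) 1

/-- The ring `𝒫^𝔪 = 𝒪(Isom^⊗(ω_dR, ω_B))` of motivic periods, an algebra over `K ⊗ Q`. -/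
def PMot (K Q : Type) [Field K] [Field Q] [Algebra K ℂ] [Algebra Q ℂ]
    [CharZero K] [CharZero Q] : Type 1 :=
  MvPolynomial (MotTriple K Q) (K ⊗[ℚ] Q) ⧸ Ideal.ofRel (MotRel K Q)

/-- The ring `𝒫^𝔡𝔯 = 𝒪(Aut^⊗(ω_dR))` of de Rham periods, an algebra over `K`. -/
def PDR (K Q : Type) [Field K] [Field Q] [Algebra K ℂ] [Algebra Q ℂ]
    [CharZero K] [CharZero Q] : Type 1 :=
  MvPolynomial (DRTriple K Q) K ⧸ Ideal.ofRel (DRRel K Q)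

instance (K Q : Type) [Field K] [Field Q] [Algebra K ℂ] [Algebra Q ℂ]
    [CharZero K] [CharZero Q] : CommRing (PMot K Q) :=
  inferInstanceAs (CommRing (MvPolynomial (MotTriple K Q) (K ⊗[ℚ] Q) ⧸ Ideal.ofRel (MotRel K Q)))

instance (K Q : Type) [Field K] [Field Q] [Algebra K ℂ] [Algebra Q ℂ]
    [CharZero K] [CharZero Q] : Algebra (K ⊗[ℚ] Q) (PMot K Q) :=
  inferInstanceAs (Algebra (K ⊗[ℚ] Q)
    (MvPolynomial (MotTriple K Q) (K ⊗[ℚ] Q) ⧸ Ideal.ofRel (MotRel K Q)))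

instance (K Q : Type) [Field K] [Field Q] [Algebra K ℂ] [Algebra Q ℂ]
    [CharZero K] [CharZero Q] : Algebra K (PMot K Q) :=
  inferInstanceAs (Algebra K (MvPolynomial (MotTriple K Q) (K ⊗[ℚ] Q) ⧸ Ideal.ofRel (MotRel K Q)))

instance (K Q : Type) [Field K] [Field Q] [Algebra K ℂ] [Algebra Q ℂ]
    [CharZero K] [CharZero Q] : IsScalarTower K (K ⊗[ℚ] Q) (PMot K Q) :=
  inferInstanceAs (IsScalarTower K (K ⊗[ℚ] Q)
    (MvPolynomial (MotTriple K Q) (K ⊗[ℚ] Q) ⧸ Ideal.ofRel (MotRel K Q)))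

instance (K Q : Type) [Field K] [Field Q] [Algebra K ℂ] [Algebra Q ℂ]
    [CharZero K] [CharZero Q] : CommRing (PDR K Q) :=
  inferInstanceAs (CommRing (MvPolynomial (DRTriple K Q) K ⧸ Ideal.ofRel (DRRel K Q)))

instance (K Q : Type) [Field K] [Field Q] [Algebra K ℂ] [Algebra Q ℂ]
    [CharZero K] [CharZero Q] : Algebra K (PDR K Q) :=
  inferInstanceAs (Algebra K (MvPolynomial (DRTriple K Q) K ⧸ Ideal.ofRel (DRRel K Q)))

/-- The projection from the polynomial ring on triples `(V, σ, ω)`. -/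
def motMk (K Q : Type) [Field K] [Field Q] [Algebra K ℂ] [Algebra Q ℂ]
    [CharZero K] [CharZero Q] : MvPolynomial (MotTriple K Q) (K ⊗[ℚ] Q) →ₐ[K ⊗[ℚ] Q] PMot K Q :=
  Ideal.Quotient.mkₐ _ _

/-- The projection from the polynomial ring on triples `(V, f, ω)`. -/
def drMk (K Q : Type) [Field K] [Field Q] [Algebra K ℂ] [Algebra Q ℂ]
    [CharZero K] [CharZero Q] : MvPolynomial (DRTriple K Q) K →ₐ[K] PDR K Q :=
  Ideal.Quotient.mkₐ _ _

/-- The matrix coefficient `[V, σ, ω]^𝔪`. -/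
def mot {K Q : Type} [Field K] [Field Q] [Algebra K ℂ] [Algebra Q ℂ]
    [CharZero K] [CharZero Q] (V : Obj K Q) (σ : Module.Dual Q V.B) (ω : V.dR) : PMot K Q :=
  motMk K Q (.X ⟨V, σ, ω⟩)

/-- The matrix coefficient `[V, f, ω]^𝔡𝔯`. -/
def dr {K Q : Type} [Field K] [Field Q] [Algebra K ℂ] [Algebra Q ℂ]
    [CharZero K] [CharZero Q] (V : Obj K Q) (f : Module.Dual K V.dR) (ω : V.dR) : PDR K Q :=
  drMk K Q (.X ⟨V, f, ω⟩)

theorem motMk_rel {K Q : Type} [Field K] [Field Q] [Algebra K ℂ] [Algebra Q ℂ]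
    [CharZero K] [CharZero Q] {p q : MvPolynomial (MotTriple K Q) (K ⊗[ℚ] Q)}
    (h : MotRel K Q p q) : motMk K Q p = motMk K Q q :=
  Ideal.Quotient.eq.mpr (Ideal.subset_span ⟨p, q, h, sub_add_cancel _ _⟩)

theorem drMk_rel {K Q : Type} [Field K] [Field Q] [Algebra K ℂ] [Algebra Q ℂ]
    [CharZero K] [CharZero Q] {p q : MvPolynomial (DRTriple K Q) K}
    (h : DRRel K Q p q) : drMk K Q p = drMk K Q q :=
  Ideal.Quotient.eq.mpr (Ideal.subset_span ⟨p, q, h, sub_add_cancel _ _⟩)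

section coefficients

variable {K Q : Type} [Field K] [Field Q] [Algebra K ℂ] [Algebra Q ℂ]
    [CharZero K] [CharZero Q]

theorem mot_add_left (V : Obj K Q) (σ τ : Module.Dual Q V.B) (ω : V.dR) :
    mot V (σ + τ) ω = mot V σ ω + mot V τ ω := by
  have := motMk_rel (MotRel.add_left V σ τ ω)
  rwa [map_add] at this

theorem mot_smul_left (V : Obj K Q) (q : Q) (σ : Module.Dual Q V.B) (ω : V.dR) :
    mot V (q • σ) ω = ((1 : K) ⊗ₜ[ℚ] q) • mot V σ ω := by
  have := motMk_rel (MotRel.smul_left V q σ ω)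
  rwa [← MvPolynomial.smul_eq_C_mul, map_smul] at this

theorem mot_add_right (V : Obj K Q) (σ : Module.Dual Q V.B) (ω η : V.dR) :
    mot V σ (ω + η) = mot V σ ω + mot V σ η := by
  have := motMk_rel (MotRel.add_right V σ ω η)
  rwa [map_add] at this

theorem mot_smul_right (V : Obj K Q) (r : K) (σ : Module.Dual Q V.B) (ω : V.dR) :
    mot V σ (r • ω) = r • mot V σ ω := by
  have := motMk_rel (MotRel.smul_right V r σ ω)
  rw [← MvPolynomial.smul_eq_C_mul, map_smul] at this
  refine this.trans ?_
  have h : (r ⊗ₜ[ℚ] (1 : Q) : K ⊗[ℚ] Q) = algebraMap K (K ⊗[ℚ] Q) r := rfl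
  rw [h]
  exact algebraMap_smul _ _ _

theorem mot_naturality {V W : Obj K Q} (φ : V ⟶ W) (σ : Module.Dual Q W.B) (ω : V.dR) :
    mot V (σ ∘ₗ Obj.Hom.B φ) ω = mot W σ (Obj.Hom.dR φ ω) :=
  motMk_rel (MotRel.naturality V W φ σ ω)

theorem mot_tensor (V W : Obj K Q) (σ : Module.Dual Q V.B) (τ : Module.Dual Q W.B)
    (ω : V.dR) (η : W.dR) :
    mot (V.tensor W) (dualDistrib Q V.B W.B (σ ⊗ₜ τ)) (ω ⊗ₜ[K] η) = mot V σ ω * mot W τ η := by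
  have := motMk_rel (MotRel.tensor V W σ τ ω η)
  rwa [map_mul] at this

theorem mot_unit :
    mot (Obj.unit K Q) (LinearMap.id : Q →ₗ[Q] Q) (1 : K) = 1 := by
  have := motMk_rel (MotRel.unit (K := K) (Q := Q))
  rwa [map_one] at this

theorem dr_add_left (V : Obj K Q) (f g : Module.Dual K V.dR) (ω : V.dR) :
    dr V (f + g) ω = dr V f ω + dr V g ω := by
  have := drMk_rel (DRRel.add_left V f g ω)
  rwa [map_add] at this

theorem dr_smul_left (V : Obj K Q) (r : K) (f : Module.Dual K V.dR) (ω : V.dR) :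
    dr V (r • f) ω = r • dr V f ω := by
  have := drMk_rel (DRRel.smul_left V r f ω)
  rwa [← MvPolynomial.smul_eq_C_mul, map_smul] at this

theorem dr_add_right (V : Obj K Q) (f : Module.Dual K V.dR) (ω η : V.dR) :
    dr V f (ω + η) = dr V f ω + dr V f η := by
  have := drMk_rel (DRRel.add_right V f ω η)
  rwa [map_add] at this

theorem dr_smul_right (V : Obj K Q) (r : K) (f : Module.Dual K V.dR) (ω : V.dR) :
    dr V f (r • ω) = r • dr V f ω := by
  have := drMk_rel (DRRel.smul_right V r f ω)
  rwa [← MvPolynomial.smul_eq_C_mul, map_smul] at this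

theorem dr_naturality {V W : Obj K Q} (φ : V ⟶ W) (f : Module.Dual K W.dR) (ω : V.dR) :
    dr V (f ∘ₗ Obj.Hom.dR φ) ω = dr W f (Obj.Hom.dR φ ω) :=
  drMk_rel (DRRel.naturality V W φ f ω)

theorem dr_tensor (V W : Obj K Q) (f : Module.Dual K V.dR) (g : Module.Dual K W.dR)
    (ω : V.dR) (η : W.dR) :
    dr (V.tensor W) (dualDistrib K V.dR W.dR (f ⊗ₜ g)) (ω ⊗ₜ[K] η) = dr V f ω * dr W g η := by
  have := drMk_rel (DRRel.tensor V W f g ω η)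
  rwa [map_mul] at this

theorem dr_unit :
    dr (Obj.unit K Q) (LinearMap.id : K →ₗ[K] K) (1 : K) = 1 := by
  have := drMk_rel (DRRel.unit (K := K) (Q := Q))
  rwa [map_one] at this

/-! ### The coaction -/

/-- `(η, f) ↦ [V, σ, η]^𝔪 ⊗ [W, f, ω]^𝔡𝔯` as a bilinear map. -/
def coactionPairing (V W : Obj K Q) (σ : Module.Dual Q V.B) (ω : W.dR) :
    V.dR →ₗ[K] Module.Dual K W.dR →ₗ[K] PMot K Q ⊗[K] PDR K Q :=
  LinearMap.mk₂ K (fun η f => mot V σ η ⊗ₜ[K] dr W f ω)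
    (fun η η' f => by rw [mot_add_right, add_tmul])
    (fun r η f => by rw [mot_smul_right, smul_tmul'])
    (fun η f f' => by rw [dr_add_left, tmul_add])
    (fun r η f => by rw [dr_smul_left, tmul_smul])

theorem sum_coord_exchange {K : Type} [Field K] {ι κ V W N : Type*} [Fintype ι] [Fintype κ]
    [AddCommGroup V] [Module K V] [AddCommGroup W] [Module K W] [AddCommMonoid N] [Module K N]
    (b : Module.Basis ι K V) (b' : Module.Basis κ K W) (f : V →ₗ[K] W)
    (P : W →ₗ[K] Module.Dual K V →ₗ[K] N) :
    ∑ i, P (f (b i)) (b.coord i) = ∑ j, P (b' j) (b'.coord j ∘ₗ f) := by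
  have h1 : ∀ i, P (f (b i)) (b.coord i)
      = ∑ j, P (b' j) (b'.coord j (f (b i)) • b.coord i) := by
    intro i
    conv_lhs => rw [← b'.sum_repr (f (b i)), map_sum, LinearMap.sum_apply]
    simp only [map_smul, LinearMap.smul_apply, Module.Basis.coord_apply]
  rw [Finset.sum_congr rfl fun i _ => h1 i, Finset.sum_comm]
  refine Finset.sum_congr rfl fun j _ => ?_
  rw [← map_sum]
  congr 1
  refine b.ext fun i => ?_
  classical
  simp [LinearMap.sum_apply, Finsupp.single_apply, Finset.sum_ite_eq]

/-- The expression `∑ i, [V, σ, e i]^𝔪 ⊗ [V, (e i)^∨, ω]^𝔡𝔯` for a basis `e` of `V_dR`. -/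
def coactionGen (V : Obj K Q) (σ : Module.Dual Q V.B) (ω : V.dR) : PMot K Q ⊗[K] PDR K Q :=
  ∑ i, mot V σ (Module.finBasis K V.dR i) ⊗ₜ[K] dr V ((Module.finBasis K V.dR).coord i) ω

theorem coactionGen_eq (V : Obj K Q) (σ : Module.Dual Q V.B) (ω : V.dR)
    {ι : Type*} [Fintype ι] (e : Module.Basis ι K V.dR) :
    coactionGen V σ ω = ∑ i, mot V σ (e i) ⊗ₜ[K] dr V (e.coord i) ω :=
  sum_coord_exchange (Module.finBasis K V.dR) e LinearMap.id (coactionPairing V V σ ω)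

theorem coactionGen_naturality {V W : Obj K Q} (φ : V ⟶ W) (σ : Module.Dual Q W.B) (ω : V.dR) :
    coactionGen V (σ ∘ₗ Obj.Hom.B φ) ω = coactionGen W σ (Obj.Hom.dR φ ω) := by
  have := sum_coord_exchange (Module.finBasis K V.dR) (Module.finBasis K W.dR) (Obj.Hom.dR φ)
    (coactionPairing W V σ ω)
  simpa only [coactionGen, coactionPairing, LinearMap.mk₂_apply, mot_naturality, dr_naturality]
    using this

theorem coactionGen_tensor (V W : Obj K Q) (σ : Module.Dual Q V.B) (τ : Module.Dual Q W.B)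
    (ω : V.dR) (η : W.dR) :
    coactionGen (V.tensor W) (dualDistrib Q V.B W.B (σ ⊗ₜ τ)) (ω ⊗ₜ[K] η)
      = coactionGen V σ ω * coactionGen W τ η := by
  have hc : ∀ p : Fin (Module.finrank K V.dR) × Fin (Module.finrank K W.dR),
      ((Module.finBasis K V.dR).tensorProduct (Module.finBasis K W.dR)).coord p
        = dualDistrib K V.dR W.dR
          ((Module.finBasis K V.dR).coord p.1 ⊗ₜ (Module.finBasis K W.dR).coord p.2) := by
    intro p
    refine TensorProduct.ext' fun x y => ?_
    simp only [dualDistrib_apply, Module.Basis.coord_apply]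
    exact (Module.Basis.tensorProduct_repr_tmul_apply _ _ _ _ _ _).trans (by simp [mul_comm])
  refine (coactionGen_eq (V.tensor W) _ _
    ((Module.finBasis K V.dR).tensorProduct (Module.finBasis K W.dR))).trans ?_
  rw [coactionGen, coactionGen, Finset.sum_mul_sum, Fintype.sum_prod_type]
  refine Finset.sum_congr rfl fun i _ => Finset.sum_congr rfl fun j _ => ?_
  rw [hc, Algebra.TensorProduct.tmul_mul_tmul, ← mot_tensor, ← dr_tensor,
    Module.Basis.tensorProduct_apply]

theorem coactionGen_unit :
    coactionGen (Obj.unit K Q) (LinearMap.id : Q →ₗ[Q] Q) (1 : K) = 1 := by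
  refine (coactionGen_eq (Obj.unit K Q) _ _ (Module.Basis.singleton Unit K)).trans ?_
  have hc : (Module.Basis.singleton Unit K).coord () = LinearMap.id := by
    ext; simp
  rw [Fintype.sum_unique]
  refine (congrArg₂ (fun x y => x ⊗ₜ[K] y) ?_ ?_ :
    _ = (1 : PMot K Q) ⊗ₜ[K] (1 : PDR K Q))
  · rw [← mot_unit]
    congr 1
    exact Module.Basis.singleton_apply _ _ _
  · rw [← dr_unit]
    congr 1

theorem coactionGen_rel {p q : MvPolynomial (MotTriple K Q) (K ⊗[ℚ] Q)} (h : MotRel K Q p q) :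
    MvPolynomial.aeval (fun t : MotTriple K Q => coactionGen t.V t.σ t.ω) p =
      MvPolynomial.aeval (fun t : MotTriple K Q => coactionGen t.V t.σ t.ω) q := by
  induction h with
  | add_left V σ τ ω =>
    simp [coactionGen, mot_add_left, add_tmul, Finset.sum_add_distrib]
  | smul_left V q σ ω =>
    simp [coactionGen, mot_smul_left, ← MvPolynomial.smul_eq_C_mul, smul_tmul', Finset.smul_sum]
  | add_right V σ ω η =>
    simp [coactionGen, dr_add_right, tmul_add, Finset.sum_add_distrib]
  | smul_right V r σ ω =>
    have h : (r ⊗ₜ[ℚ] (1 : Q) : K ⊗[ℚ] Q) = algebraMap K (K ⊗[ℚ] Q) r := rfl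
    rw [← MvPolynomial.smul_eq_C_mul, map_smul, h, algebraMap_smul]
    simp [coactionGen, dr_smul_right, Finset.smul_sum]
  | naturality V W φ σ ω =>
    simpa using coactionGen_naturality φ σ ω
  | tensor V W σ τ ω η =>
    simpa using coactionGen_tensor V W σ τ ω η
  | unit => simpa using coactionGen_unit

/-- The coaction `Δ : 𝒫^𝔪 → 𝒫^𝔪 ⊗ 𝒫^𝔡𝔯`, a homomorphism of algebras. -/
def coaction (K Q : Type) [Field K] [Field Q] [Algebra K ℂ] [Algebra Q ℂ]
    [CharZero K] [CharZero Q] : PMot K Q →ₐ[K ⊗[ℚ] Q] PMot K Q ⊗[K] PDR K Q :=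
  Ideal.Quotient.liftₐ (Ideal.ofRel (MotRel K Q))
    (MvPolynomial.aeval fun t => coactionGen t.V t.σ t.ω) (by
      intro p hp
      refine Submodule.span_le (p := RingHom.ker (MvPolynomial.aeval (R := K ⊗[ℚ] Q)
        fun t : MotTriple K Q => coactionGen t.V t.σ t.ω)).mpr ?_ hp
      rintro x ⟨p, q, h, hx⟩
      rw [SetLike.mem_coe, RingHom.mem_ker, ← add_right_cancel_iff (a := MvPolynomial.aeval
        (fun t : MotTriple K Q => coactionGen t.V t.σ t.ω) q), ← map_add, hx, zero_add]
      exact coactionGen_rel h)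

theorem coaction_mot (V : Obj K Q) (σ : Module.Dual Q V.B) (ω : V.dR)
    {ι : Type*} [Fintype ι] (e : Module.Basis ι K V.dR) :
    coaction K Q (mot V σ ω) = ∑ i, mot V σ (e i) ⊗ₜ[K] dr V (e.coord i) ω := by
  rw [← coactionGen_eq]
  exact MvPolynomial.aeval_X _ _

end coefficients

/-! ### The punctured line and algebraic de Rham cohomology

The punctures are `Σ = {0, σ 0, …, σ (n-1)}`, with exponents `s 0, s 1, …, s n` in this order. -/

/-- The list of punctures, starting with `0`. -/
def puncture {n : ℕ} (σ : Fin n → ℂ) : Fin (n + 1) → ℂ := Fin.cons 0 σ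

/-- The complex points `ℂ ∖ Σ` of the punctured line. -/
def Line {n : ℕ} (σ : Fin n → ℂ) : Set ℂ := (Set.range (puncture σ))ᶜ

/-- The regular functions `𝒪(X) = K[x, (x - σ_i)⁻¹]` of the punctured affine line over `K`, as
functions on the complex points. A regular one-form `f dx` is represented by `f`. -/
def regular (K : Type) [Field K] [Algebra K ℂ] {n : ℕ} (σ : Fin n → ℂ) : Subalgebra K (Line σ → ℂ) :=
  Algebra.adjoin K
    ({fun x : Line σ => (x : ℂ)} ∪ Set.range fun (i : Fin (n + 1)) (x : Line σ) => ((x : ℂ) - puncture σ i)⁻¹)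

/-- The coefficient of `dx` in the connection form `∑ i, s_i dx / (x - σ_i)`. -/
def conn {n : ℕ} (σ : Fin n → ℂ) (s : Fin (n + 1) → ℂ) (x : ℂ) : ℂ :=
  ∑ i, s i / (x - puncture σ i)

/-- The forms `∇_s f = (f' + (∑ i, s_i / (x - σ_i)) f) dx` with `f` a regular function. -/
def exactForms (K : Type) [Field K] [Algebra K ℂ] {n : ℕ} (σ : Fin n → ℂ) (s : Fin (n + 1) → ℂ) :
    Submodule K (regular K σ) where
  carrier := {ω | ∃ f : ℂ → ℂ, (Line σ).domRestrict f ∈ regular K σ ∧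
    ∀ x : Line σ, HasDerivAt f ((ω : Line σ → ℂ) x - conn σ s x * f x) x}
  zero_mem' := ⟨0, (regular K σ).zero_mem, fun x => by
    simp⟩
  add_mem' := by
    rintro ω η ⟨f, hf, hf'⟩ ⟨g, hg, hg'⟩
    refine ⟨f + g, (regular K σ).add_mem hf hg, fun x => ?_⟩
    refine ((hf' x).add (hg' x)).congr_deriv ?_
    simp only [Subalgebra.coe_add, Pi.add_apply]
    ring
  smul_mem' := by
    rintro r ω ⟨f, hf, hf'⟩
    refine ⟨fun z => algebraMap K ℂ r * f z, ?_, fun x => ?_⟩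
    · convert (regular K σ).smul_mem hf r using 1
      funext x
      simp [Set.domRestrict, Algebra.smul_def]
    refine ((hf' x).const_mul (algebraMap K ℂ r)).congr_deriv ?_
    rw [Subalgebra.coe_smul, Pi.smul_apply, Algebra.smul_def]
    ring

/-- `H¹_dR(X, ∇_s)`. As `X` is affine, this is the cokernel of `∇_s : 𝒪(X) → Ω¹(X)`. -/
abbrev HdR (K : Type) [Field K] [Algebra K ℂ] {n : ℕ} (σ : Fin n → ℂ) (s : Fin (n + 1) → ℂ) : Type :=
  regular K σ ⧸ exactForms K σ s

/-- The class in `H¹_dR(X, ∇_s)` of a regular one-form. -/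
def dRClass (K : Type) [Field K] [Algebra K ℂ] {n : ℕ} (σ : Fin n → ℂ) (s : Fin (n + 1) → ℂ) :
    regular K σ →ₗ[K] HdR K σ s :=
  (exactForms K σ s).mkQ

/-! ### Betti cohomology with coefficients -/

/-- The function `x` for the puncture `0`, and `1 - x / σ_k` for the other punctures. -/
def factor {n : ℕ} (σ : Fin n → ℂ) : Fin (n + 1) → ℂ → ℂ :=
  Fin.cons (fun x => x) fun k x => 1 - x / σ k

/-- Singular `d`-simplices of `ℂ ∖ Σ`. -/
abbrev Simplex {n : ℕ} (σ : Fin n → ℂ) (d : ℕ) : Type :=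
  C(stdSimplex ℝ (Fin (d + 1)), Line σ)

/-- The sections along a singular simplex `γ` of the local system
`ℒ_s^∨ = Q · x ^ s_0 * ∏ k, (1 - x / σ_k) ^ s_k`, i.e. the `Q`-span of the branches of this
multivalued function along `γ`. -/
def sections (Q : Type) [Field Q] [Algebra Q ℂ] {n : ℕ} (σ : Fin n → ℂ) (s : Fin (n + 1) → ℂ) {d : ℕ}
    (γ : Simplex σ d) : Submodule Q (stdSimplex ℝ (Fin (d + 1)) → ℂ) :=
  Submodule.span Q {g | ∃ l : Fin (n + 1) → C(stdSimplex ℝ (Fin (d + 1)), ℂ),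
    (∀ k t, Complex.exp (l k t) = factor σ k (γ t)) ∧
    ∀ t, g t = Complex.exp (∑ k, s k * l k t)}

/-- The `i`-th face inclusion of standard simplices. -/
def faceMap (d : ℕ) (i : Fin (d + 2)) :
    C(stdSimplex ℝ (Fin (d + 1)), stdSimplex ℝ (Fin (d + 2))) :=
  ⟨stdSimplex.map i.succAbove, stdSimplex.continuous_map _⟩

/-- Restriction of sections to the `i`-th face. -/
def restrictFace (Q : Type) [Field Q] [Algebra Q ℂ] {n : ℕ} (σ : Fin n → ℂ) (s : Fin (n + 1) → ℂ) {d : ℕ}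
    (γ : Simplex σ (d + 1)) (i : Fin (d + 2)) :
    sections Q σ s γ →ₗ[Q] sections Q σ s (γ.comp (faceMap d i)) :=
  (LinearMap.funLeft Q ℂ (faceMap d i)).restrict fun g hg => by
    induction hg using Submodule.span_induction with
    | mem g hg =>
      obtain ⟨l, hl, hg⟩ := hg
      exact Submodule.subset_span
        ⟨fun k => (l k).comp (faceMap d i), fun k t => hl k _, fun t => hg _⟩
    | zero => simp
    | add g h _ _ hg hh => rw [map_add]; exact Submodule.add_mem _ hg hh
    | smul r g _ hg => rw [map_smul]; exact Submodule.smul_mem _ r hg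

instance (Q : Type) [Field Q] [Algebra Q ℂ] {n : ℕ} (σ : Fin n → ℂ) (s : Fin (n + 1) → ℂ) {d : ℕ}
    (γ : Simplex σ d) : AddCommGroup (sections Q σ s γ) :=
  Submodule.addCommGroup _

/-- Singular chains of `ℂ ∖ Σ` with coefficients in `ℒ_s^∨`. -/
def Chain (Q : Type) [Field Q] [Algebra Q ℂ] {n : ℕ} (σ : Fin n → ℂ) (s : Fin (n + 1) → ℂ) (d : ℕ) : Type :=
  DirectSum (Simplex σ d) fun γ => sections Q σ s γ

instance (Q : Type) [Field Q] [Algebra Q ℂ] {n : ℕ} (σ : Fin n → ℂ) (s : Fin (n + 1) → ℂ) (d : ℕ) :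
    AddCommGroup (Chain Q σ s d) :=
  inferInstanceAs (AddCommGroup (DirectSum (Simplex σ d) fun γ => sections Q σ s γ))

instance (Q : Type) [Field Q] [Algebra Q ℂ] {n : ℕ} (σ : Fin n → ℂ) (s : Fin (n + 1) → ℂ) (d : ℕ) :
    Module Q (Chain Q σ s d) :=
  inferInstanceAs (Module Q (DirectSum (Simplex σ d) fun γ => sections Q σ s γ))

/-- The coefficient at `γ` of a chain, a section of `ℒ_s^∨` along `γ`. -/
def Chain.coeff {Q : Type} [Field Q] [Algebra Q ℂ] {n : ℕ} {σ : Fin n → ℂ} {s : Fin (n + 1) → ℂ} {d : ℕ}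
    (z : Chain Q σ s d) (γ : Simplex σ d) : sections Q σ s γ :=
  DirectSum.component Q (Simplex σ d) (fun γ => sections Q σ s γ) γ z

open Classical in
/-- The chain `γ ⊗ g`. -/
def Chain.of {Q : Type} [Field Q] [Algebra Q ℂ] {n : ℕ} {σ : Fin n → ℂ} {s : Fin (n + 1) → ℂ} {d : ℕ}
    (γ : Simplex σ d) : sections Q σ s γ →ₗ[Q] Chain Q σ s d :=
  DirectSum.lof Q (Simplex σ d) (fun γ => sections Q σ s γ) γ

open Classical in
/-- The boundary `∂ (γ ⊗ g) = ∑ i, (-1) ^ i (γ ∘ d_i) ⊗ (g ∘ d_i)`. -/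
def boundary (Q : Type) [Field Q] [Algebra Q ℂ] {n : ℕ} (σ : Fin n → ℂ) (s : Fin (n + 1) → ℂ) (d : ℕ) :
    Chain Q σ s (d + 1) →ₗ[Q] Chain Q σ s d :=
  DirectSum.toModule Q (Simplex σ (d + 1)) (Chain Q σ s d) fun γ =>
    ∑ i : Fin (d + 2), (-1 : Q) ^ (i : ℕ) •
      Chain.of (γ.comp (faceMap d i)) ∘ₗ restrictFace Q σ s γ i

/-- The `1`-cycles with coefficients in `ℒ_s^∨`. -/
abbrev Cycle (Q : Type) [Field Q] [Algebra Q ℂ] {n : ℕ} (σ : Fin n → ℂ) (s : Fin (n + 1) → ℂ) :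
    Submodule Q (Chain Q σ s 1) :=
  LinearMap.ker (boundary Q σ s 0)

/-- The cochains `C^d(ℒ_s) = Hom(C_d(ℒ_s^∨), Q)`. -/
def Cochain (Q : Type) [Field Q] [Algebra Q ℂ] {n : ℕ} (σ : Fin n → ℂ) (s : Fin (n + 1) → ℂ)
    (d : ℕ) : Type :=
  Chain Q σ s d →ₗ[Q] Q

instance (Q : Type) [Field Q] [Algebra Q ℂ] {n : ℕ} (σ : Fin n → ℂ) (s : Fin (n + 1) → ℂ)
    (d : ℕ) : AddCommGroup (Cochain Q σ s d) :=
  inferInstanceAs (AddCommGroup (Chain Q σ s d →ₗ[Q] Q))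

instance (Q : Type) [Field Q] [Algebra Q ℂ] {n : ℕ} (σ : Fin n → ℂ) (s : Fin (n + 1) → ℂ)
    (d : ℕ) : Module Q (Cochain Q σ s d) :=
  inferInstanceAs (Module Q (Chain Q σ s d →ₗ[Q] Q))

/-- Evaluation of cochains at a chain. -/
def Cochain.eval {Q : Type} [Field Q] [Algebra Q ℂ] {n : ℕ} {σ : Fin n → ℂ}
    {s : Fin (n + 1) → ℂ} {d : ℕ} (z : Chain Q σ s d) : Cochain Q σ s d →ₗ[Q] Q :=
  LinearMap.applyₗ (R := Q) (M₂ := Q) z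

/-- The coboundary `u ↦ u ∘ ∂`. -/
def coboundary (Q : Type) [Field Q] [Algebra Q ℂ] {n : ℕ} (σ : Fin n → ℂ) (s : Fin (n + 1) → ℂ)
    (d : ℕ) : Cochain Q σ s d →ₗ[Q] Cochain Q σ s (d + 1) :=
  LinearMap.lcomp Q Q (boundary Q σ s d)

theorem Cochain.eval_coboundary {Q : Type} [Field Q] [Algebra Q ℂ] {n : ℕ} {σ : Fin n → ℂ}
    {s : Fin (n + 1) → ℂ} {d : ℕ} (u : Cochain Q σ s d) (z : Chain Q σ s (d + 1)) :
    Cochain.eval z (coboundary Q σ s d u) = Cochain.eval (boundary Q σ s d z) u :=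
  rfl

/-- Singular cohomology `H¹(ℂ ∖ Σ, ℒ_s)`. -/
abbrev HB (Q : Type) [Field Q] [Algebra Q ℂ] {n : ℕ} (σ : Fin n → ℂ) (s : Fin (n + 1) → ℂ) :
    Type :=
  LinearMap.ker (coboundary Q σ s 1) ⧸
    (LinearMap.range (coboundary Q σ s 0)).submoduleOf (LinearMap.ker (coboundary Q σ s 1))

/-- The linear form on `H¹(ℂ ∖ Σ, ℒ_s)` defined by a `1`-cycle with coefficients in `ℒ_s^∨`. -/
def evalCycle {Q : Type} [Field Q] [Algebra Q ℂ] {n : ℕ} {σ : Fin n → ℂ} {s : Fin (n + 1) → ℂ}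
    (z : Cycle Q σ s) : Module.Dual Q (HB Q σ s) :=
  Submodule.liftQ _
    (Cochain.eval (z : Chain Q σ s 1) ∘ₗ (LinearMap.ker (coboundary Q σ s 1)).subtype) (by
      rintro u ⟨v, hv⟩
      have hz : boundary Q σ s 0 (z : Chain Q σ s 1) = 0 := z.2
      rw [LinearMap.mem_ker, LinearMap.comp_apply, ← hv, Cochain.eval_coboundary, hz]
      exact LinearMap.map_zero (show Chain Q σ s 0 →ₗ[Q] Q from v))

/-! ### The comparison isomorphism -/

/-- The parametrisation of the standard `1`-simplex by `[0, 1]` from the vertex `0` to the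
vertex `1`, extended by constants to the real line. -/
def edge (t : ℝ) : stdSimplex ℝ (Fin 2) :=
  ⟨![1 - (Set.projIcc (0 : ℝ) 1 zero_le_one t : ℝ), (Set.projIcc (0 : ℝ) 1 zero_le_one t : ℝ)], by
    have h := (Set.projIcc (0 : ℝ) 1 zero_le_one t).2
    refine ⟨fun i => ?_, by simp⟩
    fin_cases i
    · simpa using h.2
    · simpa using h.1⟩

/-- A singular `1`-simplex as a path in `ℂ`. -/
def path {n : ℕ} {σ : Fin n → ℂ} (γ : Simplex σ 1) (t : ℝ) : ℂ := γ (edge t)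

/-- A `1`-chain is smooth if it is supported on paths that are continuously differentiable. -/
def Chain.IsSmooth {Q : Type} [Field Q] [Algebra Q ℂ] {n : ℕ} {σ : Fin n → ℂ} {s : Fin (n + 1) → ℂ}
    (z : Chain Q σ s 1) : Prop :=
  ∀ γ, z.coeff γ ≠ 0 → ContDiffOn ℝ 1 (path γ) (Set.Icc 0 1)

/-- The integral of a form `ω = f dx` along a smooth chain `∑ γ ⊗ g_γ`, that is
`∑ γ, ∫_γ g_γ f dx`. -/
def Chain.integral {Q : Type} [Field Q] [Algebra Q ℂ] {n : ℕ} {σ : Fin n → ℂ} {s : Fin (n + 1) → ℂ}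
    (z : Chain Q σ s 1) (f : Line σ → ℂ) : ℂ :=
  ∑ᶠ γ : Simplex σ 1, ∫ t in (0 : ℝ)..1,
    (z.coeff γ : stdSimplex ℝ (Fin 2) → ℂ) (edge t) * f (γ (edge t)) * deriv (path γ) t

/-- The `ℂ`-linear extension of a linear form. -/
def extendForm {Q : Type} [Field Q] [Algebra Q ℂ] {V : Type} [AddCommGroup V] [Module Q V] (φ : Module.Dual Q V) :
    ℂ ⊗[Q] V →ₗ[ℂ] ℂ :=
  (AlgebraTensorModule.rid Q ℂ ℂ).toLinearMap ∘ₗ LinearMap.baseChange ℂ φ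

/-- The comparison isomorphism `comp_{B,dR}`: it is computed by integrating forms along smooth
cycles with coefficients. -/
def IsComparison (K Q : Type) [Field K] [Field Q] [Algebra K ℂ] [Algebra Q ℂ] {n : ℕ} (σ : Fin n → ℂ) (s : Fin (n + 1) → ℂ)
    (c : ℂ ⊗[K] HdR K σ s ≃ₗ[ℂ] ℂ ⊗[Q] HB Q σ s) : Prop :=
  ∀ (ω : regular K σ) (z : Cycle Q σ s), (z : Chain Q σ s 1).IsSmooth →
    extendForm (evalCycle z) (c (1 ⊗ₜ dRClass K σ s ω)) = (z : Chain Q σ s 1).integral ω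

/-! ### The de Rham intersection pairing -/

/-- `ν + ∇_s φ`, with `φ` smooth on `ℂ ∖ Σ`, has compact support in `ℂ ∖ Σ`. Outside the support,
both the `dx̄`-component `∂φ/∂x̄` and the `dx`-component `∂φ/∂x + conn * φ + ν` vanish. -/
def IsCompactModification {n : ℕ} (σ : Fin n → ℂ) (s : Fin (n + 1) → ℂ) (ν : Line σ → ℂ)
    (φ : ℂ → ℂ) : Prop :=
  ContDiffOn ℝ (⊤ : ℕ∞) φ (Line σ) ∧ ∃ C : Set ℂ, IsCompact C ∧ C ⊆ Line σ ∧
    ∀ x : Line σ, (x : ℂ) ∉ C → HasDerivAt φ (-(ν x) - conn σ s x * φ x) x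

/-- `(2πi)⁻¹ ∬ (ν + ∇φ) ∧ f dx`. Only the component `(∂φ/∂x̄) dx̄` of `ν + ∇φ` contributes, and
`dx̄ ∧ dx` is `2i` times the Lebesgue measure. -/
def intersectionIntegral {n : ℕ} {σ : Fin n → ℂ} (φ : ℂ → ℂ) (f : Line σ → ℂ) : ℂ :=
  (2 * Real.pi * Complex.I)⁻¹ * ∫ x : Line σ,
    (2 * Complex.I) * (((fderiv ℝ φ x 1 + Complex.I * fderiv ℝ φ x Complex.I) / 2) * f x)
      ∂(MeasureTheory.volume.comap Subtype.val)

/-- The de Rham intersection pairing `⟨[ν], [ω]⟩ = (2πi)⁻¹ ∬ ν' ∧ ω`, where `ν'` is a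
representative with compact support of the class of `ν` in the cohomology of `∇_{-s}`. -/
def IsDRPairing (K : Type) [Field K] [Algebra K ℂ] {n : ℕ} (σ : Fin n → ℂ) (s : Fin (n + 1) → ℂ)
    (P : HdR K σ (-s) →ₗ[K] HdR K σ s →ₗ[K] K) : Prop :=
  ∀ ν : regular K σ, ∃ φ : ℂ → ℂ, IsCompactModification σ (-s) ν φ ∧
    ∀ ω : regular K σ,
      algebraMap K ℂ (P (dRClass K σ (-s) ν) (dRClass K σ s ω)) = intersectionIntegral φ (ω : Line σ → ℂ)

/-! ### The class of the open interval -/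

/-- The cycle `z` represents the image under `H₁^lf(ℂ ∖ Σ, ℒ_s^∨) ≅ H₁(ℂ ∖ Σ, ℒ_s^∨)` of the open
interval `(0, 1)` with the principal branch of `x ^ s_0 * ∏ k, (1 - x / σ_k) ^ s_k`. Locally finite
homology is the inverse limit of `H₁(ℂ ∖ Σ, (ℂ ∖ Σ) ∖ C; ℒ_s^∨)` over the compact `C ⊆ ℂ ∖ Σ`, so
this means: modulo boundaries and chains outside `C`, the cycle is equal to the segment
`[ε, 1 - ε]` with this branch, for all sufficiently small `ε`. -/
def IsRegularisedInterval {Q : Type} [Field Q] [Algebra Q ℂ] {n : ℕ} {σ : Fin n → ℂ} {s : Fin (n + 1) → ℂ}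
    (z : Cycle Q σ s) : Prop :=
  ∀ C : Set ℂ, IsCompact C → C ⊆ Line σ → ∃ ε₀ > (0 : ℝ), ∀ ε : ℝ, 0 < ε → ε < ε₀ →
    ∃ (γ : Simplex σ 1) (g : sections Q σ s γ) (w : Chain Q σ s 2) (r : Chain Q σ s 1),
      (∀ t ∈ Set.Icc (0 : ℝ) 1, path γ t = ((ε + (1 - 2 * ε) * t : ℝ) : ℂ)) ∧
      (∀ u, (g : stdSimplex ℝ (Fin 2) → ℂ) u = ∏ k, factor σ k (γ u) ^ s k) ∧
      (∀ τ, r.coeff τ ≠ 0 → ∀ u, (τ u : ℂ) ∉ C) ∧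
      (z : Chain Q σ s 1) = Chain.of γ g + boundary Q σ s 1 w + r

/-- The linear form on `H¹(ℂ ∖ Σ, ℒ_s)` defined by the open interval `(0, 1)`. -/
def IsIntervalClass (Q : Type) [Field Q] [Algebra Q ℂ] {n : ℕ} (σ : Fin n → ℂ) (s : Fin (n + 1) → ℂ)
    (φ : Module.Dual Q (HB Q σ s)) : Prop :=
  ∃ z : Cycle Q σ s, IsRegularisedInterval z ∧ φ = evalCycle z

/-! ### The objects of `𝒯` attached to the punctured line -/

/-- The data attached to `(Σ, s)` are defined: the cohomology groups are finite-dimensional, and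
the comparison isomorphism, the intersection pairing and the class of the interval exist and
are unique. -/
structure IsRealised (K Q : Type) [Field K] [Field Q] [Algebra K ℂ] [Algebra Q ℂ]
    {n : ℕ} (σ : Fin n → ℂ) (s : Fin (n + 1) → ℂ) : Prop where
  finite_dR : FiniteDimensional K (HdR K σ s)
  finite_B : FiniteDimensional Q (HB Q σ s)
  comparison : ∃! c, IsComparison K Q σ s c
  pairing : ∃! P, IsDRPairing K σ s P
  interval : ∃! φ, IsIntervalClass Q σ s φ

namespace IsRealised

variable {K Q : Type} [Field K] [Field Q] [Algebra K ℂ] [Algebra Q ℂ]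
    [CharZero K] [CharZero Q] {n : ℕ} {σ : Fin n → ℂ} {s : Fin (n + 1) → ℂ}

/-- The object `M_Σ(s) = (H¹(ℂ ∖ Σ, ℒ_s), H¹_dR(X, ∇_s), comp_{B,dR})` of `𝒯`. -/
def M (h : IsRealised K Q σ s) : Obj K Q :=
  letI := h.finite_dR
  letI := h.finite_B
  { B := HB Q σ s
    dR := HdR K σ s
    comp := h.comparison.choose }

/-- The class in `M_Σ(s)_B^∨` of the interval `(0, 1)` with the principal branch. -/
def φ₁ (h : IsRealised K Q σ s) : Module.Dual Q (HB Q σ s) := h.interval.choose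

/-- The linear form on `M_Σ(s)_dR` defined by the class of `ν` in `M_Σ(-s)_dR`. -/
def dual (h : IsRealised K Q σ s) (ν : regular K σ) : Module.Dual K (HdR K σ s) :=
  h.pairing.choose (dRClass K σ (-s) ν)

/-- `[M_Σ(s), φ₁, ω]^𝔪`. -/
def motPeriod (h : IsRealised K Q σ s) (ω : regular K σ) : PMot K Q :=
  mot h.M h.φ₁ (dRClass K σ s ω)

/-- `[M_Σ(s), ν, ω]^𝔡𝔯` with `ν` viewed in `M_Σ(-s)_dR ≅ M_Σ(s)_dR^∨`. -/
def drPeriod (h : IsRealised K Q σ s) (ν ω : regular K σ) : PDR K Q :=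
  dr h.M (h.dual ν) (dRClass K σ s ω)

end IsRealised

/-! ### Motivic beta and hypergeometric functions -/

theorem inv_sub_mem (K : Type) [Field K] [Algebra K ℂ] {n : ℕ} (σ : Fin n → ℂ) (i : Fin (n + 1)) :
    (fun x : Line σ => ((x : ℂ) - puncture σ i)⁻¹) ∈ regular K σ :=
  Algebra.subset_adjoin (Or.inr ⟨i, rfl⟩)

/-- The form `η = dx / (x (1 - x))`, when `1` is the first non-zero puncture. -/
def η₁ (K : Type) [Field K] [Algebra K ℂ] {n : ℕ} (σ : Fin (n + 1) → ℂ) (h1 : σ 0 = 1) : regular K σ :=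
  ⟨fun x => 1 / ((x : ℂ) * (1 - x)), by
    have e : (fun x : Line σ => 1 / ((x : ℂ) * (1 - x))) =
        -((fun x : Line σ => ((x : ℂ) - puncture σ 0)⁻¹) *
          fun x : Line σ => ((x : ℂ) - puncture σ 1)⁻¹) := by
      funext x
      have : puncture σ 1 = 1 := h1
      have h0 : puncture σ 0 = 0 := rfl
      simp only [Pi.neg_apply, Pi.mul_apply, this, h0, sub_zero, one_div, mul_inv]
      rw [← neg_sub (x : ℂ) 1, inv_neg, mul_neg]
    rw [e]
    exact Subalgebra.neg_mem _ (Subalgebra.mul_mem _ (inv_sub_mem K σ 0) (inv_sub_mem K σ 1))⟩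

/-- The punctures `{0, 1, y⁻¹}`. -/
abbrev hypPunctures (y : ℂ) : Fin 2 → ℂ := ![1, y⁻¹]

/-- The form `η₂ = dx / (1 - y x)`. -/
def η₂ {K : Type} [Field K] [Algebra K ℂ] (y : K) (hy : y ≠ 0) : regular K (hypPunctures (algebraMap K ℂ y)) :=
  ⟨fun x => 1 / (1 - algebraMap K ℂ y * (x : ℂ)), by
    have e : (fun x : Line (hypPunctures (algebraMap K ℂ y)) => 1 / (1 - algebraMap K ℂ y * (x : ℂ))) =
        (-y⁻¹) • fun x : Line (hypPunctures (algebraMap K ℂ y)) =>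
          ((x : ℂ) - puncture (hypPunctures (algebraMap K ℂ y)) 2)⁻¹ := by
      funext x
      have h2 : puncture (hypPunctures (algebraMap K ℂ y)) 2 = (algebraMap K ℂ y)⁻¹ := rfl
      have hy' : algebraMap K ℂ y ≠ 0 := by simpa using hy
      simp only [Pi.smul_apply, h2, Algebra.smul_def, map_neg, map_inv₀, one_div]
      rw [← inv_neg, ← mul_inv]
      congr 1
      field_simp
      ring
    rw [e]
    exact Subalgebra.smul_mem _ (inv_sub_mem K _ 2) _⟩

/-- The objects `M_{a,b,c}(y) = M_{0,1,y⁻¹}(b, c - b, -a)` and `M_{b,c-b} = M_{0,1}(b, c - b)` are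
defined. -/
structure HypRealised (K Q : Type) [Field K] [Field Q] [Algebra K ℂ] [Algebra Q ℂ]
    [CharZero K] [CharZero Q] (a b c y : K) : Prop where
  hyp : IsRealised K Q (hypPunctures (algebraMap K ℂ y)) ![algebraMap K ℂ b, algebraMap K ℂ (c - b), algebraMap K ℂ (-a)]
  beta : IsRealised K Q ![1] ![algebraMap K ℂ b, algebraMap K ℂ (c - b)]

namespace HypRealised

variable {K Q : Type} [Field K] [Field Q] [Algebra K ℂ] [Algebra Q ℂ]
    [CharZero K] [CharZero Q] {a b c y : K}

/-- `β^𝔪(b, c - b) = [M_{b,c-b}, φ, η]^𝔪`. -/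
def betaMot (h : HypRealised K Q a b c y) : PMot K Q := h.beta.motPeriod (η₁ K ![1] rfl)

/-- `β^𝔡𝔯(b, c - b) = [M_{b,c-b}, -η, η]^𝔡𝔯`. -/
def betaDR (h : HypRealised K Q a b c y) : PDR K Q :=
  h.beta.drPeriod (-η₁ K ![1] rfl) (η₁ K ![1] rfl)

/-- `ℱ^𝔪(a, b, c; y) = [M_{a,b,c}(y), φ₁, η₁]^𝔪`. -/
def calFMot (h : HypRealised K Q a b c y) : PMot K Q :=
  h.hyp.motPeriod (η₁ K (hypPunctures (algebraMap K ℂ y)) rfl)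

/-- `ℱ^𝔡𝔯(a, b, c; y) = [M_{a,b,c}(y), -η₁, η₁]^𝔡𝔯`. -/
def calFDR (h : HypRealised K Q a b c y) : PDR K Q :=
  h.hyp.drPeriod (-η₁ K (hypPunctures (algebraMap K ℂ y)) rfl) (η₁ K (hypPunctures (algebraMap K ℂ y)) rfl)

/-- `𝒢^𝔡𝔯(a, b, c; y) = [M_{a,b,c}(y), -y η₂, η₁]^𝔡𝔯`. -/
def calGDR (h : HypRealised K Q a b c y) (hy : y ≠ 0) : PDR K Q :=
  h.hyp.drPeriod (-(y • η₂ y hy)) (η₁ K (hypPunctures (algebraMap K ℂ y)) rfl)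

/-- `F^𝔪(a, b, c; y) = β^𝔪(b, c - b)⁻¹ ℱ^𝔪(a, b, c; y)`. -/
def FMot (h : HypRealised K Q a b c y) : PMot K Q := Ring.inverse h.betaMot * h.calFMot

/-- `F^𝔡𝔯(a, b, c; y) = β^𝔡𝔯(b, c - b)⁻¹ ℱ^𝔡𝔯(a, b, c; y)`. -/
def FDR (h : HypRealised K Q a b c y) : PDR K Q := Ring.inverse h.betaDR * h.calFDR

/-- `G^𝔡𝔯(a, b, c; y) = (a (c - a) / c) β^𝔡𝔯(b, c - b)⁻¹ 𝒢^𝔡𝔯(a, b, c; y)`. -/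
def GDR (h : HypRealised K Q a b c y) (hy : y ≠ 0) : PDR K Q :=
  (a * (c - a) / c) • (Ring.inverse h.betaDR * h.calGDR hy)

end HypRealised

end TwistedPeriods

end

/-! ### Analysis on the punctured line: compactly supported representatives and the residue formula
for the pairing. -/

noncomputable section
namespace TwistedPeriods

open Complex Metric Set Filter Topology

/-! ### Local theory of first order linear equations at a regular singular point -/

/-! The hypotheses say that the exponents at all punctures and at infinity are non-integral, so the
local monodromies are non-trivial. Locally the equation `∇φ = -ν` then has a unique single-valued
solution when `ν` is logarithmic, and a flat single-valued function near a puncture or near infinity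
is zero. Everything about `M_Σ(s)` rests on these two facts.

De Rham side. Pole reduction (`exists_logForm_sub_mem`) makes every form cohomologous to a
logarithmic form with residues `r_k` of sum zero. For such a form the local solutions take the value
`-r_k / s_k` at the punctures and vanish at infinity. Cut off and summed, they give a smooth `φ` for
which `ν + ∇φ` has compact support, and the Cauchy-Pompeiu formula evaluates the intersection
integral against residues `r'_k` as `∑ r_k r'_k / s_k` (`exists_modification_conn`). It is
independent of `φ` (`intersectionIntegral_congr`) and vanishes on exact forms
(`intersectionIntegral_exact`), so the pairing exists and is unique.

Betti side. A cover of the punctured line by convex strips and half strips, with `n` more gluing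
edges than patches, bounds `dim H¹` by `n` (`finrank_HB_le`), because there is no global flat
section. Conversely, a logarithmic form with residue sum zero whose smooth periods all vanish has a
holomorphic potential `f`. Then `-f` is an admissible modification with vanishing `∂̄`, so all
intersection numbers are zero and the residue formula kills the form (`eq_zero_of_smooth_periods`).
Hence the period matrix of `n` smooth cycles against `n` logarithmic forms is invertible. This gives
both dimensions, the comparison isomorphism and its uniqueness, and the fact that a cycle without
periods is a boundary.

The interval. The ends of `[ρ, 1 - ρ]` are closed by loops divided by (monodromy minus one). Cycles
close to the punctures have no periods, since logarithmic forms have potentials there. They are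
therefore boundaries, and the resulting class depends neither on `ρ` nor on other choices.

The coaction. The classes of `η₁, η₂` form a basis of the de Rham space of `M_{a,b,c}(y)`. The
residue formula shows that the dual basis consists of multiples of `-η₁` and `-y η₂`, with constants
`b(c-b)/c` and `-y a(c-a)/c`. Multiplication by `x (1 - x) / (1 - y x)` is a morphism from the
object with parameters `(1+a, 1+b, 2+c)` to the one with `(a, b, c)`; it matches the interval
classes and sends `η₁` to `η₂`. So `[M, φ₁, η₂]` is the shifted function, and the first formula is
the definition of `Δ` in this basis.

The beta object has rank one, so `Δβ = (b(c-b)/c) β ⊗ β^𝔡𝔯`. A matrix coefficient of a rank one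
object is invertible when its form is non-zero and its functional is non-zero (motivic case) or
non-zero on the form (de Rham case), by an explicit inverse object. The interval class is non-zero
because, after shifting the exponents to positive real part, its vanishing would force an Euler beta
integral to vanish. Finally `β^𝔪(1+b, 1+c-b) = b(c-b)/(c(1+c)) β^𝔪(b, c-b)`, and the second formula
follows by dividing the first by `Δβ`. -/

theorem exists_bound_inv_add_natCast (τ : ℂ) : ∃ D : ℝ, ∀ m : ℕ, ‖((m : ℂ) + τ)⁻¹‖ ≤ D := by
  have h : Tendsto (fun m : ℕ => ((m : ℂ) + τ)⁻¹) atTop (𝓝 0) :=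
    tendsto_inv₀_cobounded.comp
      (tendsto_add_const_cobounded τ |>.comp (tendsto_natCast_atTop_cobounded (α := ℂ)))
  obtain ⟨D, hD⟩ := (Metric.isBounded_range_of_tendsto _ h).exists_norm_le
  exact ⟨D, fun m => hD _ ⟨m, rfl⟩⟩

/-- The Euler operator `w d/dw + τ` is diagonal on monomials with eigenvalues `m + τ`, none of which
is zero. Dividing the Taylor coefficients of `h` by them inverts it; the inverses are bounded in
`m`, so convergence is not lost. -/
theorem exists_mul_deriv_add_eq {h : ℂ → ℂ} {r : ℝ} (hr : 0 < r)
    (hh : DifferentiableOn ℂ h (ball 0 r)) {τ : ℂ} (hτ : ∀ m : ℤ, τ ≠ m) :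
    ∃ χ : ℂ → ℂ, DifferentiableOn ℂ χ (ball 0 (r / 2)) ∧
      ∀ w ∈ ball (0 : ℂ) (r / 2), w * deriv χ w + τ * χ w = h w := by
  obtain ⟨D, hD⟩ := exists_bound_inv_add_natCast τ
  have hne : ∀ m : ℕ, (m : ℂ) + τ ≠ 0 := fun m hm =>
    hτ (-m) (by push_cast; exact eq_neg_of_add_eq_zero_right hm)
  set a : ℕ → ℂ := fun m => (m.factorial : ℂ)⁻¹ * iteratedDeriv m h 0 with ha
  have hs : ∀ w ∈ ball (0 : ℂ) r, HasSum (fun m => a m * w ^ m) (h w) := by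
    intro w hw
    have := Complex.hasSum_taylorSeries_on_ball hh hw
    refine this.congr_fun ?_ |> fun h => h
    intro m
    simp [ha, smul_eq_mul]; ring
  have hw0 : ((r / 2 : ℝ) : ℂ) ∈ ball (0 : ℂ) r := by
    rw [mem_ball_zero_iff, norm_real, Real.norm_eq_abs, abs_of_pos (by linarith)]; linarith
  -- Absolute convergence of the Taylor series at the single point `r / 2` is the majorant on the
  -- whole ball of radius `r / 2`; this is why the radius is halved.
  have hsum : Summable fun m => ‖a m * ((r / 2 : ℝ) : ℂ) ^ m‖ * D :=
    ((hs _ hw0).summable.norm).mul_right D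
  set F : ℕ → ℂ → ℂ := fun m w => a m * ((m : ℂ) + τ)⁻¹ * w ^ m with hF
  have hFd : ∀ m w, HasDerivAt (F m) (a m * ((m : ℂ) + τ)⁻¹ * (m * w ^ (m - 1))) w := fun m w =>
    (hasDerivAt_pow m w).const_mul _
  have hFD : ∀ m, DifferentiableOn ℂ (F m) (ball 0 (r / 2)) := fun m w _ =>
    (hFd m w).differentiableAt.differentiableWithinAt
  have hle : ∀ (m : ℕ) (w : ℂ), w ∈ ball (0 : ℂ) (r / 2) →
      ‖F m w‖ ≤ ‖a m * ((r / 2 : ℝ) : ℂ) ^ m‖ * D := by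
    intro m w hw
    rw [mem_ball_zero_iff] at hw
    have e : F m w = a m * w ^ m * ((m : ℂ) + τ)⁻¹ := by simp only [hF]; ring
    rw [e, norm_mul]
    refine mul_le_mul ?_ (hD m) (norm_nonneg _) (norm_nonneg _)
    rw [norm_mul (a m), norm_mul (a m), norm_pow, norm_pow]
    refine mul_le_mul_of_nonneg_left (pow_le_pow_left₀ (norm_nonneg _) ?_ m) (norm_nonneg _)
    rw [norm_real, Real.norm_eq_abs, abs_of_pos (by linarith)]
    exact hw.le
  refine ⟨fun w => ∑' m, F m w,
    Complex.differentiableOn_tsum_of_summable_norm hsum hFD isOpen_ball hle, fun w hw => ?_⟩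
  have h1 := (Complex.hasSum_deriv_of_summable_norm hsum hFD isOpen_ball hle hw).mul_left w
  have h2 := (Summable.of_norm_bounded hsum (fun m => hle m w hw)).hasSum.mul_left τ
  refine (h1.add h2).unique ?_
  have hw' : w ∈ ball (0 : ℂ) r := ball_subset_ball (by linarith) hw
  refine (hs w hw').congr_fun fun m => ?_
  rw [(hFd m w).deriv]
  rcases m with _ | m
  · have := hne 0
    simp only [hF, Nat.cast_zero, zero_add, pow_zero, zero_mul, mul_zero, mul_one] at this ⊢
    field_simp
  · have := hne (m + 1)
    simp only [hF, Nat.add_sub_cancel]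
    field_simp
    ring

theorem exists_exp_primitive {A : ℂ → ℂ} {c : ℂ} {r : ℝ} (hA : DifferentiableOn ℂ A (ball c r)) :
    ∃ E : ℂ → ℂ, (∀ w, E w ≠ 0) ∧ ∀ w ∈ ball c r, HasDerivAt E (A w * E w) w := by
  obtain ⟨g, hg⟩ := hA.isExactOn_ball
  refine ⟨fun w => exp (g w), fun w => exp_ne_zero _, fun w hw => ?_⟩
  have := (hg w hw).cexp
  rwa [mul_comm] at this

/-- With the integrating factor `E' = A E`, the substitution `ψ = χ / E` removes the regular part
`A` and leaves the Euler equation `w χ' + τ χ = h E`. -/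
theorem exists_solution_regularSingular {A h : ℂ → ℂ} {r : ℝ} (hr : 0 < r)
    (hA : DifferentiableOn ℂ A (ball 0 r)) (hh : DifferentiableOn ℂ h (ball 0 r)) {τ : ℂ}
    (hτ : ∀ m : ℤ, τ ≠ m) :
    ∃ ψ : ℂ → ℂ, DifferentiableOn ℂ ψ (ball 0 (r / 2)) ∧
      ∀ w ∈ ball (0 : ℂ) (r / 2), w * deriv ψ w + (τ + w * A w) * ψ w = h w := by
  obtain ⟨E, hE0, hE⟩ := exists_exp_primitive hA
  have hED : DifferentiableOn ℂ E (ball 0 r) := fun w hw =>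
    (hE w hw).differentiableAt.differentiableWithinAt
  obtain ⟨χ, hχ, hχ'⟩ := exists_mul_deriv_add_eq hr (hh.mul hED) hτ
  have hsub : ball (0 : ℂ) (r / 2) ⊆ ball 0 r := ball_subset_ball (by linarith)
  refine ⟨fun w => χ w / E w, hχ.div (hED.mono hsub) fun w _ => hE0 w, fun w hw => ?_⟩
  have h1 := (hχ.differentiableAt (isOpen_ball.mem_nhds hw)).hasDerivAt
  have h2 := (h1.div (hE w (hsub hw)) (hE0 w)).deriv
  have h3 := hχ' w hw
  simp only [Pi.mul_apply] at h3
  have h4 := hE0 w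
  have e : deriv (fun w => χ w / E w) w = (deriv χ w * E w - χ w * (A w * E w)) / E w ^ 2 := h2
  rw [e]
  have h5 : w * deriv χ w = h w * E w - τ * χ w := by rw [← h3]; ring
  field_simp
  linear_combination h5

/-- Continuation around `c` multiplies a flat germ by `exp (-2πiτ)`, which is not `1`. As `φ` is
single-valued, it must vanish. -/
theorem eq_zero_of_flat_punctured {φ A : ℂ → ℂ} {c τ : ℂ} {r : ℝ}
    (hA : DifferentiableOn ℂ A (ball c r)) (hτ : ∀ m : ℤ, τ ≠ m)
    (hφ : ∀ x ∈ ball c r, x ≠ c → HasDerivAt φ (-(τ / (x - c) + A x) * φ x) x) :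
    ∀ x ∈ ball c r, x ≠ c → φ x = 0 := by
  intro x hx hxc
  obtain ⟨E, hE0, hE⟩ := exists_exp_primitive hA
  set ℓ : ℝ → ℂ := fun t => c + (x - c) * exp (t * I) with hℓ
  have hℓd : ∀ t : ℝ, HasDerivAt ℓ ((x - c) * (exp (t * I) * I)) t := by
    intro t
    have h1 : HasDerivAt (fun t : ℝ => (t : ℂ) * I) (1 * I) t := (ofRealCLM.hasDerivAt).mul_const I
    exact ((h1.cexp.const_mul (x - c)).const_add c).congr_deriv (by ring)
  have hsub : x - c ≠ 0 := sub_ne_zero.mpr hxc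
  have hℓm : ∀ t, ℓ t ∈ ball c r := fun t => by
    simp only [hℓ, mem_ball, dist_eq, add_sub_cancel_left, norm_mul, norm_exp_ofReal_mul_I, mul_one]
    simpa [dist_eq] using hx
  have hℓc : ∀ t, ℓ t ≠ c := fun t h => by
    have : (x - c) * exp (t * I) = 0 := by simpa [hℓ] using h
    exact (mul_ne_zero hsub (exp_ne_zero _)) this
  -- On the circle through `x`, `exp (τ * (t * I))` is a constant multiple of a branch of `(z - c) ^
  -- τ`. The product of `φ`, `E` and this branch is constant, while `φ` and `E` return to their
  -- values after one turn.
  set Θ : ℝ → ℂ := fun t => φ (ℓ t) * E (ℓ t) * exp (τ * (t * I)) with hΘ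
  have hd : ∀ t, HasDerivAt Θ 0 t := by
    intro t
    have h1 : HasDerivAt (fun t : ℝ => τ * ((t : ℂ) * I)) (τ * (1 * I)) t :=
      ((ofRealCLM.hasDerivAt).mul_const I).const_mul τ
    have h2 := (hφ _ (hℓm t) (hℓc t)).comp_of_eq t (hℓd t) rfl
    have h3 := (hE _ (hℓm t)).comp_of_eq t (hℓd t) rfl
    refine ((h2.mul h3).mul h1.cexp).congr_deriv ?_
    have e : ℓ t - c = (x - c) * exp (t * I) := by simp [hℓ]
    have h0 := exp_ne_zero ((t : ℂ) * I)
    simp only [Function.comp, Pi.mul_apply, e]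
    field_simp
    ring
  have hconst : Θ (2 * Real.pi) = Θ 0 :=
    is_const_of_deriv_eq_zero (fun t => (hd t).differentiableAt) (fun t => (hd t).deriv) _ _
  have e0 : ℓ 0 = x := by simp [hℓ]
  have e1 : ℓ (2 * Real.pi) = x := by
    simp only [hℓ]; push_cast; rw [exp_two_pi_mul_I]; ring
  simp only [hΘ, e0, e1, ofReal_zero, zero_mul, mul_zero, exp_zero, mul_one] at hconst
  by_contra hne
  have h6 : exp (τ * (((2 * Real.pi : ℝ) : ℂ) * I)) = 1 :=
    mul_left_cancel₀ (mul_ne_zero hne (hE0 x)) (by rw [hconst, mul_one])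
  obtain ⟨m, hm⟩ := exp_eq_one_iff.mp h6
  refine hτ m ?_
  push_cast at hm
  exact mul_right_cancel₀ two_pi_I_ne_zero (by rw [← hm])

/-! ### The punctures, the factors and the connection form -/

variable {n : ℕ} {σ : Fin n → ℂ} {s : Fin (n + 1) → ℂ}

theorem mem_Line_iff {x : ℂ} : x ∈ Line σ ↔ ∀ k, x ≠ puncture σ k := by
  simp [Line, eq_comm]

theorem sub_puncture_ne_zero {x : ℂ} (hx : x ∈ Line σ) (k : Fin (n + 1)) : x - puncture σ k ≠ 0 :=
  sub_ne_zero.mpr (mem_Line_iff.mp hx k)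

theorem isOpen_Line : IsOpen (Line σ) :=
  (Set.finite_range (puncture σ)).isClosed.isOpen_compl

/-- The constant `e_k` with `factor σ k x = e_k * (x - puncture σ k)`. -/
def factorConst (σ : Fin n → ℂ) : Fin (n + 1) → ℂ := Fin.cons 1 fun k => -(σ k)⁻¹

theorem factor_eq (h0 : ∀ k, σ k ≠ 0) (k : Fin (n + 1)) (x : ℂ) :
    factor σ k x = factorConst σ k * (x - puncture σ k) := by
  refine Fin.cases ?_ (fun k => ?_) k
  · simp [factor, factorConst, puncture]
  · have := h0 k
    simp only [factor, factorConst, puncture, Fin.cons_succ]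
    field_simp
    ring

theorem factorConst_ne_zero (h0 : ∀ k, σ k ≠ 0) (k : Fin (n + 1)) : factorConst σ k ≠ 0 := by
  refine Fin.cases ?_ (fun k => ?_) k
  · simp [factorConst]
  · simp [factorConst, h0 k]

theorem ne_zero_of_puncture_injective (h : Function.Injective (puncture σ)) (k : Fin n) :
    σ k ≠ 0 := fun h0 => by
  have : puncture σ k.succ = puncture σ 0 := by simpa [puncture] using h0
  exact absurd (h this) (Fin.succ_ne_zero k)

theorem conn_eq_add (k : Fin (n + 1)) (x : ℂ) :
    conn σ s x = s k / (x - puncture σ k) + ∑ j ∈ Finset.univ.erase k, s j / (x - puncture σ j) := by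
  rw [conn, ← Finset.add_sum_erase _ _ (Finset.mem_univ k)]

theorem conn_neg (x : ℂ) : conn σ (-s) x = -conn σ s x := by
  simp [conn, neg_div, Finset.sum_neg_distrib]

/-- With `2 r` at most the minimal distance, an open ball of radius `2 r` around a puncture contains
no other puncture. For a single puncture any radius serves. -/
theorem exists_isolating_radius (h : Function.Injective (puncture σ)) :
    ∃ r > (0 : ℝ), ∀ j k, j ≠ k → 2 * r ≤ ‖puncture σ j - puncture σ k‖ := by
  classical
  by_cases hne : (Finset.univ.filter fun p : Fin (n + 1) × Fin (n + 1) => p.1 ≠ p.2).Nonempty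
  · obtain ⟨p, hp, hmin⟩ := Finset.exists_min_image _
      (fun p : Fin (n + 1) × Fin (n + 1) => ‖puncture σ p.1 - puncture σ p.2‖) hne
    have hp' : p.1 ≠ p.2 := (Finset.mem_filter.mp hp).2
    refine ⟨‖puncture σ p.1 - puncture σ p.2‖ / 2,
      half_pos (norm_pos_iff.mpr (sub_ne_zero.mpr (h.ne hp'))), fun j k hjk => ?_⟩
    have := hmin (j, k) (Finset.mem_filter.mpr ⟨Finset.mem_univ _, hjk⟩)
    simp only at this
    linarith
  · refine ⟨1, one_pos, fun j k hjk => absurd ⟨(j, k), ?_⟩ hne⟩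
    exact Finset.mem_filter.mpr ⟨Finset.mem_univ _, hjk⟩

theorem differentiableOn_conn_erase {r : ℝ}
    (hr : ∀ j k, j ≠ k → 2 * r ≤ ‖puncture σ j - puncture σ k‖) (k : Fin (n + 1)) :
    DifferentiableOn ℂ (fun x => ∑ j ∈ Finset.univ.erase k, s j / (x - puncture σ j))
      (ball (puncture σ k) (2 * r)) := by
  refine DifferentiableOn.fun_sum fun j hj => ?_
  have hjk : j ≠ k := (Finset.mem_erase.mp hj).1
  refine (differentiableOn_const _).div (differentiableOn_id.sub_const _) fun x hx h => ?_
  have : x = puncture σ j := sub_eq_zero.mp h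
  subst this
  have := hr j k hjk
  rw [mem_ball, dist_eq] at hx
  linarith

/-- A flat function near a puncture is zero. -/
theorem eq_zero_of_flat_near_puncture {φ : ℂ → ℂ} {k : Fin (n + 1)} (hs : ∀ m : ℤ, s k ≠ m) {r ρ : ℝ}
    (hr : ∀ j k, j ≠ k → 2 * r ≤ ‖puncture σ j - puncture σ k‖) (hρ : ρ ≤ 2 * r)
    (hφ : ∀ x ∈ ball (puncture σ k) ρ, x ≠ puncture σ k → HasDerivAt φ (-conn σ s x * φ x) x) :
    ∀ x ∈ ball (puncture σ k) ρ, x ≠ puncture σ k → φ x = 0 :=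
  eq_zero_of_flat_punctured ((differentiableOn_conn_erase hr k).mono (ball_subset_ball hρ)) hs
    fun x hx hxk => by rw [← conn_eq_add]; exact hφ x hx hxk

/-- A flat function near infinity is zero. -/
theorem eq_zero_of_flat_near_infinity {φ : ℂ → ℂ} (hs : ∀ m : ℤ, ∑ k, s k ≠ m) {R : ℝ} (hR0 : 0 < R)
    (hR : ∀ k, ‖puncture σ k‖ < R)
    (hφ : ∀ x : ℂ, R < ‖x‖ → HasDerivAt φ (-conn σ s x * φ x) x) :
    ∀ x : ℂ, R < ‖x‖ → φ x = 0 := by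
  have hpw : ∀ (w : ℂ) k, ‖w‖ < R⁻¹ → 1 - puncture σ k * w ≠ 0 := by
    intro w k hw h0
    have h1 : ‖puncture σ k * w‖ = 1 := by rw [← sub_eq_zero.mp h0, norm_one]
    rw [norm_mul] at h1
    have : ‖puncture σ k‖ * ‖w‖ ≤ R * ‖w‖ := by gcongr; exact (hR k).le
    have h3 : R * ‖w‖ < R * R⁻¹ := by gcongr
    rw [mul_inv_cancel₀ hR0.ne'] at h3
    linarith
  -- In the coordinate `w = x⁻¹` infinity becomes a regular singular point at `0` with exponent `-∑
  -- s_k`.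
  have key := eq_zero_of_flat_punctured (φ := fun w => φ w⁻¹) (c := 0) (r := R⁻¹) (τ := -∑ k, s k)
    (A := fun w => -∑ k, s k * puncture σ k / (1 - puncture σ k * w)) ?_ ?_ ?_
  · intro x hx
    have hx0 : x ≠ 0 := fun h => by rw [h, norm_zero] at hx; linarith
    have := key x⁻¹ (by
      rw [mem_ball_zero_iff, norm_inv]; exact inv_strictAnti₀ hR0 hx) (inv_ne_zero hx0)
    simpa using this
  · refine (DifferentiableOn.fun_sum fun k _ => ?_).neg
    exact (differentiableOn_const _).div ((differentiableOn_const _).sub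
      (differentiableOn_id.const_mul _)) fun w hw => hpw w k (by simpa using hw)
  · intro m h
    exact hs (-m) (by push_cast; rw [← h, neg_neg])
  · intro w hw hw0
    rw [mem_ball_zero_iff] at hw
    have hwR : R < ‖w⁻¹‖ := by
      rw [norm_inv]; exact (lt_inv_comm₀ (norm_pos_iff.mpr hw0) hR0).mp hw
    refine ((hφ _ hwR).comp w (hasDerivAt_inv hw0)).congr_deriv ?_
    have e : conn σ s w⁻¹ = w * ∑ k, s k + w ^ 2 * ∑ k, s k * puncture σ k / (1 - puncture σ k * w) := by
      rw [conn, Finset.mul_sum, Finset.mul_sum, ← Finset.sum_add_distrib]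
      refine Finset.sum_congr rfl fun k _ => ?_
      have h1 := hpw w k hw
      have h2 : w⁻¹ - puncture σ k = (1 - puncture σ k * w) / w := by field_simp
      rw [h2]
      field_simp
      ring
    rw [e, sub_zero]
    field_simp
    ring

end TwistedPeriods
end

noncomputable section
namespace TwistedPeriods

open Complex Metric Set Filter Topology Bornology

/-! ### Representatives with compact support of logarithmic forms -/

variable {n : ℕ} {σ : Fin n → ℂ} {s : Fin (n + 1) → ℂ}

/-- After translating `p_k` to `0` and multiplying by `w`, the equation `∇ψ = -ν` for the
logarithmic form `ν` is of the regular singular type with `τ = s_k`. Its value at `w = 0` reads `s_k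
ψ(p_k) = -r_k`; this number is what the residue formula for the pairing sees. -/
theorem exists_solution_near_puncture {r : Fin (n + 1) → ℂ} {k : Fin (n + 1)}
    (hs : ∀ m : ℤ, s k ≠ m) {ρ : ℝ} (hρ0 : 0 < ρ)
    (hρ : ∀ j k, j ≠ k → 2 * ρ ≤ ‖puncture σ j - puncture σ k‖) :
    ∃ ψ : ℂ → ℂ, DifferentiableOn ℂ ψ (ball (puncture σ k) ρ) ∧
      ψ (puncture σ k) = -(r k / s k) ∧
      ∀ x ∈ ball (puncture σ k) ρ, x ≠ puncture σ k →
        HasDerivAt ψ (-conn σ r x - conn σ s x * ψ x) x := by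
  set p := puncture σ k with hp
  have hmaps : MapsTo (fun w : ℂ => w + p) (ball 0 (2 * ρ)) (ball p (2 * ρ)) := fun w hw => by
    simpa [mem_ball, dist_eq] using hw
  have hsh : DifferentiableOn ℂ (fun w : ℂ => w + p) (ball 0 (2 * ρ)) :=
    differentiableOn_id.add_const p
  have hA := (differentiableOn_conn_erase (s := s) hρ k).comp hsh hmaps
  have hR := (differentiableOn_conn_erase (s := r) hρ k).comp hsh hmaps
  obtain ⟨ψ, hψ, hψ'⟩ := exists_solution_regularSingular (h := fun w => -(r k + w *
    ∑ j ∈ Finset.univ.erase k, r j / (w + p - puncture σ j))) (by linarith) hA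
    ((differentiableOn_id.mul hR).const_add (r k)).neg hs
  rw [mul_div_cancel_left₀ ρ two_ne_zero] at hψ hψ'
  have hmaps' : MapsTo (fun x : ℂ => x - p) (ball p ρ) (ball 0 ρ) := fun x hx => by
    simpa [mem_ball, dist_eq] using hx
  refine ⟨fun x => ψ (x - p), hψ.comp (differentiableOn_id.sub_const p) hmaps', ?_, ?_⟩
  · have h1 := hψ' 0 (by simpa using hρ0)
    have h0 : s k ≠ 0 := by simpa using hs 0
    simp only [zero_mul, add_zero, zero_add] at h1
    simp only [sub_self]
    field_simp
    linear_combination h1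
  · intro x hx hxp
    have hxp' : x - p ≠ 0 := sub_ne_zero.mpr hxp
    have h1 := (hψ.differentiableAt (isOpen_ball.mem_nhds (hmaps' hx))).hasDerivAt
    have h2 := hψ' _ (hmaps' hx)
    refine (h1.comp_sub_const x p).congr_deriv ?_
    simp only [Function.comp, sub_add_cancel] at h2
    rw [conn_eq_add k, conn_eq_add (s := s) k, ← hp]
    field_simp
    linear_combination h2

theorem one_sub_puncture_mul_ne_zero {R : ℝ} (hR0 : 0 < R) (hR : ∀ k, ‖puncture σ k‖ < R)
    {w : ℂ} (hw : ‖w‖ < R⁻¹) (k : Fin (n + 1)) : 1 - puncture σ k * w ≠ 0 := by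
  intro h0
  have h1 : ‖puncture σ k * w‖ = 1 := by rw [← sub_eq_zero.mp h0, norm_one]
  rw [norm_mul] at h1
  have : ‖puncture σ k‖ * ‖w‖ ≤ R * ‖w‖ := by gcongr; exact (hR k).le
  have h3 : R * ‖w‖ < R * R⁻¹ := by gcongr
  rw [mul_inv_cancel₀ hR0.ne'] at h3
  linarith

theorem conn_inv {w : ℂ} (hw : w ≠ 0) (h : ∀ k, 1 - puncture σ k * w ≠ 0) :
    conn σ s w⁻¹ = w * (∑ k, s k + w * ∑ k, s k * puncture σ k / (1 - puncture σ k * w)) := by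
  rw [conn, mul_add, Finset.mul_sum, Finset.mul_sum, Finset.mul_sum, ← Finset.sum_add_distrib]
  refine Finset.sum_congr rfl fun k _ => ?_
  have h1 := h k
  have h2 : w⁻¹ - puncture σ k = (1 - puncture σ k * w) / w := by field_simp
  rw [h2]
  field_simp
  ring

/-- Residue sum zero means that the form has no pole at infinity. In the coordinate `w = x⁻¹` the
right-hand side is then divisible by `w`, which forces `ψ 0 = 0`, so infinity contributes nothing to
the Cauchy-Pompeiu formula. -/
theorem exists_solution_near_infinity {r : Fin (n + 1) → ℂ} (hs : ∀ m : ℤ, ∑ k, s k ≠ m)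
    (hr : ∑ k, r k = 0) {R : ℝ} (hR0 : 0 < R) (hR : ∀ k, ‖puncture σ k‖ < R) :
    ∃ ψ : ℂ → ℂ, DifferentiableOn ℂ ψ (ball 0 (2 * R)⁻¹) ∧ ψ 0 = 0 ∧
      ∀ x : ℂ, 2 * R < ‖x‖ →
        HasDerivAt (fun x => ψ x⁻¹) (-conn σ r x - conn σ s x * ψ x⁻¹) x := by
  have hd : ∀ t : Fin (n + 1) → ℂ, DifferentiableOn ℂ
      (fun w => ∑ k, t k * puncture σ k / (1 - puncture σ k * w)) (ball 0 R⁻¹) := fun t =>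
    DifferentiableOn.fun_sum fun k _ => (differentiableOn_const _).div
      ((differentiableOn_const _).sub (differentiableOn_id.const_mul _))
      fun w hw => one_sub_puncture_mul_ne_zero hR0 hR (by simpa using hw) k
  obtain ⟨ψ, hψ, hψ'⟩ := exists_solution_regularSingular (τ := -∑ k, s k)
    (h := fun w => w * ∑ k, r k * puncture σ k / (1 - puncture σ k * w))
    (inv_pos.mpr hR0) (hd s).neg (differentiableOn_id.mul (hd r))
    (fun m h => hs (-m) (by push_cast; rw [← h, neg_neg]))
  have e : R⁻¹ / 2 = (2 * R)⁻¹ := by rw [mul_inv]; ring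
  rw [e] at hψ hψ'
  refine ⟨ψ, hψ, ?_, fun x hx => ?_⟩
  · have h1 := hψ' 0 (by simpa using hR0)
    simp only [zero_mul, add_zero, zero_add] at h1
    exact (mul_eq_zero.mp h1).resolve_left (neg_ne_zero.mpr (by simpa using hs 0))
  · have hx0 : x ≠ 0 := fun h => by rw [h, norm_zero] at hx; linarith
    have hm : x⁻¹ ∈ ball (0 : ℂ) (2 * R)⁻¹ := by
      rw [mem_ball_zero_iff, norm_inv]; exact inv_strictAnti₀ (by linarith) hx
    have hm' : ‖x⁻¹‖ < R⁻¹ := by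
      rw [norm_inv]; exact inv_strictAnti₀ hR0 (by linarith)
    have h1 := (hψ.differentiableAt (isOpen_ball.mem_nhds hm)).hasDerivAt
    have h2 := hψ' _ hm
    refine (h1.comp x (hasDerivAt_inv hx0)).congr_deriv ?_
    have h3 := conn_inv (s := s) (inv_ne_zero hx0) (one_sub_puncture_mul_ne_zero hR0 hR hm')
    have h4 := conn_inv (s := r) (inv_ne_zero hx0) (one_sub_puncture_mul_ne_zero hR0 hR hm')
    rw [inv_inv] at h3 h4
    rw [h3, h4, hr]
    simp only [Pi.neg_apply] at h2
    have h5 : (x ^ 2)⁻¹ = x⁻¹ * x⁻¹ := by rw [← mul_inv, sq]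
    rw [h5]
    linear_combination (-x⁻¹) * h2

theorem contDiff_bump_mul {c : ℂ} {ψ : ℂ → ℂ} {ρ : ℝ} (f : ContDiffBump c) (hf : f.rOut < ρ)
    (hψ : DifferentiableOn ℂ ψ (ball c ρ)) :
    ContDiff ℝ (⊤ : ℕ∞) fun x => (f x : ℂ) * ψ x := by
  rw [contDiff_iff_contDiffAt]
  intro x
  by_cases hx : x ∈ ball c ρ
  · exact (ofRealCLM.contDiff.comp f.contDiff).contDiffAt.mul
      (((hψ.contDiffOn isOpen_ball).restrict_scalars ℝ).contDiffAt (isOpen_ball.mem_nhds hx))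
  · have hx' : x ∈ (closedBall c f.rOut)ᶜ := fun h =>
      hx (closedBall_subset_ball hf h)
    refine (contDiffAt_const (c := (0 : ℂ))).congr_of_eventuallyEq ?_
    filter_upwards [isClosed_closedBall.isOpen_compl.mem_nhds hx'] with y hy
    rw [mem_compl_iff, mem_closedBall, not_le] at hy
    rw [f.zero_of_le_dist hy.le]
    simp

/-- The local solutions are cut off and added. The sum is smooth on all of `ℂ`, including the
punctures, where it keeps its prescribed values, and it solves `∇φ = -ν` off a compact subset of the
punctured line. -/
theorem exists_smooth_modification (hinj : Function.Injective (puncture σ))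
    (hs : ∀ k, ∀ m : ℤ, s k ≠ m) (hS : ∀ m : ℤ, ∑ k, s k ≠ m)
    {r : Fin (n + 1) → ℂ} (hr : ∑ k, r k = 0) :
    ∃ φ : ℂ → ℂ, ContDiff ℝ (⊤ : ℕ∞) φ ∧ (∀ k, φ (puncture σ k) = -(r k / s k)) ∧
      Tendsto φ (cobounded ℂ) (𝓝 0) ∧
      ∃ C : Set ℂ, IsCompact C ∧ C ⊆ Line σ ∧
        (∀ x ∉ C, DifferentiableAt ℂ φ x) ∧
        ∀ x ∈ Line σ, x ∉ C → HasDerivAt φ (-conn σ r x - conn σ s x * φ x) x := by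
  obtain ⟨ρ, hρ0, hρ⟩ := exists_isolating_radius hinj
  choose ψ hψ hψv hψ' using fun k => exists_solution_near_puncture (r := r) (hs k) hρ0 hρ
  obtain ⟨R₁, hR₁⟩ := (Set.finite_range (puncture σ)).isBounded.exists_norm_le
  -- The cutoffs at the punctures live in discs of radius `ρ / 2`, all inside `‖x‖ < R`; the cutoff
  -- at infinity lives in `‖x‖ ≥ 3 R`, where the solution, defined for `‖x‖ > 2 R`, is available.
  -- The supports are disjoint.
  set R : ℝ := |R₁| + 1 + ρ with hRdef
  have hR0 : 0 < R := by positivity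
  have hRp : ∀ k, ‖puncture σ k‖ + ρ < R := fun k => by
    have := hR₁ _ ⟨k, rfl⟩
    have := le_abs_self R₁
    simp only [hRdef]; linarith
  obtain ⟨ψi, hψi, hψi0, hψi'⟩ := exists_solution_near_infinity hS hr hR0
    (fun k => by have := hRp k; linarith)
  let f : ∀ k, ContDiffBump (puncture σ k) := fun k => ⟨ρ / 3, ρ / 2, by linarith, by linarith⟩
  let g : ContDiffBump (0 : ℂ) := ⟨3 * R, 4 * R, by linarith, by linarith⟩
  set u : Fin (n + 1) → ℂ → ℂ := fun k x => (f k x : ℂ) * ψ k x with hu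
  set ui : ℂ → ℂ := fun x => (1 - (g x : ℂ)) * ψi x⁻¹ with hui
  have hu_smooth : ∀ k, ContDiff ℝ (⊤ : ℕ∞) (u k) := fun k =>
    contDiff_bump_mul (f k) (show ρ / 2 < ρ by linarith) (hψ k)
  have hui_zero : ∀ x : ℂ, ‖x‖ ≤ 3 * R → ui x = 0 := fun x hx => by
    have : g x = 1 := g.one_of_mem_closedBall (by simpa using hx)
    simp [hui, this]
  have hu_zero : ∀ k (x : ℂ), ρ / 2 ≤ dist x (puncture σ k) → u k x = 0 := fun k x hx => by
    simp [hu, (f k).zero_of_le_dist hx]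
  have hu_eq : ∀ k (x : ℂ), dist x (puncture σ k) ≤ ρ / 3 → u k x = ψ k x := fun k x hx => by
    have : f k x = 1 := (f k).one_of_mem_closedBall hx
    simp [hu, this]
  have hui_eq : ∀ x : ℂ, 4 * R ≤ ‖x‖ → ui x = ψi x⁻¹ := fun x hx => by
    have : g x = 0 := g.zero_of_le_dist (by simpa using hx)
    simp [hui, this]
  have hui_smooth : ContDiff ℝ (⊤ : ℕ∞) ui := by
    rw [contDiff_iff_contDiffAt]
    intro x
    by_cases hx : ‖x‖ < 3 * R
    · refine (contDiffAt_const (c := (0 : ℂ))).congr_of_eventuallyEq ?_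
      filter_upwards [(isOpen_lt continuous_norm continuous_const).mem_nhds hx] with y hy
      exact hui_zero y (le_of_lt hy)
    · have hx2 : 2 * R < ‖x‖ := by linarith
      have hopen : IsOpen {x : ℂ | 2 * R < ‖x‖} := isOpen_lt continuous_const continuous_norm
      have hd : DifferentiableOn ℂ (fun x => ψi x⁻¹) {x : ℂ | 2 * R < ‖x‖} := fun y hy =>
        (hψi' y hy).differentiableAt.differentiableWithinAt
      exact (contDiffAt_const.sub (ofRealCLM.contDiff.comp g.contDiff).contDiffAt).mul
        (((hd.contDiffOn hopen).restrict_scalars ℝ).contDiffAt (hopen.mem_nhds hx2))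
  set φ : ℂ → ℂ := fun x => ∑ k, u k x + ui x with hφ
  have hnear : ∀ k (x : ℂ), dist x (puncture σ k) ≤ ρ / 3 → φ x = ψ k x := by
    intro k x hx
    have h1 : ∑ j, u j x = u k x := by
      refine Finset.sum_eq_single_of_mem k (Finset.mem_univ _) fun j _ hjk => hu_zero j x ?_
      have h1 := hρ j k hjk
      have h2 : ‖puncture σ j - puncture σ k‖ ≤ dist x (puncture σ j) + dist x (puncture σ k) := by
        rw [← dist_eq, dist_comm x]; exact dist_triangle _ _ _
      linarith
    have h2 : ‖x‖ ≤ ‖puncture σ k‖ + dist x (puncture σ k) := by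
      rw [dist_eq]; simpa using norm_add_le (puncture σ k) (x - puncture σ k)
    have h3 := hRp k
    simp only [hφ]
    rw [h1, hu_eq k x hx, hui_zero x (by linarith), add_zero]
  have hfar : ∀ x : ℂ, 4 * R ≤ ‖x‖ → φ x = ψi x⁻¹ := by
    intro x hx
    have h1 : ∑ j, u j x = 0 := Finset.sum_eq_zero fun j _ => hu_zero j x (by
      have h2 : ‖x‖ ≤ ‖puncture σ j‖ + dist x (puncture σ j) := by
        rw [dist_eq]; simpa using norm_add_le (puncture σ j) (x - puncture σ j)
      have h3 := hRp j
      linarith)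
    simp only [hφ]
    rw [h1, hui_eq x hx, zero_add]
  have hnear_ev : ∀ k (x : ℂ), dist x (puncture σ k) < ρ / 3 → φ =ᶠ[𝓝 x] ψ k := fun k x hx => by
    filter_upwards [isOpen_ball.mem_nhds (mem_ball.mpr hx)] with y hy
    exact hnear k y (le_of_lt hy)
  have hfar_ev : ∀ x : ℂ, 4 * R < ‖x‖ → φ =ᶠ[𝓝 x] fun x => ψi x⁻¹ := fun x hx => by
    filter_upwards [(isOpen_lt continuous_const continuous_norm).mem_nhds hx] with y hy
    exact hfar y (le_of_lt hy)
  -- The compact set is the closed disc of radius `4 R` minus the discs of radius `ρ / 3`: off it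
  -- exactly one cutoff is identically one and `φ` is the local solution.
  refine ⟨φ, (ContDiff.sum fun k _ => hu_smooth k).add hui_smooth, fun k => ?_, ?_,
    closedBall 0 (4 * R) ∩ ⋂ k, (ball (puncture σ k) (ρ / 3))ᶜ, ?_, ?_, ?_, ?_⟩
  · rw [hnear k _ (by simpa using (by linarith : 0 ≤ ρ / 3)), hψv]
  · have h1 : Tendsto (fun x : ℂ => ψi x⁻¹) (cobounded ℂ) (𝓝 0) := by
      have h2 : ContinuousAt ψi 0 := (hψi.differentiableAt (isOpen_ball.mem_nhds
        (mem_ball_self (by positivity)))).continuousAt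
      have h3 : Tendsto ψi (𝓝 0) (𝓝 0) := by simpa [hψi0] using h2.tendsto
      exact h3.comp tendsto_inv₀_cobounded
    refine h1.congr' ?_
    filter_upwards [tendsto_norm_cobounded_atTop.eventually_ge_atTop (4 * R)] with x hx
    exact (hfar x hx).symm
  · exact (isCompact_closedBall _ _).inter_right
      (isClosed_iInter fun k => isOpen_ball.isClosed_compl)
  · intro x hx
    rw [mem_Line_iff]
    rintro k rfl
    exact Set.mem_iInter.mp hx.2 k (mem_ball_self (by linarith))
  · intro x hx
    by_cases h4 : 4 * R < ‖x‖
    · exact (hψi' x (by linarith)).differentiableAt.congr_of_eventuallyEq (hfar_ev x h4)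
    · have : ∃ k, x ∈ ball (puncture σ k) (ρ / 3) := by
        by_contra hcon
        push Not at hcon
        exact hx ⟨by simpa using not_lt.mp h4, Set.mem_iInter.mpr hcon⟩
      obtain ⟨k, hk⟩ := this
      exact ((hψ k).differentiableAt (isOpen_ball.mem_nhds
        (ball_subset_ball (by linarith) hk))).congr_of_eventuallyEq (hnear_ev k x hk)
  · intro x hxL hx
    by_cases h4 : 4 * R < ‖x‖
    · rw [hfar x h4.le]
      exact (hψi' x (by linarith)).congr_of_eventuallyEq (hfar_ev x h4)
    · have : ∃ k, x ∈ ball (puncture σ k) (ρ / 3) := by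
        by_contra hcon
        push Not at hcon
        exact hx ⟨by simpa using not_lt.mp h4, Set.mem_iInter.mpr hcon⟩
      obtain ⟨k, hk⟩ := this
      rw [hnear k x (le_of_lt hk)]
      exact (hψ' k x (ball_subset_ball (by linarith) hk) (mem_Line_iff.mp hxL k)).congr_of_eventuallyEq
        (hnear_ev k x hk)

end TwistedPeriods
end

noncomputable section
namespace TwistedPeriods

open Complex Metric Set Filter Topology Bornology MeasureTheory

/-! ### The Cauchy-Pompeiu formula -/

/-- The derivative `∂φ/∂x̄`. -/
def dbar (φ : ℂ → ℂ) (x : ℂ) : ℂ := (fderiv ℝ φ x 1 + I * fderiv ℝ φ x I) / 2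

theorem dbar_eq_zero {φ : ℂ → ℂ} {x : ℂ} (h : DifferentiableAt ℂ φ x) : dbar φ x = 0 := by
  have e := h.fderiv_restrictScalars ℝ
  have h1 : fderiv ℝ φ x I = I * fderiv ℝ φ x 1 := by
    rw [e]
    simp only [ContinuousLinearMap.coe_restrictScalars']
    rw [← smul_eq_mul, ← map_smul, smul_eq_mul, mul_one]
  rw [dbar, h1, ← mul_assoc, I_mul_I]
  ring

/-- The operator `2 ∂̄` in polar coordinates: the phase of `x⁻¹` turns it into the derivative in the
radial direction plus `I` times the derivative in the angular direction. -/
theorem dbar_exp_mul_I (L : ℂ →L[ℝ] ℂ) (θ : ℝ) :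
    (L 1 + I * L I) * exp (-(θ * I)) = L (exp (θ * I)) + I * L (exp (θ * I) * I) := by
  have h1 : ∀ a b : ℝ, L (a + b * I) = a * L 1 + b * L I := fun a b => by
    have : (a + b * I : ℂ) = a • (1 : ℂ) + b • I := by simp
    rw [this, map_add, map_smul, map_smul]; simp
  have h2 : exp (θ * I) = (Real.cos θ : ℂ) + (Real.sin θ : ℂ) * I := by
    rw [exp_mul_I]; push_cast; ring
  have h3 : exp (-(θ * I)) = (Real.cos θ : ℂ) - (Real.sin θ : ℂ) * I := by
    rw [← neg_mul, exp_mul_I, cos_neg, sin_neg]; push_cast; ring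
  have h4 : exp (θ * I) * I = ((-Real.sin θ : ℝ) : ℂ) + (Real.cos θ : ℂ) * I := by
    rw [h2]; push_cast; ring_nf; rw [I_sq]; ring
  rw [h4, h1, h2, h1, h3]
  push_cast
  ring_nf
  rw [I_sq]
  ring

/-- In polar coordinates the Jacobian cancels the pole of `x⁻¹`. The radial derivative integrates to
boundary values and the angular derivative to zero. -/
theorem integral_dbar_exp {Φ : ℂ → ℂ} (hΦ : ContDiff ℝ 1 Φ) {R : ℝ} (hR : 0 < R)
    (h0 : ∀ x, R < ‖x‖ → dbar Φ x = 0) :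
    ∫ x, dbar Φ x / x = 2⁻¹ * ∫ θ in (-Real.pi)..Real.pi, (Φ (R * exp (θ * I)) - Φ 0) := by
  have hcont : Continuous (fderiv ℝ Φ) := hΦ.continuous_fderiv one_ne_zero
  have hd : ∀ x, HasFDerivAt Φ (fderiv ℝ Φ x) x := fun x =>
    (hΦ.differentiable one_ne_zero x).hasFDerivAt
  set w : ℝ × ℝ → ℂ := fun p => p.1 * exp (p.2 * I) with hw
  have hwc : Continuous w := by fun_prop
  set H₁ : ℝ × ℝ → ℂ := fun p => fderiv ℝ Φ (w p) (exp (p.2 * I)) with hH₁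
  set H₂ : ℝ × ℝ → ℂ := fun p => fderiv ℝ Φ (w p) (exp (p.2 * I) * I) with hH₂
  have hH₁c : Continuous H₁ := (hcont.comp hwc).clm_apply (by fun_prop)
  have hH₂c : Continuous H₂ := (hcont.comp hwc).clm_apply (by fun_prop)
  have hpi : -Real.pi ≤ Real.pi := by linarith [Real.pi_pos]
  rw [← Complex.integral_comp_polarCoord_symm]
  have e1 : ∀ p ∈ polarCoord.target, p.1 • (dbar Φ (Complex.polarCoord.symm p) /
      Complex.polarCoord.symm p) = (Ioc 0 R ×ˢ Ioo (-Real.pi) Real.pi).indicator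
        (fun p => 2⁻¹ * (H₁ p + I * H₂ p)) p := by
    rintro ⟨r, θ⟩ ⟨hr, hθ⟩
    have hr' : (0 : ℝ) < r := hr
    have ew : Complex.polarCoord.symm (r, θ) = w (r, θ) := by
      simp [hw, exp_mul_I]
    rw [ew]
    by_cases hrR : r ≤ R
    · rw [indicator_of_mem (by exact ⟨⟨hr, hrR⟩, hθ⟩)]
      simp only [hH₁, hH₂]
      rw [← dbar_exp_mul_I, dbar, exp_neg]
      have h1 := exp_ne_zero (θ * I)
      have h2 : (r : ℂ) ≠ 0 := by exact_mod_cast hr'.ne'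
      simp only [hw, real_smul]
      field_simp
    · rw [indicator_of_notMem (by rintro ⟨h, -⟩; exact hrR h.2), h0]
      · simp
      · simp only [hw, norm_mul, norm_real, norm_exp_ofReal_mul_I, mul_one, Real.norm_eq_abs]
        rw [abs_of_pos hr']
        exact not_le.mp hrR
  rw [setIntegral_congr_fun polarCoord.open_target.measurableSet e1,
    setIntegral_indicator (measurableSet_Ioc.prod measurableSet_Ioo)]
  have e2 : polarCoord.target ∩ Ioc 0 R ×ˢ Ioo (-Real.pi) Real.pi
      = Ioc 0 R ×ˢ Ioo (-Real.pi) Real.pi := by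
    refine inter_eq_right.mpr fun p hp => ⟨hp.1.1, hp.2⟩
  rw [e2]
  have hint : ∀ H : ℝ × ℝ → ℂ, Continuous H →
      IntegrableOn H (Ioc 0 R ×ˢ Ioo (-Real.pi) Real.pi) (volume.prod volume) := fun H hH =>
    (hH.continuousOn.integrableOn_compact (isCompact_Icc.prod isCompact_Icc)).mono_set
      (prod_mono Ioc_subset_Icc_self Ioo_subset_Icc_self)
  have hint' : ∀ H : ℝ × ℝ → ℂ, Continuous H →
      IntegrableOn H (Ioo (-Real.pi) Real.pi ×ˢ Ioc 0 R) (volume.prod volume) := fun H hH =>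
    (hH.continuousOn.integrableOn_compact (isCompact_Icc.prod isCompact_Icc)).mono_set
      (prod_mono Ioo_subset_Icc_self Ioc_subset_Icc_self)
  rw [integral_const_mul, Measure.volume_eq_prod,
    integral_add (hint _ hH₁c) ((hint _ hH₂c).const_mul I), integral_const_mul]
  -- For fixed `r` the angular term is the `θ`-derivative of the periodic function `r⁻¹ Φ(r
  -- e^{iθ})`.
  have i2 : ∫ p in Ioc 0 R ×ˢ Ioo (-Real.pi) Real.pi, H₂ p ∂(volume.prod volume) = 0 := by
    rw [setIntegral_prod _ (hint _ hH₂c)]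
    refine setIntegral_eq_zero_of_forall_eq_zero fun r hr => ?_
    rw [← integral_Ioc_eq_integral_Ioo, ← intervalIntegral.integral_of_le hpi]
    have hr0 : (r : ℂ) ≠ 0 := by exact_mod_cast hr.1.ne'
    have hder : ∀ θ : ℝ, HasDerivAt (fun θ : ℝ => (r : ℂ)⁻¹ * Φ (w (r, θ))) (H₂ (r, θ)) θ := by
      intro θ
      have h1 : HasDerivAt (fun θ : ℝ => (θ : ℂ) * I) (1 * I) θ :=
        (ofRealCLM.hasDerivAt).mul_const I
      have h2 : HasDerivAt (fun θ : ℝ => w (r, θ)) (r • (exp (θ * I) * I)) θ :=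
        (h1.cexp.const_mul (r : ℂ)).congr_deriv (by simp)
      refine (((hd (w (r, θ))).comp_hasDerivAt θ h2).const_mul (r : ℂ)⁻¹).congr_deriv ?_
      rw [map_smul, real_smul, ← mul_assoc, inv_mul_cancel₀ hr0, one_mul]
    rw [intervalIntegral.integral_eq_sub_of_hasDerivAt (fun θ _ => hder θ)
      ((hH₂c.comp (by fun_prop : Continuous fun θ : ℝ => (r, θ))).intervalIntegrable _ _)]
    simp only [hw]
    push_cast
    rw [neg_mul, exp_neg, exp_pi_mul_I]
    norm_num
  have i1 : ∫ p in Ioc 0 R ×ˢ Ioo (-Real.pi) Real.pi, H₁ p ∂(volume.prod volume) =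
      ∫ θ in (-Real.pi)..Real.pi, (Φ (R * exp (θ * I)) - Φ 0) := by
    rw [← setIntegral_prod_swap, setIntegral_prod _ (hint' (fun z => H₁ z.swap)
      (hH₁c.comp continuous_swap)), ← integral_Ioc_eq_integral_Ioo,
      ← intervalIntegral.integral_of_le hpi]
    congr 1
    funext θ
    rw [← intervalIntegral.integral_of_le hR.le]
    have hder : ∀ r : ℝ, HasDerivAt (fun r : ℝ => Φ (w (r, θ))) (H₁ (r, θ)) r := by
      intro r
      have h2 : HasDerivAt (fun r : ℝ => w (r, θ)) (exp (θ * I)) r := by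
        exact ((ofRealCLM.hasDerivAt).mul_const (exp (θ * I))).congr_deriv (by simp)
      exact (hd (w (r, θ))).comp_hasDerivAt r h2
    simp only [Prod.swap_prod_mk]
    rw [intervalIntegral.integral_eq_sub_of_hasDerivAt (fun r _ => hder r)
      ((hH₁c.comp (by fun_prop : Continuous fun r : ℝ => (r, θ))).intervalIntegrable _ _)]
    simp [hw]
  rw [i1, i2, mul_zero, add_zero]

/-- The previous formula holds for every large radius, while the left side does not depend on it. As
the radius grows, the circle integral of `Φ` tends to zero and only `-Φ 0` times half of `2π`
remains. -/
theorem integral_dbar_div_id {Φ : ℂ → ℂ} (hΦ : ContDiff ℝ 1 Φ) {R : ℝ}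
    (h0 : ∀ x, R < ‖x‖ → dbar Φ x = 0) (hlim : Tendsto Φ (cobounded ℂ) (𝓝 0)) :
    ∫ x, dbar Φ x / x = -Real.pi * Φ 0 := by
  rw [← sub_eq_zero, ← norm_eq_zero]
  refine le_antisymm (le_of_forall_pos_le_add fun ε hε => ?_) (norm_nonneg _)
  have h1 : ∀ᶠ x in cobounded ℂ, ‖Φ x‖ < ε / Real.pi := by
    have := hlim.norm.eventually (gt_mem_nhds (by simpa using div_pos hε Real.pi_pos))
    simpa using this
  obtain ⟨R', hR'⟩ := (hasBasis_cobounded_norm.eventually_iff.mp h1)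
  set T := max (max R 1) R' with hT
  have hT0 : 0 < T := lt_of_lt_of_le one_pos ((le_max_right _ _).trans (le_max_left _ _))
  rw [integral_dbar_exp hΦ hT0 fun x hx =>
    h0 x (lt_of_le_of_lt ((le_max_left _ _).trans (le_max_left _ _)) hx)]
  have hc : Continuous fun θ : ℝ => Φ (T * exp (θ * I)) := hΦ.continuous.comp (by fun_prop)
  rw [intervalIntegral.integral_sub (hc.intervalIntegrable _ _) (by simp),
    intervalIntegral.integral_const]
  have e : (2⁻¹ : ℂ) * ((∫ θ in (-Real.pi)..Real.pi, Φ (T * exp (θ * I)))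
      - (Real.pi - -Real.pi) • Φ 0) - -Real.pi * Φ 0 =
      2⁻¹ * ∫ θ in (-Real.pi)..Real.pi, Φ (T * exp (θ * I)) := by
    rw [real_smul]; push_cast; ring
  rw [e, norm_mul]
  have h2 : ‖∫ θ in (-Real.pi)..Real.pi, Φ (T * exp (θ * I))‖
      ≤ ε / Real.pi * |Real.pi - -Real.pi| := by
    refine intervalIntegral.norm_integral_le_of_norm_le_const fun θ _ => le_of_lt ?_
    refine hR'.2 ?_
    simp only [mem_ofPred_eq, norm_mul, norm_real, norm_exp_ofReal_mul_I, mul_one, Real.norm_eq_abs]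
    rw [abs_of_pos hT0]
    exact le_max_right _ _
  have h3 : |Real.pi - -Real.pi| = 2 * Real.pi := by
    rw [sub_neg_eq_add, ← two_mul, abs_of_pos (by positivity)]
  rw [h3] at h2
  have h4 : ε / Real.pi * (2 * Real.pi) = 2 * ε := by
    have := Real.pi_pos.ne'
    field_simp
  rw [h4] at h2
  have h5 : ‖(2⁻¹ : ℂ)‖ = 2⁻¹ := by simp
  rw [h5]
  linarith

/-- The Cauchy-Pompeiu formula for a function vanishing at infinity. -/
theorem integral_dbar_div {φ : ℂ → ℂ} (hφ : ContDiff ℝ 1 φ) {C : Set ℂ} (hC : IsCompact C)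
    (h0 : ∀ x ∉ C, dbar φ x = 0) (hlim : Tendsto φ (cobounded ℂ) (𝓝 0)) (p : ℂ) :
    ∫ x, dbar φ x / (x - p) = -Real.pi * φ p := by
  have e : ∀ y, dbar (fun y => φ (p + y)) y = dbar φ (p + y) := fun y => by
    simp only [dbar, fderiv_comp_add_left]
  obtain ⟨R₁, hR₁⟩ := hC.isBounded.exists_norm_le
  have := integral_dbar_div_id (Φ := fun y => φ (p + y)) (hφ.comp (contDiff_const.add contDiff_id))
    (R := R₁ + ‖p‖) (fun x hx => ?_) (hlim.comp (tendsto_const_add_cobounded p))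
  · simp only [e, add_zero] at this
    rw [← this, ← integral_add_left_eq_self _ p]
    simp
  · rw [e]
    refine h0 _ fun hmem => ?_
    have h1 := hR₁ _ hmem
    have h2 : ‖x‖ ≤ ‖p + x‖ + ‖p‖ := by simpa using norm_sub_le (p + x) p
    linarith

end TwistedPeriods
end

noncomputable section
namespace TwistedPeriods

open Complex Metric Set Filter Topology Bornology MeasureTheory

/-! ### Integrals of compactly supported functions on the punctured line -/

variable {n : ℕ} {σ : Fin n → ℂ} {s : Fin (n + 1) → ℂ}

open Classical in
/-- Extension by zero of a function on the punctured line. -/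
def extendZero (f : Line σ → ℂ) (z : ℂ) : ℂ := if h : z ∈ Line σ then f ⟨z, h⟩ else 0

theorem extendZero_coe (f : Line σ → ℂ) (x : Line σ) : extendZero f x = f x := dif_pos x.2

theorem extendZero_of_mem (f : Line σ → ℂ) {x : ℂ} (hx : x ∈ Line σ) : extendZero f x = f ⟨x, hx⟩ :=
  dif_pos hx

theorem differentiableOn_extendZero {K : Type} [Field K] [Algebra K ℂ] (ω : regular K σ) :
    DifferentiableOn ℂ (extendZero (ω : Line σ → ℂ)) (Line σ) := by
  obtain ⟨f, hf⟩ := ω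
  simp only
  induction hf using Algebra.adjoin_induction with
  | mem f hf =>
    rcases hf with rfl | ⟨i, rfl⟩
    · exact differentiableOn_id.congr fun x hx => extendZero_of_mem _ hx
    · refine DifferentiableOn.congr (f := fun x => (x - puncture σ i)⁻¹) ?_
        fun x hx => extendZero_of_mem _ hx
      exact (differentiableOn_id.sub_const _).inv fun x hx => sub_puncture_ne_zero hx i
  | algebraMap r =>
    exact (differentiableOn_const (algebraMap K ℂ r)).congr fun x hx => extendZero_of_mem _ hx
  | add f g _ _ hf hg =>
    exact (hf.add hg).congr fun x hx => by simp [extendZero_of_mem _ hx]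
  | mul f g _ _ hf hg =>
    exact (hf.mul hg).congr fun x hx => by simp [extendZero_of_mem _ hx]

theorem intersectionIntegral_eq (φ : ℂ → ℂ) (f : Line σ → ℂ) :
    intersectionIntegral φ f = (Real.pi : ℂ)⁻¹ * ∫ x in Line σ, dbar φ x * extendZero f x := by
  have h := integral_subtype_comap (μ := volume) (isOpen_Line (σ := σ)).measurableSet
    (fun x => (2 * I) * (dbar φ x * extendZero f x))
  simp only [extendZero_coe] at h
  rw [intersectionIntegral]
  simp only [dbar] at h ⊢
  rw [h, integral_const_mul, ← mul_assoc]
  congr 1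
  have h1 := I_ne_zero
  have h2 : (Real.pi : ℂ) ≠ 0 := by exact_mod_cast Real.pi_ne_zero
  field_simp

theorem setIntegral_Line (f : ℂ → ℂ) : ∫ x in Line σ, f x = ∫ x, f x := by
  rw [← setIntegral_univ (μ := volume) (f := f)]
  refine setIntegral_congr_set ?_
  rw [ae_eq_univ, Line, compl_compl]
  exact (Set.finite_range _).measure_zero _

theorem integrableOn_of_eq_zero_off {w : ℂ → ℂ} {C : Set ℂ} (hC : IsCompact C) (hCL : C ⊆ Line σ)
    (hw : ContinuousOn w (Line σ)) (h0 : ∀ x ∈ Line σ, x ∉ C → w x = 0) :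
    IntegrableOn w (Line σ) :=
  ((hw.mono hCL).integrableOn_compact hC).of_forall_sdiff_eq_zero isOpen_Line.measurableSet
    fun x hx => h0 x hx.1 hx.2

/-- Extended by zero, `w` is a compactly supported `C¹` function on the whole plane, whose
derivatives have integral zero. This is the only form of Stokes' theorem that the pairing needs. -/
theorem integral_fderiv_eq_zero {w : ℂ → ℂ} {C : Set ℂ} (hC : IsCompact C) (hCL : C ⊆ Line σ)
    (hw : ContDiffOn ℝ 1 w (Line σ)) (h0 : ∀ x ∈ Line σ, x ∉ C → w x = 0) (v : ℂ) :
    IntegrableOn (fun x => fderiv ℝ w x v) (Line σ) ∧ ∫ x in Line σ, fderiv ℝ w x v = 0 := by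
  classical
  set W := (Line σ).indicator w with hW
  have hWL : ∀ x ∈ Line σ, W =ᶠ[𝓝 x] w := fun x hx => by
    filter_upwards [isOpen_Line.mem_nhds hx] with y hy
    exact indicator_of_mem hy _
  have hWC : ∀ x ∉ C, W x = 0 := fun x hx => by
    by_cases hL : x ∈ Line σ
    · rw [hW, indicator_of_mem hL, h0 x hL hx]
    · exact indicator_of_notMem hL _
  have hWs : ContDiff ℝ 1 W := by
    rw [contDiff_iff_contDiffAt]
    intro x
    by_cases hx : x ∈ C
    · exact ((hw x (hCL hx)).contDiffAt (isOpen_Line.mem_nhds (hCL hx))).congr_of_eventuallyEq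
        (hWL x (hCL hx))
    · refine (contDiffAt_const (c := (0 : ℂ))).congr_of_eventuallyEq ?_
      filter_upwards [hC.isClosed.isOpen_compl.mem_nhds hx] with y hy
      exact hWC y hy
  have hsupp : HasCompactSupport W := HasCompactSupport.intro hC hWC
  have hfs : HasCompactSupport (fun x => fderiv ℝ W x v) :=
    hsupp.fderiv_apply (𝕜 := ℝ) v
  have hfc : Continuous (fun x => fderiv ℝ W x v) :=
    (hWs.continuous_fderiv one_ne_zero).clm_apply continuous_const
  have hint : Integrable (fun x => fderiv ℝ W x v) := hfc.integrable_of_hasCompactSupport hfs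
  have hWint : Integrable W := hWs.continuous.integrable_of_hasCompactSupport hsupp
  have hcongr : EqOn (fun x => fderiv ℝ W x v) (fun x => fderiv ℝ w x v) (Line σ) := fun x hx => by
    simp only [(hWL x hx).fderiv_eq]
  refine ⟨hint.integrableOn.congr_fun hcongr isOpen_Line.measurableSet, ?_⟩
  rw [← setIntegral_congr_fun isOpen_Line.measurableSet hcongr, setIntegral_Line]
  -- Integration by parts against the constant function `1`.
  have := integral_mul_fderiv_eq_neg_fderiv_mul_of_integrable (𝕜 := ℂ) (μ := volume) (f := W)
    (g := fun _ => (1 : ℂ)) (v := v) (by simpa using hint) (by simp) (by simpa using hWint)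
    (fun x _ => hWs.differentiable one_ne_zero x) (fun x _ => differentiableAt_const _)
  simpa using this.symm

/-- The derivative `∂φ/∂x`. -/
def del (φ : ℂ → ℂ) (x : ℂ) : ℂ := (fderiv ℝ φ x 1 - I * fderiv ℝ φ x I) / 2

theorem del_eq {φ : ℂ → ℂ} {x φ' : ℂ} (h : HasDerivAt φ φ' x) : del φ x = φ' := by
  have e := h.differentiableAt.fderiv_restrictScalars ℝ
  rw [del, e]
  simp only [ContinuousLinearMap.coe_restrictScalars']
  have h1 : fderiv ℂ φ x I = I * fderiv ℂ φ x 1 := by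
    rw [← smul_eq_mul, ← map_smul, smul_eq_mul, mul_one]
  rw [h1, fderiv_apply_one_eq_deriv, h.deriv, ← mul_assoc, I_mul_I]
  ring

theorem dbar_mul {φ g : ℂ → ℂ} {x : ℂ} (hφ : DifferentiableAt ℝ φ x) (hg : DifferentiableAt ℝ g x) :
    dbar (fun x => φ x * g x) x = dbar φ x * g x + φ x * dbar g x := by
  simp only [dbar, fderiv_fun_mul hφ hg]
  simp
  ring

theorem del_mul {φ g : ℂ → ℂ} {x : ℂ} (hφ : DifferentiableAt ℝ φ x) (hg : DifferentiableAt ℝ g x) :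
    del (fun x => φ x * g x) x = del φ x * g x + φ x * del g x := by
  simp only [del, fderiv_fun_mul hφ hg]
  simp
  ring

theorem dbar_add {φ g : ℂ → ℂ} {x : ℂ} (hφ : DifferentiableAt ℝ φ x) (hg : DifferentiableAt ℝ g x) :
    dbar (fun x => φ x + g x) x = dbar φ x + dbar g x := by
  simp only [dbar, fderiv_fun_add hφ hg]
  simp
  ring

theorem contDiffOn_fderiv_apply {φ : ℂ → ℂ} (h : ContDiffOn ℝ (⊤ : ℕ∞) φ (Line σ)) (v : ℂ) :
    ContDiffOn ℝ (⊤ : ℕ∞) (fun x => fderiv ℝ φ x v) (Line σ) :=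
  (h.fderiv_of_isOpen isOpen_Line (by simp)).clm_apply contDiffOn_const

theorem contDiffOn_dbar {φ : ℂ → ℂ} (h : ContDiffOn ℝ (⊤ : ℕ∞) φ (Line σ)) :
    ContDiffOn ℝ (⊤ : ℕ∞) (dbar φ) (Line σ) :=
  ((contDiffOn_fderiv_apply h 1).add (contDiffOn_const.mul (contDiffOn_fderiv_apply h I))).div_const 2

theorem contDiffOn_del {φ : ℂ → ℂ} (h : ContDiffOn ℝ (⊤ : ℕ∞) φ (Line σ)) :
    ContDiffOn ℝ (⊤ : ℕ∞) (del φ) (Line σ) :=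
  ((contDiffOn_fderiv_apply h 1).sub (contDiffOn_const.mul (contDiffOn_fderiv_apply h I))).div_const 2

theorem contDiffOn_of_holomorphic {g : ℂ → ℂ} (h : DifferentiableOn ℂ g (Line σ)) :
    ContDiffOn ℝ (⊤ : ℕ∞) g (Line σ) :=
  (h.contDiffOn isOpen_Line).restrict_scalars ℝ

theorem differentiableAt_of_contDiffOn {φ : ℂ → ℂ} (h : ContDiffOn ℝ (⊤ : ℕ∞) φ (Line σ)) {x : ℂ}
    (hx : x ∈ Line σ) : DifferentiableAt ℝ φ x :=
  (h.contDiffAt (isOpen_Line.mem_nhds hx)).differentiableAt (by simp)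

/-- Symmetry of the second derivative. -/
theorem dbar_del {φ : ℂ → ℂ} (h : ContDiffOn ℝ (⊤ : ℕ∞) φ (Line σ)) {x : ℂ} (hx : x ∈ Line σ) :
    dbar (del φ) x = del (dbar φ) x := by
  have hat := h.contDiffAt (isOpen_Line.mem_nhds hx)
  have hsym := hat.isSymmSndFDerivAt (by
    rw [minSmoothness_of_isRCLikeNormedField]
    exact WithTop.coe_le_coe.mpr (le_top : (2 : ℕ∞) ≤ ⊤))
  have hd : DifferentiableAt ℝ (fderiv ℝ φ) x :=
    (hat.fderiv_right (m := (⊤ : ℕ∞)) (by simp)).differentiableAt (by simp)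
  have hv : ∀ v, HasFDerivAt (fun y => fderiv ℝ φ y v) ((fderiv ℝ (fderiv ℝ φ) x).flip v) x := fun v => by
    simpa using hd.hasFDerivAt.clm_apply (hasFDerivAt_const v x)
  have h1 : HasFDerivAt (del φ) _ x := ((hv 1).sub ((hv I).const_mul I)).mul_const (2 : ℂ)⁻¹
  have h2 : HasFDerivAt (dbar φ) _ x := ((hv 1).add ((hv I).const_mul I)).mul_const (2 : ℂ)⁻¹
  rw [dbar, del, h1.fderiv, h2.fderiv]
  simp only [smul_apply, sub_apply, add_apply, ContinuousLinearMap.flip_apply, smul_eq_mul, hsym I 1]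
  ring

theorem differentiableOn_conn : DifferentiableOn ℂ (conn σ s) (Line σ) :=
  DifferentiableOn.fun_sum fun k _ => (differentiableOn_const _).div (differentiableOn_id.sub_const _)
    fun _ hx => sub_puncture_ne_zero hx k

theorem IsCompactModification.dbar_eq_zero {ν : Line σ → ℂ} {φ : ℂ → ℂ} {C : Set ℂ}
    (h : ∀ x : Line σ, (x : ℂ) ∉ C → HasDerivAt φ (-(ν x) - conn σ s x * φ x) x) {x : ℂ}
    (hx : x ∈ Line σ) (hxC : x ∉ C) : dbar φ x = 0 :=
  TwistedPeriods.dbar_eq_zero (h ⟨x, hx⟩ hxC).differentiableAt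

theorem IsCompactModification.integrableOn {ν : Line σ → ℂ} {φ : ℂ → ℂ}
    (h : IsCompactModification σ s ν φ) {g : ℂ → ℂ} (hg : ContinuousOn g (Line σ)) :
    IntegrableOn (fun x => dbar φ x * g x) (Line σ) := by
  obtain ⟨hφ, C, hC, hCL, hd⟩ := h
  refine integrableOn_of_eq_zero_off hC hCL ((contDiffOn_dbar hφ).continuousOn.mul hg) fun x hx hxC => ?_
  rw [IsCompactModification.dbar_eq_zero hd hx hxC, zero_mul]

/-- A compact subset of the punctured line stays away from the punctures and from infinity. The
bound `ρ ≤ 2 * r` keeps every disc of the collar free of other punctures, so that flat functions can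
be studied on it. -/
theorem exists_collar {C : Set ℂ} (hinj : Function.Injective (puncture σ))
    (hC : IsCompact C) (hCL : C ⊆ Line σ) :
    ∃ r ρ R : ℝ, 0 < r ∧ (∀ j k, j ≠ k → 2 * r ≤ ‖puncture σ j - puncture σ k‖) ∧ 0 < ρ ∧ ρ ≤ 2 * r ∧
      0 < R ∧ (∀ k, ‖puncture σ k‖ < R) ∧ (∀ k, ∀ x ∈ ball (puncture σ k) ρ, x ∉ C) ∧
      ∀ x, R < ‖x‖ → x ∉ C := by
  obtain ⟨r, hr0, hr⟩ := exists_isolating_radius hinj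
  have h1 : ∀ k, ∃ ρ > 0, ball (puncture σ k) ρ ⊆ Cᶜ := fun k =>
    Metric.isOpen_iff.mp hC.isClosed.isOpen_compl _ fun hk =>
      (mem_Line_iff.mp (hCL hk) k) rfl
  choose ρ hρ0 hρ using h1
  obtain ⟨R₁, hR₁⟩ := ((Set.finite_range (puncture σ)).isBounded.union hC.isBounded).exists_norm_le
  have hne : (Finset.univ : Finset (Fin (n + 1))).Nonempty := Finset.univ_nonempty
  refine ⟨r, min (Finset.univ.inf' hne ρ) (2 * r), |R₁| + 1, hr0, hr, ?_, min_le_right _ _,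
    by positivity, fun k => ?_, fun k x hx => ?_, fun x hx hxC => ?_⟩
  · exact lt_min ((Finset.lt_inf'_iff hne).mpr fun k _ => hρ0 k) (by linarith)
  · have := hR₁ _ (Or.inl ⟨k, rfl⟩)
    have := le_abs_self R₁
    linarith
  · exact hρ k (ball_subset_ball ((min_le_left _ _).trans (Finset.inf'_le _ (Finset.mem_univ k))) hx)
  · have := hR₁ _ (Or.inr hxC)
    have := le_abs_self R₁
    linarith

theorem mem_Line_of_mem_ball {r ρ : ℝ} (hr : ∀ j k, j ≠ k → 2 * r ≤ ‖puncture σ j - puncture σ k‖)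
    (hρ : ρ ≤ 2 * r) {k : Fin (n + 1)} {x : ℂ} (hx : x ∈ ball (puncture σ k) ρ)
    (hxk : x ≠ puncture σ k) : x ∈ Line σ := by
  rw [mem_Line_iff]
  rintro j rfl
  have hjk : j ≠ k := fun h => hxk (by rw [h])
  have := hr j k hjk
  rw [mem_ball, dist_eq] at hx
  linarith

theorem mem_Line_of_lt_norm {R : ℝ} (hR : ∀ k, ‖puncture σ k‖ < R) {x : ℂ} (hx : R < ‖x‖) :
    x ∈ Line σ := by
  rw [mem_Line_iff]
  rintro k rfl
  exact absurd (hR k) (not_lt.mpr hx.le)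

/-- A function that is flat outside of a compact set vanishes outside of a compact set. -/
theorem exists_compact_of_flat_off (hinj : Function.Injective (puncture σ))
    (hs : ∀ k, ∀ m : ℤ, s k ≠ m) (hS : ∀ m : ℤ, ∑ k, s k ≠ m) {ψ : ℂ → ℂ} {C : Set ℂ}
    (hC : IsCompact C) (hCL : C ⊆ Line σ)
    (hψ : ∀ x ∈ Line σ, x ∉ C → HasDerivAt ψ (-conn σ s x * ψ x) x) :
    ∃ D : Set ℂ, IsCompact D ∧ D ⊆ Line σ ∧ ∀ x ∈ Line σ, x ∉ D → ψ x = 0 := by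
  obtain ⟨r, ρ, R, hr0, hr, hρ0, hρ, hR0, hR, h1, h2⟩ := exists_collar hinj hC hCL
  refine ⟨closedBall 0 R ∩ ⋂ k, (ball (puncture σ k) ρ)ᶜ,
    (isCompact_closedBall _ _).inter_right (isClosed_iInter fun k => isOpen_ball.isClosed_compl),
    fun x hx => ?_, fun x hxL hx => ?_⟩
  · rw [mem_Line_iff]
    rintro k rfl
    exact Set.mem_iInter.mp hx.2 k (mem_ball_self hρ0)
  · by_cases h4 : R < ‖x‖
    · exact eq_zero_of_flat_near_infinity hS hR0 hR
        (fun y hy => hψ y (mem_Line_of_lt_norm hR hy) (h2 y hy)) x h4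
    · have : ∃ k, x ∈ ball (puncture σ k) ρ := by
        by_contra hcon
        push Not at hcon
        exact hx ⟨by simpa using not_lt.mp h4, Set.mem_iInter.mpr hcon⟩
      obtain ⟨k, hk⟩ := this
      exact eq_zero_of_flat_near_puncture (hs k) hr hρ
        (fun y hy hyk => hψ y (mem_Line_of_mem_ball hr hρ hy hyk) (h1 k y hy)) x hk
        (mem_Line_iff.mp hxL k)

/-- The difference of two modifications is flat near the punctures and infinity, hence zero there by
the monodromy argument. Since `f` is holomorphic, the difference of the integrands is `∂̄` of a
compactly supported function. -/
theorem intersectionIntegral_congr (hinj : Function.Injective (puncture σ))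
    (hs : ∀ k, ∀ m : ℤ, s k ≠ m) (hS : ∀ m : ℤ, ∑ k, s k ≠ m) {ν : Line σ → ℂ} {φ φ' : ℂ → ℂ}
    (h : IsCompactModification σ s ν φ) (h' : IsCompactModification σ s ν φ')
    {f : Line σ → ℂ} (hf : DifferentiableOn ℂ (extendZero f) (Line σ)) :
    intersectionIntegral φ f = intersectionIntegral φ' f := by
  have hi := h.integrableOn hf.continuousOn
  have hi' := h'.integrableOn hf.continuousOn
  obtain ⟨hφ, C, hC, hCL, hd⟩ := h
  obtain ⟨hφ', C', hC', hCL', hd'⟩ := h'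
  have hψ := hφ.sub hφ'
  obtain ⟨D, hD, hDL, hD0⟩ := exists_compact_of_flat_off (ψ := fun x => φ x - φ' x) hinj hs hS
    (hC.union hC') (union_subset hCL hCL') fun x hx hxC => by
      rw [mem_union, not_or] at hxC
      refine ((hd ⟨x, hx⟩ hxC.1).sub (hd' ⟨x, hx⟩ hxC.2)).congr_deriv ?_
      ring
  have hF := contDiffOn_of_holomorphic hf
  have h0 := fun v => integral_fderiv_eq_zero (w := fun x => (φ x - φ' x) * extendZero f x) hD hDL
    ((hψ.mul hF).of_le (by exact_mod_cast le_top)) (fun x hx hxD => by simp [hD0 x hx hxD]) v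
  rw [intersectionIntegral_eq, intersectionIntegral_eq]
  congr 1
  rw [← sub_eq_zero, ← integral_sub hi hi']
  have e : EqOn (fun x => dbar φ x * extendZero f x - dbar φ' x * extendZero f x)
      (fun x => (fderiv ℝ (fun x => (φ x - φ' x) * extendZero f x) x 1 +
        I * fderiv ℝ (fun x => (φ x - φ' x) * extendZero f x) x I) / 2) (Line σ) := by
    intro x hx
    have h1 := differentiableAt_of_contDiffOn hφ hx
    have h2 := differentiableAt_of_contDiffOn hφ' hx
    have h3 := dbar_mul (h1.fun_sub h2) (differentiableAt_of_contDiffOn hF hx)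
    have h4 := dbar_eq_zero (hf.differentiableAt (isOpen_Line.mem_nhds hx))
    have h5 : dbar (fun x => φ x - φ' x) x = dbar φ x - dbar φ' x := by
      simp only [dbar, fderiv_fun_sub h1 h2]
      simp
      ring
    rw [h4, mul_zero, add_zero, h5] at h3
    simp only
    rw [← sub_mul, ← h3, dbar]
  rw [setIntegral_congr_fun isOpen_Line.measurableSet e, integral_div,
    integral_add (h0 1).1 ((h0 I).1.const_mul I), integral_const_mul, (h0 1).2, (h0 I).2]
  simp

theorem integral_half_add_eq_zero {μ : Measure ℂ} {p q : ℂ → ℂ} (c : ℂ)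
    (hp : Integrable p μ ∧ ∫ x, p x ∂μ = 0) (hq : Integrable q μ ∧ ∫ x, q x ∂μ = 0) :
    Integrable (fun x => (p x + c * q x) / 2) μ ∧ ∫ x, (p x + c * q x) / 2 ∂μ = 0 := by
  refine ⟨(hp.1.add (hq.1.const_mul c)).div_const 2, ?_⟩
  rw [integral_div, integral_add hp.1 (hq.1.const_mul c), integral_const_mul, hp.2, hq.2]
  simp

/-- Stokes' theorem for the closed compactly supported form `A dx + B dx̄ = ν + ∇φ` against the
potential `g`, which need not be algebraic. The sign in `hg` is that of the dual connection: `f = g'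
- conn * g`. -/
theorem intersectionIntegral_exact {ν : Line σ → ℂ} {φ : ℂ → ℂ}
    (h : IsCompactModification σ s ν φ) (hν : DifferentiableOn ℂ (extendZero ν) (Line σ))
    {f : Line σ → ℂ} {g : ℂ → ℂ}
    (hg : ∀ x : Line σ, HasDerivAt g (f x + conn σ s x * g x) x) :
    intersectionIntegral φ f = 0 := by
  obtain ⟨hφ, C, hC, hCL, hd⟩ := h
  have hgD : DifferentiableOn ℂ g (Line σ) := fun x hx =>
    (hg ⟨x, hx⟩).differentiableAt.differentiableWithinAt
  have hgS := contDiffOn_of_holomorphic hgD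
  have hνS := contDiffOn_of_holomorphic hν
  have hcS := contDiffOn_of_holomorphic (differentiableOn_conn (σ := σ) (s := s))
  set A : ℂ → ℂ := fun x => extendZero ν x + (del φ x + conn σ s x * φ x) with hA
  have hAS : ContDiffOn ℝ (⊤ : ℕ∞) A (Line σ) := hνS.add ((contDiffOn_del hφ).add (hcS.mul hφ))
  have hBS := contDiffOn_dbar hφ
  have hA0 : ∀ x ∈ Line σ, x ∉ C → A x = 0 := fun x hx hxC => by
    simp only [hA]
    rw [del_eq (hd ⟨x, hx⟩ hxC), extendZero_of_mem _ hx]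
    ring
  have hB0 : ∀ x ∈ Line σ, x ∉ C → dbar φ x = 0 := fun x hx hxC =>
    IsCompactModification.dbar_eq_zero hd hx hxC
  have hle : (1 : WithTop ℕ∞) ≤ ((⊤ : ℕ∞) : WithTop ℕ∞) := by exact_mod_cast le_top
  have i1 := fun v => integral_fderiv_eq_zero (w := fun x => dbar φ x * g x) hC hCL
    ((hBS.mul hgS).of_le hle) (fun x hx hxD => by simp [hB0 x hx hxD]) v
  have i2 := fun v => integral_fderiv_eq_zero (w := fun x => A x * g x) hC hCL
    ((hAS.mul hgS).of_le hle) (fun x hx hxD => by simp [hA0 x hx hxD]) v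
  -- With `B = ∂̄φ`, closedness reads `∂̄A = ∂B + conn * B`, and therefore `B f = ∂(B g) - ∂̄(A g)`:
  -- both terms are derivatives of compactly supported functions.
  have e : EqOn (fun x => dbar φ x * extendZero f x)
      (fun x => (fderiv ℝ (fun x => dbar φ x * g x) x 1 +
        (-I) * fderiv ℝ (fun x => dbar φ x * g x) x I) / 2 -
        (fderiv ℝ (fun x => A x * g x) x 1 + I * fderiv ℝ (fun x => A x * g x) x I) / 2)
      (Line σ) := by
    intro x hx
    have dB := differentiableAt_of_contDiffOn hBS hx
    have dg := differentiableAt_of_contDiffOn hgS hx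
    have dφ := differentiableAt_of_contDiffOn hφ hx
    have dc := differentiableAt_of_contDiffOn hcS hx
    have dν := differentiableAt_of_contDiffOn hνS hx
    have ddel := differentiableAt_of_contDiffOn (contDiffOn_del hφ) hx
    have h1 := del_mul dB dg
    have h2 := dbar_mul (differentiableAt_of_contDiffOn hAS hx) dg
    have h3 := dbar_eq_zero (hg ⟨x, hx⟩).differentiableAt
    have h4 := del_eq (hg ⟨x, hx⟩)
    have h5 : dbar A x = dbar (del φ) x + conn σ s x * dbar φ x := by
      have a1 := dbar_add dν (ddel.fun_add (dc.fun_mul dφ))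
      have a2 := dbar_add ddel (dc.fun_mul dφ)
      have a3 := dbar_mul dc dφ
      have a4 := dbar_eq_zero (hν.differentiableAt (isOpen_Line.mem_nhds hx))
      have a5 := dbar_eq_zero (differentiableOn_conn (s := s).differentiableAt (isOpen_Line.mem_nhds hx))
      simp only [hA]
      rw [a1, a2, a3, a4, a5]
      ring
    simp only
    rw [neg_mul, ← sub_eq_add_neg]
    change _ = del (fun x => dbar φ x * g x) x - dbar (fun x => A x * g x) x
    rw [h1, h2, h3, h4, h5, dbar_del hφ hx, extendZero_of_mem _ hx]
    ring
  rw [intersectionIntegral_eq, setIntegral_congr_fun isOpen_Line.measurableSet e,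
    integral_sub (integral_half_add_eq_zero (-I) (i1 1) (i1 I)).1
      (integral_half_add_eq_zero I (i2 1) (i2 I)).1,
    (integral_half_add_eq_zero (-I) (i1 1) (i1 I)).2, (integral_half_add_eq_zero I (i2 1) (i2 I)).2]
  simp

/-- The pairing of logarithmic forms. -/
theorem exists_modification_conn (hinj : Function.Injective (puncture σ))
    (hs : ∀ k, ∀ m : ℤ, s k ≠ m) (hS : ∀ m : ℤ, ∑ k, s k ≠ m)
    {r : Fin (n + 1) → ℂ} (hr : ∑ k, r k = 0) :
    ∃ φ : ℂ → ℂ, IsCompactModification σ s (fun x : Line σ => conn σ r x) φ ∧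
      ∀ r' : Fin (n + 1) → ℂ, intersectionIntegral φ (fun x : Line σ => conn σ r' x) =
        ∑ k, r k * r' k / s k := by
  obtain ⟨φ, hφ, hv, hlim, C, hC, hCL, hhol, hflat⟩ := exists_smooth_modification hinj hs hS hr
  have hmod : IsCompactModification σ s (fun x : Line σ => conn σ r x) φ :=
    ⟨hφ.contDiffOn, C, hC, hCL, fun x hx => hflat x x.2 hx⟩
  refine ⟨φ, hmod, fun r' => ?_⟩
  rw [intersectionIntegral_eq]
  have e : EqOn (fun x => dbar φ x * extendZero (fun x : Line σ => conn σ r' x) x)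
      (fun x => ∑ k, r' k * (dbar φ x * (x - puncture σ k)⁻¹)) (Line σ) := fun x hx => by
    simp only [extendZero_of_mem _ hx, conn, Finset.mul_sum]
    exact Finset.sum_congr rfl fun k _ => by ring
  rw [setIntegral_congr_fun isOpen_Line.measurableSet e, integral_finsetSum]
  -- Each polar term `(x - p_k)⁻¹` is evaluated by Cauchy-Pompeiu as `-π φ(p_k) = π r_k / s_k`.
  · have hp : ∀ k, ∫ x in Line σ, r' k * (dbar φ x * (x - puncture σ k)⁻¹) =
        Real.pi * (r k * r' k / s k) := fun k => by
      rw [integral_const_mul, setIntegral_Line]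
      have := integral_dbar_div (hφ.of_le (by exact_mod_cast le_top)) hC
        (fun x hx => dbar_eq_zero (hhol x hx)) hlim (puncture σ k)
      simp only [div_eq_mul_inv] at this ⊢
      rw [this, hv]
      ring
    simp only [hp]
    rw [← Finset.mul_sum, ← mul_assoc, inv_mul_cancel₀ (by exact_mod_cast Real.pi_ne_zero), one_mul]
  · intro k _
    refine (hmod.integrableOn ?_).const_mul _
    exact ((continuousOn_id.sub continuousOn_const).inv₀ fun x hx => sub_puncture_ne_zero hx k)

end TwistedPeriods
end

/-! ### Pole reduction in algebraic de Rham cohomology. -/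

noncomputable section
namespace TwistedPeriods

open Complex Set

/-! ### Generators of the de Rham cohomology -/

/-- The punctures are distinct and, together with the exponents, are defined over `K`; the
monodromies are defined over `Q`, and none of them (including the one at infinity) is trivial. -/
structure Admissible (K Q : Type) [Field K] [Field Q] [Algebra K ℂ] [Algebra Q ℂ]
    {n : ℕ} (σ : Fin n → ℂ) (s : Fin (n + 1) → ℂ) : Prop where
  inj : Function.Injective (puncture σ)
  puncture_mem : ∀ k, ∃ r : K, algebraMap K ℂ r = puncture σ k
  exponent_mem : ∀ k, ∃ r : K, algebraMap K ℂ r = s k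
  monodromy_mem : ∀ k, ∃ q : Q, algebraMap Q ℂ q = exp (2 * Real.pi * I * s k)
  nonint : ∀ k, ∀ m : ℤ, s k ≠ m
  nonint_sum : ∀ m : ℤ, ∑ k, s k ≠ m

variable {K Q : Type} [Field K] [Field Q] [Algebra K ℂ] [Algebra Q ℂ]
  {n : ℕ} {σ : Fin n → ℂ} {s : Fin (n + 1) → ℂ}

theorem Admissible.neg (h : Admissible K Q σ s) : Admissible K Q σ (-s) where
  inj := h.inj
  puncture_mem := h.puncture_mem
  exponent_mem k := by
    obtain ⟨r, hr⟩ := h.exponent_mem k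
    exact ⟨-r, by rw [map_neg, hr, Pi.neg_apply]⟩
  monodromy_mem k := by
    obtain ⟨q, hq⟩ := h.monodromy_mem k
    exact ⟨q⁻¹, by rw [map_inv₀, hq, ← exp_neg, Pi.neg_apply, mul_neg]⟩
  nonint k m hm := h.nonint k (-m) (by push_cast; rw [← hm]; simp)
  nonint_sum m hm := h.nonint_sum (-m) (by push_cast; rw [← hm]; simp)

/-- The coordinate function. -/
def regX (K : Type) [Field K] [Algebra K ℂ] {n : ℕ} (σ : Fin n → ℂ) : regular K σ :=
  ⟨fun x => x, Algebra.subset_adjoin (Or.inl rfl)⟩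

/-- The function `(x - p_k)⁻¹`. -/
def regInv (K : Type) [Field K] [Algebra K ℂ] {n : ℕ} (σ : Fin n → ℂ) (k : Fin (n + 1)) : regular K σ :=
  ⟨fun x => ((x : ℂ) - puncture σ k)⁻¹, inv_sub_mem K σ k⟩

theorem regX_apply (x : Line σ) : (regX K σ : Line σ → ℂ) x = x := rfl

theorem regInv_apply (k : Fin (n + 1)) (x : Line σ) :
    (regInv K σ k : Line σ → ℂ) x = ((x : ℂ) - puncture σ k)⁻¹ := rfl

theorem regular_ext {f g : regular K σ} (h : ∀ x, (f : Line σ → ℂ) x = (g : Line σ → ℂ) x) : f = g :=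
  Subtype.ext (funext h)

theorem coe_smul_apply (r : K) (f : regular K σ) (x : Line σ) :
    ((r • f : regular K σ) : Line σ → ℂ) x = algebraMap K ℂ r * (f : Line σ → ℂ) x := by
  rw [Subalgebra.coe_smul, Pi.smul_apply, Algebra.smul_def]

theorem coe_add_apply (f g : regular K σ) (x : Line σ) :
    ((f + g : regular K σ) : Line σ → ℂ) x = (f : Line σ → ℂ) x + (g : Line σ → ℂ) x := rfl

theorem coe_sub_apply (f g : regular K σ) (x : Line σ) :
    ((f - g : regular K σ) : Line σ → ℂ) x = (f : Line σ → ℂ) x - (g : Line σ → ℂ) x := rfl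

theorem coe_mul_apply (f g : regular K σ) (x : Line σ) :
    ((f * g : regular K σ) : Line σ → ℂ) x = (f : Line σ → ℂ) x * (g : Line σ → ℂ) x := rfl

theorem coe_pow_apply (f : regular K σ) (m : ℕ) (x : Line σ) :
    ((f ^ m : regular K σ) : Line σ → ℂ) x = ((f : Line σ → ℂ) x) ^ m := rfl

theorem coe_sum_apply {ι : Type*} (t : Finset ι) (f : ι → regular K σ) (x : Line σ) :
    ((∑ i ∈ t, f i : regular K σ) : Line σ → ℂ) x = ∑ i ∈ t, (f i : Line σ → ℂ) x := by
  rw [AddSubmonoidClass.coe_finsetSum, Finset.sum_apply]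

/-- The logarithmic form `∑ k, r_k dx / (x - p_k)`. -/
def logForm (K : Type) [Field K] [Algebra K ℂ] {n : ℕ} (σ : Fin n → ℂ) :
    (Fin (n + 1) → K) →ₗ[K] regular K σ :=
  Fintype.linearCombination K (regInv K σ)

theorem logForm_eq_sum (r : Fin (n + 1) → K) : logForm K σ r = ∑ k, r k • regInv K σ k :=
  Fintype.linearCombination_apply K _ r

theorem logForm_apply (r : Fin (n + 1) → K) (x : Line σ) :
    (logForm K σ r : Line σ → ℂ) x = conn σ (fun k => algebraMap K ℂ (r k)) x := by
  simp only [logForm_eq_sum, coe_sum_apply, coe_smul_apply, regInv_apply, conn, div_eq_mul_inv]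

/-- The monomials `x ^ m` and `(x - p_k) ^ (-m - 1)` span the regular functions. -/
theorem span_monomials (h : Admissible K Q σ s) :
    Submodule.span K (range (fun m : ℕ => regX K σ ^ m) ∪
      range fun p : Fin (n + 1) × ℕ => regInv K σ p.1 ^ (p.2 + 1)) = ⊤ := by
  set S := Submodule.span K (range (fun m : ℕ => regX K σ ^ m) ∪
      range fun p : Fin (n + 1) × ℕ => regInv K σ p.1 ^ (p.2 + 1)) with hS
  have hX : ∀ m, regX K σ ^ m ∈ S := fun m => Submodule.subset_span (Or.inl ⟨m, rfl⟩)
  have hI : ∀ k m, regInv K σ k ^ (m + 1) ∈ S := fun k m => Submodule.subset_span (Or.inr ⟨(k, m), rfl⟩)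
  choose p hp using h.puncture_mem
  -- Division with remainder and the partial fraction rule `e2` are the only two rewriting rules
  -- needed to keep the span stable under multiplication by the generators.
  have e1 : ∀ k, regX K σ * regInv K σ k = 1 + p k • regInv K σ k := fun k => regular_ext fun x => by
    have := sub_puncture_ne_zero x.2 k
    simp only [coe_mul_apply, coe_add_apply, coe_smul_apply, regX_apply, regInv_apply, hp]
    rw [show ((1 : regular K σ) : Line σ → ℂ) x = 1 from rfl]
    field_simp
    ring
  have e2 : ∀ k j, k ≠ j → regInv K σ k * regInv K σ j =
      (p k - p j)⁻¹ • (regInv K σ k - regInv K σ j) := fun k j hkj => regular_ext fun x => by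
    have h1 := sub_puncture_ne_zero x.2 k
    have h2 := sub_puncture_ne_zero x.2 j
    have h3 : puncture σ k - puncture σ j ≠ 0 := sub_ne_zero.mpr (h.inj.ne hkj)
    simp only [coe_mul_apply, coe_sub_apply, coe_smul_apply, regInv_apply, map_inv₀, map_sub, hp]
    field_simp
    ring
  have hIX : ∀ k m, regInv K σ k * regX K σ ^ m ∈ S := fun k m => by
    induction m with
    | zero => simpa using hI k 0
    | succ m ih =>
      rw [pow_succ', ← mul_assoc, mul_comm (regInv K σ k), e1, add_mul, one_mul, smul_mul_assoc]
      exact S.add_mem (hX m) (S.smul_mem _ ih)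
  have hII : ∀ k j m, regInv K σ k * regInv K σ j ^ (m + 1) ∈ S := fun k j m => by
    by_cases hkj : k = j
    · subst hkj
      rw [← pow_succ']
      exact hI k (m + 1)
    · induction m with
      | zero =>
        rw [zero_add, pow_one, e2 k j hkj]
        exact S.smul_mem _ (S.sub_mem (by simpa using hI k 0) (by simpa using hI j 0))
      | succ m ih =>
        rw [pow_succ', ← mul_assoc, e2 k j hkj, smul_mul_assoc, sub_mul]
        refine S.smul_mem _ (S.sub_mem ih ?_)
        rw [← pow_succ']
        exact hI j (m + 1)
  have hXI : ∀ k m, regX K σ * regInv K σ k ^ (m + 1) ∈ S := fun k m => by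
    rw [pow_succ', ← mul_assoc, e1, add_mul, one_mul, smul_mul_assoc, ← pow_succ']
    refine S.add_mem ?_ (S.smul_mem _ (hI k m))
    rcases m with _ | m
    · simpa using hX 0
    · exact hI k m
  have hmul : ∀ a : regular K σ, (∀ m, a * regX K σ ^ m ∈ S) → (∀ k m, a * regInv K σ k ^ (m + 1) ∈ S) →
      ∀ t ∈ S, a * t ∈ S := fun a ha hb t ht => by
    induction ht using Submodule.span_induction with
    | mem t ht =>
      rcases ht with ⟨m, rfl⟩ | ⟨⟨k, m⟩, rfl⟩
      · exact ha m
      · exact hb k m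
    | zero => simp
    | add x y _ _ hx hy => rw [mul_add]; exact S.add_mem hx hy
    | smul r x _ hx => rw [mul_smul_comm]; exact S.smul_mem _ hx
  have hgenX := hmul (regX K σ) (fun m => by rw [← pow_succ']; exact hX _) hXI
  have hgenI := fun k => hmul (regInv K σ k) (hIX k) (hII k)
  -- Stability under all regular functions; applied to the monomial `1`, it shows that the span is
  -- everything.
  have key : ∀ f : Line σ → ℂ, ∀ hf : f ∈ regular K σ, ∀ t ∈ S, (⟨f, hf⟩ : regular K σ) * t ∈ S := by
    intro f hf
    induction hf using Algebra.adjoin_induction with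
    | mem f hf =>
      rcases hf with rfl | ⟨i, rfl⟩
      · exact hgenX
      · exact hgenI i
    | algebraMap r =>
      intro t ht
      have : (⟨algebraMap K (Line σ → ℂ) r, Subalgebra.algebraMap_mem _ r⟩ : regular K σ) * t = r • t :=
        (Algebra.smul_def r t).symm
      rw [this]
      exact S.smul_mem _ ht
    | add f g hf hg ihf ihg =>
      intro t ht
      have : (⟨f + g, Subalgebra.add_mem _ hf hg⟩ : regular K σ) * t =
        (⟨f, hf⟩ : regular K σ) * t + (⟨g, hg⟩ : regular K σ) * t :=
        Subtype.ext (add_mul f g (t : Line σ → ℂ))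
      rw [this]
      exact S.add_mem (ihf t ht) (ihg t ht)
    | mul f g hf hg ihf ihg =>
      intro t ht
      have : (⟨f * g, Subalgebra.mul_mem _ hf hg⟩ : regular K σ) * t =
        (⟨f, hf⟩ : regular K σ) * ((⟨g, hg⟩ : regular K σ) * t) :=
        Subtype.ext (mul_assoc f g (t : Line σ → ℂ))
      rw [this]
      exact ihf _ (ihg t ht)
  rw [eq_top_iff]
  rintro f -
  have := key f f.2 (regX K σ ^ 0) (hX 0)
  simpa using this

theorem mem_exactForms_of_hasDerivAt {ω g : regular K σ} {f : ℂ → ℂ}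
    (hfg : ∀ x : Line σ, f x = (g : Line σ → ℂ) x)
    (hd : ∀ x : Line σ, HasDerivAt f ((ω : Line σ → ℂ) x - conn σ s x * f x) x) :
    ω ∈ exactForms K σ s :=
  ⟨f, by
    have : (Line σ).domRestrict f = (g : Line σ → ℂ) := funext hfg
    rw [this]
    exact g.2, hd⟩

theorem conn_eq_sum_regInv (x : Line σ) :
    conn σ s x = ∑ k, s k * (regInv K σ k : Line σ → ℂ) x := by
  simp [conn, regInv_apply, div_eq_mul_inv]

/-- The form is `∇(x ^ (m + 1))`; the next lemma treats `∇((x - p_j) ^ (-m - 1))`. These two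
families lower the order of the pole at infinity and at `p_j`. -/
theorem nabla_regX_mem {t : Fin (n + 1) → K} (ht : ∀ k, algebraMap K ℂ (t k) = s k) (m : ℕ) :
    ((m + 1 : ℕ) : K) • regX K σ ^ m + ∑ k, t k • (regInv K σ k * regX K σ ^ (m + 1)) ∈
      exactForms K σ s := by
  refine mem_exactForms_of_hasDerivAt (f := fun z => z ^ (m + 1)) (g := regX K σ ^ (m + 1))
    (fun x => rfl) fun x => (hasDerivAt_pow (m + 1) (x : ℂ)).congr_deriv ?_
  simp only [coe_add_apply, coe_smul_apply, coe_sum_apply, coe_pow_apply, regX_apply, coe_mul_apply, ht,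
    conn_eq_sum_regInv (K := K) x, Finset.sum_mul, map_natCast, Nat.add_sub_cancel]
  rw [eq_sub_iff_add_eq]
  congr 1
  exact Finset.sum_congr rfl fun k _ => by ring

theorem nabla_regInv_mem {t : Fin (n + 1) → K} (ht : ∀ k, algebraMap K ℂ (t k) = s k)
    (j : Fin (n + 1)) (m : ℕ) :
    (-((m + 1 : ℕ) : K)) • regInv K σ j ^ (m + 2) + ∑ k, t k • (regInv K σ k * regInv K σ j ^ (m + 1)) ∈
      exactForms K σ s := by
  refine mem_exactForms_of_hasDerivAt (f := fun z => ((z - puncture σ j)⁻¹) ^ (m + 1))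
    (g := regInv K σ j ^ (m + 1)) (fun x => rfl) fun x => ?_
  have hx := sub_puncture_ne_zero x.2 j
  have h1 := (((hasDerivAt_id (x : ℂ)).sub_const (puncture σ j)).fun_inv hx).fun_pow (m + 1)
  refine h1.congr_deriv ?_
  simp only [coe_add_apply, coe_smul_apply, coe_sum_apply, coe_pow_apply, coe_mul_apply, ht,
    conn_eq_sum_regInv (K := K) x, Finset.sum_mul, map_natCast, Nat.add_sub_cancel, regInv_apply, map_neg]
  rw [eq_sub_iff_add_eq]
  have e : ∀ z : ℂ, z + ∑ k, s k * ((x : ℂ) - puncture σ k)⁻¹ * ((x : ℂ) - puncture σ j)⁻¹ ^ (m + 1) =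
    z + ∑ k, s k * (((x : ℂ) - puncture σ k)⁻¹ * ((x : ℂ) - puncture σ j)⁻¹ ^ (m + 1)) := fun z => by
      simp only [mul_assoc]
  rw [e]
  congr 1
  simp only [id, inv_pow]
  field_simp
  ring

/-- The form is `∇ 1`. As its residue sum `∑ t_k` is non-zero, subtracting a multiple of it
normalises the residue sum of a logarithmic form to zero. -/
theorem nabla_one_mem {t : Fin (n + 1) → K} (ht : ∀ k, algebraMap K ℂ (t k) = s k) :
    logForm K σ t ∈ exactForms K σ s := by
  refine mem_exactForms_of_hasDerivAt (f := fun _ => 1) (g := 1) (fun x => rfl) fun x => ?_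
  refine (hasDerivAt_const (x : ℂ) (1 : ℂ)).congr_deriv ?_
  rw [logForm_apply]
  simp [ht]

/-- The leading coefficient of `∇(x ^ (m + 1))` is `m + 1 + ∑ t_k`, and that of `∇((x - p_j) ^ (-m -
1))` is `t_j - (m + 1)`. Non-integrality makes both non-zero, so by induction all monomials reduce
to logarithmic forms modulo exact ones. -/
theorem exists_logForm_sub_mem (h : Admissible K Q σ s) (ω : regular K σ) :
    ∃ r : Fin (n + 1) → K, ∑ k, r k = 0 ∧ ω - logForm K σ r ∈ exactForms K σ s := by
  choose p hp using h.puncture_mem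
  choose t ht using h.exponent_mem
  set T : Submodule K (regular K σ) := exactForms K σ s ⊔ LinearMap.range (logForm K σ) with hT
  have hE : exactForms K σ s ≤ T := le_sup_left
  have hI1 : ∀ k, regInv K σ k ∈ T := fun k =>
    (le_sup_right : _ ≤ T) ⟨Pi.single k 1, by
      rw [logForm, Fintype.linearCombination_apply_single, one_smul]⟩
  have hinj := (algebraMap K ℂ).injective
  have e1 : ∀ k m, regInv K σ k * regX K σ ^ (m + 1) =
      regX K σ ^ m + p k • (regInv K σ k * regX K σ ^ m) := fun k m => regular_ext fun x => by
    have := sub_puncture_ne_zero x.2 k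
    simp only [coe_mul_apply, coe_add_apply, coe_smul_apply, coe_pow_apply, regX_apply, regInv_apply, hp]
    field_simp
    ring
  have e2 : ∀ k j m, k ≠ j → regInv K σ k * regInv K σ j ^ (m + 1) =
      (p k - p j)⁻¹ • (regInv K σ k * regInv K σ j ^ m - regInv K σ j ^ (m + 1)) :=
    fun k j m hkj => regular_ext fun x => by
    have h1 := sub_puncture_ne_zero x.2 k
    have h2 := sub_puncture_ne_zero x.2 j
    have h3 : puncture σ k - puncture σ j ≠ 0 := sub_ne_zero.mpr (h.inj.ne hkj)
    simp only [coe_mul_apply, coe_sub_apply, coe_smul_apply, coe_pow_apply, regInv_apply, map_inv₀,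
      map_sub, hp, inv_pow]
    field_simp
    ring
  have hX : ∀ m, (∀ k, regInv K σ k * regX K σ ^ m ∈ T) → regX K σ ^ m ∈ T := by
    intro m hm
    have h1 := hE (nabla_regX_mem (σ := σ) ht m)
    have hne : ((m + 1 : ℕ) : K) + ∑ k, t k ≠ 0 := fun h0 => by
      refine h.nonint_sum (-(m + 1 : ℕ)) ?_
      have := congrArg (algebraMap K ℂ) h0
      rw [map_add, map_sum, map_natCast, map_zero] at this
      simp only [ht] at this
      push_cast at this ⊢
      exact eq_neg_of_add_eq_zero_right this
    have h2 : ((m + 1 : ℕ) : K) • regX K σ ^ m + ∑ k, t k • (regInv K σ k * regX K σ ^ (m + 1)) =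
        (((m + 1 : ℕ) : K) + ∑ k, t k) • regX K σ ^ m +
          ∑ k, (t k * p k) • (regInv K σ k * regX K σ ^ m) := by
      simp only [e1, smul_add, Finset.sum_add_distrib, add_smul, Finset.sum_smul, smul_smul, add_assoc]
    rw [h2] at h1
    have h3 := (T.add_mem_iff_left (T.sum_mem fun k _ => T.smul_mem (t k * p k) (hm k))).mp h1
    exact (T.smul_mem_iff hne).mp h3
  have hIX : ∀ m k, regInv K σ k * regX K σ ^ m ∈ T := fun m => by
    induction m with
    | zero => intro k; simpa using hI1 k
    | succ m ih =>
      intro k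
      rw [e1]
      exact T.add_mem (hX m ih) (T.smul_mem _ (ih k))
  have hII : ∀ j m, regInv K σ j ^ (m + 1) ∈ T ∧ ∀ k, k ≠ j → regInv K σ k * regInv K σ j ^ m ∈ T := by
    intro j m
    induction m with
    | zero => exact ⟨by simpa using hI1 j, fun k _ => by simpa using hI1 k⟩
    | succ m ih =>
      have hk : ∀ k, k ≠ j → regInv K σ k * regInv K σ j ^ (m + 1) ∈ T := fun k hkj => by
        rw [e2 k j m hkj]
        exact T.smul_mem _ (T.sub_mem (ih.2 k hkj) ih.1)
      refine ⟨?_, hk⟩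
      have h1 := hE (nabla_regInv_mem (σ := σ) ht j m)
      -- The summand `k = j` of the connection has the same pole order as the derivative; their
      -- coefficients add up to this one.
      have hne : -((m + 1 : ℕ) : K) + t j ≠ 0 := fun h0 => by
        refine h.nonint j (m + 1 : ℕ) ?_
        have := congrArg (algebraMap K ℂ) h0
        rw [map_add, map_neg, map_natCast, map_zero, ht] at this
        push_cast at this ⊢
        linear_combination this
      rw [← Finset.add_sum_erase _ _ (Finset.mem_univ j), ← pow_succ', ← add_assoc, ← add_smul] at h1
      have h3 := (T.add_mem_iff_left (T.sum_mem fun k hkj =>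
        T.smul_mem (t k) (hk k (Finset.mem_erase.mp hkj).1))).mp h1
      exact (T.smul_mem_iff hne).mp h3
  have htop : T = ⊤ := by
    rw [eq_top_iff, ← span_monomials h, Submodule.span_le]
    rintro f (⟨m, rfl⟩ | ⟨⟨k, m⟩, rfl⟩)
    · exact hX m (hIX m)
    · exact (hII k m).1
  have hω : ω ∈ T := htop ▸ Submodule.mem_top
  obtain ⟨e, he, l, ⟨r, rfl⟩, hel⟩ := Submodule.mem_sup.mp hω
  have hS : ∑ k, t k ≠ 0 := fun h0 => by
    refine h.nonint_sum 0 ?_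
    have := congrArg (algebraMap K ℂ) h0
    rw [map_sum, map_zero] at this
    simpa only [ht, Int.cast_zero] using this
  refine ⟨r - ((∑ k, r k) / ∑ k, t k) • t, ?_, ?_⟩
  · simp only [Pi.sub_apply, Pi.smul_apply, smul_eq_mul, Finset.sum_sub_distrib, ← Finset.mul_sum]
    field_simp
    ring
  · rw [← hel, map_sub, map_smul, add_sub_assoc, sub_sub_cancel]
    exact Submodule.add_mem _ he (Submodule.smul_mem _ _ (nabla_one_mem ht))

end TwistedPeriods
end

/-! ### Integration of multivalued forms along continuous singular chains. -/

noncomputable section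
namespace TwistedPeriods

open Complex Metric Set Filter Topology

/-! ### Local branches and primitives along continuous maps -/

variable {n : ℕ} {σ : Fin n → ℂ} {s : Fin (n + 1) → ℂ}

/-- The branch near `x` of `∏ (z - p_k) ^ s_k`, normalised to be `1` at `x`. -/
def localBranch (σ : Fin n → ℂ) (s : Fin (n + 1) → ℂ) (x z : ℂ) : ℂ :=
  exp (∑ k, s k * log ((z - puncture σ k) / (x - puncture σ k)))

theorem localBranch_self {x : ℂ} (hx : x ∈ Line σ) : localBranch σ s x x = 1 := by
  simp [localBranch, div_self (sub_puncture_ne_zero hx _)]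

/-- The radius is the distance from `x` to the nearest puncture: then each ratio lies in the disc of
radius `1` around `1`, hence in the right half plane, where the principal logarithm is holomorphic
and additive. -/
theorem exists_safe_radius {x : ℂ} (hx : x ∈ Line σ) :
    ∃ ρ > 0, ball x ρ ⊆ Line σ ∧ ∀ z ∈ ball x ρ, ∀ k,
      0 < ((z - puncture σ k) / (x - puncture σ k)).re := by
  have hne : (Finset.univ : Finset (Fin (n + 1))).Nonempty := Finset.univ_nonempty
  have key : ∀ z ∈ ball x (Finset.univ.inf' hne fun k => ‖x - puncture σ k‖), ∀ k,
      0 < ((z - puncture σ k) / (x - puncture σ k)).re := by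
    intro z hz k
    have h0 := sub_puncture_ne_zero hx k
    have h1 : ‖z - x‖ < ‖x - puncture σ k‖ := by
      rw [mem_ball, dist_eq] at hz
      exact hz.trans_le (Finset.inf'_le _ (Finset.mem_univ k))
    have h2 : (z - puncture σ k) / (x - puncture σ k) = 1 + (z - x) / (x - puncture σ k) := by
      field_simp
      ring
    have h3 : ‖(z - x) / (x - puncture σ k)‖ < 1 := by
      rw [norm_div]
      exact (div_lt_one (norm_pos_iff.mpr h0)).mpr h1
    have h4 := (abs_le.mp (abs_re_le_norm ((z - x) / (x - puncture σ k)))).1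
    rw [h2, add_re, one_re]
    linarith
  refine ⟨_, (Finset.lt_inf'_iff hne).mpr fun k _ => norm_pos_iff.mpr (sub_puncture_ne_zero hx k),
    fun z hz => mem_Line_iff.mpr fun k hk => ?_, key⟩
  have := key z hz k
  rw [hk, sub_self, zero_div, zero_re] at this
  exact lt_irrefl _ this

theorem hasDerivAt_localBranch {x z : ℂ} (hz : z ∈ Line σ) (hx : x ∈ Line σ)
    (h : ∀ k, 0 < ((z - puncture σ k) / (x - puncture σ k)).re) :
    HasDerivAt (localBranch σ s x) (conn σ s z * localBranch σ s x z) z := by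
  have h1 : ∀ k, HasDerivAt (fun z => s k * log ((z - puncture σ k) / (x - puncture σ k)))
      (s k / (z - puncture σ k)) z := fun k => by
    have hzk := sub_puncture_ne_zero hz k
    have hxk := sub_puncture_ne_zero hx k
    refine ((((hasDerivAt_id z).sub_const (puncture σ k)).div_const (x - puncture σ k)).clog
      (Or.inl (h k)) |>.const_mul (s k)).congr_deriv ?_
    simp only [id]
    field_simp
  refine ((HasDerivAt.fun_sum fun k _ => h1 k).cexp).congr_deriv ?_
  rw [mul_comm]
  rfl

/-- Both arguments are smaller than `π / 2` in absolute value, so their sum does not leave the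
principal range. -/
theorem log_mul_of_re_pos {a b : ℂ} (ha : 0 < a.re) (hb : 0 < b.re) : log (a * b) = log a + log b := by
  have ha0 : a ≠ 0 := fun h => by simp [h] at ha
  have hb0 : b ≠ 0 := fun h => by simp [h] at hb
  refine (log_mul_eq_add_log_iff ha0 hb0).mpr ?_
  have h1 := abs_lt.mp (abs_arg_lt_pi_div_two_iff.mpr (Or.inl ha))
  have h2 := abs_lt.mp (abs_arg_lt_pi_div_two_iff.mpr (Or.inl hb))
  exact ⟨by linarith [h1.1, h2.1], by linarith [h1.2, h2.2]⟩

theorem localBranch_mul {x y z : ℂ} (hy : y ∈ Line σ)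
    (h1 : ∀ k, 0 < ((y - puncture σ k) / (x - puncture σ k)).re)
    (h2 : ∀ k, 0 < ((z - puncture σ k) / (y - puncture σ k)).re) :
    localBranch σ s x z = localBranch σ s x y * localBranch σ s y z := by
  rw [localBranch, localBranch, localBranch, ← exp_add, ← Finset.sum_add_distrib]
  congr 1
  refine Finset.sum_congr rfl fun k _ => ?_
  have hyk := sub_puncture_ne_zero hy k
  rw [← mul_add, ← log_mul_of_re_pos (h1 k) (h2 k), mul_comm ((y - _) / _), div_mul_div_cancel₀ hyk]

section primitives

variable {X Y : Type*} [TopologicalSpace X] [TopologicalSpace Y]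

/-- `g` is a section along `h : D → ℂ ∖ Σ` of the local system of solutions of `dg = conn * g`. -/
def IsFlatOn (σ : Fin n → ℂ) (s : Fin (n + 1) → ℂ) (D : Set X) (h g : X → ℂ) : Prop :=
  ∀ p ∈ D, ∀ᶠ q in 𝓝[D] p, g q = g p * localBranch σ s (h p) (h q)

/-- `G` is a primitive of `g * F` along `h : D → ℂ ∖ Σ`. -/
def IsPrimOn (σ : Fin n → ℂ) (s : Fin (n + 1) → ℂ) (F : ℂ → ℂ) (D : Set X) (h g G : X → ℂ) : Prop :=
  ∀ p ∈ D, ∃ Φ : ℂ → ℂ,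
    (∀ᶠ z in 𝓝 (h p), HasDerivAt Φ (g p * localBranch σ s (h p) z * F z) z) ∧
    ∀ᶠ q in 𝓝[D] p, G q = Φ (h q)

variable {F : ℂ → ℂ} {D : Set X} {h g G G' : X → ℂ}

theorem IsFlatOn.add {g' : X → ℂ} (hg : IsFlatOn σ s D h g) (hg' : IsFlatOn σ s D h g') :
    IsFlatOn σ s D h (g + g') := fun p hp => by
  filter_upwards [hg p hp, hg' p hp] with q h1 h2
  rw [Pi.add_apply, Pi.add_apply, h1, h2, add_mul]

theorem IsFlatOn.const_mul (hg : IsFlatOn σ s D h g) (c : ℂ) :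
    IsFlatOn σ s D h (fun x => c * g x) := fun p hp => by
  filter_upwards [hg p hp] with q h1
  rw [h1, mul_assoc]

theorem IsFlatOn.comp {κ : Y → X} {D' : Set Y} (hg : IsFlatOn σ s D h g) (hκ : ContinuousOn κ D')
    (hm : MapsTo κ D' D) : IsFlatOn σ s D' (h ∘ κ) (g ∘ κ) := fun p hp =>
  ((hκ p hp).tendsto_nhdsWithin hm).eventually (hg (κ p) (hm hp))

theorem IsPrimOn.comp {κ : Y → X} {D' : Set Y} (hG : IsPrimOn σ s F D h g G) (hκ : ContinuousOn κ D')
    (hm : MapsTo κ D' D) : IsPrimOn σ s F D' (h ∘ κ) (g ∘ κ) (G ∘ κ) := fun p hp => by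
  obtain ⟨Φ, h1, h2⟩ := hG (κ p) (hm hp)
  exact ⟨Φ, h1, ((hκ p hp).tendsto_nhdsWithin hm).eventually h2⟩

theorem IsPrimOn.mono {D' : Set X} (hG : IsPrimOn σ s F D h g G) (hD : D' ⊆ D) :
    IsPrimOn σ s F D' h g G := fun p hp => by
  obtain ⟨Φ, h1, h2⟩ := hG p (hD hp)
  exact ⟨Φ, h1, h2.filter_mono (nhdsWithin_mono _ hD)⟩

theorem IsPrimOn.add {g' : X → ℂ} (hG : IsPrimOn σ s F D h g G) (hG' : IsPrimOn σ s F D h g' G') :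
    IsPrimOn σ s F D h (g + g') (G + G') := fun p hp => by
  obtain ⟨Φ, h1, h2⟩ := hG p hp
  obtain ⟨Φ', h1', h2'⟩ := hG' p hp
  refine ⟨Φ + Φ', ?_, ?_⟩
  · filter_upwards [h1, h1'] with z hz hz'
    exact (hz.add hz').congr_deriv (by rw [Pi.add_apply]; ring)
  · filter_upwards [h2, h2'] with q hq hq'
    simp [hq, hq']

theorem IsPrimOn.const_mul (hG : IsPrimOn σ s F D h g G) (c : ℂ) :
    IsPrimOn σ s F D h (fun x => c * g x) (fun x => c * G x) := fun p hp => by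
  obtain ⟨Φ, h1, h2⟩ := hG p hp
  refine ⟨fun z => c * Φ z, ?_, ?_⟩
  · filter_upwards [h1] with z hz
    exact (hz.const_mul c).congr_deriv (by ring)
  · filter_upwards [h2] with q hq
    rw [hq]

theorem IsPrimOn.form_add {F' : ℂ → ℂ} (hG : IsPrimOn σ s F D h g G) (hG' : IsPrimOn σ s F' D h g G') :
    IsPrimOn σ s (fun z => F z + F' z) D h g (fun x => G x + G' x) := fun p hp => by
  obtain ⟨Φ, h1, h2⟩ := hG p hp
  obtain ⟨Φ', h1', h2'⟩ := hG' p hp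
  refine ⟨fun z => Φ z + Φ' z, ?_, ?_⟩
  · filter_upwards [h1, h1'] with z hz hz'
    exact (hz.add hz').congr_deriv (by ring)
  · filter_upwards [h2, h2'] with q hq hq'
    simp [hq, hq']

theorem IsPrimOn.form_const_mul (hG : IsPrimOn σ s F D h g G) (c : ℂ) :
    IsPrimOn σ s (fun z => c * F z) D h g (fun x => c * G x) := fun p hp => by
  obtain ⟨Φ, h1, h2⟩ := hG p hp
  refine ⟨fun z => c * Φ z, ?_, ?_⟩
  · filter_upwards [h1] with z hz
    exact (hz.const_mul c).congr_deriv (by ring)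
  · filter_upwards [h2] with q hq
    rw [hq]

theorem IsPrimOn.add_const (hG : IsPrimOn σ s F D h g G) (c : ℂ) :
    IsPrimOn σ s F D h g (fun x => G x + c) := fun p hp => by
  obtain ⟨Φ, h1, h2⟩ := hG p hp
  refine ⟨fun z => Φ z + c, ?_, ?_⟩
  · filter_upwards [h1] with z hz
    exact hz.add_const c
  · filter_upwards [h2] with q hq
    rw [hq]

theorem IsPrimOn.congr (hG : IsPrimOn σ s F D h g G) (hGG : EqOn G' G D) :
    IsPrimOn σ s F D h g G' := fun p hp => by
  obtain ⟨Φ, h1, h2⟩ := hG p hp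
  refine ⟨Φ, h1, ?_⟩
  filter_upwards [h2, self_mem_nhdsWithin] with q hq hqD
  rw [hGG hqD, hq]

theorem constant_of_locally_constant {D : Set X} (hD : IsPreconnected D) {f : X → ℂ}
    (hf : ∀ p ∈ D, ∀ᶠ q in 𝓝[D] p, f q = f p) {p q : X} (hp : p ∈ D) (hq : q ∈ D) : f p = f q := by
  have hc : IsLocallyConstant fun x : D => f x := by
    rw [IsLocallyConstant.iff_eventually_eq]
    rintro ⟨x, hx⟩
    exact (eventually_nhds_subtype_iff D ⟨x, hx⟩ (fun y => f y = f x)).mpr (hf x hx)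
  have := isPreconnected_iff_preconnectedSpace.mp hD
  exact hc.apply_eq_of_isPreconnected isPreconnected_univ (x := ⟨p, hp⟩) (y := ⟨q, hq⟩) trivial trivial

theorem eventually_sub_eq_of_hasDerivAt {Φ Φ' f : ℂ → ℂ} {x : ℂ}
    (h : ∀ᶠ z in 𝓝 x, HasDerivAt Φ (f z) z) (h' : ∀ᶠ z in 𝓝 x, HasDerivAt Φ' (f z) z) :
    ∀ᶠ z in 𝓝 x, Φ z - Φ' z = Φ x - Φ' x := by
  obtain ⟨ρ, hρ, hball⟩ := Metric.eventually_nhds_iff_ball.mp (h.and h')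
  filter_upwards [ball_mem_nhds x hρ] with z hz
  have hd : ∀ y ∈ ball x ρ, HasDerivWithinAt (fun y => Φ y - Φ' y) 0 (ball x ρ) y := fun y hy =>
    (((hball y hy).1.sub (hball y hy).2).congr_deriv (sub_self _)).hasDerivWithinAt
  exact (convex_ball x ρ).is_const_of_fderivWithin_eq_zero (𝕜 := ℂ)
    (fun y hy => (hd y hy).differentiableWithinAt)
    (fun y hy => by
      rw [((hd y hy).hasFDerivWithinAt).fderivWithin (isOpen_ball.uniqueDiffWithinAt hy)]
      ext; simp) hz (mem_ball_self hρ)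

theorem IsPrimOn.sub_locally_const (hh : ContinuousOn h D) (hG : IsPrimOn σ s F D h g G)
    (hG' : IsPrimOn σ s F D h g G') {p : X} (hp : p ∈ D) :
    ∀ᶠ q in 𝓝[D] p, G q - G' q = G p - G' p := by
  obtain ⟨Φ, h1, h2⟩ := hG p hp
  obtain ⟨Φ', h1', h2'⟩ := hG' p hp
  have h3 := (hh p hp).eventually (eventually_sub_eq_of_hasDerivAt h1 h1')
  filter_upwards [h2, h2', h3] with q hq hq' hq3
  rw [hq, hq', hq3, h2.self_of_nhdsWithin hp, h2'.self_of_nhdsWithin hp]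

theorem IsPrimOn.sub_eq (hD : IsPreconnected D) (hh : ContinuousOn h D)
    (hG : IsPrimOn σ s F D h g G) (hG' : IsPrimOn σ s F D h g G') {p q : X} (hp : p ∈ D) (hq : q ∈ D) :
    G q - G p = G' q - G' p := by
  have := constant_of_locally_constant (f := fun x => G x - G' x) hD
    (fun p hp => hG.sub_locally_const hh hG' hp) hp hq
  linear_combination -this

/-- Gluing of primitives. -/
theorem IsPrimOn.union {D₁ D₂ : Set X} (h₁ : IsClosed D₁) (h₂ : IsClosed D₂)
    (hconn : IsPreconnected (D₁ ∩ D₂)) (hh : ContinuousOn h (D₁ ∪ D₂))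
    (e₁ : ∃ G, IsPrimOn σ s F D₁ h g G) (e₂ : ∃ G, IsPrimOn σ s F D₂ h g G) :
    ∃ G, IsPrimOn σ s F (D₁ ∪ D₂) h g G := by
  classical
  obtain ⟨G₁, hG₁⟩ := e₁
  obtain ⟨G₂, hG₂⟩ := e₂
  -- On the connected overlap the two primitives differ by a constant, which is absorbed into the
  -- second one.
  obtain ⟨c, hc⟩ : ∃ c, ∀ x ∈ D₁ ∩ D₂, G₁ x = G₂ x + c := by
    by_cases hne : (D₁ ∩ D₂).Nonempty
    · obtain ⟨x₀, hx₀⟩ := hne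
      refine ⟨G₁ x₀ - G₂ x₀, fun x hx => ?_⟩
      have := (hG₁.mono inter_subset_left).sub_eq hconn
        (hh.mono (inter_subset_left.trans subset_union_left)) (hG₂.mono inter_subset_right) hx₀ hx
      linear_combination this
    · exact ⟨0, fun x hx => absurd ⟨x, hx⟩ hne⟩
  set G : X → ℂ := fun x => if x ∈ D₁ then G₁ x else G₂ x + c with hGdef
  have a₁ : IsPrimOn σ s F D₁ h g G := hG₁.congr fun x hx => if_pos hx
  have a₂ : IsPrimOn σ s F D₂ h g G := (hG₂.add_const c).congr fun x hx => by
    by_cases hx1 : x ∈ D₁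
    · simp only [hGdef, if_pos hx1]; exact hc x ⟨hx1, hx⟩
    · simp only [hGdef, if_neg hx1]
  refine ⟨G, fun p hp => ?_⟩
  rw [nhdsWithin_union]
  by_cases hp1 : p ∈ D₁
  · obtain ⟨Φ, b1, b2⟩ := a₁ p hp1
    by_cases hp2 : p ∈ D₂
    · obtain ⟨Φ', b1', b2'⟩ := a₂ p hp2
      refine ⟨Φ, b1, eventually_sup.mpr ⟨b2, ?_⟩⟩
      have b3 := ((hh p hp).mono subset_union_right).eventually
        (eventually_sub_eq_of_hasDerivAt b1 b1')
      filter_upwards [b2', b3] with q hq hq3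
      have c1 := b2.self_of_nhdsWithin hp1
      have c2 := b2'.self_of_nhdsWithin hp2
      rw [hq]
      linear_combination -hq3 + c1 - c2
    · refine ⟨Φ, b1, eventually_sup.mpr ⟨b2, ?_⟩⟩
      -- The point lies off the closed set `D₂`, so nothing is required there.
      rw [notMem_closure_iff_nhdsWithin_eq_bot.mp (by rwa [h₂.closure_eq])]
      exact eventually_bot
  · have hp2 : p ∈ D₂ := hp.resolve_left hp1
    obtain ⟨Φ, b1, b2⟩ := a₂ p hp2
    refine ⟨Φ, b1, eventually_sup.mpr ⟨?_, b2⟩⟩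
    rw [notMem_closure_iff_nhdsWithin_eq_bot.mp (by rwa [h₁.closure_eq])]
    exact eventually_bot

/-- By flatness, `g * F` near `p` is the pullback of a holomorphic function of one variable on a
ball, and this function has a primitive. The cocycle rule `localBranch_mul` moves the base point of
the branch from `h p` to `h q`. -/
theorem exists_isPrimOn_local (hF : DifferentiableOn ℂ F (Line σ)) {h g : X → ℂ} (hh : Continuous h)
    (hL : ∀ x, h x ∈ Line σ) (hg : IsFlatOn σ s univ h g) (p : X) :
    ∃ N : Set X, IsOpen N ∧ p ∈ N ∧ ∃ G, IsPrimOn σ s F N h g G := by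
  obtain ⟨ρ, hρ, hball, hre⟩ := exists_safe_radius (hL p)
  have hBd : ∀ z ∈ ball (h p) ρ, HasDerivAt (localBranch σ s (h p))
      (conn σ s z * localBranch σ s (h p) z) z := fun z hz =>
    hasDerivAt_localBranch (hball hz) (hL p) (hre z hz)
  have hD : DifferentiableOn ℂ (fun z => localBranch σ s (h p) z * F z) (ball (h p) ρ) :=
    DifferentiableOn.fun_mul (fun z hz => (hBd z hz).differentiableAt.differentiableWithinAt)
      (hF.mono hball)
  obtain ⟨Φ, hΦ⟩ := hD.isExactOn_ball
  have hN := (hg p trivial)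
  rw [nhdsWithin_univ] at hN
  obtain ⟨N, hNsub, hNopen, hpN⟩ := eventually_nhds_iff.mp
    (hN.and (hh.continuousAt.eventually (ball_mem_nhds (h p) hρ)))
  refine ⟨N, hNopen, hpN, fun q => g p * Φ (h q), fun q hq => ⟨fun z => g p * Φ z, ?_, ?_⟩⟩
  · obtain ⟨hgq, hhq⟩ := hNsub q hq
    obtain ⟨ρ', hρ', -, hre'⟩ := exists_safe_radius (hL q)
    filter_upwards [isOpen_ball.mem_nhds hhq, ball_mem_nhds (h q) hρ'] with z hz hz'
    refine ((hΦ z hz).const_mul (g p)).congr_deriv ?_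
    change g p * (localBranch σ s (h p) z * F z) = _
    rw [localBranch_mul (hL q) (hre _ hhq) (hre' z hz'), hgq]
    ring
  · exact Eventually.of_forall fun q => rfl

/-- Primitives exist along continuous images of a square. -/
theorem exists_isPrimOn_square (hF : DifferentiableOn ℂ F (Line σ)) {h g : unitInterval × unitInterval → ℂ} (hh : Continuous h)
    (hL : ∀ x, h x ∈ Line σ) (hg : IsFlatOn σ s univ h g) : ∃ G, IsPrimOn σ s F univ h g G := by
  choose N hNo hpN hNe using exists_isPrimOn_local hF hh hL hg
  -- The square is subdivided so finely that every cell carries a primitive. Cells are glued to rows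
  -- and rows to the square; each time the overlap is a segment or a point times a segment, hence
  -- connected.
  obtain ⟨t, ht0, htm, ⟨M, hM⟩, hcov⟩ :=
    exists_monotone_Icc_subset_open_cover_unitInterval_prod_self hNo
      (fun p _ => mem_iUnion.mpr ⟨p, hpN p⟩)
  have hcell : ∀ a b, ∃ G, IsPrimOn σ s F (Icc (t a) (t (a + 1)) ×ˢ Icc (t b) (t (b + 1))) h g G :=
    fun a b => by
      obtain ⟨p, hp⟩ := hcov a b
      obtain ⟨G, hG⟩ := hNe p
      exact ⟨G, hG.mono hp⟩
  have hIcc : ∀ a b c : unitInterval, a ≤ b → b ≤ c → Icc a b ∪ Icc b c = Icc a c := fun a b c h1 h2 =>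
    Icc_union_Icc_eq_Icc h1 h2
  have hIccI : ∀ a b c : unitInterval, a ≤ b → b ≤ c → Icc a b ∩ Icc b c = Icc b b := fun a b c h1 h2 => by
    ext x
    simp only [mem_inter_iff, mem_Icc]
    exact ⟨fun hx => ⟨hx.2.1, hx.1.2⟩, fun hx => ⟨⟨h1.trans hx.1, hx.2⟩, hx.1, hx.2.trans h2⟩⟩
  have hrow : ∀ b a, ∃ G, IsPrimOn σ s F (Icc (t 0) (t (a + 1)) ×ˢ Icc (t b) (t (b + 1))) h g G := by
    intro b a
    induction a with
    | zero => exact hcell 0 b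
    | succ a ih =>
      have e := IsPrimOn.union (isClosed_Icc.prod isClosed_Icc) (isClosed_Icc.prod isClosed_Icc) ?_
        hh.continuousOn ih (hcell (a + 1) b)
      · rwa [← union_prod, hIcc _ _ _ (htm (Nat.zero_le _)) (htm (Nat.le_succ _))] at e
      · rw [prod_inter_prod, hIccI _ _ _ (htm (Nat.zero_le _)) (htm (Nat.le_succ _)), inter_self]
        exact isPreconnected_Icc.prod isPreconnected_Icc
  have hall : ∀ b, ∃ G, IsPrimOn σ s F (Icc (t 0) (t (M + 1)) ×ˢ Icc (t 0) (t (b + 1))) h g G := by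
    intro b
    induction b with
    | zero => exact hrow 0 M
    | succ b ih =>
      have e := IsPrimOn.union (isClosed_Icc.prod isClosed_Icc) (isClosed_Icc.prod isClosed_Icc) ?_
        hh.continuousOn ih (hrow (b + 1) M)
      · rwa [← prod_union, hIcc _ _ _ (htm (Nat.zero_le _)) (htm (Nat.le_succ _))] at e
      · rw [prod_inter_prod, hIccI _ _ _ (htm (Nat.zero_le _)) (htm (Nat.le_succ _)), inter_self]
        exact isPreconnected_Icc.prod isPreconnected_Icc
  have e := hall M
  rw [ht0, hM (M + 1) (Nat.le_succ _)] at e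
  have : Icc (0 : unitInterval) 1 ×ˢ Icc (0 : unitInterval) 1 = univ := by
    ext x
    simp only [mem_prod, mem_Icc, mem_univ, iff_true]
    exact ⟨⟨x.1.2.1, x.1.2.2⟩, x.2.2.1, x.2.2.2⟩
  rwa [this] at e

theorem exists_isPrimOn_path (hF : DifferentiableOn ℂ F (Line σ)) {h g : unitInterval → ℂ} (hh : Continuous h)
    (hL : ∀ x, h x ∈ Line σ) (hg : IsFlatOn σ s univ h g) : ∃ G, IsPrimOn σ s F univ h g G := by
  obtain ⟨G, hG⟩ := exists_isPrimOn_square hF (hh.comp continuous_fst) (fun x => hL x.1)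
    (hg.comp continuous_fst.continuousOn (mapsTo_univ _ _))
  exact ⟨_, hG.comp (κ := fun t : unitInterval => (t, (0 : unitInterval))) (by fun_prop) (mapsTo_univ _ _)⟩

/-- A branch defined by continuous logarithms is flat. -/
theorem isFlatOn_of_log (h0 : ∀ k, σ k ≠ 0) {l : Fin (n + 1) → X → ℂ} (hl : ∀ k, ContinuousOn (l k) D)
    (hL : ∀ x ∈ D, h x ∈ Line σ) (hexp : ∀ k, ∀ x ∈ D, exp (l k x) = factor σ k (h x)) :
    IsFlatOn σ s D h (fun x => exp (∑ k, s k * l k x)) := by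
  intro p hp
  -- If a continuous logarithm moves by less than `π`, its increment is the principal logarithm of
  -- the ratio.
  have h1 : ∀ k, ∀ᶠ q in 𝓝[D] p, ‖l k q - l k p‖ < Real.pi := fun k => by
    have : Tendsto (fun q => ‖l k q - l k p‖) (𝓝[D] p) (𝓝 0) := by
      have := (((hl k) p hp).sub_const (l k p)).norm
      simpa [ContinuousWithinAt] using this
    exact this.eventually (gt_mem_nhds Real.pi_pos)
  filter_upwards [eventually_all.mpr h1, self_mem_nhdsWithin] with q hq hqD
  rw [localBranch, ← exp_add, ← Finset.sum_add_distrib]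
  congr 1
  refine Finset.sum_congr rfl fun k _ => ?_
  have e : (h q - puncture σ k) / (h p - puncture σ k) = exp (l k q - l k p) := by
    have hp' := sub_puncture_ne_zero (hL p hp) k
    have he := factorConst_ne_zero h0 k
    rw [exp_sub, hexp k q hqD, hexp k p hp, factor_eq h0, factor_eq h0]
    field_simp
  have h2 := abs_le.mp (abs_im_le_norm (l k q - l k p))
  have h3 := hq k
  rw [e, log_exp (by linarith [h2.1]) (by linarith [h2.2])]
  ring

end primitives

end TwistedPeriods
end

noncomputable section
namespace TwistedPeriods

open Complex Metric Set Filter Topology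

variable {n : ℕ} {σ : Fin n → ℂ} {s : Fin (n + 1) → ℂ} {Q : Type} [Field Q] [Algebra Q ℂ] {d : ℕ}

/-! ### Chains -/

/-- The branch defined by a system of logarithms, as a section along a simplex. -/
def branchSection (Q : Type) [Field Q] [Algebra Q ℂ] (s : Fin (n + 1) → ℂ) (γ : Simplex σ d)
    (l : Fin (n + 1) → C(stdSimplex ℝ (Fin (d + 1)), ℂ))
    (hl : ∀ k t, exp (l k t) = factor σ k (γ t)) : sections Q σ s γ :=
  ⟨fun t => exp (∑ k, s k * l k t), Submodule.subset_span ⟨l, hl, fun _ => rfl⟩⟩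

theorem chain_hom_ext {M : Type*} [AddCommMonoid M] [Module Q M] {f g : Chain Q σ s d →ₗ[Q] M}
    (h : ∀ (γ : Simplex σ d) (l : Fin (n + 1) → C(stdSimplex ℝ (Fin (d + 1)), ℂ))
      (hl : ∀ k t, exp (l k t) = factor σ k (γ t)),
      f (Chain.of γ (branchSection Q s γ l hl)) = g (Chain.of γ (branchSection Q s γ l hl))) :
    f = g := by
  classical
  refine DirectSum.linearMap_ext Q (M := fun γ => sections Q σ s γ) fun γ => LinearMap.ext fun x => ?_
  change f (Chain.of γ x) = g (Chain.of γ x)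
  obtain ⟨x, hx⟩ := x
  -- The span induction runs over plain functions; quantifying over all sections with a given
  -- underlying function keeps membership proofs out of the induction.
  suffices H : ∀ (y : sections Q σ s γ), (y : stdSimplex ℝ (Fin (d + 1)) → ℂ) = x →
      f (Chain.of γ y) = g (Chain.of γ y) from H _ rfl
  have hx' := hx
  induction hx' using Submodule.span_induction with
  | mem x hx1 =>
    obtain ⟨l, hl, hg⟩ := hx1
    intro y hy
    have : y = branchSection Q s γ l hl := Subtype.ext (by rw [hy]; funext t; exact hg t)
    rw [this]
    exact h γ l hl
  | zero =>
    intro y hy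
    have : y = 0 := Subtype.ext hy
    rw [this, map_zero, map_zero, map_zero]
  | add x₁ x₂ h₁ h₂ e₁ e₂ =>
    intro y hy
    have : y = ⟨x₁, h₁⟩ + ⟨x₂, h₂⟩ := Subtype.ext hy
    rw [this, map_add, map_add, map_add, e₁ h₁ _ rfl, e₂ h₂ _ rfl]
  | smul q x hx1 e =>
    intro y hy
    have : y = q • ⟨x, hx1⟩ := Subtype.ext hy
    rw [this, map_smul, map_smul, map_smul, e hx1 _ rfl]

theorem chain_of_congr {γ γ' : Simplex σ d} (h : γ = γ') {g : sections Q σ s γ} {g' : sections Q σ s γ'}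
    (hg : (g : stdSimplex ℝ (Fin (d + 1)) → ℂ) = g') : Chain.of γ g = Chain.of γ' g' := by
  subst h
  rw [Subtype.ext hg]

theorem boundary_of (γ : Simplex σ (d + 1)) (g : sections Q σ s γ) :
    boundary Q σ s d (Chain.of γ g) =
      ∑ i : Fin (d + 2), (-1 : Q) ^ (i : ℕ) •
        Chain.of (γ.comp (faceMap d i)) (restrictFace Q σ s γ i g) := by
  classical
  have h1 : boundary Q σ s d (Chain.of γ g) = (∑ i : Fin (d + 2), (-1 : Q) ^ (i : ℕ) •
      Chain.of (γ.comp (faceMap d i)) ∘ₗ restrictFace Q σ s γ i) g :=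
    DirectSum.toModule_lof (M := fun γ => sections Q σ s γ) Q γ g
  rw [h1, LinearMap.sum_apply]
  rfl

theorem restrictFace_apply (γ : Simplex σ (d + 1)) (i : Fin (d + 2)) (g : sections Q σ s γ)
    (t : stdSimplex ℝ (Fin (d + 1))) :
    (restrictFace Q σ s γ i g : stdSimplex ℝ (Fin (d + 1)) → ℂ) t =
      (g : stdSimplex ℝ (Fin (d + 2)) → ℂ) (faceMap d i t) := rfl

theorem faceMap_succAbove (i : Fin (d + 2)) (u : stdSimplex ℝ (Fin (d + 1))) (j : Fin (d + 1)) :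
    faceMap d i u (i.succAbove j) = u j := by
  classical
  change (stdSimplex.map i.succAbove u : Fin (d + 2) → ℝ) (i.succAbove j) = u j
  rw [stdSimplex.map_coe, FunOnFinite.linearMap_apply_apply]
  rw [Finset.sum_eq_single j]
  · intro b hb hbj
    simp only [Finset.mem_filter, Finset.mem_univ, true_and] at hb
    exact absurd (Fin.succAbove_right_injective hb) hbj
  · intro hj
    simp at hj

theorem faceMap_self (i : Fin (d + 2)) (u : stdSimplex ℝ (Fin (d + 1))) : faceMap d i u i = 0 := by
  classical
  change (stdSimplex.map i.succAbove u : Fin (d + 2) → ℝ) i = 0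
  rw [stdSimplex.map_coe, FunOnFinite.linearMap_apply_apply]
  refine Finset.sum_eq_zero fun b hb => ?_
  simp only [Finset.mem_filter, Finset.mem_univ, true_and] at hb
  exact absurd hb (Fin.succAbove_ne i b)

theorem sum_faceMap_smul {E : Type*} [AddCommGroup E] [Module ℝ E] (v : Fin (d + 2) → E)
    (i : Fin (d + 2)) (u : stdSimplex ℝ (Fin (d + 1))) :
    ∑ j, faceMap d i u j • v j = ∑ j, u j • v (i.succAbove j) := by
  rw [Fin.sum_univ_succAbove _ i, faceMap_self, zero_smul, zero_add]
  simp_rw [faceMap_succAbove]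

theorem continuous_edge : Continuous edge := by
  refine Continuous.subtype_mk (continuous_pi fun i => ?_) _
  fin_cases i
  · exact continuous_const.sub (continuous_subtype_val.comp continuous_projIcc)
  · exact continuous_subtype_val.comp continuous_projIcc

theorem edge_zero_apply {t : ℝ} (ht : t ∈ Icc (0 : ℝ) 1) : edge t 0 = 1 - t := by
  change 1 - (projIcc (0 : ℝ) 1 zero_le_one t : ℝ) = _
  rw [projIcc_of_mem _ ht]

theorem edge_one_apply {t : ℝ} (ht : t ∈ Icc (0 : ℝ) 1) : edge t 1 = t := by
  change (projIcc (0 : ℝ) 1 zero_le_one t : ℝ) = _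
  rw [projIcc_of_mem _ ht]

theorem edge_projIcc (t : ℝ) : edge (projIcc (0 : ℝ) 1 zero_le_one t : ℝ) = edge t := by
  refine Subtype.ext ?_
  simp [edge]

theorem exists_edge_eq (u : stdSimplex ℝ (Fin 2)) : ∃ t ∈ Icc (0 : ℝ) 1, edge t = u := by
  have h0 : 0 ≤ u 0 := u.2.1 0
  have h1 : 0 ≤ u 1 := u.2.1 1
  have h2 : ∑ i, u i = 1 := u.2.2
  rw [Fin.sum_univ_two] at h2
  have ht : u 1 ∈ Icc (0 : ℝ) 1 := ⟨h1, by linarith⟩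
  refine ⟨_, ht, Subtype.ext (funext fun i => ?_)⟩
  fin_cases i
  · exact (edge_zero_apply ht).trans (sub_eq_of_eq_add h2.symm)
  · exact edge_one_apply ht

theorem isFlatOn_section (h0 : ∀ k, σ k ≠ 0) (γ : Simplex σ d) (g : sections Q σ s γ) :
    IsFlatOn σ s univ (fun u => (γ u : ℂ)) (g : stdSimplex ℝ (Fin (d + 1)) → ℂ) := by
  obtain ⟨g, hg⟩ := g
  change IsFlatOn σ s univ (fun u => (γ u : ℂ)) g
  induction hg using Submodule.span_induction with
  | mem g hg =>
    obtain ⟨l, hl, hg⟩ := hg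
    have : g = fun t => exp (∑ k, s k * l k t) := funext hg
    rw [this]
    exact isFlatOn_of_log h0 (fun k => (l k).continuous.continuousOn) (fun x _ => (γ x).2)
      fun k x _ => hl k x
  | zero => exact fun p _ => Eventually.of_forall fun q => by simp
  | add g g' _ _ h h' => exact h.add h'
  | smul r g _ h =>
    have : r • g = fun x => algebraMap Q ℂ r * g x := by
      funext x; simp [Algebra.smul_def]
    rw [this]
    exact h.const_mul _

/-! ### Integration along continuous paths -/

/-- The primitives of `g * F` along the path `γ`. -/
def PathPrim (F : ℂ → ℂ) (γ : Simplex σ 1) (g : sections Q σ s γ) (G : unitInterval → ℂ) : Prop :=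
  IsPrimOn σ s F univ (fun t : unitInterval => (γ (edge t) : ℂ))
    (fun t => (g : stdSimplex ℝ (Fin 2) → ℂ) (edge t)) G

variable {F F' : ℂ → ℂ}

theorem exists_pathPrim (h0 : ∀ k, σ k ≠ 0) (hF : DifferentiableOn ℂ F (Line σ)) (γ : Simplex σ 1)
    (g : sections Q σ s γ) : ∃ G, PathPrim F γ g G :=
  exists_isPrimOn_path hF
    (by have := continuous_edge; fun_prop) (fun x => (γ (edge x)).2)
    ((isFlatOn_section h0 γ g).comp (κ := fun t : unitInterval => edge t)
      (continuous_edge.comp continuous_subtype_val).continuousOn (mapsTo_univ _ _))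

open Classical in
/-- The integral of `g F dz` along a continuous path. -/
def pathIntegral (F : ℂ → ℂ) (γ : Simplex σ 1) (g : sections Q σ s γ) : ℂ :=
  -- The value `0` never occurs for holomorphic `F`, by `exists_pathPrim` with non-zero `σ k`; any
  -- primitive gives the same value, by `PathPrim.integral_eq`.
  if H : ∃ G, PathPrim F γ g G then H.choose 1 - H.choose 0 else 0

theorem PathPrim.integral_eq {γ : Simplex σ 1} {g : sections Q σ s γ} {G : unitInterval → ℂ}
    (hG : PathPrim F γ g G) : pathIntegral F γ g = G 1 - G 0 := by
  have H : ∃ G, PathPrim F γ g G := ⟨G, hG⟩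
  rw [pathIntegral, dif_pos H]
  exact IsPrimOn.sub_eq isPreconnected_univ
    (by have := continuous_edge; fun_prop) H.choose_spec hG trivial trivial

/-- Integration along a continuous path, as a linear map. -/
def pathIntegralₗ (h0 : ∀ k, σ k ≠ 0) (hF : DifferentiableOn ℂ F (Line σ)) (γ : Simplex σ 1) :
    sections Q σ s γ →ₗ[Q] ℂ where
  toFun := pathIntegral F γ
  map_add' g g' := by
    obtain ⟨G, hG⟩ := exists_pathPrim h0 hF γ g
    obtain ⟨G', hG'⟩ := exists_pathPrim h0 hF γ g'
    have h : PathPrim F γ (g + g') (G + G') := IsPrimOn.add hG hG'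
    rw [hG.integral_eq, hG'.integral_eq, h.integral_eq, Pi.add_apply, Pi.add_apply]
    ring
  map_smul' r g := by
    obtain ⟨G, hG⟩ := exists_pathPrim h0 hF γ g
    have h : PathPrim F γ (r • g) (fun x => algebraMap Q ℂ r * G x) := by
      have h1 := IsPrimOn.const_mul hG (algebraMap Q ℂ r)
      have e : (fun t : unitInterval => ((r • g : sections Q σ s γ) : stdSimplex ℝ (Fin 2) → ℂ) (edge t)) =
          fun t : unitInterval => algebraMap Q ℂ r * (g : stdSimplex ℝ (Fin 2) → ℂ) (edge t) := by
        funext t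
        simp [Algebra.smul_def]
      rw [PathPrim, e]
      exact h1
    rw [hG.integral_eq, h.integral_eq, RingHom.id_apply, Algebra.smul_def]
    ring

open Classical in
/-- Integration of `F dz` along chains of continuous paths. -/
def period (Q : Type) [Field Q] [Algebra Q ℂ] (s : Fin (n + 1) → ℂ) (h0 : ∀ k, σ k ≠ 0)
    (hF : DifferentiableOn ℂ F (Line σ)) : Chain Q σ s 1 →ₗ[Q] ℂ :=
  DirectSum.toModule Q (Simplex σ 1) ℂ fun γ => pathIntegralₗ h0 hF γ

variable (h0 : ∀ k, σ k ≠ 0) (hF : DifferentiableOn ℂ F (Line σ)) (hF' : DifferentiableOn ℂ F' (Line σ))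

theorem period_of (γ : Simplex σ 1) (g : sections Q σ s γ) :
    period Q s h0 hF (Chain.of γ g) = pathIntegral F γ g := by
  classical
  exact DirectSum.toModule_lof (M := fun γ => sections Q σ s γ) Q γ g

theorem period_of_eq {γ : Simplex σ 1} {g : sections Q σ s γ} {G : unitInterval → ℂ}
    (hG : PathPrim F γ g G) : period Q s h0 hF (Chain.of γ g) = G 1 - G 0 := by
  rw [period_of, hG.integral_eq]

theorem period_add (hFF : DifferentiableOn ℂ (fun z => F z + F' z) (Line σ)) (z : Chain Q σ s 1) :
    period Q s h0 hFF z = period Q s h0 hF z + period Q s h0 hF' z := by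
  revert z
  refine LinearMap.congr_fun (f := period Q s h0 hFF) (g := period Q s h0 hF + period Q s h0 hF') ?_
  refine chain_hom_ext fun γ l hl => ?_
  obtain ⟨G, hG⟩ := exists_pathPrim h0 hF γ (branchSection Q s γ l hl)
  obtain ⟨G', hG'⟩ := exists_pathPrim h0 hF' γ (branchSection Q s γ l hl)
  rw [LinearMap.add_apply, period_of_eq h0 hF hG, period_of_eq h0 hF' hG',
    period_of_eq h0 hFF (IsPrimOn.form_add hG hG')]
  ring

theorem period_const_mul (c : ℂ) (hcF : DifferentiableOn ℂ (fun z => c * F z) (Line σ)) (z : Chain Q σ s 1) :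
    period Q s h0 hcF z = c * period Q s h0 hF z := by
  revert z
  refine LinearMap.congr_fun (f := period Q s h0 hcF) (g := c • period Q s h0 hF) ?_
  refine chain_hom_ext fun γ l hl => ?_
  obtain ⟨G, hG⟩ := exists_pathPrim h0 hF γ (branchSection Q s γ l hl)
  rw [LinearMap.smul_apply, period_of_eq h0 hF hG,
    period_of_eq h0 hcF (IsPrimOn.form_const_mul hG c), smul_eq_mul]
  ring

theorem period_congr (hFF : EqOn F F' (Line σ)) (z : Chain Q σ s 1) :
    period Q s h0 hF z = period Q s h0 hF' z := by
  revert z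
  refine LinearMap.congr_fun (f := period Q s h0 hF) (g := period Q s h0 hF') ?_
  refine chain_hom_ext fun γ l hl => ?_
  obtain ⟨G, hG⟩ := exists_pathPrim h0 hF γ (branchSection Q s γ l hl)
  rw [period_of_eq h0 hF hG]
  refine (period_of_eq h0 hF' (G := G) fun p hp => ?_).symm
  obtain ⟨Φ, h1, h2⟩ := hG p hp
  refine ⟨Φ, ?_, h2⟩
  filter_upwards [h1, isOpen_Line.mem_nhds (γ (edge p)).2] with z hz hzL
  rwa [hFF hzL] at hz

/-- The parametrisation of the standard `2`-simplex by the square. -/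
def squareMap (p : unitInterval × unitInterval) : stdSimplex ℝ (Fin 3) :=
  ⟨![1 - (p.1 : ℝ), p.1 * (1 - p.2), p.1 * p.2], by
    have h1 := p.1.2
    have h2 := p.2.2
    refine ⟨fun i => ?_, ?_⟩
    · fin_cases i
      · simpa using h1.2
      · exact mul_nonneg h1.1 (sub_nonneg.mpr h2.2)
      · exact mul_nonneg h1.1 h2.1
    · rw [Fin.sum_univ_three]
      simp
      ring⟩

theorem continuous_squareMap : Continuous squareMap := by
  refine Continuous.subtype_mk (continuous_pi fun i => ?_) _
  fin_cases i
  · simp; fun_prop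
  · simp; fun_prop
  · simp; fun_prop

theorem faceMap_edge_zero (t : unitInterval) : faceMap 1 0 (edge t) = squareMap (1, t) := by
  refine Subtype.ext (funext fun i => ?_)
  change faceMap 1 0 (edge t) i = squareMap (1, t) i
  fin_cases i
  · exact (faceMap_self 0 (edge t)).trans (by simp [squareMap, DFunLike.coe])
  · exact (faceMap_succAbove 0 (edge t) 0).trans ((edge_zero_apply t.2).trans (by simp [squareMap, DFunLike.coe]))
  · exact (faceMap_succAbove 0 (edge t) 1).trans ((edge_one_apply t.2).trans (by simp [squareMap, DFunLike.coe]))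

theorem faceMap_edge_one (t : unitInterval) : faceMap 1 1 (edge t) = squareMap (t, 1) := by
  refine Subtype.ext (funext fun i => ?_)
  change faceMap 1 1 (edge t) i = squareMap (t, 1) i
  fin_cases i
  · exact (faceMap_succAbove 1 (edge t) 0).trans ((edge_zero_apply t.2).trans (by simp [squareMap, DFunLike.coe]))
  · exact (faceMap_self 1 (edge t)).trans (by simp [squareMap, DFunLike.coe])
  · exact (faceMap_succAbove 1 (edge t) 1).trans ((edge_one_apply t.2).trans (by simp [squareMap, DFunLike.coe]))

theorem faceMap_edge_two (t : unitInterval) : faceMap 1 2 (edge t) = squareMap (t, 0) := by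
  refine Subtype.ext (funext fun i => ?_)
  change faceMap 1 2 (edge t) i = squareMap (t, 0) i
  fin_cases i
  · exact (faceMap_succAbove 2 (edge t) 0).trans ((edge_zero_apply t.2).trans (by simp [squareMap, DFunLike.coe]))
  · exact (faceMap_succAbove 2 (edge t) 1).trans ((edge_one_apply t.2).trans (by simp [squareMap, DFunLike.coe]))
  · exact (faceMap_self 2 (edge t)).trans (by simp [squareMap, DFunLike.coe])

/-- Stokes' theorem. -/
theorem period_boundary (w : Chain Q σ s 2) : period Q s h0 hF (boundary Q σ s 1 w) = 0 := by
  revert w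
  refine LinearMap.congr_fun (f := period Q s h0 hF ∘ₗ boundary Q σ s 1) (g := 0) ?_
  refine chain_hom_ext fun γ l hl => ?_
  set g := branchSection Q s γ l hl
  obtain ⟨G, hG⟩ := exists_isPrimOn_square (s := s) (h := fun p => (γ (squareMap p) : ℂ))
    (g := fun p => (g : stdSimplex ℝ (Fin 3) → ℂ) (squareMap p)) hF
    (by have := continuous_squareMap; fun_prop) (fun x => (γ _).2)
    ((isFlatOn_section h0 γ g).comp (κ := squareMap)
      continuous_squareMap.continuousOn (mapsTo_univ _ _))
  have e0 : PathPrim F (γ.comp (faceMap 1 0)) (restrictFace Q σ s γ 0 g) (fun t => G (1, t)) := by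
    have := hG.comp (κ := fun t : unitInterval => ((1 : unitInterval), t)) (D' := univ) (by fun_prop) (mapsTo_univ _ _)
    simp only [Function.comp_def, ← faceMap_edge_zero] at this
    exact this
  have e1 : PathPrim F (γ.comp (faceMap 1 1)) (restrictFace Q σ s γ 1 g) (fun t => G (t, 1)) := by
    have := hG.comp (κ := fun t : unitInterval => (t, (1 : unitInterval))) (D' := univ) (by fun_prop) (mapsTo_univ _ _)
    simp only [Function.comp_def, ← faceMap_edge_one] at this
    exact this
  have e2 : PathPrim F (γ.comp (faceMap 1 2)) (restrictFace Q σ s γ 2 g) (fun t => G (t, 0)) := by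
    have := hG.comp (κ := fun t : unitInterval => (t, (0 : unitInterval))) (D' := univ) (by fun_prop) (mapsTo_univ _ _)
    simp only [Function.comp_def, ← faceMap_edge_two] at this
    exact this
  -- The fourth side of the square is collapsed to the vertex `0` of the triangle, so a primitive is
  -- constant along it. The other three sides are the faces, with matching corner values.
  have hconst : G (0, 1) = G (0, 0) := by
    have h1 := hG.comp (κ := fun t : unitInterval => ((0 : unitInterval), t)) (D' := univ) (by fun_prop) (mapsTo_univ _ _)
    refine constant_of_locally_constant (f := fun t : unitInterval => G (0, t)) isPreconnected_univ
      (fun p hp => ?_) trivial trivial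
    obtain ⟨Φ, -, h2⟩ := h1 p hp
    have h3 := h2.self_of_nhdsWithin hp
    filter_upwards [h2] with q hq
    have e : squareMap ((0 : unitInterval), q) = squareMap ((0 : unitInterval), p) := by
      refine Subtype.ext ?_
      simp [squareMap]
    refine hq.trans (Eq.trans ?_ h3.symm)
    simp only [Function.comp_apply, e]
  rw [LinearMap.comp_apply, boundary_of, Fin.sum_univ_three]
  simp only [map_add, map_smul, period_of_eq h0 hF e0, period_of_eq h0 hF e1, period_of_eq h0 hF e2]
  simp [hconst]

end TwistedPeriods
end

/-! ### Smooth chains, and periods of forms with a potential. -/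

noncomputable section
namespace TwistedPeriods

open Complex Metric Set Filter Topology

variable {n : ℕ} {σ : Fin n → ℂ} {s : Fin (n + 1) → ℂ} {Q : Type} [Field Q] [Algebra Q ℂ] {d : ℕ}
  {F : ℂ → ℂ}

theorem continuous_path (γ : Simplex σ 1) : Continuous (path γ) := by
  have := continuous_edge
  unfold path
  fun_prop

theorem path_mem (γ : Simplex σ 1) (t : ℝ) : path γ t ∈ Line σ := (γ (edge t)).2

theorem IsFlatOn.continuousOn {X : Type*} [TopologicalSpace X] {D : Set X} {h g : X → ℂ}
    (hg : IsFlatOn σ s D h g) (hh : ContinuousOn h D) (hL : ∀ x ∈ D, h x ∈ Line σ) : ContinuousOn g D := by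
  intro p hp
  have h1 : ContinuousAt (localBranch σ s (h p)) (h p) :=
    (hasDerivAt_localBranch (hL p hp) (hL p hp) fun k => by
      rw [div_self (sub_puncture_ne_zero (hL p hp) k)]; simp).continuousAt
  have h2 : ContinuousWithinAt (fun q => g p * localBranch σ s (h p) (h q)) D p :=
    (h1.comp_continuousWithinAt (hh p hp)).const_mul (g p)
  exact h2.congr_of_eventuallyEq (hg p hp) ((hg p hp).self_of_nhdsWithin hp)

/-- Since `dg = conn * g` for a section `g` of the dual local system, `d(g f) = g ∇f`. -/
theorem pathPrim_of_potential (h0 : ∀ k, σ k ≠ 0) (γ : Simplex σ 1) (g : sections Q σ s γ) {f : ℂ → ℂ}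
    (hf : ∀ t, ∀ᶠ z in 𝓝 (path γ t), HasDerivAt f (F z - conn σ s z * f z) z) :
    PathPrim F γ g (fun t => (g : stdSimplex ℝ (Fin 2) → ℂ) (edge t) * f (path γ t)) := by
  have hfl := (isFlatOn_section h0 γ g).comp (κ := fun t : unitInterval => edge t)
      (D' := univ) (continuous_edge.comp continuous_subtype_val).continuousOn (mapsTo_univ univ _)
  intro p hp
  obtain ⟨ρ, hρ, hball, hre⟩ := exists_safe_radius (path_mem γ p)
  refine ⟨fun z => (g : stdSimplex ℝ (Fin 2) → ℂ) (edge p) * localBranch σ s (path γ p) z * f z, ?_, ?_⟩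
  · filter_upwards [hf p, ball_mem_nhds _ hρ] with z hz hzb
    have h1 := hasDerivAt_localBranch (s := s) (hball hzb) (path_mem γ p) (hre z hzb)
    refine ((h1.const_mul ((g : stdSimplex ℝ (Fin 2) → ℂ) (edge p))).mul hz).congr_deriv ?_
    change _ = (g : stdSimplex ℝ (Fin 2) → ℂ) (edge p) * localBranch σ s (path γ p) z * F z
    ring
  · filter_upwards [hfl p hp] with q hq
    simp only [Function.comp_apply] at hq
    rw [hq]
    rfl

theorem period_of_potential (h0 : ∀ k, σ k ≠ 0) (hF : DifferentiableOn ℂ F (Line σ)) (γ : Simplex σ 1)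
    (g : sections Q σ s γ) {f : ℂ → ℂ}
    (hf : ∀ t, ∀ᶠ z in 𝓝 (path γ t), HasDerivAt f (F z - conn σ s z * f z) z) :
    period Q s h0 hF (Chain.of γ g) = (g : stdSimplex ℝ (Fin 2) → ℂ) (edge 1) * f (path γ 1) -
      (g : stdSimplex ℝ (Fin 2) → ℂ) (edge 0) * f (path γ 0) := by
  rw [period_of_eq h0 hF (pathPrim_of_potential h0 γ g hf)]
  simp

/-- The fundamental theorem of calculus for `t ↦ G t`. It is applied with derivatives at interior
points only, since the path is extended by constants and may have corners at `0` and `1`. -/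
theorem PathPrim.integral_smooth (h0 : ∀ k, σ k ≠ 0) (hF : DifferentiableOn ℂ F (Line σ)) {γ : Simplex σ 1}
    {g : sections Q σ s γ} {G : unitInterval → ℂ} (hG : PathPrim F γ g G)
    (hγ : ContDiffOn ℝ 1 (path γ) (Icc 0 1)) :
    ∫ t in (0 : ℝ)..1, (g : stdSimplex ℝ (Fin 2) → ℂ) (edge t) * F (path γ t) * deriv (path γ) t =
      G 1 - G 0 := by
  have hpr : IsPrimOn σ s F univ (path γ) (fun t => (g : stdSimplex ℝ (Fin 2) → ℂ) (edge t))
      (fun t => G (projIcc 0 1 zero_le_one t)) := by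
    have := IsPrimOn.comp hG (κ := fun t : ℝ => projIcc (0 : ℝ) 1 zero_le_one t) (D' := univ)
      continuous_projIcc.continuousOn (mapsTo_univ _ _)
    simp only [Function.comp_def, edge_projIcc] at this
    exact this
  have hgc : Continuous fun t => (g : stdSimplex ℝ (Fin 2) → ℂ) (edge t) := by
    have h1 := (isFlatOn_section h0 γ g).continuousOn (by fun_prop) fun x _ => (γ x).2
    exact (continuousOn_univ.mp h1).comp continuous_edge
  have hder : ∀ t ∈ Ioo (0 : ℝ) 1, HasDerivAt (path γ) (deriv (path γ) t) t := fun t ht =>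
    ((hγ.differentiableOn (by norm_num) t (Ioo_subset_Icc_self ht)).differentiableAt
      (Icc_mem_nhds ht.1 ht.2)).hasDerivAt
  have hcont : Continuous fun t => G (projIcc 0 1 zero_le_one t) := by
    refine continuous_iff_continuousAt.mpr fun t => ?_
    obtain ⟨Φ, h1, h2⟩ := hpr t trivial
    rw [nhdsWithin_univ] at h2
    exact (h1.self_of_nhds.continuousAt.comp (continuous_path γ).continuousAt).congr_of_eventuallyEq h2
  have hderiv : ∀ t ∈ Ioo (0 : ℝ) 1, HasDerivAt (fun t => G (projIcc 0 1 zero_le_one t))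
      ((g : stdSimplex ℝ (Fin 2) → ℂ) (edge t) * F (path γ t) * deriv (path γ) t) t := fun t ht => by
    obtain ⟨Φ, h1, h2⟩ := hpr t trivial
    rw [nhdsWithin_univ] at h2
    refine (HasDerivAt.congr_of_eventuallyEq (h1.self_of_nhds.comp t (hder t ht)) h2).congr_deriv ?_
    rw [localBranch_self (path_mem γ t)]
    ring
  have hint : IntervalIntegrable (fun t => (g : stdSimplex ℝ (Fin 2) → ℂ) (edge t) * F (path γ t) *
      deriv (path γ) t) MeasureTheory.volume 0 1 := by
    have hFc : Continuous fun t => F (path γ t) :=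
      continuous_iff_continuousAt.mpr fun t =>
        ((hF.continuousOn.continuousAt (isOpen_Line.mem_nhds (path_mem γ t))).comp
          (continuous_path γ).continuousAt)
    -- Integrability is obtained from the one-sided derivative, which is continuous up to the end
    -- points and agrees with `deriv` inside.
    have h1 : ContinuousOn (fun t => (g : stdSimplex ℝ (Fin 2) → ℂ) (edge t) * F (path γ t) *
        derivWithin (path γ) (Icc 0 1) t) (Icc 0 1) :=
      (hgc.mul hFc).continuousOn.mul (hγ.continuousOn_derivWithin (uniqueDiffOn_Icc zero_lt_one) le_rfl)
    refine (h1.intervalIntegrable_of_Icc zero_le_one).congr_uIoo fun t ht => ?_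
    rw [uIoo_of_le zero_le_one] at ht
    beta_reduce
    rw [derivWithin_of_mem_nhds (Icc_mem_nhds ht.1 ht.2)]
  rw [intervalIntegral.integral_eq_sub_of_hasDerivAt_of_le zero_le_one hcont.continuousOn hderiv hint]
  simp

theorem exists_chain_eq_sum (z : Chain Q σ s d) : ∃ T : Finset (Simplex σ d),
    (∀ γ ∉ T, z.coeff γ = 0) ∧ z = ∑ γ ∈ T, Chain.of γ (z.coeff γ) := by
  classical
  let z' : DirectSum (Simplex σ d) fun γ => sections Q σ s γ := z
  refine ⟨DFinsupp.support z', fun γ hγ => DFinsupp.notMem_support_iff.mp hγ, ?_⟩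
  have := DirectSum.sum_support_of z'
  refine this.symm.trans ?_
  refine Finset.sum_congr rfl fun γ _ => ?_
  change _ = DirectSum.lof Q (Simplex σ d) (fun γ => sections Q σ s γ) γ (z' γ)
  rw [DirectSum.lof_eq_of]

/-- On smooth chains `period` is given by integration of forms. -/
theorem period_eq_integral (h0 : ∀ k, σ k ≠ 0) (hF : DifferentiableOn ℂ F (Line σ)) {z : Chain Q σ s 1}
    (hz : z.IsSmooth) {f : Line σ → ℂ} (hf : ∀ x : Line σ, F x = f x) :
    period Q s h0 hF z = z.integral f := by
  obtain ⟨T, hT, hzT⟩ := exists_chain_eq_sum z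
  have h1 : z.integral f = ∑ γ ∈ T, ∫ t in (0 : ℝ)..1,
      (z.coeff γ : stdSimplex ℝ (Fin 2) → ℂ) (edge t) * f (γ (edge t)) * deriv (path γ) t := by
    refine finsum_eq_sum_of_support_subset _ fun γ hγ => ?_
    by_contra hc
    refine hγ ?_
    simp only [hT γ hc]
    simp
  rw [h1]
  conv_lhs => rw [hzT]
  rw [map_sum]
  refine Finset.sum_congr rfl fun γ _ => ?_
  obtain ⟨G, hG⟩ := exists_pathPrim h0 hF γ (z.coeff γ)
  rw [period_of_eq h0 hF hG]
  by_cases hc : z.coeff γ = 0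
  · have e : period Q s h0 hF (Chain.of γ (z.coeff γ)) = 0 := by rw [hc]; simp
    rw [period_of_eq h0 hF hG] at e
    rw [e, hc]
    simp
  · rw [← hG.integral_smooth h0 hF (hz γ hc)]
    refine intervalIntegral.integral_congr fun t _ => ?_
    simp only [← hf]
    rfl

theorem isSmooth_of {γ : Simplex σ 1} (g : sections Q σ s γ) (hγ : ContDiffOn ℝ 1 (path γ) (Icc 0 1)) :
    (Chain.of γ g : Chain Q σ s 1).IsSmooth := by
  classical
  intro γ' h
  by_contra hc
  refine h ?_
  have hne : γ ≠ γ' := fun e => hc (e ▸ hγ)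
  exact (DirectSum.component.of Q (M := fun γ : Simplex σ 1 => ↥(sections Q σ s γ)) γ' γ g).trans (dif_neg hne)

theorem Chain.IsSmooth.add {z z' : Chain Q σ s 1} (hz : z.IsSmooth) (hz' : z'.IsSmooth) :
    (z + z').IsSmooth := fun γ h => by
  by_cases h1 : z.coeff γ = 0
  · by_cases h2 : z'.coeff γ = 0
    · refine absurd ?_ h
      have : (z + z').coeff γ = z.coeff γ + z'.coeff γ := map_add (DirectSum.component Q (Simplex σ 1) (fun γ => sections Q σ s γ) γ) z z'
      rw [this, h1, h2, add_zero]
    · exact hz' γ h2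
  · exact hz γ h1

theorem Chain.IsSmooth.smul {z : Chain Q σ s 1} (hz : z.IsSmooth) (q : Q) : (q • z).IsSmooth := fun γ h => by
  refine hz γ fun h1 => h ?_
  have : (q • z).coeff γ = q • z.coeff γ := map_smul (DirectSum.component Q (Simplex σ 1) (fun γ => sections Q σ s γ) γ) q z
  rw [this, h1, smul_zero]

theorem isSmooth_zero : (0 : Chain Q σ s 1).IsSmooth := fun γ h =>
  absurd (map_zero (DirectSum.component Q (Simplex σ 1) (fun γ => sections Q σ s γ) γ)) h

/-- The functional `g ↦ g * f` on the sections over a `0`-simplex. -/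
def evalSection (Q : Type) [Field Q] [Algebra Q ℂ] (s : Fin (n + 1) → ℂ) (f : ℂ → ℂ) (γ : Simplex σ 0) :
    sections Q σ s γ →ₗ[Q] ℂ :=
  (LinearMap.mulRight Q (f (γ default))) ∘ₗ
    LinearMap.proj (R := Q) (φ := fun _ => ℂ) (default : stdSimplex ℝ (Fin 1)) ∘ₗ
      (sections Q σ s γ).subtype

open Classical in
/-- The linear map on chains defined by linear maps on sections. -/
def chainLift {M : Type*} [AddCommMonoid M] [Module Q M]
    (φ : ∀ γ : Simplex σ d, sections Q σ s γ →ₗ[Q] M) : Chain Q σ s d →ₗ[Q] M :=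
  DirectSum.toModule Q (Simplex σ d) M φ

theorem chainLift_of {M : Type*} [AddCommMonoid M] [Module Q M]
    (φ : ∀ γ : Simplex σ d, sections Q σ s γ →ₗ[Q] M) (γ : Simplex σ d) (g : sections Q σ s γ) :
    chainLift φ (Chain.of γ g) = φ γ g := by
  classical
  exact DirectSum.toModule_lof (M := fun γ => sections Q σ s γ) (φ := φ) Q γ g

/-- The linear functional on `0`-chains defined by a function on `ℂ ∖ Σ`. -/
def evalZero (Q : Type) [Field Q] [Algebra Q ℂ] (s : Fin (n + 1) → ℂ) (f : ℂ → ℂ) :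
    Chain Q σ s 0 →ₗ[Q] ℂ :=
  chainLift (evalSection Q s f)

theorem evalZero_of (f : ℂ → ℂ) (γ : Simplex σ 0) (g : sections Q σ s γ) :
    evalZero Q s f (Chain.of γ g) = (g : stdSimplex ℝ (Fin 1) → ℂ) default * f (γ default) :=
  chainLift_of _ γ g

theorem faceMap_zero_zero (u : stdSimplex ℝ (Fin 1)) : faceMap 0 0 u = edge 1 := by
  refine Subtype.ext (funext fun i => ?_)
  change faceMap 0 0 u i = edge 1 i
  have hu : u 0 = 1 := (Fin.sum_univ_one _).symm.trans u.2.2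
  fin_cases i
  · exact (faceMap_self 0 u).trans ((edge_zero_apply (by simp)).trans (by simp)).symm
  · exact (faceMap_succAbove 0 u 0).trans (hu.trans (edge_one_apply (by simp)).symm)

theorem faceMap_zero_one (u : stdSimplex ℝ (Fin 1)) : faceMap 0 1 u = edge 0 := by
  refine Subtype.ext (funext fun i => ?_)
  change faceMap 0 1 u i = edge 0 i
  have hu : u 0 = 1 := (Fin.sum_univ_one _).symm.trans u.2.2
  fin_cases i
  · exact (faceMap_succAbove 1 u 0).trans (hu.trans ((edge_zero_apply (by simp)).trans (by simp)).symm)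
  · exact (faceMap_self 1 u).trans (edge_one_apply (by simp)).symm

theorem boundary_path (γ : Simplex σ 1) (g : sections Q σ s γ) :
    boundary Q σ s 0 (Chain.of γ g) = Chain.of (γ.comp (faceMap 0 0)) (restrictFace Q σ s γ 0 g) -
      Chain.of (γ.comp (faceMap 0 1)) (restrictFace Q σ s γ 1 g) := by
  rw [boundary_of, Fin.sum_univ_two]
  simp [sub_eq_add_neg]

theorem evalZero_boundary (f : ℂ → ℂ) (γ : Simplex σ 1) (g : sections Q σ s γ) :
    evalZero Q s f (boundary Q σ s 0 (Chain.of γ g)) =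
      (g : stdSimplex ℝ (Fin 2) → ℂ) (edge 1) * f (path γ 1) -
      (g : stdSimplex ℝ (Fin 2) → ℂ) (edge 0) * f (path γ 0) := by
  rw [boundary_path, map_sub, evalZero_of, evalZero_of]
  simp only [restrictFace_apply, ContinuousMap.comp_apply, faceMap_zero_zero, faceMap_zero_one]
  rfl

/-- The periods of an exact form are given by its potential. -/
theorem period_exact (h0 : ∀ k, σ k ≠ 0) (hF : DifferentiableOn ℂ F (Line σ)) {f : ℂ → ℂ}
    (hf : ∀ x ∈ Line σ, HasDerivAt f (F x - conn σ s x * f x) x) (z : Chain Q σ s 1) :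
    period Q s h0 hF z = evalZero Q s f (boundary Q σ s 0 z) := by
  revert z
  refine LinearMap.congr_fun (f := period Q s h0 hF) (g := evalZero Q s f ∘ₗ boundary Q σ s 0) ?_
  refine chain_hom_ext fun γ l hl => ?_
  rw [LinearMap.comp_apply, evalZero_boundary]
  exact period_of_potential h0 hF γ _ fun t => by
    filter_upwards [isOpen_Line.mem_nhds (path_mem γ t)] with z hz using hf z hz

/-- The periods along chains in an open set where the form is exact are given by its potential. -/
theorem period_eq_of_potential_on (h0 : ∀ k, σ k ≠ 0) (hF : DifferentiableOn ℂ F (Line σ)) {f : ℂ → ℂ}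
    {U : Set ℂ} (hU : IsOpen U)
    (hf : ∀ x ∈ U, HasDerivAt f (F x - conn σ s x * f x) x) {z : Chain Q σ s 1}
    (hz : ∀ γ, z.coeff γ ≠ 0 → ∀ u, (γ u : ℂ) ∈ U) :
    period Q s h0 hF z = evalZero Q s f (boundary Q σ s 0 z) := by
  obtain ⟨T, hT, hzT⟩ := exists_chain_eq_sum z
  rw [hzT, map_sum, map_sum, map_sum]
  refine Finset.sum_congr rfl fun γ _ => ?_
  by_cases hc : z.coeff γ = 0
  · simp [hc]
  · rw [evalZero_boundary]
    exact period_of_potential h0 hF γ _ fun t => by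
      filter_upwards [hU.mem_nhds (hz γ hc (edge t))] with z hz using hf z hz

end TwistedPeriods
end

/-! ### Cocycles on convex plots and the upper bound for Betti cohomology. -/

noncomputable section
namespace TwistedPeriods

open Complex Metric Set Filter Topology

variable {n : ℕ} {σ : Fin n → ℂ} {s : Fin (n + 1) → ℂ} {Q : Type} [Field Q] [Algebra Q ℂ] {d : ℕ}

/-- Logarithms on convex open sets. -/
theorem exists_log_sub {D : Set ℂ} (hD : Convex ℝ D) (hDo : IsOpen D) {p c : ℂ} (hp : p ∉ D) (hc : c ≠ 0) :
    ∃ L : ℂ → ℂ, ContinuousOn L D ∧ ∀ x ∈ D, exp (L x) = c * (x - p) := by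
  -- Hahn-Banach provides a real functional `f` that is smaller on `D` than at `p`. Since `f z = Re
  -- ((f 1 - f I * I) * z)`, the negative of this coefficient rotates `D - p` into the right half
  -- plane, where the principal logarithm is continuous.
  obtain ⟨w, hw⟩ : ∃ w : ℂ, ∀ x ∈ D, 0 < (w * (x - p)).re := by
    obtain ⟨f, hf⟩ := geometric_hahn_banach_open_point hD hDo hp
    refine ⟨-(f 1 - f I * I), fun x hx => ?_⟩
    have h2 : ∀ z : ℂ, ((f 1 - f I * I) * z).re = f z := fun z => by
      have : f z = z.re * f 1 + z.im * f I := by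
        conv_lhs => rw [← re_add_im z]
        have e1 : (z.re : ℂ) = z.re • (1 : ℂ) := by simp
        have e2 : (z.im : ℂ) * I = z.im • I := by simp
        rw [map_add, e1, e2, map_smul, map_smul, smul_eq_mul, smul_eq_mul]
      rw [this]
      simp
      ring
    rw [neg_mul, neg_re, h2, map_sub]
    linarith [hf x hx]
  have hne : ∀ x ∈ D, w * (x - p) ≠ 0 := fun x hx h => by simpa [h] using hw x hx
  refine ⟨fun x => log (w * (x - p)) + log (c / w), ?_, fun x hx => ?_⟩
  · exact ContinuousOn.add (ContinuousOn.clog (by fun_prop) fun x hx => Or.inl (hw x hx)) continuousOn_const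
  · have hw0 : w ≠ 0 := left_ne_zero_of_mul (hne x hx)
    rw [exp_add, exp_log (hne x hx), exp_log (div_ne_zero hc hw0)]
    field_simp

/-! ### Simplices in convex plots -/

/-- A continuous map from a convex set to `ℂ ∖ Σ` with logarithms of the factors. -/
structure Plot (σ : Fin n → ℂ) (E : Type) [AddCommGroup E] [Module ℝ E] [TopologicalSpace E] where
  D : Set E
  convex : Convex ℝ D
  toFun : E → ℂ
  mem : ∀ x ∈ D, toFun x ∈ Line σ
  cont : ContinuousOn toFun D
  log : Fin (n + 1) → E → ℂ
  cont_log : ∀ k, ContinuousOn (log k) D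
  exp_log : ∀ k, ∀ x ∈ D, exp (log k x) = factor σ k (toFun x)

set_option linter.unusedSectionVars false

namespace Plot

variable {E E' : Type} [AddCommGroup E] [Module ℝ E] [TopologicalSpace E]
  [IsTopologicalAddGroup E] [ContinuousSMul ℝ E]
  [AddCommGroup E'] [Module ℝ E'] [TopologicalSpace E'] [IsTopologicalAddGroup E']
  [ContinuousSMul ℝ E']

/-- The branch defined by the logarithms of a plot. -/
def branch (P : Plot σ E) (s : Fin (n + 1) → ℂ) (x : E) : ℂ := exp (∑ k, s k * P.log k x)

theorem branch_ne_zero (P : Plot σ E) (x : E) : P.branch s x ≠ 0 := exp_ne_zero _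

theorem isFlatOn_branch (h0 : ∀ k, σ k ≠ 0) (P : Plot σ E) : IsFlatOn σ s P.D P.toFun (P.branch s) :=
  isFlatOn_of_log h0 P.cont_log P.mem P.exp_log

/-- Barycentric combinations of points of a plot. -/
def bary (P : Plot σ E) (v : Fin (d + 1) → P.D) (u : stdSimplex ℝ (Fin (d + 1))) : P.D :=
  ⟨∑ j, u j • (v j : E), P.convex.sum_mem (fun j _ => u.2.1 j) u.2.2 fun j _ => (v j).2⟩

theorem continuous_bary (P : Plot σ E) (v : Fin (d + 1) → P.D) : Continuous (P.bary v) := by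
  refine Continuous.subtype_mk (continuous_finsetSum _ fun j _ => ?_) _
  exact ((continuous_apply j).comp continuous_subtype_val).smul continuous_const

/-- The affine simplex of a plot with given vertices. -/
def simplex (P : Plot σ E) (v : Fin (d + 1) → P.D) : Simplex σ d :=
  ⟨fun u => ⟨P.toFun (P.bary v u), P.mem _ (P.bary v u).2⟩,
    (P.cont.comp_continuous (continuous_subtype_val.comp (P.continuous_bary v))
      fun u => (P.bary v u).2).subtype_mk _⟩

/-- The logarithms along an affine simplex. -/
def simplexLog (P : Plot σ E) (v : Fin (d + 1) → P.D) (k : Fin (n + 1)) :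
    C(stdSimplex ℝ (Fin (d + 1)), ℂ) :=
  ⟨fun u => P.log k (P.bary v u), (P.cont_log k).comp_continuous
    (continuous_subtype_val.comp (P.continuous_bary v)) fun u => (P.bary v u).2⟩

/-- The affine simplex with the branch of the plot, as a chain. -/
def chain (Q : Type) [Field Q] [Algebra Q ℂ] (s : Fin (n + 1) → ℂ) (P : Plot σ E) (v : Fin (d + 1) → P.D) :
    Chain Q σ s d :=
  Chain.of (P.simplex v) (branchSection Q s (P.simplex v) (P.simplexLog v)
    fun k t => P.exp_log k _ (P.bary v t).2)

theorem boundary_chain (P : Plot σ E) (v : Fin (d + 2) → P.D) :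
    boundary Q σ s d (P.chain Q s v) =
      ∑ i : Fin (d + 2), (-1 : Q) ^ (i : ℕ) • P.chain Q s (v ∘ i.succAbove) := by
  rw [chain, boundary_of]
  refine Finset.sum_congr rfl fun i _ => ?_
  have hb : ∀ u, P.bary v (faceMap d i u) = P.bary (v ∘ i.succAbove) u := fun u =>
    Subtype.ext (sum_faceMap_smul (fun j => (v j : E)) i u)
  congr 1
  refine chain_of_congr (ContinuousMap.ext fun u => Subtype.ext ?_) (funext fun u => ?_)
  · exact congrArg (fun x : P.D => P.toFun x) (hb u)
  · exact congrArg (fun x : P.D => P.branch s x) (hb u)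

variable {M : Type*} [AddCommGroup M] [Module Q M] {u : Chain Q σ s 1 →ₗ[Q] M}

/-- The cocycle condition on the triangle with vertices `p, q, r`. -/
theorem cocycle_add (hu : ∀ w, u (boundary Q σ s 1 w) = 0) (P : Plot σ E) (p q r : P.D) :
    u (P.chain Q s ![p, r]) = u (P.chain Q s ![p, q]) + u (P.chain Q s ![q, r]) := by
  have h := hu (P.chain Q s ![p, q, r])
  rw [boundary_chain, Fin.sum_univ_three] at h
  have e0 : (![p, q, r] ∘ (0 : Fin 3).succAbove : Fin 2 → P.D) = ![q, r] := by
    funext i; fin_cases i <;> rfl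
  have e1 : (![p, q, r] ∘ (1 : Fin 3).succAbove : Fin 2 → P.D) = ![p, r] := by
    funext i; fin_cases i <;> rfl
  have e2 : (![p, q, r] ∘ (2 : Fin 3).succAbove : Fin 2 → P.D) = ![p, q] := by
    funext i; fin_cases i <;> rfl
  rw [e0, e1, e2] at h
  simp at h
  rw [← sub_eq_zero, ← neg_eq_zero, ← h]
  abel

theorem cocycle_self (hu : ∀ w, u (boundary Q σ s 1 w) = 0) (P : Plot σ E) (p : P.D) :
    u (P.chain Q s ![p, p]) = 0 := by
  have := cocycle_add hu P p p p
  simpa using this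

/-- Restriction of a plot along a continuous map. -/
def comp (P : Plot σ E) (κ : E' → E) (D' : Set E') (hD : Convex ℝ D') (hκ : ContinuousOn κ D')
    (hm : MapsTo κ D' P.D) : Plot σ E' where
  D := D'
  convex := hD
  toFun := P.toFun ∘ κ
  mem _ hx := P.mem _ (hm hx)
  cont := P.cont.comp hκ hm
  log k := P.log k ∘ κ
  cont_log k := (P.cont_log k).comp hκ hm
  exp_log k _ hx := P.exp_log k _ (hm hx)

theorem chain_comp_eq (P : Plot σ E) {κ : E' → E} {D' : Set E'} (hD : Convex ℝ D') (hκ : ContinuousOn κ D')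
    (hm : MapsTo κ D' P.D) {E'' : Type} [AddCommGroup E''] [Module ℝ E''] [TopologicalSpace E'']
    [IsTopologicalAddGroup E''] [ContinuousSMul ℝ E''] {κ' : E'' → E} {D'' : Set E''}
    (hD' : Convex ℝ D'') (hκ' : ContinuousOn κ' D'') (hm' : MapsTo κ' D'' P.D)
    {v : Fin (d + 1) → D'} {v' : Fin (d + 1) → D''}
    (h : ∀ u : stdSimplex ℝ (Fin (d + 1)), κ (∑ j, u j • (v j : E')) = κ' (∑ j, u j • (v' j : E''))) :
    (P.comp κ D' hD hκ hm).chain Q s v = (P.comp κ' D'' hD' hκ' hm').chain Q s v' := by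
  refine chain_of_congr (ContinuousMap.ext fun u => Subtype.ext ?_) (funext fun u => ?_)
  · exact congrArg P.toFun (h u)
  · exact congrArg (P.branch s) (h u)

theorem chain_comp_id (P : Plot σ E) (v : Fin (d + 1) → P.D) :
    (P.comp id P.D P.convex continuousOn_id (mapsTo_id _)).chain Q s v = P.chain Q s v := rfl

theorem sum_two_smul (u : stdSimplex ℝ (Fin 2)) (v : Fin 2 → E) :
    ∑ j, u j • v j = (1 - u 1) • v 0 + u 1 • v 1 := by
  have : ∑ i, u i = 1 := u.2.2
  rw [Fin.sum_univ_two] at this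
  rw [Fin.sum_univ_two, eq_sub_of_add_eq this]

/-- A path in a plot is homologous to the segment with the same end points. -/
theorem cocycle_path (hu : ∀ w, u (boundary Q σ s 1 w) = 0) (P : Plot σ E) {κ : ℝ → E}
    (hκ : Continuous κ) (hm : ∀ t, κ t ∈ P.D) :
    u ((P.comp κ univ convex_univ hκ.continuousOn fun t _ => hm t).chain Q s ![⟨0, trivial⟩, ⟨1, trivial⟩]) =
      u (P.chain Q s ![⟨κ 0, hm 0⟩, ⟨κ 1, hm 1⟩]) := by
  -- The homotopy `(t, λ) ↦ (1 - λ) κ(0) + λ κ(t)`. The diagonal from `a` to `e` is decomposed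
  -- through `b` and through `c`: the sides `ab` and `ac` are constant at `κ 0`, while `be` is the
  -- path and `ce` the segment.
  set D' : Set (ℝ × ℝ) := univ ×ˢ Icc (0 : ℝ) 1 with hD'
  have hconv : Convex ℝ D' := convex_univ.prod (convex_Icc 0 1)
  set τ : ℝ × ℝ → E := fun q => (1 - q.2) • κ 0 + q.2 • κ q.1 with hτ
  have hτc : ContinuousOn τ D' := by
    have : Continuous τ := by fun_prop
    exact this.continuousOn
  have hτm : MapsTo τ D' P.D := fun q hq =>
    P.convex (hm 0) (hm q.1) (sub_nonneg.mpr hq.2.2) hq.2.1 (by ring)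
  set H := P.comp τ D' hconv hτc hτm with hH
  set a : H.D := ⟨((0 : ℝ), (0 : ℝ)), by simp [hH, comp, hD']⟩ with ha
  set b : H.D := ⟨((0 : ℝ), (1 : ℝ)), by simp [hH, comp, hD']⟩ with hb
  set c : H.D := ⟨((1 : ℝ), (0 : ℝ)), by simp [hH, comp, hD']⟩ with hc
  set e : H.D := ⟨((1 : ℝ), (1 : ℝ)), by simp [hH, comp, hD']⟩ with he
  have h1 := cocycle_add hu H a b e
  have h2 := cocycle_add hu H a c e
  have hab : H.chain Q s ![a, b] = P.chain Q s ![⟨κ 0, hm 0⟩, ⟨κ 0, hm 0⟩] := by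
    rw [← P.chain_comp_id]
    refine chain_comp_eq _ _ _ _ _ _ _ fun u => ?_
    rw [sum_two_smul, sum_two_smul]
    simp [ha, hb, hτ, ← add_smul]
  have hac : H.chain Q s ![a, c] = P.chain Q s ![⟨κ 0, hm 0⟩, ⟨κ 0, hm 0⟩] := by
    rw [← P.chain_comp_id]
    refine chain_comp_eq _ _ _ _ _ _ _ fun u => ?_
    rw [sum_two_smul, sum_two_smul]
    simp [ha, hc, hτ, ← add_smul]
  have hbe : H.chain Q s ![b, e] = (P.comp κ univ convex_univ hκ.continuousOn fun t _ => hm t).chain Q s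
      ![⟨0, trivial⟩, ⟨1, trivial⟩] := by
    refine chain_comp_eq _ _ _ _ _ _ _ fun u => ?_
    rw [sum_two_smul, sum_two_smul]
    simp [hb, he, hτ]
  have hce : H.chain Q s ![c, e] = P.chain Q s ![⟨κ 0, hm 0⟩, ⟨κ 1, hm 1⟩] := by
    rw [← P.chain_comp_id]
    refine chain_comp_eq _ _ _ _ _ _ _ fun u => ?_
    rw [sum_two_smul, sum_two_smul]
    simp [hc, he, hτ]
  rw [hab, cocycle_self hu, zero_add, hbe] at h1
  rw [hac, cocycle_self hu, zero_add, hce] at h2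
  rw [← h1, h2]

/-- The plot defined by a path with logarithms. -/
def ofPath (γ : Simplex σ 1) (l : Fin (n + 1) → C(stdSimplex ℝ (Fin 2), ℂ))
    (hl : ∀ k t, exp (l k t) = factor σ k (γ t)) : Plot σ ℝ where
  D := univ
  convex := convex_univ
  toFun := path γ
  mem t _ := path_mem γ t
  cont := (continuous_path γ).continuousOn
  log k t := l k (edge t)
  cont_log k := ((l k).continuous.comp continuous_edge).continuousOn
  exp_log k _ _ := hl k _

theorem edge_apply_one (u : stdSimplex ℝ (Fin 2)) : edge (u 1) = u := by
  obtain ⟨t, ht, rfl⟩ := exists_edge_eq u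
  rw [edge_one_apply ht]

theorem chain_ofPath (γ : Simplex σ 1) (l : Fin (n + 1) → C(stdSimplex ℝ (Fin 2), ℂ))
    (hl : ∀ k t, exp (l k t) = factor σ k (γ t)) :
    (ofPath γ l hl).chain Q s ![⟨0, trivial⟩, ⟨1, trivial⟩] = Chain.of γ (branchSection Q s γ l hl) := by
  have hb : ∀ u : stdSimplex ℝ (Fin 2), edge (∑ j, u j • ((![⟨0, trivial⟩, ⟨1, trivial⟩] : Fin 2 → (ofPath γ l hl).D) j : ℝ)) = u := fun u => by
    rw [sum_two_smul]
    simp [edge_apply_one]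
  refine chain_of_congr (ContinuousMap.ext fun u => Subtype.ext ?_) (funext fun u => ?_)
  · exact congrArg (fun x => (γ x : ℂ)) (hb u)
  · exact congrArg (fun x => exp (∑ k, s k * l k x)) (hb u)

/-- The plot defined by a convex open set of `ℂ ∖ Σ`. -/
theorem exists_of_convex (h0 : ∀ k, σ k ≠ 0) {D : Set ℂ} (hD : Convex ℝ D) (hDo : IsOpen D) (hDL : D ⊆ Line σ) :
    ∃ P : Plot σ ℂ, P.D = D ∧ P.toFun = id := by
  choose L hL hexp using fun k => exists_log_sub hD hDo
    (fun h => mem_Line_iff.mp (hDL h) k rfl : puncture σ k ∉ D) (factorConst_ne_zero h0 k)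
  exact ⟨⟨D, hD, id, hDL, continuousOn_id, L, hL, fun k x hx => (hexp k x hx).trans (factor_eq h0 k x).symm⟩,
    rfl, rfl⟩

end Plot

end TwistedPeriods
end

noncomputable section
namespace TwistedPeriods

open Complex Metric Set Filter Topology

variable {n : ℕ} {σ : Fin n → ℂ} {s : Fin (n + 1) → ℂ} {K Q : Type} [Field K] [Field Q] [Algebra K ℂ]
  [Algebra Q ℂ] {d : ℕ}

/-! ### Sections form lines -/

/-- Two branches differ by a constant of the field of coefficients. -/
theorem exists_branch_ratio {X : Type*} [TopologicalSpace X] {D : Set X} (hD : IsPreconnected D)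
    (h : Admissible K Q σ s) {φ : X → ℂ} {l l' : Fin (n + 1) → X → ℂ} (hl : ∀ k, ContinuousOn (l k) D)
    (hl' : ∀ k, ContinuousOn (l' k) D) (he : ∀ k, ∀ x ∈ D, exp (l k x) = factor σ k (φ x))
    (he' : ∀ k, ∀ x ∈ D, exp (l' k x) = factor σ k (φ x)) :
    ∃ q : Q, q ≠ 0 ∧ ∀ x ∈ D, exp (∑ k, s k * l k x) = algebraMap Q ℂ q * exp (∑ k, s k * l' k x) := by
  -- Two logarithms of the same function differ by an integer multiple of `2πi`. The integer is
  -- locally constant because distinct multiples are at distance more than `1`, hence constant on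
  -- the connected set.
  have hm : ∀ k, ∃ m : ℤ, ∀ x ∈ D, l k x = l' k x + m * (2 * Real.pi * I) := fun k => by
    by_cases hne : D.Nonempty
    · obtain ⟨x₀, hx₀⟩ := hne
      have h1 : ∀ x ∈ D, ∃ m : ℤ, l k x = l' k x + m * (2 * Real.pi * I) := fun x hx =>
        exp_eq_exp_iff_exists_int.mp ((he k x hx).trans (he' k x hx).symm)
      obtain ⟨m, hm⟩ := h1 x₀ hx₀
      refine ⟨m, fun x hx => ?_⟩
      have h2 := constant_of_locally_constant (f := fun x => l k x - l' k x) hD (fun p hp => ?_) hx hx₀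
      · linear_combination h2 + hm
      · have hc : ContinuousWithinAt (fun x => l k x - l' k x) D p := (hl k p hp).sub (hl' k p hp)
        filter_upwards [hc.eventually (ball_mem_nhds _ (zero_lt_one' ℝ)), self_mem_nhdsWithin] with q hq hqD
        obtain ⟨a, ha⟩ := h1 q hqD
        obtain ⟨b, hb⟩ := h1 p hp
        have e : (l k q - l' k q) - (l k p - l' k p) = ((a - b : ℤ) : ℂ) * (2 * Real.pi * I) := by
          rw [ha, hb]; push_cast; ring
        rw [dist_eq, e, norm_mul, norm_intCast] at hq
        have hpi : (1 : ℝ) ≤ ‖(2 * Real.pi * I : ℂ)‖ := by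
          simp only [norm_mul, norm_real, norm_I, mul_one, Real.norm_eq_abs, abs_of_pos Real.pi_pos]
          norm_num
          linarith [Real.pi_gt_three]
        have : |((a - b : ℤ) : ℝ)| < 1 := by nlinarith [abs_nonneg ((a - b : ℤ) : ℝ)]
        have hab : a - b = 0 := by
          rw [← Int.cast_abs] at this
          have h3 : |a - b| < 1 := by exact_mod_cast this
          exact Int.abs_lt_one_iff.mp h3
        rw [hab] at e
        linear_combination e
    · exact ⟨0, fun x hx => absurd ⟨x, hx⟩ hne⟩
  choose m hm using hm
  choose q hq using h.monodromy_mem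
  have hq0 : ∀ k, q k ≠ 0 := fun k e => by
    have := hq k
    rw [e, map_zero] at this
    exact exp_ne_zero _ this.symm
  -- The ratio of the branches is the product of the `exp (2πi s_k) ^ m_k`, which lies in the field
  -- of coefficients because the local monodromies do.
  refine ⟨∏ k, q k ^ m k, Finset.prod_ne_zero_iff.mpr fun k _ => zpow_ne_zero _ (hq0 k), fun x hx => ?_⟩
  rw [map_prod, exp_sum, exp_sum, ← Finset.prod_mul_distrib]
  refine Finset.prod_congr rfl fun k _ => ?_
  rw [map_zpow₀, hq, ← exp_int_mul, ← exp_add, hm k x hx]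
  congr 1
  ring

/-- A simplex is connected, so all branches along it are proportional over `Q`: the local system has
rank one. -/
theorem exists_eq_smul_branch (h : Admissible K Q σ s) (γ : Simplex σ d)
    (l : Fin (n + 1) → C(stdSimplex ℝ (Fin (d + 1)), ℂ)) (hl : ∀ k t, exp (l k t) = factor σ k (γ t))
    (g : sections Q σ s γ) : ∃ q : Q, g = q • branchSection Q s γ l hl := by
  obtain ⟨g, hg⟩ := g
  have hc : IsPreconnected (univ : Set (stdSimplex ℝ (Fin (d + 1)))) := by
    have := isPreconnected_iff_preconnectedSpace.mp (convex_stdSimplex ℝ (Fin (d + 1))).isPreconnected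
    exact isPreconnected_univ
  suffices H : ∃ q : Q, g = q • (branchSection Q s γ l hl : stdSimplex ℝ (Fin (d + 1)) → ℂ) by
    obtain ⟨q, hq⟩ := H
    exact ⟨q, Subtype.ext hq⟩
  induction hg using Submodule.span_induction with
  | mem g hg =>
    obtain ⟨l', hl', hg⟩ := hg
    obtain ⟨q, -, hq⟩ := exists_branch_ratio hc h (φ := fun t => (γ t : ℂ)) (l := fun k => l' k) (l' := fun k => l k)
      (fun k => (l' k).continuous.continuousOn) (fun k => (l k).continuous.continuousOn)
      (fun k x _ => hl' k x) (fun k x _ => hl k x)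
    refine ⟨q, funext fun t => ?_⟩
    rw [hg, hq t trivial, Pi.smul_apply, Algebra.smul_def]
    rfl
  | zero => exact ⟨0, by simp⟩
  | add g g' _ _ e e' =>
    obtain ⟨q, hq⟩ := e
    obtain ⟨q', hq'⟩ := e'
    exact ⟨q + q', by rw [hq, hq', add_smul]⟩
  | smul r g _ e =>
    obtain ⟨q, hq⟩ := e
    exact ⟨r * q, by rw [hq, mul_smul]⟩

/-! ### Potentials of cocycles -/

/-- On paths in `D` the functional `u` is the coboundary of `g ↦ g * θ`. -/
def IsPotentialOn (u : Chain Q σ s 1 →ₗ[Q] ℂ) (D : Set ℂ) (θ : ℂ → ℂ) : Prop :=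
  ∀ γ : Simplex σ 1, (∀ t, (γ t : ℂ) ∈ D) → ∀ g : sections Q σ s γ,
    u (Chain.of γ g) = (g : stdSimplex ℝ (Fin 2) → ℂ) (edge 1) * θ (path γ 1) -
      (g : stdSimplex ℝ (Fin 2) → ℂ) (edge 0) * θ (path γ 0)

variable {u : Chain Q σ s 1 →ₗ[Q] ℂ}

theorem Plot.bary_edge {E : Type} [AddCommGroup E] [Module ℝ E] [TopologicalSpace E]
    (P : Plot σ E) (v : Fin 2 → P.D) {r : ℝ} (hr : r ∈ Icc (0 : ℝ) 1) :
    (P.bary v (edge r) : E) = (1 - r) • (v 0 : E) + r • (v 1 : E) := by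
  change ∑ j, edge r j • (v j : E) = _
  rw [Fin.sum_univ_two, edge_one_apply hr, edge_zero_apply hr]

open Classical in
/-- The segment between two points of a plot. -/
def Plot.seg (Q : Type) [Field Q] [Algebra Q ℂ] (s : Fin (n + 1) → ℂ) (P : Plot σ ℂ) (x y : ℂ) : Chain Q σ s 1 :=
  if h : x ∈ P.D ∧ y ∈ P.D then P.chain Q s ![⟨x, h.1⟩, ⟨y, h.2⟩] else 0

theorem Plot.seg_eq (P : Plot σ ℂ) {x y : ℂ} (hx : x ∈ P.D) (hy : y ∈ P.D) :
    P.seg Q s x y = P.chain Q s ![⟨x, hx⟩, ⟨y, hy⟩] := dif_pos ⟨hx, hy⟩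

/-- The potential of a cocycle on a convex plot. -/
def Plot.potential (P : Plot σ ℂ) (x₀ : ℂ) (u : Chain Q σ s 1 →ₗ[Q] ℂ) (x : ℂ) : ℂ :=
  u (P.seg Q s x₀ x) / P.branch s x

/-- A path in a convex plot is homologous to the segment between its ends, and that segment to the
difference of the segments from `x₀`. Dividing by the branch of the plot makes the resulting
function independent of the section used. -/
theorem Plot.isPotentialOn (h : Admissible K Q σ s) (hu : ∀ w, u (boundary Q σ s 1 w) = 0) (P : Plot σ ℂ)
    (hP : P.toFun = id) {x₀ : ℂ} (hx₀ : x₀ ∈ P.D) : IsPotentialOn u P.D (P.potential x₀ u) := by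
  intro γ hγ g
  have hm : ∀ t, path γ t ∈ P.D := fun t => hγ _
  let l : Fin (n + 1) → C(stdSimplex ℝ (Fin 2), ℂ) := fun k =>
    ⟨fun t => P.log k (γ t), (P.cont_log k).comp_continuous (by fun_prop) hγ⟩
  have hl : ∀ k t, exp (l k t) = factor σ k (γ t) := fun k t => by
    have := P.exp_log k _ (hγ t)
    rwa [hP] at this
  obtain ⟨q, rfl⟩ := exists_eq_smul_branch h γ l hl g
  have e1 : Chain.of γ (branchSection Q s γ l hl) =
      (P.comp (path γ) univ convex_univ (continuous_path γ).continuousOn fun t _ => hm t).chain Q s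
        ![⟨0, trivial⟩, ⟨1, trivial⟩] := by
    rw [← Plot.chain_ofPath]
    refine chain_of_congr (ContinuousMap.ext fun u => Subtype.ext ?_) (funext fun u => ?_)
    · change path γ _ = P.toFun (path γ _)
      rw [hP]
      rfl
    · rfl
  have e2 := P.cocycle_path hu (continuous_path γ) hm
  have e3 := P.cocycle_add hu ⟨x₀, hx₀⟩ ⟨_, hm 0⟩ ⟨_, hm 1⟩
  rw [map_smul, map_smul, e1, e2]
  simp only [Plot.potential, P.seg_eq hx₀ (hm _)]
  have b1 := P.branch_ne_zero (s := s) (path γ 1)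
  have b0 := P.branch_ne_zero (s := s) (path γ 0)
  have c : ∀ t, ((q • branchSection Q s γ l hl : sections Q σ s γ) : stdSimplex ℝ (Fin 2) → ℂ) (edge t) =
      algebraMap Q ℂ q * P.branch s (path γ t) := fun t => by
    rw [Submodule.coe_smul, Pi.smul_apply, Algebra.smul_def]
    rfl
  rw [c, c, e3, Algebra.smul_def]
  field_simp
  ring

/-- A functional which has a global function as potential locally is its coboundary. -/
theorem eq_evalZero_boundary (hu : ∀ w, u (boundary Q σ s 1 w) = 0) {θ : ℂ → ℂ}
    (hθ : ∀ x ∈ Line σ, ∃ D, IsOpen D ∧ x ∈ D ∧ IsPotentialOn u D θ) (z : Chain Q σ s 1) :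
    u z = evalZero Q s θ (boundary Q σ s 0 z) := by
  revert z
  refine LinearMap.congr_fun (f := u) (g := evalZero Q s θ ∘ₗ boundary Q σ s 0) ?_
  refine chain_hom_ext fun γ l hl => ?_
  rw [LinearMap.comp_apply, evalZero_boundary, ← Plot.chain_ofPath]
  set R := Plot.ofPath γ l hl with hR
  choose D hDo hxD hD using fun t : unitInterval => hθ (path γ t) (path_mem γ t)
  -- The path is cut into pieces lying in sets where `θ` is a potential; the contributions
  -- telescope.
  obtain ⟨t, ht0, htm, ⟨M, hM⟩, hcov⟩ := exists_monotone_Icc_subset_open_cover_unitInterval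
    (c := fun i => (fun t : unitInterval => path γ t) ⁻¹' D i)
    (fun i => (hDo i).preimage ((continuous_path γ).comp continuous_subtype_val))
    (fun p _ => mem_iUnion.mpr ⟨p, hxD p⟩)
  have hstep : ∀ a b : unitInterval, ∀ i, Icc a b ⊆ (fun t : unitInterval => path γ t) ⁻¹' D i → a ≤ b →
      u (R.chain Q s ![⟨a, trivial⟩, ⟨b, trivial⟩]) =
        R.branch s b * θ (path γ b) - R.branch s a * θ (path γ a) := by
    intro a b i hi hab
    have hval : ∀ r ∈ Icc (0 : ℝ) 1, (R.bary ![⟨a, trivial⟩, ⟨b, trivial⟩] (edge r) : ℝ) = (1 - r) * a + r * b := by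
      intro r hr
      exact R.bary_edge _ hr
    have := hD i (R.simplex ![⟨a, trivial⟩, ⟨b, trivial⟩]) (fun v => ?_) (branchSection Q s _ (R.simplexLog _)
      fun k t => R.exp_log k _ (R.bary _ t).2)
    · refine this.trans ?_
      have e1 := hval 1 (by simp)
      have e0 := hval 0 (by simp)
      simp only [sub_self, zero_mul, one_mul, zero_add, sub_zero, add_zero] at e1 e0
      change R.branch s (R.bary _ (edge 1) : ℝ) * θ (path γ (R.bary _ (edge 1) : ℝ)) -
        R.branch s (R.bary _ (edge 0) : ℝ) * θ (path γ (R.bary _ (edge 0) : ℝ)) = _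
      rw [e1, e0]
    · obtain ⟨r, hr, rfl⟩ := exists_edge_eq v
      change path γ (R.bary ![⟨a, trivial⟩, ⟨b, trivial⟩] (edge r) : ℝ) ∈ D i
      rw [hval r hr]
      have hab' : (a : ℝ) ≤ b := hab
      have hmem : (1 - r) * (a : ℝ) + r * b ∈ Icc (a : ℝ) b := ⟨by nlinarith [hr.1, hr.2], by nlinarith [hr.1, hr.2]⟩
      exact hi (a := ⟨_, a.2.1.trans hmem.1, hmem.2.trans b.2.2⟩) ⟨hmem.1, hmem.2⟩
  have hall : ∀ m, u (R.chain Q s ![⟨t 0, trivial⟩, ⟨t m, trivial⟩]) =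
      R.branch s (t m) * θ (path γ (t m)) - R.branch s (t 0) * θ (path γ (t 0)) := by
    intro m
    induction m with
    | zero => rw [Plot.cocycle_self hu, sub_self]
    | succ m ih =>
      obtain ⟨i, hi⟩ := hcov m
      rw [Plot.cocycle_add hu R _ ⟨t m, trivial⟩, ih, hstep _ _ i hi (htm (Nat.le_succ m))]
      ring
  have := hall M
  rw [ht0, hM M le_rfl] at this
  exact this

/-- Two potentials on a convex set differ by a flat section. -/
theorem IsPotentialOn.sub_eq {θ θ' : ℂ → ℂ} (P : Plot σ ℂ) (hP : P.toFun = id) (hθ : IsPotentialOn u P.D θ)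
    (hθ' : IsPotentialOn u P.D θ') {x y : ℂ} (hx : x ∈ P.D) (hy : y ∈ P.D) :
    P.branch s x * (θ x - θ' x) = P.branch s y * (θ y - θ' y) := by
  set v : Fin 2 → P.D := ![⟨x, hx⟩, ⟨y, hy⟩]
  have hm : ∀ t, (P.simplex v t : ℂ) ∈ P.D := fun t => by
    change P.toFun _ ∈ P.D
    rw [hP]
    exact (P.bary v t).2
  set g := branchSection Q s (P.simplex v) (P.simplexLog v) fun k t => P.exp_log k _ (P.bary v t).2
  have h1 := hθ _ hm g
  have h2 := hθ' _ hm g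
  have b1 : (P.bary v (edge 1) : ℂ) = y := by
    rw [P.bary_edge _ (by simp)]
    simp [v]
  have b0 : (P.bary v (edge 0) : ℂ) = x := by
    rw [P.bary_edge _ (by simp)]
    simp [v]
  have c1 : (g : stdSimplex ℝ (Fin 2) → ℂ) (edge 1) = P.branch s y := congrArg (P.branch s) b1
  have c0 : (g : stdSimplex ℝ (Fin 2) → ℂ) (edge 0) = P.branch s x := congrArg (P.branch s) b0
  have d1 : path (P.simplex v) 1 = y := by
    change P.toFun _ = y
    rw [hP]
    exact b1
  have d0 : path (P.simplex v) 0 = x := by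
    change P.toFun _ = x
    rw [hP]
    exact b0
  rw [c1, c0, d1, d0] at h1 h2
  linear_combination h1 - h2

end TwistedPeriods
end

noncomputable section
namespace TwistedPeriods

open Complex Metric Set Filter Topology

variable {n : ℕ} {σ : Fin n → ℂ} {s : Fin (n + 1) → ℂ} {K Q : Type} [Field K] [Field Q] [Algebra K ℂ]
  [Algebra Q ℂ] {d : ℕ}

/-! ### A convex cover of the punctured line -/

/-- A finite cover of `ℂ ∖ Σ` by convex sets, glued along edges, with `n` more edges than sets. -/
structure ConvexCover (σ : Fin n → ℂ) where
  V : Type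
  E : Type
  [fintypeV : Fintype V]
  [fintypeE : Fintype E]
  patch : V → Set ℂ
  convex : ∀ v, Convex ℝ (patch v)
  isOpen : ∀ v, IsOpen (patch v)
  subset : ∀ v, patch v ⊆ Line σ
  cover : ∀ x ∈ Line σ, ∃ v, x ∈ patch v
  src : E → V
  dst : E → V
  pt : E → ℂ
  pt_src : ∀ e, pt e ∈ patch (src e)
  pt_dst : ∀ e, pt e ∈ patch (dst e)
  -- The patches that contain `x` form a connected graph under the edges whose two ends both contain
  -- `x`.
  glue : ∀ (x : ℂ) (f : V → ℂ),
    (∀ e, x ∈ patch (src e) → x ∈ patch (dst e) → f (src e) = f (dst e)) →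
      ∀ v w, x ∈ patch v → x ∈ patch w → f v = f w
  -- Every patch comes arbitrarily near some puncture, where a global flat function vanishes.
  touch : ∀ v, ∃ k, ∀ ρ > 0, ∃ x ∈ patch v, ‖x - puncture σ k‖ < ρ
  card : Fintype.card E = Fintype.card V + n

attribute [instance] ConvexCover.fintypeV ConvexCover.fintypeE

/-- A real linear function on the plane. -/
def slope (t : ℝ) : ℂ →L[ℝ] ℝ := reCLM + t • imCLM

theorem slope_apply (t : ℝ) (z : ℂ) : slope t z = z.re + t * z.im := by
  simp [slope]

/-- Each pair of distinct punctures excludes at most one parameter `t`, so some linear function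
`slope t` separates all of them. -/
theorem exists_sorted (hinj : Function.Injective (puncture σ)) :
    ∃ (t : ℝ) (e : Equiv.Perm (Fin (n + 1))), StrictMono fun k => slope t (puncture σ (e k)) := by
  have hfin : (⋃ j : Fin (n + 1), ⋃ k : Fin (n + 1),
      {t : ℝ | j ≠ k ∧ slope t (puncture σ j) = slope t (puncture σ k)}).Finite := by
    refine finite_iUnion fun j => finite_iUnion fun k => Set.Subsingleton.finite ?_
    rintro t ⟨hjk, ht⟩ t' ⟨-, ht'⟩
    rw [slope_apply, slope_apply] at ht ht'
    by_contra hne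
    have h1 : (t - t') * ((puncture σ j).im - (puncture σ k).im) = 0 := by linear_combination ht - ht'
    have h2 : (puncture σ j).im = (puncture σ k).im :=
      sub_eq_zero.mp ((mul_eq_zero.mp h1).resolve_left (sub_ne_zero.mpr hne))
    rw [h2] at ht
    exact hjk (hinj (Complex.ext (by linarith) h2))
  obtain ⟨t, ht⟩ := hfin.infinite_compl.nonempty
  simp only [mem_compl_iff, mem_iUnion, mem_ofPred_eq, not_exists, not_and] at ht
  refine ⟨t, Tuple.sort fun k => slope t (puncture σ k),
    (Tuple.monotone_sort fun k => slope t (puncture σ k)).strictMono_of_injective ?_⟩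
  intro j k hjk
  by_contra hne
  exact ht _ _ (fun h => hne (Equiv.injective _ h)) hjk

theorem convex_isOpen_slab {ι : Type*} [Finite ι] (f : ℂ →L[ℝ] ℝ) (b : ι → ℝ) (p q : ι → Prop) :
    Convex ℝ {x | (∀ k, p k → b k < f x) ∧ ∀ k, q k → f x < b k} ∧
      IsOpen {x | (∀ k, p k → b k < f x) ∧ ∀ k, q k → f x < b k} := by
  simp only [ofPred_and, ofPred_forall]
  constructor
  · exact (convex_iInter fun k => convex_iInter fun _ => convex_halfSpace_gt f.isBoundedLinearMap.toIsLinearMap _).inter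
      (convex_iInter fun k => convex_iInter fun _ => convex_halfSpace_lt f.isBoundedLinearMap.toIsLinearMap _)
  · exact (isOpen_iInter_of_finite fun k => isOpen_iInter_of_finite fun _ => isOpen_lt continuous_const f.continuous).inter
      (isOpen_iInter_of_finite fun k => isOpen_iInter_of_finite fun _ => isOpen_lt f.continuous continuous_const)

section cover

variable (t : ℝ) (p : Fin (n + 1) → ℂ)

/-- The strip between two consecutive lines through the punctures. -/
def strip (j : Fin (n + 2)) : Set ℂ :=
  {x | (∀ k : Fin (n + 1), k.castSucc < j → slope t (p k) < slope t x) ∧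
    ∀ k : Fin (n + 1), j ≤ k.castSucc → slope t x < slope t (p k)}

/-- The sign attached to a boolean. -/
def boolSign (ε : Bool) : ℝ := if ε then 1 else -1

/-- The half strip above or below a puncture. -/
def halfStrip (k : Fin (n + 1)) (ε : Bool) : Set ℂ :=
  {x | (∀ i, i < k → slope t (p i) < slope t x) ∧ ∀ i, k < i → slope t x < slope t (p i)} ∩
    {x | 0 < boolSign ε * (x.im - (p k).im)}

variable {t p}

theorem mem_strip_of_lt {k : Fin (n + 1)} {ε : Bool} {x : ℂ}
    (hx : x ∈ halfStrip t p k ε) (h : slope t x < slope t (p k)) : x ∈ strip t p k.castSucc := by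
  refine ⟨fun i hi => hx.1.1 i (Fin.castSucc_lt_castSucc_iff.mp hi), fun i hi => ?_⟩
  rcases (Fin.castSucc_le_castSucc_iff.mp hi).eq_or_lt with rfl | h'
  · exact h
  · exact hx.1.2 i h'

theorem mem_strip_of_gt {k : Fin (n + 1)} {ε : Bool} {x : ℂ}
    (hx : x ∈ halfStrip t p k ε) (h : slope t (p k) < slope t x) : x ∈ strip t p k.succ := by
  refine ⟨fun i hi => ?_, fun i hi => hx.1.2 i (Fin.succ_le_castSucc_iff.mp hi)⟩
  rcases (Fin.castSucc_lt_succ_iff.mp hi).eq_or_lt with rfl | h'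
  · exact h
  · exact hx.1.1 i h'

theorem ne_of_mem_strip {j : Fin (n + 2)} {x : ℂ} (hx : x ∈ strip t p j) (k : Fin (n + 1)) :
    slope t x ≠ slope t (p k) := by
  rcases lt_or_ge k.castSucc j with h | h
  · exact (hx.1 k h).ne'
  · exact (hx.2 k h).ne

theorem strip_unique {j j' : Fin (n + 2)} {x : ℂ} (hx : x ∈ strip t p j) (hx' : x ∈ strip t p j') :
    j = j' := by
  have key : ∀ {j j' : Fin (n + 2)}, x ∈ strip t p j → x ∈ strip t p j' → ¬ j < j' := by
    intro j j' h h' hlt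
    obtain ⟨k, rfl⟩ := Fin.exists_castSucc_eq.mpr (Fin.ne_last_of_lt hlt)
    exact lt_asymm (h.2 k le_rfl) (h'.1 k hlt)
  exact le_antisymm (not_lt.mp (key hx' hx)) (not_lt.mp (key hx hx'))

/-- These points serve twice: as gluing points of a half strip with an adjacent strip, and as
witnesses that every patch approaches a puncture. -/
theorem exists_near (hmono : StrictMono fun k => slope t (p k)) (k : Fin (n + 1)) (ε δ : Bool) {ρ : ℝ} (hρ : 0 < ρ) :
    ∃ x, x ∈ halfStrip t p k ε ∧ x ∈ strip t p (if δ then k.succ else k.castSucc) ∧ ‖x - p k‖ < ρ := by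
  obtain ⟨g, hg, hgap⟩ : ∃ g > 0, ∀ i, i ≠ k → g < |slope t (p i) - slope t (p k)| := by
    have hev : ∀ᶠ g : ℝ in 𝓝[>] 0, ∀ i, i ≠ k → g < |slope t (p i) - slope t (p k)| := by
      refine eventually_all.mpr fun i => ?_
      by_cases hi : i = k
      · exact Eventually.of_forall fun g h => absurd hi h
      · have : 0 < |slope t (p i) - slope t (p k)| :=
          abs_pos.mpr (sub_ne_zero.mpr fun h => hi (hmono.injective h))
        filter_upwards [mem_nhdsWithin_of_mem_nhds (gt_mem_nhds this)] with g hg _ using hg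
    obtain ⟨g, hg1, hg2⟩ := (hev.and self_mem_nhdsWithin).exists
    exact ⟨g, hg2, hg1⟩
  obtain ⟨h, hh0, hh1, hh2⟩ : ∃ h : ℝ, 0 < h ∧ h < g ∧ h * (2 + |t|) < ρ := by
    refine ⟨min (g / 2) (ρ / (2 * (2 + |t|))), by positivity, ?_, ?_⟩
    · exact (min_le_left _ _).trans_lt (by linarith)
    · have h2 : (0 : ℝ) < 2 + |t| := by positivity
      calc _ ≤ ρ / (2 * (2 + |t|)) * (2 + |t|) := by gcongr; exact min_le_right _ _
        _ = ρ / 2 := by field_simp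
        _ < ρ := by linarith
  set τ := boolSign δ * h with hτ
  set η := boolSign ε * h with hη
  -- The real displacement is corrected by `- t * η`, so that `slope t` changes by exactly `τ` while
  -- the imaginary part changes by `η`. Here `h < g` keeps the point between the neighbouring lines
  -- and `h * (2 + |t|) < ρ` bounds its distance from the puncture.
  set x : ℂ := p k + ⟨τ - t * η, η⟩ with hx
  have habs : ∀ b : Bool, |boolSign b * h| = h := fun b => by
    cases b <;> simp [boolSign, abs_of_pos hh0]
  have hsl : slope t x = slope t (p k) + τ := by
    simp only [hx, map_add, slope_apply]
    ring
  have hτlt : ∀ i, i ≠ k → |τ| < |slope t (p i) - slope t (p k)| := fun i hi => by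
    rw [hτ, habs]
    exact hh1.trans (hgap i hi)
  have hhalf : x ∈ halfStrip t p k ε := by
    refine ⟨⟨fun i hi => ?_, fun i hi => ?_⟩, ?_⟩
    · have h1 := hmono hi
      have h2 := hτlt i hi.ne
      rw [abs_of_neg (sub_neg.mpr h1)] at h2
      rw [hsl]
      linarith [neg_abs_le τ]
    · have h1 := hmono hi
      have h2 := hτlt i hi.ne'
      rw [abs_of_pos (sub_pos.mpr h1)] at h2
      rw [hsl]
      linarith [le_abs_self τ]
    · have : boolSign ε * (x.im - (p k).im) = h := by
        simp only [hx, add_im, hη]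
        cases ε <;> simp [boolSign]
      rw [mem_ofPred_eq, this]
      exact hh0
  refine ⟨x, hhalf, ?_, ?_⟩
  · cases δ
    · refine mem_strip_of_lt hhalf ?_
      rw [hsl, hτ]
      simp [boolSign, hh0]
    · refine mem_strip_of_gt hhalf ?_
      rw [hsl, hτ]
      simp [boolSign, hh0]
  · rw [hx, add_sub_cancel_left]
    refine (norm_le_abs_re_add_abs_im _).trans_lt ?_
    simp only
    refine lt_of_le_of_lt ?_ hh2
    have h1 : |τ - t * η| ≤ |τ| + |t| * |η| := by
      rw [← abs_mul]
      exact abs_sub _ _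
    rw [hτ, hη, habs, habs] at h1
    rw [hη, habs, hτ]
    nlinarith

theorem mem_cases {k : Fin (n + 1)} {ε : Bool} {x : ℂ}
    (hx : x ∈ halfStrip t p k ε) :
    slope t x = slope t (p k) ∨ ∃ δ : Bool, x ∈ strip t p (if δ then k.succ else k.castSucc) := by
  rcases lt_trichotomy (slope t x) (slope t (p k)) with h | h | h
  · exact Or.inr ⟨false, mem_strip_of_lt hx h⟩
  · exact Or.inl h
  · exact Or.inr ⟨true, mem_strip_of_gt hx h⟩

end cover

/-- The parallel lines `slope t = const` through the `n + 1` punctures leave `n + 2` open strips.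
These lines are never horizontal, so the imaginary part splits each line minus its puncture in two,
and two half strips per puncture cover the pieces. Each half strip is glued to the two strips beside
its line. -/
theorem exists_convexCover (hinj : Function.Injective (puncture σ)) : Nonempty (ConvexCover σ) := by
  obtain ⟨t, e, hmono⟩ := exists_sorted hinj
  set p : Fin (n + 1) → ℂ := fun k => puncture σ (e k) with hp
  have hmono : StrictMono fun k => slope t (p k) := hmono
  choose pt h1 h2 h3 using fun a : Fin (n + 1) × Bool × Bool =>
    exists_near hmono a.1 a.2.1 a.2.2 zero_lt_one
  have hLine : ∀ x, (∀ k, x ≠ p k) → x ∈ Line σ := fun x hx =>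
    mem_Line_iff.mpr fun k => by simpa [hp] using hx (e.symm k)
  refine ⟨{ V := Fin (n + 2) ⊕ (Fin (n + 1) × Bool)
            E := Fin (n + 1) × Bool × Bool
            patch := Sum.elim (strip t p) fun a => halfStrip t p a.1 a.2
            convex := ?_
            isOpen := ?_
            subset := ?_
            cover := ?_
            src := fun a => Sum.inr (a.1, a.2.1)
            dst := fun a => Sum.inl (if a.2.2 then a.1.succ else a.1.castSucc)
            pt := pt
            pt_src := h1
            pt_dst := h2
            glue := ?_
            touch := ?_
            card := ?_ }⟩
  · rintro (j | ⟨k, ε⟩)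
    · exact (convex_isOpen_slab (slope t) _ _ _).1
    · refine (convex_isOpen_slab (slope t) _ _ _).1.inter ?_
      have : {x : ℂ | 0 < boolSign ε * (x.im - (p k).im)} =
          {x : ℂ | boolSign ε * (p k).im < (boolSign ε • imCLM) x} := by
        ext x
        simp [mul_sub]
      rw [this]
      exact convex_halfSpace_gt (boolSign ε • imCLM).isBoundedLinearMap.toIsLinearMap _
  · rintro (j | ⟨k, ε⟩)
    · exact (convex_isOpen_slab (slope t) _ _ _).2
    · exact (convex_isOpen_slab (slope t) _ _ _).2.inter (isOpen_lt continuous_const (by fun_prop))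
  · rintro (j | ⟨k, ε⟩) x hx
    · exact hLine x fun k h => ne_of_mem_strip hx k (by rw [h])
    · refine hLine x fun i h => ?_
      rcases lt_trichotomy i k with hi | rfl | hi
      · exact (hx.1.1 i hi).ne (by rw [h])
      · have := hx.2
        rw [mem_ofPred_eq, h, sub_self, mul_zero] at this
        exact lt_irrefl _ this
      · exact (hx.1.2 i hi).ne (by rw [h])
  · intro x hx
    by_cases hk : ∃ k, slope t x = slope t (p k)
    · obtain ⟨k, hk⟩ := hk
      have him : x.im - (p k).im ≠ 0 := fun h => by
        rw [slope_apply, slope_apply] at hk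
        have h' := sub_eq_zero.mp h
        rw [h'] at hk
        exact mem_Line_iff.mp hx (e k) (Complex.ext (by simpa using hk) h')
      refine ⟨Sum.inr (k, decide (0 < x.im - (p k).im)), ⟨fun i hi => ?_, fun i hi => ?_⟩, ?_⟩
      · rw [hk]; exact hmono hi
      · rw [hk]; exact hmono hi
      · by_cases h : 0 < x.im - (p k).im
        · rw [mem_ofPred_eq, decide_eq_true h]
          simpa [boolSign] using h
        · have h' := lt_of_le_of_ne (not_lt.mp h) him
          simp only [h, decide_false, boolSign, mem_ofPred_eq]
          simp
          linarith
    · push Not at hk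
      refine ⟨Sum.inl ((Finset.univ.filter fun k : Fin (n + 1) => slope t (p k) < slope t x).sup
        fun k => k.succ), fun k hk' => ?_, fun k hk' => ?_⟩
      · obtain ⟨i, hi, hki⟩ := (Finset.lt_sup_iff).mp hk'
        exact (hmono.monotone (Fin.castSucc_lt_succ_iff.mp hki)).trans_lt (Finset.mem_filter.mp hi).2
      · refine lt_of_le_of_ne (not_lt.mp fun h => ?_) (hk k)
        have : k.succ ≤ k.castSucc := (Finset.le_sup (f := fun k : Fin (n + 1) => k.succ)
          (Finset.mem_filter.mpr ⟨Finset.mem_univ k, h⟩)).trans hk'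
        exact absurd this (not_le.mpr (Fin.castSucc_lt_succ))
  · intro x f hf v w hv hw
    have hadj : ∀ (k : Fin (n + 1)) (ε δ : Bool), x ∈ halfStrip t p k ε →
        x ∈ strip t p (if δ then k.succ else k.castSucc) →
        f (Sum.inr (k, ε)) = f (Sum.inl (if δ then k.succ else k.castSucc)) := fun k ε δ h1 h2 =>
      hf (k, ε, δ) h1 h2
    -- If `x` lies in a strip, every other patch containing `x` is a half strip glued to that strip.
    -- If `x` lies on one of the lines, only one half strip contains it.
    have hstrip : ∀ j, x ∈ strip t p j → ∀ v, x ∈ Sum.elim (strip t p) (fun a => halfStrip t p a.1 a.2) v →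
        f v = f (Sum.inl j) := by
      rintro j hj (j' | ⟨k, ε⟩) hv
      · rw [strip_unique (show x ∈ strip t p j' from hv) hj]
      · rcases mem_cases (show x ∈ halfStrip t p k ε from hv) with h | ⟨δ, h⟩
        · exact absurd h (ne_of_mem_strip hj k)
        · rw [hadj k ε δ hv h, strip_unique h hj]
    by_cases hj : ∃ j, x ∈ strip t p j
    · obtain ⟨j, hj⟩ := hj
      rw [hstrip j hj v hv, hstrip j hj w hw]
    · push Not at hj
      rcases v with j | ⟨k, ε⟩
      · exact absurd hv (hj j)
      rcases w with j | ⟨k', ε'⟩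
      · exact absurd hw (hj j)
      have hv' : x ∈ halfStrip t p k ε := hv
      have hw' : x ∈ halfStrip t p k' ε' := hw
      have e1 := (mem_cases hv').resolve_right fun ⟨δ, h⟩ => hj _ h
      have e2 := (mem_cases hw').resolve_right fun ⟨δ, h⟩ => hj _ h
      obtain rfl : k = k' := hmono.injective (e1.symm.trans e2)
      have s1 := hv'.2
      have s2 := hw'.2
      rw [mem_ofPred_eq] at s1 s2
      have : ε = ε' := by
        cases ε <;> cases ε' <;> simp [boolSign] at s1 s2 ⊢ <;> linarith
      rw [this]
  · have key : ∀ (k : Fin (n + 1)) (ρ : ℝ), 0 < ρ → ∀ (ε δ : Bool), ∃ x, x ∈ halfStrip t p k ε ∧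
        x ∈ strip t p (if δ then k.succ else k.castSucc) ∧ ‖x - puncture σ (e k)‖ < ρ :=
      fun k ρ hρ ε δ => exists_near hmono k ε δ hρ
    rintro (j | ⟨k, ε⟩)
    · rcases Fin.eq_zero_or_eq_succ j with rfl | ⟨i, rfl⟩
      · refine ⟨e 0, fun ρ hρ => ?_⟩
        obtain ⟨x, -, h, h'⟩ := key 0 ρ hρ true false
        exact ⟨x, h, h'⟩
      · refine ⟨e i, fun ρ hρ => ?_⟩
        obtain ⟨x, -, h, h'⟩ := key i ρ hρ true true
        exact ⟨x, h, h'⟩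
    · refine ⟨e k, fun ρ hρ => ?_⟩
      obtain ⟨x, h, -, h'⟩ := key k ρ hρ ε true
      exact ⟨x, h, h'⟩
  -- There are `4(n + 1)` edges and `(n + 2) + 2(n + 1)` patches.
  · simp only [Fintype.card_prod, Fintype.card_sum, Fintype.card_fin, Fintype.card_bool]
    ring

end TwistedPeriods
end

noncomputable section
namespace TwistedPeriods

open Complex Metric Set Filter Topology

variable {n : ℕ} {σ : Fin n → ℂ} {s : Fin (n + 1) → ℂ} {K Q : Type} [Field K] [Field Q] [Algebra K ℂ]
  [Algebra Q ℂ] {d : ℕ}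

/-! ### The dimension of Betti cohomology -/

theorem Admissible.ne_zero (h : Admissible K Q σ s) (k : Fin n) : σ k ≠ 0 :=
  ne_zero_of_puncture_injective h.inj k

theorem exists_section_eq (h : Admissible K Q σ s) (P : Plot σ ℂ) (hP : P.toFun = id) {γ : Simplex σ d}
    (hγ : ∀ t, (γ t : ℂ) ∈ P.D) (g : sections Q σ s γ) :
    ∃ q : Q, ∀ t, (g : stdSimplex ℝ (Fin (d + 1)) → ℂ) t = algebraMap Q ℂ q * P.branch s (γ t) := by
  let l : Fin (n + 1) → C(stdSimplex ℝ (Fin (d + 1)), ℂ) := fun k =>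
    ⟨fun t => P.log k (γ t), (P.cont_log k).comp_continuous (by fun_prop) hγ⟩
  have hl : ∀ k t, exp (l k t) = factor σ k (γ t) := fun k t => by
    have := P.exp_log k _ (hγ t)
    rwa [hP] at this
  obtain ⟨q, rfl⟩ := exists_eq_smul_branch h γ l hl g
  refine ⟨q, fun t => ?_⟩
  rw [Submodule.coe_smul, Pi.smul_apply, Algebra.smul_def]
  rfl

theorem IsPotentialOn.mono {u : Chain Q σ s 1 →ₗ[Q] ℂ} {D D' : Set ℂ} {θ : ℂ → ℂ} (hθ : IsPotentialOn u D θ)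
    (hD : D' ⊆ D) : IsPotentialOn u D' θ := fun γ hγ g => hθ γ (fun t => hD (hγ t)) g

theorem IsPotentialOn.congr {u : Chain Q σ s 1 →ₗ[Q] ℂ} {D : Set ℂ} {θ θ' : ℂ → ℂ} (hθ : IsPotentialOn u D θ)
    (h : ∀ x ∈ D, θ' x = θ x) : IsPotentialOn u D θ' := fun γ hγ g => by
  rw [hθ γ hγ g, h (path γ 1) (hγ _), h (path γ 0) (hγ _)]

/-- The function `a / branch` is flat: its product with any section is constant and contributes
nothing to the difference of end values. -/
theorem IsPotentialOn.sub_flat {u : Chain Q σ s 1 →ₗ[Q] ℂ} (h : Admissible K Q σ s) {P : Plot σ ℂ} (hP : P.toFun = id)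
    {θ : ℂ → ℂ} (hθ : IsPotentialOn u P.D θ) (a : ℂ) :
    IsPotentialOn u P.D (fun x => θ x - a / P.branch s x) := fun γ hγ g => by
  obtain ⟨q, hq⟩ := exists_section_eq h P hP hγ g
  have e : ∀ t, (g : stdSimplex ℝ (Fin 2) → ℂ) (edge t) * (a / P.branch s (path γ t)) = algebraMap Q ℂ q * a :=
    fun t => by
      have := P.branch_ne_zero (s := s) (path γ t)
      rw [hq]
      change algebraMap Q ℂ q * P.branch s (path γ t) * _ = _
      field_simp
  rw [hθ γ hγ g, mul_sub, mul_sub, e, e]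
  ring

/-- On a convex overlap two potentials of the same functional differ by a flat section, so agreement
at the one point `pt e` implies agreement on the whole overlap. -/
theorem ConvexCover.exists_glued (c : ConvexCover σ) (h0 : ∀ k, σ k ≠ 0) {u : Chain Q σ s 1 →ₗ[Q] ℂ}
    {θ : c.V → ℂ → ℂ} (hθ : ∀ v, IsPotentialOn u (c.patch v) (θ v))
    (he : ∀ e, θ (c.src e) (c.pt e) = θ (c.dst e) (c.pt e)) :
    ∃ Θ : ℂ → ℂ, ∀ v, ∀ x ∈ c.patch v, Θ x = θ v x := by
  classical
  have key : ∀ x v w, x ∈ c.patch v → x ∈ c.patch w → θ v x = θ w x := fun x => by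
    refine c.glue x (fun v => θ v x) fun e h1 h2 => ?_
    obtain ⟨P, hPD, hP⟩ := Plot.exists_of_convex h0 ((c.convex (c.src e)).inter (c.convex (c.dst e)))
      ((c.isOpen _).inter (c.isOpen _)) (inter_subset_left.trans (c.subset _))
    have hx : x ∈ P.D := hPD ▸ ⟨h1, h2⟩
    have hp : c.pt e ∈ P.D := hPD ▸ ⟨c.pt_src e, c.pt_dst e⟩
    have := IsPotentialOn.sub_eq P hP ((hθ (c.src e)).mono (hPD ▸ inter_subset_left))
      ((hθ (c.dst e)).mono (hPD ▸ inter_subset_right)) hx hp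
    rw [he, sub_self, mul_zero] at this
    exact sub_eq_zero.mp ((mul_eq_zero.mp this).resolve_left (P.branch_ne_zero _))
  refine ⟨fun x => if h : ∃ v, x ∈ c.patch v then θ h.choose x else 0, fun v x hx => ?_⟩
  have h : ∃ v, x ∈ c.patch v := ⟨v, hx⟩
  refine (dif_pos h).trans ?_
  exact key x _ _ h.choose_spec hx

theorem hasDerivAt_branch (h0 : ∀ k, σ k ≠ 0) {P : Plot σ ℂ} (hP : P.toFun = id) (hPo : IsOpen P.D) {x : ℂ}
    (hx : x ∈ P.D) : HasDerivAt (P.branch s) (conn σ s x * P.branch s x) x := by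
  have h1 := P.isFlatOn_branch (s := s) h0 x hx
  rw [hPo.nhdsWithin_eq hx, hP] at h1
  have hxL : x ∈ Line σ := by
    have := P.mem x hx
    rwa [hP] at this
  have h2 := (hasDerivAt_localBranch (s := s) hxL hxL fun k => by
    rw [div_self (sub_puncture_ne_zero hxL k)]; simp).const_mul (P.branch s x)
  refine (h2.congr_of_eventuallyEq h1).congr_deriv ?_
  rw [localBranch_self hxL]
  ring

/-- A linear form with values in the field of coefficients descends. -/
theorem exists_cochain_of_mem_range {f : Chain Q σ s d →ₗ[Q] ℂ}
    (hf : ∀ (γ : Simplex σ d) (g : sections Q σ s γ), ∃ q : Q, algebraMap Q ℂ q = f (Chain.of γ g)) :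
    ∃ w : Chain Q σ s d →ₗ[Q] Q, ∀ z, algebraMap Q ℂ (w z) = f z := by
  have hz : ∀ z, ∃ q : Q, algebraMap Q ℂ q = f z := fun z => by
    obtain ⟨T, -, hT⟩ := exists_chain_eq_sum z
    choose q hq using fun γ => hf γ (z.coeff γ)
    refine ⟨∑ γ ∈ T, q γ, ?_⟩
    conv_rhs => rw [hT]
    rw [map_sum, map_sum]
    exact Finset.sum_congr rfl fun γ _ => hq γ
  choose w hw using hz
  have hinj := (algebraMap Q ℂ).injective
  refine ⟨⟨⟨w, fun x y => hinj ?_⟩, fun r x => hinj ?_⟩, hw⟩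
  · rw [map_add, hw, hw, hw, map_add]
  · rw [hw, map_smul, RingHom.id_apply, smul_eq_mul, map_mul, hw, Algebra.smul_def]

/-- `H¹(ℂ ∖ Σ, ℒ_s)` has dimension at most `n`. -/
theorem finrank_HB_le (h : Admissible K Q σ s) :
    FiniteDimensional Q (HB Q σ s) ∧ Module.finrank Q (HB Q σ s) ≤ n := by
  obtain ⟨c⟩ := exists_convexCover h.inj
  choose P hPD hP using fun v => Plot.exists_of_convex h.ne_zero (c.convex v) (c.isOpen v) (c.subset v)
  have hx : ∀ v, ∃ x, x ∈ c.patch v := fun v => by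
    obtain ⟨k, hk⟩ := c.touch v
    obtain ⟨x, hx, -⟩ := hk 1 zero_lt_one
    exact ⟨x, hx⟩
  choose x₀ hx₀ using hx
  have hμ : ∀ e, ∃ μ : Q, (P (c.src e)).branch s (c.pt e) = algebraMap Q ℂ μ * (P (c.dst e)).branch s (c.pt e) :=
    fun e => by
      have hs : c.pt e ∈ (P (c.src e)).D := hPD _ ▸ c.pt_src e
      have hd : c.pt e ∈ (P (c.dst e)).D := hPD _ ▸ c.pt_dst e
      obtain ⟨μ, -, hμ⟩ := exists_branch_ratio (φ := id) (isPreconnected_singleton (x := c.pt e)) h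
        (l := (P (c.src e)).log) (l' := (P (c.dst e)).log) (fun k => continuousOn_singleton _ _)
        (fun k => continuousOn_singleton _ _)
        (fun k x hx => by rw [mem_singleton_iff.mp hx, (P _).exp_log k _ hs, hP])
        (fun k x hx => by rw [mem_singleton_iff.mp hx, (P _).exp_log k _ hd, hP])
      exact ⟨μ, hμ _ rfl⟩
  choose μ hμ using hμ
  -- The Čech cocycle of `u`: the jump, across each edge, of the local potentials. The factor `μ e`
  -- compares the two branches at the gluing point.
  let D : LinearMap.ker (coboundary Q σ s 1) →ₗ[Q] (c.E → Q) := (LinearMap.pi fun e =>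
    Cochain.eval ((P (c.src e)).seg Q s (x₀ (c.src e)) (c.pt e)) -
      μ e • Cochain.eval ((P (c.dst e)).seg Q s (x₀ (c.dst e)) (c.pt e))) ∘ₗ Submodule.subtype _
  -- The Čech coboundary of the flat local sections `a v / branch`.
  let C : (c.V → Q) →ₗ[Q] (c.E → Q) := LinearMap.pi fun e =>
    LinearMap.proj (c.src e) - μ e • LinearMap.proj (c.dst e)
  -- An element of the kernel glues to a global flat function. It vanishes near a puncture touched
  -- by each patch, so all its coefficients are zero.
  have hCinj : Function.Injective C := by
    rw [← LinearMap.ker_eq_bot, LinearMap.ker_eq_bot']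
    intro a ha
    have hae : ∀ e, a (c.src e) = μ e * a (c.dst e) := fun e => by
      have := congrFun ha e
      exact sub_eq_zero.mp this
    have hpot : ∀ v, IsPotentialOn (0 : Chain Q σ s 1 →ₗ[Q] ℂ) (c.patch v)
        (fun x => algebraMap Q ℂ (a v) / (P v).branch s x) := fun v => by
      have h1 : IsPotentialOn (0 : Chain Q σ s 1 →ₗ[Q] ℂ) (P v).D 0 := fun γ hγ g => by simp
      have := h1.sub_flat h (hP v) (-algebraMap Q ℂ (a v))
      rw [hPD] at this
      exact this.congr fun x _ => by simp [neg_div]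
    obtain ⟨Θ, hΘ⟩ := c.exists_glued h.ne_zero hpot fun e => by
      rw [hae, hμ, map_mul]
      have := (P (c.dst e)).branch_ne_zero (s := s) (c.pt e)
      have hμ0 : algebraMap Q ℂ (μ e) ≠ 0 := fun h => by
        have := hμ e
        rw [h, zero_mul] at this
        exact (P (c.src e)).branch_ne_zero _ this
      field_simp
    have hflat : ∀ x ∈ Line σ, HasDerivAt Θ (-conn σ s x * Θ x) x := fun x hx => by
      obtain ⟨v, hv⟩ := c.cover x hx
      have hxP : x ∈ (P v).D := hPD v ▸ hv
      have h1 := hasDerivAt_branch (s := s) h.ne_zero (hP v) (hPD v ▸ c.isOpen v) hxP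
      have hb := (P v).branch_ne_zero (s := s) x
      have h2 : HasDerivAt (fun x => algebraMap Q ℂ (a v) / (P v).branch s x)
          (-conn σ s x * (algebraMap Q ℂ (a v) / (P v).branch s x)) x := by
        refine ((h1.inv hb).const_mul (algebraMap Q ℂ (a v))).congr_deriv ?_
        field_simp
      rw [hΘ v x hv]
      refine h2.congr_of_eventuallyEq ?_
      filter_upwards [(c.isOpen v).mem_nhds hv] with y hy using hΘ v y hy
    obtain ⟨r, hr, hr2⟩ := exists_isolating_radius h.inj
    funext v
    obtain ⟨k, hk⟩ := c.touch v
    obtain ⟨x, hxv, hxk⟩ := hk (2 * r) (by positivity)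
    have hz := eq_zero_of_flat_near_puncture (φ := Θ) (h.nonint k) hr2 le_rfl
      (fun x hx hxk => hflat x (mem_Line_of_mem_ball hr2 le_rfl hx hxk)) x (mem_ball_iff_norm.mpr hxk)
      (fun e => mem_Line_iff.mp (c.subset v hxv) k e)
    rw [hΘ v x hxv] at hz
    have := (div_eq_zero_iff.mp hz).resolve_right ((P v).branch_ne_zero _)
    exact (algebraMap Q ℂ).injective (this.trans (map_zero _).symm)
  -- If the jumps of `u` are a Čech coboundary, the corrected local potentials glue to one function
  -- `Θ`, and `u` is its coboundary.
  have hker : ∀ u : LinearMap.ker (coboundary Q σ s 1), D u ∈ LinearMap.range C →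
      u ∈ (LinearMap.range (coboundary Q σ s 0)).submoduleOf (LinearMap.ker (coboundary Q σ s 1)) := by
    rintro ⟨u, hu⟩ ⟨a, ha⟩
    let u' : Chain Q σ s 1 →ₗ[Q] Q := u
    let uC : Chain Q σ s 1 →ₗ[Q] ℂ := Algebra.linearMap Q ℂ ∘ₗ u'
    have hu0 : ∀ w, uC (boundary Q σ s 1 w) = 0 := fun w => by
      have h1 : u' (boundary Q σ s 1 w) = 0 := LinearMap.congr_fun (show u' ∘ₗ boundary Q σ s 1 = 0 from hu) w
      change algebraMap Q ℂ (u' _) = 0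
      rw [h1, map_zero]
    have hpot : ∀ v, IsPotentialOn uC (c.patch v)
        (fun x => (P v).potential (x₀ v) uC x - algebraMap Q ℂ (a v) / (P v).branch s x) := fun v => by
      have := ((P v).isPotentialOn h hu0 (hP v) (x₀ := x₀ v) (by rw [hPD]; exact hx₀ v)).sub_flat h (hP v)
        (algebraMap Q ℂ (a v))
      rwa [hPD] at this
    obtain ⟨Θ, hΘ⟩ := c.exists_glued h.ne_zero hpot fun e => by
      have h1 : a (c.src e) - μ e * a (c.dst e) = u' ((P (c.src e)).seg Q s (x₀ (c.src e)) (c.pt e)) -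
          μ e * u' ((P (c.dst e)).seg Q s (x₀ (c.dst e)) (c.pt e)) := congrFun ha e
      have h2 := congrArg (algebraMap Q ℂ) h1
      simp only [map_sub, map_mul] at h2
      have hd := (P (c.dst e)).branch_ne_zero (s := s) (c.pt e)
      have hs := (P (c.src e)).branch_ne_zero (s := s) (c.pt e)
      have hμ0 : algebraMap Q ℂ (μ e) ≠ 0 := fun h => by
        have := hμ e
        rw [h, zero_mul] at this
        exact hs this
      have e1 : ∀ z, uC z = algebraMap Q ℂ (u' z) := fun z => rfl
      simp only [Plot.potential, e1]
      rw [hμ]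
      field_simp
      linear_combination -h2
    have hglob := eq_evalZero_boundary hu0 (θ := Θ) fun x hx => by
      obtain ⟨v, hv⟩ := c.cover x hx
      exact ⟨c.patch v, c.isOpen v, hv, (hpot v).congr (hΘ v)⟩
    -- The product of `Θ` with a section is a value of `u` minus a coefficient `a v`, times an
    -- element of `Q`; so the complex primitive is defined over `Q`.
    obtain ⟨w, hw⟩ := exists_cochain_of_mem_range (f := evalZero Q s Θ) fun γ g => by
      obtain ⟨v, hv⟩ := c.cover (γ default) (γ default).2
      obtain ⟨q, hq⟩ := exists_section_eq h (P v) (hP v) (γ := γ) (fun t => by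
        rw [hPD, Subsingleton.elim t default]; exact hv) g
      refine ⟨q * (u' ((P v).seg Q s (x₀ v) (γ default)) - a v), ?_⟩
      rw [evalZero_of, hq, hΘ v _ hv, map_mul, map_sub]
      have hb := (P v).branch_ne_zero (s := s) (γ default)
      change _ = _ * (algebraMap Q ℂ (u' ((P v).seg Q s (x₀ v) (γ default))) / _ - _)
      field_simp
    refine ⟨w, ?_⟩
    change w ∘ₗ boundary Q σ s 0 = u'
    refine LinearMap.ext fun z => (algebraMap Q ℂ).injective ?_
    exact (hw _).trans (hglob z).symm
  -- The kernel of `Ψ` consists of coboundaries, so the dimension of `HB` is at most that of the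
  -- cokernel of `C`, which is `card E - card V = n`.
  let Ψ := (LinearMap.range C).mkQ ∘ₗ D
  have hΨ : LinearMap.ker Ψ ≤ (LinearMap.range (coboundary Q σ s 0)).submoduleOf
      (LinearMap.ker (coboundary Q σ s 1)) := fun u hu => hker u (by
    simpa [Ψ, Submodule.Quotient.mk_eq_zero] using hu)
  have hfin : FiniteDimensional Q (LinearMap.ker (coboundary Q σ s 1) ⧸ LinearMap.ker Ψ) :=
    Module.Finite.equiv Ψ.quotKerEquivRange.symm
  have hsurj := Submodule.factor_surjective hΨ
  refine ⟨Module.Finite.of_surjective _ hsurj, ?_⟩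
  have h1 : Module.finrank Q (HB Q σ s) ≤ Module.finrank Q (LinearMap.ker (coboundary Q σ s 1) ⧸ LinearMap.ker Ψ) :=
    LinearMap.finrank_le_finrank_of_surjective hsurj
  have h2 := Ψ.quotKerEquivRange.finrank_eq
  have h3 := Submodule.finrank_le (LinearMap.range Ψ)
  have h4 := (LinearMap.range C).finrank_quotient_add_finrank
  have h5 := LinearMap.finrank_range_of_inj hCinj
  rw [Module.finrank_pi] at h5
  rw [Module.finrank_pi, c.card] at h4
  omega

end TwistedPeriods
end

/-! ### Perfectness of the period pairing. -/

noncomputable section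
namespace TwistedPeriods

open Complex Metric Set Filter Topology

variable {n : ℕ} {σ : Fin n → ℂ} {s : Fin (n + 1) → ℂ} {K Q : Type} [Field K] [Field Q] [Algebra K ℂ]
  [Algebra Q ℂ] {d : ℕ}

/-! ### Non-degeneracy of periods -/

theorem exists_factorisation {M N : Type*} [AddCommGroup M] [Module Q M] [AddCommGroup N] [Module Q N]
    (f : M →ₗ[Q] N) (u : M →ₗ[Q] ℂ) (h : ∀ x, f x = 0 → u x = 0) : ∃ v : N →ₗ[Q] ℂ, ∀ x, v (f x) = u x := by
  obtain ⟨g, hg⟩ := f.rangeRestrict.exists_rightInverse_of_surjective f.range_rangeRestrict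
  obtain ⟨v, hv⟩ := LinearMap.exists_extend (u ∘ₗ g)
  refine ⟨v, fun x => ?_⟩
  have h1 : v (f x) = u (g (f.rangeRestrict x)) := LinearMap.congr_fun hv (f.rangeRestrict x)
  rw [h1, ← sub_eq_zero, ← map_sub]
  refine h _ ?_
  have h2 := congrArg Subtype.val (LinearMap.congr_fun hg (f.rangeRestrict x))
  rw [map_sub, sub_eq_zero]
  exact h2

theorem factor_ne_zero (h0 : ∀ k, σ k ≠ 0) {x : ℂ} (hx : x ∈ Line σ) (k : Fin (n + 1)) : factor σ k x ≠ 0 := by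
  rw [factor_eq h0]
  exact mul_ne_zero (factorConst_ne_zero h0 k) (sub_puncture_ne_zero hx k)

/-- A linear functional on `0`-chains is given by a function. -/
theorem exists_eq_evalZero (h : Admissible K Q σ s) (v : Chain Q σ s 0 →ₗ[Q] ℂ) :
    ∃ f : ℂ → ℂ, v = evalZero Q s f := by
  classical
  let l : ∀ x : Line σ, Fin (n + 1) → C(stdSimplex ℝ (Fin 1), ℂ) := fun x k =>
    ContinuousMap.const _ (log (factor σ k x))
  let γ₀ : Line σ → Simplex σ 0 := fun x => ContinuousMap.const _ x
  have hl : ∀ x : Line σ, ∀ k t, exp (l x k t) = factor σ k (γ₀ x t) := fun x k t =>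
    exp_log (factor_ne_zero h.ne_zero x.2 k)
  let g₀ : ∀ x : Line σ, sections Q σ s (γ₀ x) := fun x => branchSection Q s (γ₀ x) (l x) (hl x)
  let f : Line σ → ℂ := fun x => v (Chain.of (γ₀ x) (g₀ x)) / (g₀ x : stdSimplex ℝ (Fin 1) → ℂ) default
  refine ⟨extendZero f, chain_hom_ext fun γ l' hl' => ?_⟩
  obtain ⟨x, rfl⟩ : ∃ x, γ = γ₀ x :=
    ⟨γ default, ContinuousMap.ext fun t => by rw [Subsingleton.elim t default]; rfl⟩
  obtain ⟨q, hq⟩ := exists_eq_smul_branch h (γ₀ x) (l x) (hl x) (branchSection Q s (γ₀ x) l' hl')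
  rw [hq, map_smul, map_smul, map_smul, evalZero_of]
  congr 1
  have : (g₀ x : stdSimplex ℝ (Fin 1) → ℂ) default ≠ 0 := exp_ne_zero _
  change _ = (g₀ x : stdSimplex ℝ (Fin 1) → ℂ) default * extendZero f x
  rw [extendZero_coe, mul_div_cancel₀ _ this]

theorem path_simplex (P : Plot σ ℂ) (hP : P.toFun = id) (v : Fin 2 → P.D) {t : ℝ} (ht : t ∈ Icc (0 : ℝ) 1) :
    path (P.simplex v) t = (1 - t) • (v 0 : ℂ) + t • (v 1 : ℂ) := by
  rw [← P.bary_edge v ht]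
  change P.toFun _ = _
  rw [hP]
  rfl

theorem Plot.isSmooth_seg (P : Plot σ ℂ) (hP : P.toFun = id) (x y : ℂ) : (P.seg Q s x y).IsSmooth := by
  by_cases h : x ∈ P.D ∧ y ∈ P.D
  · rw [P.seg_eq h.1 h.2]
    refine isSmooth_of _ ?_
    have : ContDiffOn ℝ 1 (fun t : ℝ => (1 - t) • x + t • y) (Icc 0 1) := by fun_prop
    exact this.congr fun t ht => path_simplex P hP _ ht
  · rw [Plot.seg, dif_neg h]
    exact isSmooth_zero

theorem Plot.evalZero_boundary_seg (P : Plot σ ℂ) (hP : P.toFun = id) {x y : ℂ} (hx : x ∈ P.D) (hy : y ∈ P.D)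
    (f : ℂ → ℂ) : evalZero Q s f (boundary Q σ s 0 (P.seg Q s x y)) =
      P.branch s y * f y - P.branch s x * f x := by
  rw [P.seg_eq hx hy]
  refine (evalZero_boundary f _ _).trans ?_
  have b1 := P.bary_edge (![⟨x, hx⟩, ⟨y, hy⟩] : Fin 2 → P.D) (r := 1) (by simp)
  have b0 := P.bary_edge (![⟨x, hx⟩, ⟨y, hy⟩] : Fin 2 → P.D) (r := 0) (by simp)
  rw [path_simplex P hP _ (by simp), path_simplex P hP _ (by simp)]
  simp only [sub_self, zero_smul, one_smul, zero_add, sub_zero, add_zero, Matrix.cons_val_one,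
    Matrix.cons_val_zero, Matrix.cons_val_fin_one] at b1 b0 ⊢
  change P.branch s (P.bary _ (edge 1) : ℂ) * f y - P.branch s (P.bary _ (edge 0) : ℂ) * f x = _
  rw [b1, b0]

/-- A form without periods along smooth cycles is exact. -/
theorem exists_potential_of_smooth_periods (h : Admissible K Q σ s) {F : ℂ → ℂ} (hF : DifferentiableOn ℂ F (Line σ))
    (hz : ∀ z : Cycle Q σ s, (z : Chain Q σ s 1).IsSmooth → period Q s h.ne_zero hF z = 0) :
    ∃ f : ℂ → ℂ, ∀ x ∈ Line σ, HasDerivAt f (F x - conn σ s x * f x) x := by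
  let A : Submodule Q (Chain Q σ s 1) :=
    { carrier := {z | z.IsSmooth}
      add_mem' := fun h h' => h.add h'
      zero_mem' := isSmooth_zero
      smul_mem' := fun q z h => h.smul q }
  -- Integration kills the smooth cycles, hence factors through the boundary of smooth chains. The
  -- factor is a functional on `0`-chains, that is, evaluation of a function `f`, of which no
  -- regularity is known yet.
  obtain ⟨v, hv⟩ := exists_factorisation (boundary Q σ s 0 ∘ₗ A.subtype) (period Q s h.ne_zero hF ∘ₗ A.subtype)
    fun x hx => hz ⟨x, hx⟩ x.2
  obtain ⟨f, rfl⟩ := exists_eq_evalZero h v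
  refine ⟨f, fun x hx => ?_⟩
  obtain ⟨ρ, hρ, hball, -⟩ := exists_safe_radius hx
  obtain ⟨P, hPD, hP⟩ := Plot.exists_of_convex h.ne_zero (convex_ball x ρ) isOpen_ball hball
  have hPo : IsOpen P.D := hPD ▸ isOpen_ball
  have hb : ∀ z ∈ P.D, HasDerivAt (P.branch s) (conn σ s z * P.branch s z) z := fun z hz =>
    hasDerivAt_branch h.ne_zero hP hPo hz
  have hD : DifferentiableOn ℂ (fun z => P.branch s z * F z) (ball x ρ) :=
    DifferentiableOn.fun_mul (fun z hz => (hb z (hPD ▸ hz)).differentiableAt.differentiableWithinAt)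
      (hF.mono hball)
  obtain ⟨G, hG⟩ := hD.isExactOn_ball
  have hθ : ∀ z ∈ P.D, HasDerivAt (fun z => G z / P.branch s z) (F z - conn σ s z * (G z / P.branch s z)) z :=
    fun z hz => by
      have hne := P.branch_ne_zero (s := s) z
      have h1 : HasDerivAt G (P.branch s z * F z) z := hG z (hPD ▸ hz)
      refine (h1.div (hb z hz) hne).congr_deriv ?_
      field_simp
  have hxP : x ∈ P.D := hPD ▸ mem_ball_self hρ
  -- Segments are smooth chains: comparing `f` with the local potential `G / branch` along them
  -- shows that the two differ by a flat section, so `f` is itself a holomorphic potential.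
  have hper : ∀ z ∈ P.D, f z = G z / P.branch s z + (P.branch s x * f x - G x) / P.branch s z := fun z hz => by
    have h1 := hv ⟨P.seg Q s x z, P.isSmooth_seg hP x z⟩
    have h1' : evalZero Q s f (boundary Q σ s 0 (P.seg Q s x z)) = period Q s h.ne_zero hF (P.seg Q s x z) := h1
    have h2 : period Q s h.ne_zero hF (P.seg Q s x z) =
        evalZero Q s (fun z => G z / P.branch s z) (boundary Q σ s 0 (P.seg Q s x z)) := by
      rw [P.seg_eq hxP hz, Plot.chain, evalZero_boundary]
      refine period_of_potential (s := s) (f := fun z => G z / P.branch s z) h.ne_zero hF _ _ fun t => ?_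
      have hm : path (P.simplex ![⟨x, hxP⟩, ⟨z, hz⟩]) t ∈ P.D := by
        change P.toFun _ ∈ P.D
        rw [hP]
        exact (P.bary _ _).2
      filter_upwards [hPo.mem_nhds hm] with w hw using hθ w hw
    rw [Plot.evalZero_boundary_seg (Q := Q) P hP hxP hz] at h1' h2
    have hne := P.branch_ne_zero (s := s) z
    have hne' := P.branch_ne_zero (s := s) x
    rw [h2] at h1'
    field_simp at h1' ⊢
    linear_combination h1'
  have hne := P.branch_ne_zero (s := s) x
  have h3 : HasDerivAt (fun z => G z / P.branch s z + (P.branch s x * f x - G x) / P.branch s z)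
      (F x - conn σ s x * f x) x := by
    refine ((hθ x hxP).add (((hb x hxP).inv hne).const_mul (P.branch s x * f x - G x))).congr_deriv ?_
    field_simp
    ring
  refine h3.congr_of_eventuallyEq ?_
  filter_upwards [hPo.mem_nhds hxP] with z hz using hper z hz

/-- The potential `f` makes `ν + ∇(-f)` vanish identically, so `-f` is a compact modification with
empty support and zero `∂̄`. Independence of the modification makes `∑ r_k r'_k / s_k` zero for
every `r'`, whence `r = 0`. It does not matter that `f` may fail to be algebraic. -/
theorem eq_zero_of_smooth_periods (h : Admissible K Q σ s) {r : Fin (n + 1) → ℂ} (hr : ∑ k, r k = 0)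
    (hz : ∀ z : Cycle Q σ s, (z : Chain Q σ s 1).IsSmooth →
      period Q s h.ne_zero (differentiableOn_conn (s := r)) z = 0) : r = 0 := by
  obtain ⟨f, hf⟩ := exists_potential_of_smooth_periods h differentiableOn_conn hz
  obtain ⟨φ, hφ, hpair⟩ := exists_modification_conn h.inj h.nonint h.nonint_sum hr
  have hfD : DifferentiableOn ℂ f (Line σ) := fun x hx => (hf x hx).differentiableAt.differentiableWithinAt
  have hmod : IsCompactModification σ s (fun x : Line σ => conn σ r x) (fun x => -f x) :=
    ⟨contDiffOn_of_holomorphic hfD.neg, ∅, isCompact_empty, empty_subset _, fun x _ =>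
      (hf x x.2).neg.congr_deriv (by ring)⟩
  have hzero : ∀ r' : Fin (n + 1) → ℂ, intersectionIntegral (fun x => -f x) (fun x : Line σ => conn σ r' x) = 0 := by
    intro r'
    rw [intersectionIntegral_eq, MeasureTheory.setIntegral_congr_fun (g := fun _ => 0) isOpen_Line.measurableSet]
    · simp
    · intro x hx
      have : DifferentiableAt ℂ (fun x => -f x) x := (hf x hx).neg.differentiableAt
      simp only [dbar_eq_zero this, zero_mul]
  funext k
  have h1 := hpair (Pi.single k 1)
  rw [intersectionIntegral_congr h.inj h.nonint h.nonint_sum hφ hmod, hzero] at h1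
  · rw [Finset.sum_eq_single k] at h1
    · simp only [Pi.single_eq_same, mul_one] at h1
      have hsk : s k ≠ 0 := fun e => h.nonint k 0 (by simpa using e)
      exact (div_eq_zero_iff.mp h1.symm).resolve_right hsk
    · intro j _ hj
      simp [Pi.single_eq_of_ne hj]
    · simp
  · refine differentiableOn_conn (s := Pi.single k 1) |>.congr fun x hx => ?_
    rw [extendZero_of_mem _ hx]

end TwistedPeriods
end

noncomputable section
namespace TwistedPeriods

open Complex Metric Set Filter Topology

variable {n : ℕ} {σ : Fin n → ℂ} {s : Fin (n + 1) → ℂ} {K Q : Type} [Field K] [Field Q] [Algebra K ℂ]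
  [Algebra Q ℂ] {d : ℕ}

/-! ### The comparison isomorphism -/

/-- `evalCycle` as a linear map. -/
def evalCycleₗ (Q : Type) [Field Q] [Algebra Q ℂ] (σ : Fin n → ℂ) (s : Fin (n + 1) → ℂ) :
    Cycle Q σ s →ₗ[Q] Module.Dual Q (HB Q σ s) where
  toFun := evalCycle
  map_add' z z' := by
    refine Submodule.linearMap_qext _ (LinearMap.ext fun u => ?_)
    exact map_add (show Chain Q σ s 1 →ₗ[Q] Q from u.1) z.1 z'.1
  map_smul' q z := by
    refine Submodule.linearMap_qext _ (LinearMap.ext fun u => ?_)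
    exact map_smul (show Chain Q σ s 1 →ₗ[Q] Q from u.1) q z.1

/-- Over a field a cycle that is not a boundary is detected by a linear form vanishing on
boundaries, and such a form is a cocycle. -/
theorem evalCycle_eq_zero_iff (z : Cycle Q σ s) :
    evalCycle z = 0 ↔ ∃ w, boundary Q σ s 1 w = z := by
  constructor
  · intro h
    by_contra hw
    have hz : (z : Chain Q σ s 1) ∉ LinearMap.range (boundary Q σ s 1) := hw
    obtain ⟨f, hf, hf'⟩ := Submodule.exists_dual_map_eq_bot_of_notMem hz inferInstance
    have hu : (show Cochain Q σ s 1 from f) ∈ LinearMap.ker (coboundary Q σ s 1) := by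
      refine LinearMap.ext fun w => ?_
      have : f (boundary Q σ s 1 w) ∈ (LinearMap.range (boundary Q σ s 1)).map f :=
        Submodule.mem_map_of_mem ⟨w, rfl⟩
      rw [hf'] at this
      exact this
    exact hf (LinearMap.congr_fun h (Submodule.Quotient.mk ⟨_, hu⟩))
  · rintro ⟨w, hw⟩
    refine Submodule.linearMap_qext _ (LinearMap.ext fun u => ?_)
    have h1 : coboundary Q σ s 1 u.1 = 0 := u.2
    have h2 := LinearMap.congr_fun (show (show Chain Q σ s 2 →ₗ[Q] Q from coboundary Q σ s 1 u.1) = 0 from h1) w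
    change (show Chain Q σ s 1 →ₗ[Q] Q from u.1) z.1 = 0
    rw [← hw]
    exact h2

/-- A form with residues `1` at `0` and `-1` at another puncture. -/
def resVec (R : Type*) [Ring R] (j : Fin n) : Fin (n + 1) → R := Pi.single 0 1 - Pi.single j.succ 1

theorem sum_resVec (R : Type*) [Ring R] (j : Fin n) : ∑ k, resVec R j k = 0 := by
  simp [resVec, Finset.sum_sub_distrib]

theorem resVec_succ (R : Type*) [Ring R] (i j : Fin n) : resVec R j i.succ = -(if i = j then 1 else 0) := by
  simp [resVec, Pi.single_apply, Fin.succ_ne_zero]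

theorem eq_sum_resVec {R : Type*} [CommRing R] {r : Fin (n + 1) → R} (hr : ∑ k, r k = 0) :
    r = ∑ j, (-r j.succ) • resVec R j := by
  funext k
  rw [Finset.sum_apply]
  rcases Fin.eq_zero_or_eq_succ k with rfl | ⟨i, rfl⟩
  · rw [Fin.sum_univ_succ] at hr
    have : ∀ j : Fin n, ((-r j.succ) • resVec R j) 0 = -r j.succ := fun j => by
      simp [resVec, (Fin.succ_ne_zero j).symm]
    rw [Finset.sum_congr rfl fun j _ => this j, Finset.sum_neg_distrib]
    linear_combination hr
  · simp [resVec_succ]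

theorem conn_sum_smul {ι : Type*} (T : Finset ι) (c : ι → ℂ) (r : ι → Fin (n + 1) → ℂ) (x : ℂ) :
    conn σ (∑ j ∈ T, c j • r j) x = ∑ j ∈ T, c j * conn σ (r j) x := by
  simp only [conn, Finset.mul_sum, Finset.sum_apply, Finset.sum_div, Pi.smul_apply, smul_eq_mul, mul_div_assoc]
  rw [Finset.sum_comm]

theorem period_sum (h0 : ∀ k, σ k ≠ 0) {ι : Type*} (T : Finset ι) {F : ι → ℂ → ℂ} (hF : ∀ j, DifferentiableOn ℂ (F j) (Line σ))
    (c : ι → ℂ) {G : ℂ → ℂ} (hG : DifferentiableOn ℂ G (Line σ)) (hGF : ∀ x ∈ Line σ, G x = ∑ j ∈ T, c j * F j x)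
    (z : Chain Q σ s 1) : period Q s h0 hG z = ∑ j ∈ T, c j * period Q s h0 (hF j) z := by
  classical
  induction T using Finset.induction_on generalizing G with
  | empty =>
    have h1 := period_const_mul (s := s) (Q := Q) h0 hG 0 (hG.const_mul 0) z
    rw [period_congr h0 hG (hG.const_mul 0) (fun x hx => by simp [hGF x hx]) z, h1]
    simp
  | insert a T ha ih =>
    have hs : DifferentiableOn ℂ (fun x => ∑ j ∈ T, c j * F j x) (Line σ) :=
      DifferentiableOn.fun_sum fun j _ => (hF j).const_mul _
    rw [Finset.sum_insert ha, ← ih hs fun x _ => rfl, ← period_const_mul h0 (hF a) (c a) ((hF a).const_mul _),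
      ← period_add h0 ((hF a).const_mul _) hs (((hF a).const_mul _).add hs)]
    exact period_congr h0 hG _ (fun x hx => by rw [hGF x hx, Finset.sum_insert ha]) z

/-- The periods of the logarithmic forms. -/
def logPeriods (h0 : ∀ k, σ k ≠ 0) : Chain Q σ s 1 →ₗ[Q] (Fin n → ℂ) :=
  LinearMap.pi fun j => period Q s h0 (differentiableOn_conn (s := resVec ℂ j))

/-- If the period vectors of smooth cycles did not span `ℂⁿ`, a linear form vanishing on them would
give a non-zero combination of logarithmic forms without smooth periods. -/
theorem exists_smooth_cycles (h : Admissible K Q σ s) :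
    ∃ z : Fin n → Cycle Q σ s, (∀ i, (z i : Chain Q σ s 1).IsSmooth) ∧
      LinearIndependent ℂ fun i => logPeriods h.ne_zero (z i : Chain Q σ s 1) := by
  let S : Set (Fin n → ℂ) := {p | ∃ z : Cycle Q σ s, (z : Chain Q σ s 1).IsSmooth ∧
    logPeriods h.ne_zero (z : Chain Q σ s 1) = p}
  have hS : Submodule.span ℂ S = ⊤ := by
    by_contra hne
    obtain ⟨f, hf, hf'⟩ := Submodule.exists_le_ker_of_lt_top _ (lt_top_iff_ne_top.mpr hne)
    have hfz : ∀ z : Cycle Q σ s, (z : Chain Q σ s 1).IsSmooth → f (logPeriods h.ne_zero (z : Chain Q σ s 1)) = 0 :=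
      fun z hz => hf' (Submodule.subset_span ⟨z, hz, rfl⟩)
    have hsum : ∑ k, (∑ j, f (Pi.single j 1) • resVec ℂ j) k = 0 := by
      simp only [Finset.sum_apply, Pi.smul_apply]
      rw [Finset.sum_comm]
      simp only [← Finset.smul_sum, sum_resVec, smul_zero, Finset.sum_const_zero]
    have h1 := eq_zero_of_smooth_periods h hsum fun z hz => by
      rw [period_sum h.ne_zero Finset.univ (fun j => differentiableOn_conn (s := resVec ℂ j))
        (fun j => f (Pi.single j 1)) _ (fun x _ => conn_sum_smul _ _ _ x), ← hfz z hz]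
      conv_rhs => rw [← Finset.univ_sum_single (logPeriods h.ne_zero (z : Chain Q σ s 1)), map_sum]
      refine Finset.sum_congr rfl fun j _ => ?_
      have : (Pi.single j (logPeriods h.ne_zero (z : Chain Q σ s 1) j) : Fin n → ℂ) =
          (logPeriods h.ne_zero (z : Chain Q σ s 1) j) • Pi.single j 1 := by
        rw [← Pi.single_smul, smul_eq_mul, mul_one]
      rw [this, map_smul, smul_eq_mul, mul_comm]
      rfl
    refine hf (LinearMap.pi_ext' fun j => LinearMap.ext_ring ?_)
    have h2 := congrFun h1 j.succ
    simpa [Finset.sum_apply, resVec_succ] using h2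
  obtain ⟨f, hf, -, hf'⟩ := Submodule.exists_fun_fin_finrank_span_eq ℂ S
  have hr : Module.finrank ℂ (Submodule.span ℂ S) = n := by
    rw [hS, finrank_top, Module.finrank_fin_fun]
  choose z hz hzf using hf
  refine ⟨fun i => z (Fin.cast hr.symm i), fun i => hz _, ?_⟩
  simp only [hzf]
  exact hf'.comp _ (Fin.cast_injective _)

/-- A relation over `Q` between the classes bounds a chain, so by Stokes it is a relation between
the complex period vectors. -/
theorem linearIndependent_evalCycle (h : Admissible K Q σ s) {z : Fin n → Cycle Q σ s}
    (hz : LinearIndependent ℂ fun i => logPeriods h.ne_zero (z i : Chain Q σ s 1)) :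
    LinearIndependent Q fun i => evalCycle (z i) := by
  rw [Fintype.linearIndependent_iff] at hz ⊢
  intro q hq i
  have h1 : evalCycle (∑ i, q i • z i) = 0 := by
    refine (map_sum (evalCycleₗ Q σ s) _ _).trans ?_
    simp only [map_smul]
    exact hq
  obtain ⟨w, hw⟩ := (evalCycle_eq_zero_iff _).mp h1
  have h2 : logPeriods h.ne_zero ((∑ i, q i • z i : Cycle Q σ s) : Chain Q σ s 1) = 0 := by
    rw [← hw]
    exact funext fun j => period_boundary _ _ _
  have h3 := hz (fun i => algebraMap Q ℂ (q i)) (by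
    rw [← h2, AddSubmonoidClass.coe_finsetSum, map_sum]
    refine Finset.sum_congr rfl fun i _ => ?_
    rw [Submodule.coe_smul, map_smul, algebraMap_smul]) i
  exact (algebraMap Q ℂ).injective (h3.trans (map_zero _).symm)

theorem finrank_HB (h : Admissible K Q σ s) : Module.finrank Q (HB Q σ s) = n := by
  obtain ⟨z, -, hz⟩ := exists_smooth_cycles h
  have := (finrank_HB_le h).1
  refine le_antisymm (finrank_HB_le h).2 ?_
  have h1 := (linearIndependent_evalCycle h hz).fintype_card_le_finrank
  rwa [Fintype.card_fin, Subspace.dual_finrank_eq] at h1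

theorem exists_smooth_basis (h : Admissible K Q σ s) :
    ∃ (z : Fin n → Cycle Q σ s) (b : Module.Basis (Fin n) Q (Module.Dual Q (HB Q σ s))),
      (∀ i, (z i : Chain Q σ s 1).IsSmooth) ∧ (∀ i, b i = evalCycle (z i)) ∧
      LinearIndependent ℂ fun i => logPeriods h.ne_zero (z i : Chain Q σ s 1) := by
  obtain ⟨z, hs, hz⟩ := exists_smooth_cycles h
  have := (finrank_HB_le h).1
  let b := basisOfLinearIndependentOfCardEqFinrank' _ (linearIndependent_evalCycle h hz)
    (by rw [Fintype.card_fin, Subspace.dual_finrank_eq, finrank_HB h])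
  exact ⟨z, b, hs, fun i => by simp [b], hz⟩

/-- A cycle without periods is a boundary. -/
theorem evalCycle_eq_zero_of_periods (h : Admissible K Q σ s) {Z : Cycle Q σ s}
    (hZ : logPeriods h.ne_zero (Z : Chain Q σ s 1) = 0) : evalCycle Z = 0 := by
  obtain ⟨z, b, -, hb, hz⟩ := exists_smooth_basis h
  have h1 : evalCycle (Z - ∑ i, b.repr (evalCycle Z) i • z i) = 0 := by
    refine (map_sub (evalCycleₗ Q σ s) _ _).trans ?_
    rw [map_sum]
    simp only [map_smul]
    rw [sub_eq_zero]
    refine (b.sum_repr (evalCycle Z)).symm.trans ?_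
    exact Finset.sum_congr rfl fun i _ => by rw [hb]; rfl
  obtain ⟨w, hw⟩ := (evalCycle_eq_zero_iff _).mp h1
  have h2 : logPeriods h.ne_zero ((Z - ∑ i, b.repr (evalCycle Z) i • z i : Cycle Q σ s) : Chain Q σ s 1) = 0 := by
    rw [← hw]
    exact funext fun j => period_boundary _ _ _
  rw [Submodule.coe_sub, map_sub, hZ, zero_sub, neg_eq_zero, AddSubmonoidClass.coe_finsetSum, map_sum] at h2
  have h3 := Fintype.linearIndependent_iff.mp hz (fun i => algebraMap Q ℂ (b.repr (evalCycle Z) i)) (by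
    rw [← h2]
    refine Finset.sum_congr rfl fun i _ => ?_
    rw [Submodule.coe_smul, map_smul, algebraMap_smul])
  rw [← b.sum_repr (evalCycle Z)]
  refine Finset.sum_eq_zero fun i _ => ?_
  rw [(algebraMap Q ℂ).injective ((h3 i).trans (map_zero _).symm), zero_smul]

end TwistedPeriods
end

/-! ### Periods of de Rham classes, the comparison isomorphism and the intersection pairing. -/

noncomputable section
namespace TwistedPeriods

open Complex Metric Set Filter Topology

variable {n : ℕ} {σ : Fin n → ℂ} {s : Fin (n + 1) → ℂ} {K Q : Type} [Field K] [Field Q] [Algebra K ℂ]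
  [Algebra Q ℂ] {d : ℕ}

/-- Periods of regular forms. -/
def formPeriod (K : Type) [Field K] [Algebra K ℂ] (h0 : ∀ k, σ k ≠ 0) (z : Chain Q σ s 1) : regular K σ →ₗ[K] ℂ where
  toFun ω := period Q s h0 (differentiableOn_extendZero ω) z
  map_add' ω η := by
    rw [← period_add h0 _ _ ((differentiableOn_extendZero ω).add (differentiableOn_extendZero η))]
    refine period_congr h0 _ _ (fun x hx => ?_) z
    simp only [extendZero_of_mem _ hx, coe_add_apply]
  map_smul' r ω := by
    rw [RingHom.id_apply, Algebra.smul_def r (period Q s h0 _ z),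
      ← period_const_mul h0 _ _ ((differentiableOn_extendZero ω).const_mul _)]
    refine period_congr h0 _ _ (fun x hx => ?_) z
    simp only [extendZero_of_mem _ hx, coe_smul_apply]

theorem formPeriod_eq_integral (h0 : ∀ k, σ k ≠ 0) {z : Chain Q σ s 1} (hz : z.IsSmooth) (ω : regular K σ) :
    formPeriod K h0 z ω = z.integral ω :=
  period_eq_integral h0 _ hz fun x => extendZero_coe _ x

theorem formPeriod_exact (h0 : ∀ k, σ k ≠ 0) (z : Cycle Q σ s) {ω : regular K σ}
    (hω : ω ∈ exactForms K σ s) : formPeriod K h0 (z : Chain Q σ s 1) ω = 0 := by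
  obtain ⟨f, -, hf⟩ := hω
  have h1 := period_exact (Q := Q) (s := s) (f := f) h0 (differentiableOn_extendZero ω) (fun x hx => by
    rw [extendZero_of_mem _ hx]
    exact hf ⟨x, hx⟩) z
  have hz : boundary Q σ s 0 (z : Chain Q σ s 1) = 0 := z.2
  rw [hz, map_zero] at h1
  exact h1

theorem formPeriod_logForm (h0 : ∀ k, σ k ≠ 0) (z : Chain Q σ s 1) (j : Fin n) :
    formPeriod K h0 z (logForm K σ (resVec K j)) = logPeriods h0 z j := by
  refine period_congr h0 _ _ (fun x hx => ?_) z
  rw [extendZero_of_mem _ hx, logForm_apply]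
  congr 1
  funext k
  simp only [resVec, Pi.sub_apply, Pi.single_apply, map_sub]
  split_ifs <;> simp

/-- Periods of de Rham classes along a cycle. -/
def classPeriod (K : Type) [Field K] [Algebra K ℂ] (h0 : ∀ k, σ k ≠ 0) (z : Cycle Q σ s) : HdR K σ s →ₗ[K] ℂ :=
  Submodule.liftQ _ (formPeriod K h0 (z : Chain Q σ s 1)) fun _ hω => formPeriod_exact h0 z hω

theorem classPeriod_dRClass (h0 : ∀ k, σ k ≠ 0) (z : Cycle Q σ s) (ω : regular K σ) :
    classPeriod K h0 z (dRClass K σ s ω) = formPeriod K h0 (z : Chain Q σ s 1) ω := rfl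

theorem classPeriod_sum_smul (h0 : ∀ k, σ k ≠ 0) {ι : Type*} (T : Finset ι) (q : ι → Q) (z : ι → Cycle Q σ s)
    (x : HdR K σ s) :
    classPeriod K h0 (∑ i ∈ T, q i • z i) x = ∑ i ∈ T, algebraMap Q ℂ (q i) * classPeriod K h0 (z i) x := by
  obtain ⟨ω, rfl⟩ := Submodule.Quotient.mk_surjective _ x
  refine (congrArg (period Q s h0 (differentiableOn_extendZero ω))
    (AddSubmonoidClass.coe_finsetSum (fun i => q i • z i) T)).trans ?_
  rw [map_sum]
  refine Finset.sum_congr rfl fun i _ => ?_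
  rw [Submodule.coe_smul, map_smul, Algebra.smul_def]
  rfl

theorem classPeriod_eq_of_evalCycle_eq (h0 : ∀ k, σ k ≠ 0) {z z' : Cycle Q σ s} (hz : evalCycle z = evalCycle z') :
    classPeriod K h0 z = classPeriod K h0 z' := by
  have h1 : evalCycle (z - z') = 0 := (map_sub (evalCycleₗ Q σ s) _ _).trans (sub_eq_zero.mpr hz)
  obtain ⟨w, hw⟩ := (evalCycle_eq_zero_iff _).mp h1
  refine Submodule.linearMap_qext _ (LinearMap.ext fun ω => ?_)
  have h2 : period Q s h0 (differentiableOn_extendZero ω) ((z - z' : Cycle Q σ s) : Chain Q σ s 1) = 0 := by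
    rw [← hw]
    exact period_boundary _ _ _
  rw [Submodule.coe_sub, map_sub] at h2
  exact sub_eq_zero.mp h2

/-- The logarithmic forms with residues `1` and `-1` are a basis of de Rham cohomology. -/
theorem exists_dR_basis (h : Admissible K Q σ s) :
    ∃ b : Module.Basis (Fin n) K (HdR K σ s), ∀ j, b j = dRClass K σ s (logForm K σ (resVec K j)) := by
  obtain ⟨z, hs, hz⟩ := exists_smooth_cycles h
  have hli : LinearIndependent K fun j => dRClass K σ s (logForm K σ (resVec K j)) := by
    rw [Fintype.linearIndependent_iff]
    intro k hk
    have h1 := congrArg (fun f : Fin (n + 1) → ℂ => f) (eq_zero_of_smooth_periods h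
      (r := ∑ j, algebraMap K ℂ (k j) • resVec ℂ j) (by
        simp only [Finset.sum_apply, Pi.smul_apply]
        rw [Finset.sum_comm]
        simp only [← Finset.smul_sum, sum_resVec, smul_zero, Finset.sum_const_zero]) fun z hz => by
        rw [period_sum h.ne_zero Finset.univ (fun j => differentiableOn_conn (s := resVec ℂ j))
          (fun j => algebraMap K ℂ (k j)) _ (fun x _ => conn_sum_smul _ _ _ x)]
        have h2 := congrArg (classPeriod K h.ne_zero z) hk
        rw [map_sum, map_zero] at h2
        rw [← h2]
        refine Finset.sum_congr rfl fun j _ => ?_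
        rw [map_smul, classPeriod_dRClass, formPeriod_logForm, Algebra.smul_def]
        rfl)
    intro j
    have h2 := congrFun h1 j.succ
    refine (algebraMap K ℂ).injective ?_
    simpa [Finset.sum_apply, resVec_succ] using h2
  have hsp : ⊤ ≤ Submodule.span K (Set.range fun j => dRClass K σ s (logForm K σ (resVec K j))) := by
    rintro x -
    obtain ⟨ω, rfl⟩ := Submodule.Quotient.mk_surjective _ x
    obtain ⟨r, hr, hω⟩ := exists_logForm_sub_mem h ω
    have h1 : Submodule.Quotient.mk (p := exactForms K σ s) ω = dRClass K σ s (logForm K σ r) :=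
      (Submodule.Quotient.eq _).mpr hω
    rw [h1, eq_sum_resVec hr, map_sum, map_sum]
    refine Submodule.sum_mem _ fun j _ => ?_
    rw [map_smul, map_smul]
    exact Submodule.smul_mem _ _ (Submodule.subset_span ⟨j, rfl⟩)
  exact ⟨Module.Basis.mk hli hsp, fun j => Module.Basis.mk_apply hli hsp j⟩

section extendForm

variable {V : Type} [AddCommGroup V] [Module Q V]

theorem extendForm_tmul (φ : Module.Dual Q V) (a : ℂ) (v : V) : extendForm φ (a ⊗ₜ[Q] v) = algebraMap Q ℂ (φ v) * a := by
  change (AlgebraTensorModule.rid Q ℂ ℂ) (a ⊗ₜ[Q] φ v) = _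
  rw [AlgebraTensorModule.rid_tmul, Algebra.smul_def]

theorem extendForm_sum_smul {ι : Type*} (T : Finset ι) (q : ι → Q) (φ : ι → Module.Dual Q V) (x : ℂ ⊗[Q] V) :
    extendForm (∑ i ∈ T, q i • φ i) x = ∑ i ∈ T, algebraMap Q ℂ (q i) * extendForm (φ i) x := by
  induction x using TensorProduct.induction_on with
  | zero => simp
  | tmul a v =>
    simp only [extendForm_tmul, LinearMap.sum_apply, map_sum, Finset.sum_mul, LinearMap.smul_apply, smul_eq_mul,
      map_mul, mul_assoc]
  | add x y hx hy => simp only [map_add, hx, hy, mul_add, Finset.sum_add_distrib]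

theorem extendForm_coord {ι : Type*} (b : Module.Basis ι Q V) (i : ι) (x : ℂ ⊗[Q] V) :
    extendForm (b.coord i) x = (b.baseChange ℂ).repr x i := by
  induction x using TensorProduct.induction_on with
  | zero => simp
  | tmul a v => rw [extendForm_tmul, Module.Basis.baseChange_repr_tmul, Algebra.smul_def]; rfl
  | add x y hx hy => simp only [map_add, hx, hy, Finsupp.add_apply]

end extendForm

theorem exists_basis_of_dual {k V : Type} [Field k] [AddCommGroup V] [Module k V] [FiniteDimensional k V]
    (b : Module.Basis (Fin n) k (Module.Dual k V)) :
    ∃ e : Module.Basis (Fin n) k V, ∀ i, e.coord i = b i := by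
  classical
  refine ⟨b.dualBasis.map (Module.evalEquiv k V).symm, fun i => ?_⟩
  have h2 : ∀ j, b i ((Module.evalEquiv k V).symm (b.dualBasis j)) = (b.dualBasis j) (b i) := fun j => by
    rw [Module.apply_evalEquiv_symm_apply]
  refine (b.dualBasis.map (Module.evalEquiv k V).symm).ext fun j => ?_
  rw [Module.Basis.coord_apply, Module.Basis.repr_self, Module.Basis.map_apply, h2,
    Module.Basis.dualBasis_apply_self, Finsupp.single_apply]
  simp only [eq_comm]

/-- The comparison isomorphism exists and is unique. -/
theorem existsUnique_comparison (h : Admissible K Q σ s) : ∃! c, IsComparison K Q σ s c := by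
  classical
  obtain ⟨z, bd, hsm, hbd, hz⟩ := exists_smooth_basis h
  obtain ⟨ν, hν⟩ := exists_dR_basis h
  have := (finrank_HB_le h).1
  obtain ⟨e, he⟩ := exists_basis_of_dual bd
  have hez : ∀ i x, (e.baseChange ℂ).repr x i = extendForm (evalCycle (z i)) x := fun i x => by
    rw [← hbd, ← he, extendForm_coord]
  -- The period matrix in the bases of logarithmic forms and smooth cycles; it is invertible because
  -- its rows are linearly independent, and it defines the comparison.
  let A : Matrix (Fin n) (Fin n) ℂ := fun i j => logPeriods h.ne_zero (z i : Chain Q σ s 1) j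
  have hA : IsUnit A.det := (Matrix.isUnit_iff_isUnit_det A).mp (Matrix.linearIndependent_rows_iff_isUnit.mp hz)
  obtain ⟨c, hcν⟩ : ∃ c : ℂ ⊗[K] HdR K σ s ≃ₗ[ℂ] ℂ ⊗[Q] HB Q σ s,
      ∀ j, c (1 ⊗ₜ ν j) = ∑ i, A i j • (e.baseChange ℂ) i := by
    refine ⟨((ν.baseChange ℂ).equiv (e.baseChange ℂ) (Equiv.refl _)).trans
      (Matrix.toLinearEquiv (e.baseChange ℂ) A hA), fun j => ?_⟩
    have h1 : (1 : ℂ) ⊗ₜ[K] ν j = (ν.baseChange ℂ) j := by simp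
    rw [LinearEquiv.trans_apply, h1, Module.Basis.equiv_apply, Equiv.refl_apply, Matrix.toLinearEquiv_apply,
      Matrix.toLin_self]
  have hci : ∀ i (x : HdR K σ s), extendForm (evalCycle (z i)) (c (1 ⊗ₜ x)) = classPeriod K h.ne_zero (z i) x := by
    intro i
    let f : HdR K σ s →ₗ[K] ℂ := (LinearMap.restrictScalars K (extendForm (evalCycle (z i)) ∘ₗ c.toLinearMap)) ∘ₗ
      (TensorProduct.mk K ℂ (HdR K σ s) 1)
    have hfν : ∀ x, f x = extendForm (evalCycle (z i)) (c (1 ⊗ₜ x)) := fun x => rfl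
    suffices hf : f = classPeriod K h.ne_zero (z i) by
      intro x
      rw [← hfν, hf]
    refine ν.ext fun j => ?_
    rw [hfν]
    rw [hcν, ← hez, map_sum, Finsupp.finsetSum_apply, hν, classPeriod_dRClass, formPeriod_logForm]
    rw [Finset.sum_eq_single i]
    · simp [A]
    · intro k _ hk
      simp [hk]
    · simp
  refine ⟨c, fun ω Z hZ => ?_, fun c' hc' => ?_⟩
  · rw [← formPeriod_eq_integral h.ne_zero hZ, ← classPeriod_dRClass]
    -- An arbitrary smooth cycle is expanded in the basis. Periods depend only on its class, so the
    -- identity on the basis cycles is enough.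
    have h1 : evalCycle Z = evalCycle (∑ i, bd.repr (evalCycle Z) i • z i) := by
      refine Eq.trans ?_ (map_sum (evalCycleₗ Q σ s) _ _).symm
      simp only [map_smul]
      refine (bd.sum_repr (evalCycle Z)).symm.trans ?_
      exact Finset.sum_congr rfl fun i _ => by rw [hbd]; rfl
    rw [classPeriod_eq_of_evalCycle_eq h.ne_zero h1, classPeriod_sum_smul]
    have h2 : evalCycle Z = ∑ i, bd.repr (evalCycle Z) i • evalCycle (z i) := by
      refine (bd.sum_repr (evalCycle Z)).symm.trans ?_
      exact Finset.sum_congr rfl fun i _ => by rw [hbd]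
    conv_lhs => rw [h2]
    rw [extendForm_sum_smul]
    exact Finset.sum_congr rfl fun i _ => by rw [hci]
  · refine LinearEquiv.toLinearMap_injective ((ν.baseChange ℂ).ext fun j => ?_)
    rw [Module.Basis.baseChange_apply]
    refine (e.baseChange ℂ).repr.injective (Finsupp.ext fun i => ?_)
    rw [LinearEquiv.coe_coe, LinearEquiv.coe_coe]
    rw [hez, hez, hci, hν, hc' _ _ (hsm i), classPeriod_dRClass, formPeriod_eq_integral h.ne_zero (hsm i)]

/-! ### The intersection pairing -/

theorem intersectionIntegral_add {φ : ℂ → ℂ} {ν : Line σ → ℂ} {t : Fin (n + 1) → ℂ} (h : IsCompactModification σ t ν φ) {f g : Line σ → ℂ}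
    (hf : ContinuousOn (extendZero f) (Line σ)) (hg : ContinuousOn (extendZero g) (Line σ)) :
    intersectionIntegral φ (f + g) = intersectionIntegral φ f + intersectionIntegral φ g := by
  rw [intersectionIntegral_eq, intersectionIntegral_eq, intersectionIntegral_eq, ← mul_add,
    ← MeasureTheory.integral_add (h.integrableOn hf) (h.integrableOn hg)]
  congr 1
  refine MeasureTheory.setIntegral_congr_fun isOpen_Line.measurableSet fun x hx => ?_
  simp only [extendZero_of_mem _ hx, Pi.add_apply, mul_add]

/-- The intersection pairing exists, is unique, and is computed on logarithmic forms by residues. -/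
theorem exists_pairing (h : Admissible K Q σ s) {t : Fin (n + 1) → K} (ht : ∀ k, algebraMap K ℂ (t k) = s k) :
    ∃ P, IsDRPairing K σ s P ∧ ∀ r r' : Fin (n + 1) → K, ∑ k, r k = 0 →
      P (dRClass K σ (-s) (logForm K σ r)) (dRClass K σ s (logForm K σ r')) = -∑ k, r k * r' k / t k := by
  have ht0 : ∀ k, t k ≠ 0 := fun k e => h.nonint k 0 (by rw [← ht, e]; simp)
  obtain ⟨b, hb⟩ := exists_dR_basis h
  obtain ⟨b', hb'⟩ := exists_dR_basis h.neg
  let B : (Fin (n + 1) → K) →ₗ[K] (Fin (n + 1) → K) →ₗ[K] K :=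
    LinearMap.mk₂ K (fun r r' => -∑ k, r k * r' k / t k)
      (fun r r₁ r' => by simp only [Pi.add_apply, add_mul, add_div, Finset.sum_add_distrib]; ring)
      (fun a r r' => by simp only [Pi.smul_apply, smul_eq_mul, mul_assoc, mul_div_assoc, ← Finset.mul_sum, mul_neg])
      (fun r r' r₁ => by simp only [Pi.add_apply, mul_add, add_div, Finset.sum_add_distrib]; ring)
      (fun a r r' => by
        simp only [Pi.smul_apply, smul_eq_mul, mul_left_comm _ a, mul_div_assoc, ← Finset.mul_sum, mul_neg])
  have hB : ∀ r r', B r r' = -∑ k, r k * r' k / t k := fun r r' => rfl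
  let P : HdR K σ (-s) →ₗ[K] HdR K σ s →ₗ[K] K :=
    b'.constr K fun i => b.constr K fun j => B (resVec K i) (resVec K j)
  have hP : ∀ i j, P (b' i) (b j) = B (resVec K i) (resVec K j) := fun i j => by
    simp only [P, Module.Basis.constr_basis]
  -- The residue form vanishes against the residues of `∇ 1` when `r` has sum zero; this allows the
  -- second argument to have any residue sum.
  have hBt : ∀ r, ∑ k, r k = 0 → B r t = 0 := fun r hr => by
    rw [hB]
    have : ∀ k, r k * t k / t k = r k := fun k => mul_div_cancel_right₀ _ (ht0 k)
    simp only [this, hr, neg_zero]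
  have hP0 : ∀ r r' : Fin (n + 1) → K, ∑ k, r k = 0 → ∑ k, r' k = 0 →
      P (dRClass K σ (-s) (logForm K σ r)) (dRClass K σ s (logForm K σ r')) = B r r' := by
    intro r r' hr hr'
    conv_lhs => rw [eq_sum_resVec hr, eq_sum_resVec hr']
    conv_rhs => rw [eq_sum_resVec hr, eq_sum_resVec hr']
    simp only [map_sum, map_smul, LinearMap.sum_apply, LinearMap.smul_apply, ← hb, ← hb', hP]
  have hPlog : ∀ r r' : Fin (n + 1) → K, ∑ k, r k = 0 →
      P (dRClass K σ (-s) (logForm K σ r)) (dRClass K σ s (logForm K σ r')) = B r r' := by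
    intro r r' hr
    have hT : ∑ k, t k ≠ 0 := fun e => h.nonint_sum 0 (by
      simp only [← ht, ← map_sum, e]; simp)
    set a := (∑ k, r' k) / ∑ k, t k with ha
    have h1 : dRClass K σ s (logForm K σ r') = dRClass K σ s (logForm K σ (r' - a • t)) := by
      rw [map_sub, map_sub, map_smul, map_smul]
      have : dRClass K σ s (logForm K σ t) = 0 := (Submodule.Quotient.mk_eq_zero _).mpr (nabla_one_mem ht)
      rw [this, smul_zero, sub_zero]
    rw [h1, hP0 r _ hr (by
      simp only [Pi.sub_apply, Pi.smul_apply, smul_eq_mul, Finset.sum_sub_distrib, ← Finset.mul_sum, ha]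
      rw [div_mul_cancel₀ _ hT, sub_self]), map_sub, map_smul, hBt r hr, smul_zero, sub_zero]
  refine ⟨P, fun ν => ?_, fun r r' hr => hPlog r r' hr⟩
  obtain ⟨r, hr, hν⟩ := exists_logForm_sub_mem h.neg ν
  obtain ⟨g, hgreg, hg⟩ := hν
  obtain ⟨φ, hφ, hpair⟩ := exists_modification_conn h.inj h.neg.nonint h.neg.nonint_sum
    (r := fun k => algebraMap K ℂ (r k)) (by rw [← map_sum, hr, map_zero])
  have hgD : DifferentiableOn ℂ g (Line σ) := fun x hx => (hg ⟨x, hx⟩).differentiableAt.differentiableWithinAt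
  -- If `ν` is the logarithmic form plus `∇g`, subtracting `g` from the modification of the
  -- logarithmic form gives one for `ν`; as `g` is holomorphic, `∂̄` is unchanged.
  have hmod : IsCompactModification σ (-s) ν (fun x => φ x - g x) := by
    obtain ⟨hφ1, C, hC, hCL, hφ2⟩ := hφ
    refine ⟨hφ1.sub (contDiffOn_of_holomorphic hgD), C, hC, hCL, fun x hx => ?_⟩
    refine ((hφ2 x hx).sub (hg x)).congr_deriv ?_
    rw [coe_sub_apply, logForm_apply]
    ring
  have hII : ∀ f : Line σ → ℂ, intersectionIntegral (fun x => φ x - g x) f = intersectionIntegral φ f := fun f => by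
    rw [intersectionIntegral_eq, intersectionIntegral_eq]
    congr 1
    refine MeasureTheory.setIntegral_congr_fun isOpen_Line.measurableSet fun x hx => ?_
    have h1 := dbar_add (φ := φ) (g := fun x => -g x) (differentiableAt_of_contDiffOn hφ.1 hx)
      ((hg ⟨x, hx⟩).neg.differentiableAt.restrictScalars ℝ)
    have h2 := dbar_eq_zero (φ := fun x => -g x) (hg ⟨x, hx⟩).neg.differentiableAt
    simp only [sub_eq_add_neg]
    rw [h1, h2, add_zero]
  refine ⟨_, hmod, fun ω => ?_⟩
  rw [hII]
  have hclν : dRClass K σ (-s) ν = dRClass K σ (-s) (logForm K σ r) :=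
    (Submodule.Quotient.eq _).mpr ⟨g, hgreg, hg⟩
  obtain ⟨r', hr', hω⟩ := exists_logForm_sub_mem h ω
  have hclω : dRClass K σ s ω = dRClass K σ s (logForm K σ r') := (Submodule.Quotient.eq _).mpr hω
  obtain ⟨g', -, hg'⟩ := hω
  rw [hclν, hclω, hPlog r r' hr]
  have h1 : (ω : Line σ → ℂ) = (logForm K σ r' : Line σ → ℂ) + ((ω - logForm K σ r' : regular K σ) : Line σ → ℂ) := by
    funext x
    rw [Pi.add_apply, coe_sub_apply]
    ring
  have hex : intersectionIntegral φ ((ω - logForm K σ r' : regular K σ) : Line σ → ℂ) = 0 := by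
    refine intersectionIntegral_exact hφ ?_ (g := g') fun x => (hg' x).congr_deriv ?_
    · refine (differentiableOn_conn (s := fun k => algebraMap K ℂ (r k))).congr fun x hx => ?_
      rw [extendZero_of_mem _ hx]
    · rw [conn_neg]
      ring
  have hlog : (logForm K σ r' : Line σ → ℂ) = fun x : Line σ => conn σ (fun k => algebraMap K ℂ (r' k)) x :=
    funext fun x => logForm_apply r' x
  rw [h1, intersectionIntegral_add hφ (differentiableOn_extendZero _).continuousOn
    (differentiableOn_extendZero _).continuousOn, hex, add_zero, hlog, hpair, hB]
  -- The minus sign of the formula comes from the exponents `-s` of the first argument.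
  simp only [map_neg, map_sum, map_div₀, map_mul, ht, Pi.neg_apply, div_neg, Finset.sum_neg_distrib]

theorem IsDRPairing.unique (h : Admissible K Q σ s) {P P' : HdR K σ (-s) →ₗ[K] HdR K σ s →ₗ[K] K}
    (hP : IsDRPairing K σ s P) (hP' : IsDRPairing K σ s P') : P = P' := by
  refine Submodule.linearMap_qext _ (LinearMap.ext fun ν => Submodule.linearMap_qext _ (LinearMap.ext fun ω => ?_))
  obtain ⟨φ, hφ, h1⟩ := hP ν
  obtain ⟨φ', hφ', h1'⟩ := hP' ν
  refine (algebraMap K ℂ).injective ((h1 ω).trans (Eq.trans ?_ (h1' ω).symm))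
  exact intersectionIntegral_congr h.inj h.neg.nonint h.neg.nonint_sum hφ hφ' (differentiableOn_extendZero ω)

end TwistedPeriods
end

/-! ### Regularisation and uniqueness of the class of the interval. -/

noncomputable section
namespace TwistedPeriods

open Complex Metric Set Filter Topology

variable {n : ℕ} {σ : Fin n → ℂ} {s : Fin (n + 1) → ℂ} {K Q : Type} [Field K] [Field Q] [Algebra K ℂ]
  [Algebra Q ℂ] {d : ℕ}

/-! ### Supports of chains -/

theorem eq_of_coeff_of_ne_zero {γ τ : Simplex σ d} {g : sections Q σ s γ}
    (h : (Chain.of γ g : Chain Q σ s d).coeff τ ≠ 0) : τ = γ := by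
  classical
  by_contra hne
  exact h ((DirectSum.component.of Q (M := fun γ : Simplex σ d => ↥(sections Q σ s γ)) τ γ g).trans
    (dif_neg fun e => hne e.symm))

/-- The chain is supported on simplices in `U`. -/
def Chain.SupportedOn (z : Chain Q σ s d) (U : Set ℂ) : Prop := ∀ τ, z.coeff τ ≠ 0 → ∀ u, (τ u : ℂ) ∈ U

namespace Chain.SupportedOn

variable {U : Set ℂ} {z z' : Chain Q σ s d}

theorem of {γ : Simplex σ d} (g : sections Q σ s γ) (h : ∀ u, (γ u : ℂ) ∈ U) :
    (Chain.of γ g : Chain Q σ s d).SupportedOn U := fun τ hτ u => by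
  rw [eq_of_coeff_of_ne_zero hτ]
  exact h u

theorem add (h : z.SupportedOn U) (h' : z'.SupportedOn U) : (z + z').SupportedOn U := fun τ hτ => by
  by_cases h1 : z.coeff τ = 0
  · refine h' τ fun h2 => hτ ?_
    have : (z + z').coeff τ = z.coeff τ + z'.coeff τ :=
      map_add (DirectSum.component Q (Simplex σ d) (fun γ => sections Q σ s γ) τ) z z'
    rw [this, h1, h2, add_zero]
  · exact h τ h1

theorem smul (h : z.SupportedOn U) (q : Q) : (q • z).SupportedOn U := fun τ hτ => by
  refine h τ fun h1 => hτ ?_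
  have : (q • z).coeff τ = q • z.coeff τ :=
    map_smul (DirectSum.component Q (Simplex σ d) (fun γ => sections Q σ s γ) τ) q z
  rw [this, h1, smul_zero]

theorem sub (h : z.SupportedOn U) (h' : z'.SupportedOn U) : (z - z').SupportedOn U := by
  have := h.add (h'.smul (-1))
  rwa [neg_one_smul, ← sub_eq_add_neg] at this

theorem mono (h : z.SupportedOn U) {U' : Set ℂ} (hU : U ⊆ U') : z.SupportedOn U' := fun τ hτ u => hU (h τ hτ u)

end Chain.SupportedOn

theorem chain_zero_congr {γ γ' : Simplex σ 0} {g : sections Q σ s γ} {g' : sections Q σ s γ'}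
    (h : (γ default : ℂ) = γ' default)
    (hg : (g : stdSimplex ℝ (Fin 1) → ℂ) default = (g' : stdSimplex ℝ (Fin 1) → ℂ) default) :
    Chain.of γ g = Chain.of γ' g' := by
  refine chain_of_congr (ContinuousMap.ext fun t => Subtype.ext ?_) (funext fun t => ?_)
  · rw [Subsingleton.elim t default]; exact h
  · rw [Subsingleton.elim t default]; exact hg

theorem boundary_boundary (w : Chain Q σ s 2) : boundary Q σ s 0 (boundary Q σ s 1 w) = 0 := by
  revert w
  refine LinearMap.congr_fun (f := boundary Q σ s 0 ∘ₗ boundary Q σ s 1) (g := 0) (chain_hom_ext fun γ l hl => ?_)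
  rw [LinearMap.comp_apply, boundary_of, Fin.sum_univ_three]
  simp only [map_add, map_smul, boundary_path]
  have e : ∀ (i : Fin 3) (j : Fin 2) (i' : Fin 3) (j' : Fin 2),
      faceMap 1 i (faceMap 0 j default) = faceMap 1 i' (faceMap 0 j' default) →
      Chain.of ((γ.comp (faceMap 1 i)).comp (faceMap 0 j)) (restrictFace Q σ s _ j
        (restrictFace Q σ s γ i (branchSection Q s γ l hl))) =
      Chain.of ((γ.comp (faceMap 1 i')).comp (faceMap 0 j')) (restrictFace Q σ s _ j'
        (restrictFace Q σ s γ i' (branchSection Q s γ l hl))) := fun i j i' j' he => by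
    refine chain_zero_congr ?_ ?_
    · exact congrArg (fun x => (γ x : ℂ)) he
    · exact congrArg (branchSection Q s γ l hl : stdSimplex ℝ (Fin 3) → ℂ) he
  have h0 : edge (0 : ℝ) = edge ((0 : unitInterval) : ℝ) := by simp
  have h1 : edge (1 : ℝ) = edge ((1 : unitInterval) : ℝ) := by simp
  have q0 : ∀ a b : unitInterval, squareMap (0, a) = squareMap (0, b) := fun a b =>
    Subtype.ext (by simp [squareMap])
  rw [e 0 0 1 0 (by rw [faceMap_zero_zero, h1, faceMap_edge_zero, faceMap_edge_one]),
    e 0 1 2 0 (by rw [faceMap_zero_zero, faceMap_zero_one, h1, h0, faceMap_edge_zero, faceMap_edge_two]),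
    e 2 1 1 1 (by rw [faceMap_zero_one, h0, faceMap_edge_two, faceMap_edge_one]; exact q0 _ _)]
  simp

/-- Cycles near the punctures and infinity have no periods. -/
theorem exists_compact_periods (h : Admissible K Q σ s) : ∃ C : Set ℂ, IsCompact C ∧ C ⊆ Line σ ∧
    ∀ T : Chain Q σ s 1, boundary Q σ s 0 T = 0 → T.SupportedOn Cᶜ → logPeriods h.ne_zero T = 0 := by
  choose φ hφ _ using fun j : Fin n => exists_modification_conn h.inj h.nonint h.nonint_sum
    (r := resVec ℂ j) (sum_resVec ℂ j)
  choose _ C hC hCL hd using hφ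
  refine ⟨⋃ j, C j, isCompact_iUnion hC, iUnion_subset hCL, fun T hT hTs => funext fun j => ?_⟩
  -- Off `C j` the modification solves `∇φ = -ν`, so `-φ` is a potential of the logarithmic form
  -- there, and a cycle has no boundary on which to evaluate it.
  have h1 := period_eq_of_potential_on (Q := Q) (s := s) (f := fun x => -φ j x) (U := Line σ ∩ (C j)ᶜ) h.ne_zero
    (differentiableOn_conn (s := resVec ℂ j)) (isOpen_Line.inter (hC j).isClosed.isOpen_compl)
    (fun x hx => (hd j ⟨x, hx.1⟩ hx.2).neg.congr_deriv (by ring)) (z := T)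
    fun γ hγ u => ⟨(γ u).2, fun hc => hTs γ hγ u (mem_iUnion.mpr ⟨j, hc⟩)⟩
  rw [hT, map_zero] at h1
  exact h1

/-- A cycle near the punctures and infinity has no periods against a basis of logarithmic forms, and
cycles without periods are boundaries. -/
theorem boundary_eq_of_supportedOn (h : Admissible K Q σ s) {C : Set ℂ}
    (hC : ∀ T : Chain Q σ s 1, boundary Q σ s 0 T = 0 → T.SupportedOn Cᶜ → logPeriods h.ne_zero T = 0)
    {T : Chain Q σ s 1} (hT : boundary Q σ s 0 T = 0) (hTC : T.SupportedOn Cᶜ) :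
    ∃ w, boundary Q σ s 1 w = T :=
  (evalCycle_eq_zero_iff ⟨T, hT⟩).mp (evalCycle_eq_zero_of_periods h (hC T hT hTC))

/-- Any section at a point near a puncture is the boundary of a chain on a circle. -/
theorem exists_loop (h : Admissible K Q σ s) (j : Fin (n + 1)) {r : ℝ}
    (hr : ∀ j k, j ≠ k → 2 * r ≤ ‖puncture σ j - puncture σ k‖) {γ : Simplex σ 0} (g : sections Q σ s γ)
    (hγ : ‖(γ default : ℂ) - puncture σ j‖ < 2 * r) :
    ∃ A : Chain Q σ s 1, boundary Q σ s 0 A = Chain.of γ g ∧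
      A.SupportedOn (sphere (puncture σ j) ‖(γ default : ℂ) - puncture σ j‖) := by
  classical
  set x : ℂ := ((γ default : Line σ) : ℂ) with hx
  have hxL : x ∈ Line σ := (γ default).2
  have hxj := sub_puncture_ne_zero hxL j
  have hlog : ∀ k, ∃ L : ℂ → ℂ, k ≠ j → (ContinuousOn L (ball (puncture σ j) (2 * r)) ∧
      ∀ z ∈ ball (puncture σ j) (2 * r), exp (L z) = factorConst σ k * (z - puncture σ k)) := fun k => by
    by_cases hk : k = j
    · exact ⟨0, fun h => absurd hk h⟩
    · obtain ⟨L, hL⟩ := exists_log_sub (convex_ball (puncture σ j) (2 * r)) isOpen_ball (p := puncture σ k)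
        (c := factorConst σ k) (fun hm => by
          rw [mem_ball, dist_eq] at hm
          exact absurd (hr k j hk) (not_le.mpr hm)) (factorConst_ne_zero h.ne_zero k)
      exact ⟨L, fun _ => hL⟩
  choose L hL using hlog
  let ζ : ℝ → ℂ := fun t => puncture σ j + (x - puncture σ j) * exp (2 * Real.pi * I * t)
  have hζ : Continuous ζ := by fun_prop
  have hnorm : ∀ t, ‖ζ t - puncture σ j‖ = ‖x - puncture σ j‖ := fun t => by
    have : (2 * Real.pi * I * t : ℂ) = (2 * Real.pi * t : ℝ) * I := by push_cast; ring
    simp only [ζ, add_sub_cancel_left, norm_mul]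
    rw [this, norm_exp_ofReal_mul_I, mul_one]
  have hball : ∀ t, ζ t ∈ ball (puncture σ j) (2 * r) := fun t => by
    rw [mem_ball, dist_eq, hnorm]; exact hγ
  let P : Plot σ ℝ :=
    { D := univ
      convex := convex_univ
      toFun := ζ
      mem := fun t _ => mem_Line_of_mem_ball hr le_rfl (hball t) fun e => by
        have := hnorm t
        rw [e, sub_self, norm_zero] at this
        exact hxj (norm_eq_zero.mp this.symm)
      cont := hζ.continuousOn
      -- Only the logarithm of the factor at `p_j` winds around the circle; the others are
      -- restrictions of logarithms on the ball, which contains no other puncture.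
      log := fun k t => if k = j then log (factorConst σ j * (x - puncture σ j)) + 2 * Real.pi * I * t
        else L k (ζ t)
      cont_log := fun k => by
        by_cases hk : k = j
        · simp only [hk, if_true]
          fun_prop
        · simp only [hk, if_false]
          exact (hL k hk).1.comp hζ.continuousOn fun t _ => hball t
      exp_log := fun k t _ => by
        by_cases hk : k = j
        · subst hk
          simp only [if_true]
          rw [exp_add, exp_log (mul_ne_zero (factorConst_ne_zero h.ne_zero k) hxj), factor_eq h.ne_zero]
          simp only [ζ]
          ring
        · simp only [hk, if_false]
          rw [(hL k hk).2 _ (hball t), factor_eq h.ne_zero] }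
  have hζ1 : ζ 1 = ζ 0 := by simp [ζ, exp_two_pi_mul_I]
  have hζ0 : ζ 0 = x := by simp [ζ]
  obtain ⟨lam, hlam⟩ := h.monodromy_mem j
  have hlam1 : lam - 1 ≠ 0 := fun e => by
    rw [sub_eq_zero.mp e, map_one] at hlam
    obtain ⟨m, hm⟩ := exp_eq_one_iff.mp hlam.symm
    refine h.nonint j m (mul_left_cancel₀ two_pi_I_ne_zero (hm.trans (mul_comm _ _)))
  have hb : P.branch s 1 = algebraMap Q ℂ lam * P.branch s 0 := by
    have e1 : ∑ k, s k * P.log k 1 = 2 * Real.pi * I * s j + ∑ k, s k * P.log k 0 := by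
      have : ∀ k, s k * P.log k 1 = (if k = j then 2 * Real.pi * I * s j else 0) + s k * P.log k 0 := fun k => by
        by_cases hk : k = j
        · simp only [P, hk, if_true]
          push_cast
          ring
        · simp only [P, hk, if_false, hζ1, zero_add]
      rw [Finset.sum_congr rfl fun k _ => this k, Finset.sum_add_distrib]
      simp
    rw [Plot.branch, Plot.branch, e1, exp_add, hlam]
  let l0 : Fin (n + 1) → C(stdSimplex ℝ (Fin 1), ℂ) := fun k => ContinuousMap.const _ (P.log k 0)
  have hl0 : ∀ k t, exp (l0 k t) = factor σ k (γ t) := fun k t => by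
    rw [Subsingleton.elim t default]
    refine (P.exp_log k 0 trivial).trans ?_
    change factor σ k (ζ 0) = _
    rw [hζ0]
  obtain ⟨q, hq⟩ := exists_eq_smul_branch h γ l0 hl0 g
  have hc0 : ∀ t : ℝ, ∀ q' : Q, ζ t = x → P.branch s t = algebraMap Q ℂ q' * P.branch s 0 →
      P.chain Q s ![⟨t, trivial⟩] = q' • Chain.of γ (branchSection Q s γ l0 hl0) := fun t q' ht hb => by
    rw [← map_smul]
    have hbar : (P.bary ![(⟨t, trivial⟩ : P.D)] default : ℝ) = t := by
      simp [Plot.bary]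
    refine chain_zero_congr ?_ ?_
    · change ζ (P.bary _ default : ℝ) = _
      rw [hbar, ht]
    · change P.branch s (P.bary _ default : ℝ) = (q' • (branchSection Q s γ l0 hl0 : stdSimplex ℝ (Fin 1) → ℂ)) default
      rw [hbar, hb, Pi.smul_apply, Algebra.smul_def]
      rfl
  -- The loop with the transported branch has boundary `lam - 1` times the branch at its base point.
  -- Non-integrality of `s j` makes `lam - 1` invertible.
  refine ⟨(q / (lam - 1)) • P.chain Q s ![⟨0, trivial⟩, ⟨1, trivial⟩], ?_, ?_⟩
  · rw [map_smul, Plot.boundary_chain, Fin.sum_univ_two]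
    have f0 : (![⟨0, trivial⟩, ⟨1, trivial⟩] ∘ (0 : Fin 2).succAbove : Fin 1 → P.D) = ![⟨1, trivial⟩] := by
      funext i; fin_cases i; rfl
    have f1 : (![⟨0, trivial⟩, ⟨1, trivial⟩] ∘ (1 : Fin 2).succAbove : Fin 1 → P.D) = ![⟨0, trivial⟩] := by
      funext i; fin_cases i; rfl
    rw [f0, f1, hc0 1 lam (hζ1.trans hζ0) hb, hc0 0 1 hζ0 (by simp), hq, map_smul]
    simp only [Fin.val_zero, pow_zero, one_smul, Fin.val_one, pow_one, neg_smul, ← sub_eq_add_neg]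
    rw [smul_sub, smul_smul, ← sub_smul, ← mul_sub_one, div_mul_cancel₀ _ hlam1]
  · refine Chain.SupportedOn.smul (Chain.SupportedOn.of _ fun u => ?_) _
    rw [mem_sphere, dist_eq]
    exact hnorm _

end TwistedPeriods
end

noncomputable section
namespace TwistedPeriods

open Complex Metric Set Filter Topology

variable {n : ℕ} {σ : Fin n → ℂ} {s : Fin (n + 1) → ℂ} {K Q : Type} [Field K] [Field Q] [Algebra K ℂ]
  [Algebra Q ℂ] {d : ℕ}

/-! ### The class of the interval -/

section plots

variable {E : Type} [AddCommGroup E] [Module ℝ E] [TopologicalSpace E] [IsTopologicalAddGroup E]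
  [ContinuousSMul ℝ E]

theorem Plot.boundary_segment (P : Plot σ E) (p q : P.D) :
    boundary Q σ s 0 (P.chain Q s ![p, q]) = P.chain Q s ![q] - P.chain Q s ![p] := by
  rw [Plot.boundary_chain, Fin.sum_univ_two]
  have f0 : (![p, q] ∘ (0 : Fin 2).succAbove : Fin 1 → P.D) = ![q] := by
    funext i; fin_cases i; rfl
  have f1 : (![p, q] ∘ (1 : Fin 2).succAbove : Fin 1 → P.D) = ![p] := by
    funext i; fin_cases i; rfl
  rw [f0, f1]
  simp [sub_eq_add_neg]

theorem Plot.segment_add (P : Plot σ E) (p q r : P.D) :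
    ∃ w, boundary Q σ s 1 w = P.chain Q s ![p, r] - (P.chain Q s ![p, q] + P.chain Q s ![q, r]) := by
  have h := P.cocycle_add (Q := Q) (s := s) (u := (LinearMap.range (boundary Q σ s 1)).mkQ)
    (fun w => (Submodule.Quotient.mk_eq_zero _).mpr ⟨w, rfl⟩) p q r
  rw [← map_add] at h
  exact (Submodule.Quotient.eq _).mp h

end plots

/-- The principal branches of all factors are defined on `(0, 1)`. -/
def IsCut (σ : Fin n → ℂ) : Prop := ∀ k, ∀ x : ℝ, 0 < x → x < 1 → factor σ k x ∈ slitPlane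

theorem IsCut.mem (h0 : ∀ k, σ k ≠ 0) (h : IsCut σ) {x : ℝ} (hx : 0 < x) (hx1 : x < 1) : (x : ℂ) ∈ Line σ := by
  refine mem_Line_iff.mpr fun k e => slitPlane_ne_zero (h k x hx hx1) ?_
  rw [factor_eq h0, e, sub_self, mul_zero]

/-- The interval `(0, 1)` with the principal branch. -/
def IsCut.plot (h0 : ∀ k, σ k ≠ 0) (h : IsCut σ) : Plot σ ℝ where
  D := Ioo 0 1
  convex := convex_Ioo 0 1
  toFun x := x
  mem x hx := h.mem h0 hx.1 hx.2
  cont := continuous_ofReal.continuousOn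
  log k x := log (factor σ k x)
  cont_log k := by
    refine ContinuousOn.clog ?_ fun x hx => h k x hx.1 hx.2
    simp only [factor_eq h0]
    fun_prop
  exp_log k x hx := exp_log (slitPlane_ne_zero (h k x hx.1 hx.2))

theorem IsCut.branch_eq (h0 : ∀ k, σ k ≠ 0) (h : IsCut σ) {x : ℝ} (hx : x ∈ Ioo (0 : ℝ) 1) :
    (h.plot h0).branch s x = ∏ k, factor σ k x ^ s k := by
  rw [Plot.branch, exp_sum]
  refine Finset.prod_congr rfl fun k _ => ?_
  rw [cpow_def_of_ne_zero (slitPlane_ne_zero (h k x hx.1 hx.2)), mul_comm]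
  rfl

theorem exists_ball_disjoint {C : Set ℂ} (hC : IsCompact C) (hCL : C ⊆ Line σ) (k : Fin (n + 1)) :
    ∃ ε > 0, ball (puncture σ k) ε ⊆ Cᶜ :=
  isOpen_iff.mp hC.isClosed.isOpen_compl _ fun hk => mem_Line_iff.mp (hCL hk) k rfl

theorem Chain.SupportedOn.segment {P : Plot σ ℝ} {p q : P.D} {c : ℂ} {R : ℝ}
    (hP : P.toFun = fun x : ℝ => (x : ℂ)) (hp : ((p : ℝ) : ℂ) ∈ ball c R) (hq : ((q : ℝ) : ℂ) ∈ ball c R) :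
    (P.chain Q s ![p, q]).SupportedOn (ball c R) := by
  refine Chain.SupportedOn.of _ fun u => ?_
  change P.toFun (P.bary ![p, q] u : ℝ) ∈ _
  rw [hP]
  have e : ((P.bary ![p, q] u : ℝ) : ℂ) = u 0 • ((p : ℝ) : ℂ) + u 1 • ((q : ℝ) : ℂ) := by
    simp [Plot.bary, Fin.sum_univ_two]
  change ((P.bary ![p, q] u : ℝ) : ℂ) ∈ _
  rw [e]
  exact convex_ball c R hp hq (u.2.1 0) (u.2.1 1) ((Fin.sum_univ_two _).symm.trans u.2.2)

/-- The regularisation of the interval. -/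
theorem exists_interval_cycle (h : Admissible K Q σ s) (hcut : IsCut σ) {j₁ : Fin (n + 1)}
    (hj₁ : puncture σ j₁ = 1) :
    ∃ z : Cycle Q σ s, ∃ ρ₀ > 0, ∀ ρ (_ : 0 < ρ) (_ : ρ < ρ₀), ∃ hρ : ρ ∈ Ioo (0 : ℝ) 1,
      ∃ hρ' : 1 - ρ ∈ Ioo (0 : ℝ) 1, ∃ (A B : Chain Q σ s 1) (w : Chain Q σ s 2),
        (z : Chain Q σ s 1) = (hcut.plot h.ne_zero).chain Q s ![⟨ρ, hρ⟩, ⟨1 - ρ, hρ'⟩] + boundary Q σ s 1 w + (A - B) ∧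
        boundary Q σ s 0 A = (hcut.plot h.ne_zero).chain Q s ![⟨ρ, hρ⟩] ∧
        boundary Q σ s 0 B = (hcut.plot h.ne_zero).chain Q s ![⟨1 - ρ, hρ'⟩] ∧
        A.SupportedOn (sphere 0 ρ) ∧ B.SupportedOn (sphere 1 ρ) := by
  obtain ⟨C₀, hC₀, hCL, hper⟩ := exists_compact_periods h
  obtain ⟨r, hr0, hr⟩ := exists_isolating_radius h.inj
  obtain ⟨ε, hε, hεC⟩ := exists_ball_disjoint hC₀ hCL 0
  obtain ⟨ε', hε', hεC'⟩ := exists_ball_disjoint hC₀ hCL j₁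
  rw [hj₁] at hεC'
  have hp0 : puncture σ 0 = 0 := rfl
  rw [hp0] at hεC
  set P := hcut.plot h.ne_zero with hP
  -- The bounds `ε, ε'` keep the discs at `0` and `1` off `C₀`, `2 r` isolates the punctures as
  -- required for the loops, and `1 / 2` puts `ρ` and `1 - ρ` inside the interval.
  set ρ₀ : ℝ := min (min ε ε') (min (2 * r) (1 / 2)) with hρ₀
  have hρ₀p : 0 < ρ₀ := by positivity
  have b1 : ρ₀ ≤ ε := (min_le_left _ _).trans (min_le_left _ _)
  have b2 : ρ₀ ≤ ε' := (min_le_left _ _).trans (min_le_right _ _)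
  have b3 : ρ₀ ≤ 2 * r := (min_le_right _ _).trans (min_le_left _ _)
  have b4 : ρ₀ ≤ 1 / 2 := (min_le_right _ _).trans (min_le_right _ _)
  have m1 : ∀ ρ, 0 < ρ → ρ < ρ₀ → ρ ∈ Ioo (0 : ℝ) 1 := fun ρ h1 h2 => ⟨h1, by linarith⟩
  have m2 : ∀ ρ, 0 < ρ → ρ < ρ₀ → 1 - ρ ∈ Ioo (0 : ℝ) 1 := fun ρ h1 h2 => ⟨by linarith, by linarith⟩
  have hpt : ∀ x : P.D, (((P.simplex ![x]) default : Line σ) : ℂ) = ((x : ℝ) : ℂ) := fun x => by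
    change (((P.bary ![x] default : P.D) : ℝ) : ℂ) = _
    simp [Plot.bary]
  have key : ∀ ρ (h1 : 0 < ρ) (h2 : ρ < ρ₀), ∃ A B : Chain Q σ s 1,
      boundary Q σ s 0 A = P.chain Q s ![⟨ρ, m1 ρ h1 h2⟩] ∧
      boundary Q σ s 0 B = P.chain Q s ![⟨1 - ρ, m2 ρ h1 h2⟩] ∧
      A.SupportedOn (sphere 0 ρ) ∧ B.SupportedOn (sphere 1 ρ) := fun ρ h1 h2 => by
    have n0 : ‖(((P.simplex ![⟨ρ, m1 ρ h1 h2⟩]) default : Line σ) : ℂ) - puncture σ 0‖ = ρ := by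
      rw [hpt, hp0, sub_zero, norm_real, Real.norm_of_nonneg h1.le]
    have n1 : ‖(((P.simplex ![⟨1 - ρ, m2 ρ h1 h2⟩]) default : Line σ) : ℂ) - puncture σ j₁‖ = ρ := by
      rw [hpt, hj₁]
      have : (((1 - ρ : ℝ) : ℂ)) - 1 = ((-ρ : ℝ) : ℂ) := by push_cast; ring
      rw [this, norm_real, norm_neg, Real.norm_of_nonneg h1.le]
    obtain ⟨A, hA, hAs⟩ := exists_loop h 0 hr (branchSection Q s (P.simplex ![⟨ρ, m1 ρ h1 h2⟩]) (P.simplexLog _)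
      fun k t => P.exp_log k _ (P.bary _ t).2) (by rw [n0]; linarith)
    obtain ⟨B, hB, hBs⟩ := exists_loop h j₁ hr (branchSection Q s (P.simplex ![⟨1 - ρ, m2 ρ h1 h2⟩])
      (P.simplexLog _) fun k t => P.exp_log k _ (P.bary _ t).2) (by rw [n1]; linarith)
    rw [n0, hp0] at hAs
    rw [n1, hj₁] at hBs
    exact ⟨A, B, hA, hB, hAs, hBs⟩
  choose A B hA hB hAs hBs using key
  have hρ₁ : 0 < ρ₀ / 2 := by positivity
  have hρ₁' : ρ₀ / 2 < ρ₀ := by linarith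
  -- The cycle is built once, at `ρ₀ / 2`: the segment plus a loop at the left end minus a loop at
  -- the right end.
  refine ⟨⟨P.chain Q s ![⟨_, m1 _ hρ₁ hρ₁'⟩, ⟨_, m2 _ hρ₁ hρ₁'⟩] + (A _ hρ₁ hρ₁' - B _ hρ₁ hρ₁'), ?_⟩, ρ₀, hρ₀p,
    fun ρ h1 h2 => ⟨m1 ρ h1 h2, m2 ρ h1 h2, A ρ h1 h2, B ρ h1 h2, ?_⟩⟩
  · rw [LinearMap.mem_ker, map_add, map_sub, hA, hB, Plot.boundary_segment]
    abel
  have s1 : ∀ ρ, 0 < ρ → ρ < ρ₀ → ((ρ : ℝ) : ℂ) ∈ ball (0 : ℂ) ρ₀ := fun ρ h1 h2 => by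
    rw [mem_ball_zero_iff, norm_real, Real.norm_of_nonneg h1.le]
    exact h2
  have s2 : ∀ ρ, 0 < ρ → ρ < ρ₀ → ((1 - ρ : ℝ) : ℂ) ∈ ball (1 : ℂ) ρ₀ := fun ρ h1 h2 => by
    have : (((1 - ρ : ℝ) : ℂ)) - 1 = ((-ρ : ℝ) : ℂ) := by push_cast; ring
    rw [mem_ball, dist_eq, this, norm_real, norm_neg, Real.norm_of_nonneg h1.le]
    exact h2
  have c1 : ball (0 : ℂ) ρ₀ ⊆ C₀ᶜ := (ball_subset_ball b1).trans hεC
  have c2 : ball (1 : ℂ) ρ₀ ⊆ C₀ᶜ := (ball_subset_ball b2).trans hεC'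
  have c3 : ∀ ρ, ρ < ρ₀ → sphere (0 : ℂ) ρ ⊆ C₀ᶜ := fun ρ h => (sphere_subset_ball h).trans c1
  have c4 : ∀ ρ, ρ < ρ₀ → sphere (1 : ℂ) ρ ⊆ C₀ᶜ := fun ρ h => (sphere_subset_ball h).trans c2
  obtain ⟨w₁, hw₁⟩ := P.segment_add (Q := Q) (s := s) ⟨ρ, m1 ρ h1 h2⟩ ⟨_, m1 _ hρ₁ hρ₁'⟩ ⟨_, m2 ρ h1 h2⟩
  obtain ⟨w₂, hw₂⟩ := P.segment_add (Q := Q) (s := s) ⟨_, m1 _ hρ₁ hρ₁'⟩ ⟨_, m2 _ hρ₁ hρ₁'⟩ ⟨_, m2 ρ h1 h2⟩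
  -- The constructions at `ρ` and at `ρ₀ / 2` differ, up to subdividing the segment, by a cycle in
  -- the two small discs, which is a boundary.
  obtain ⟨w₃, hw₃⟩ := boundary_eq_of_supportedOn h hper
    (T := (A _ hρ₁ hρ₁' - B _ hρ₁ hρ₁') - (A ρ h1 h2 - B ρ h1 h2) -
      (P.chain Q s ![⟨ρ, m1 ρ h1 h2⟩, ⟨_, m1 _ hρ₁ hρ₁'⟩] + P.chain Q s ![⟨_, m2 _ hρ₁ hρ₁'⟩, ⟨_, m2 ρ h1 h2⟩]))
    (by
      simp only [map_add, map_sub, hA, hB, Plot.boundary_segment]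
      abel)
    ((((hAs _ _ _).mono (c3 _ hρ₁')).sub ((hBs _ _ _).mono (c4 _ hρ₁'))).sub
      (((hAs _ _ _).mono (c3 _ h2)).sub ((hBs _ _ _).mono (c4 _ h2))) |>.sub
      (((Chain.SupportedOn.segment rfl (s1 _ h1 h2) (s1 _ hρ₁ hρ₁')).mono c1).add
        ((Chain.SupportedOn.segment rfl (s2 _ hρ₁ hρ₁') (s2 _ h1 h2)).mono c2)))
  refine ⟨w₃ - w₁ - w₂, ?_, hA _ _ _, hB _ _ _, hAs _ _ _, hBs _ _ _⟩
  have hw := map_sub (boundary Q σ s 1) (w₃ - w₁) w₂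
  rw [map_sub (boundary Q σ s 1) w₃ w₁, hw₁, hw₂, hw₃] at hw
  rw [hw]
  change P.chain Q s ![⟨_, m1 _ hρ₁ hρ₁'⟩, ⟨_, m2 _ hρ₁ hρ₁'⟩] + (A _ hρ₁ hρ₁' - B _ hρ₁ hρ₁') = _
  abel

/-- For small `ρ` the correcting loops, on circles of radius `ρ` about `0` and `1`, avoid any given
compact set. -/
theorem isRegularisedInterval_of (h : Admissible K Q σ s) (hcut : IsCut σ) {j₁ : Fin (n + 1)}
    (hj₁ : puncture σ j₁ = 1) {z : Cycle Q σ s} {ρ₀ : ℝ} (hρ₀ : 0 < ρ₀)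
    (hz : ∀ ρ (_ : 0 < ρ) (_ : ρ < ρ₀), ∃ hρ : ρ ∈ Ioo (0 : ℝ) 1,
      ∃ hρ' : 1 - ρ ∈ Ioo (0 : ℝ) 1, ∃ (A B : Chain Q σ s 1) (w : Chain Q σ s 2),
        (z : Chain Q σ s 1) = (hcut.plot h.ne_zero).chain Q s ![⟨ρ, hρ⟩, ⟨1 - ρ, hρ'⟩] + boundary Q σ s 1 w + (A - B) ∧
        A.SupportedOn (sphere 0 ρ) ∧ B.SupportedOn (sphere 1 ρ)) : IsRegularisedInterval z := by
  intro C hC hCL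
  obtain ⟨ε, hε, hεC⟩ := exists_ball_disjoint hC hCL 0
  obtain ⟨ε', hε', hεC'⟩ := exists_ball_disjoint hC hCL j₁
  rw [hj₁] at hεC'
  have hp0 : puncture σ 0 = 0 := rfl
  rw [hp0] at hεC
  refine ⟨min ρ₀ (min ε ε'), by positivity, fun ρ h1 h2 => ?_⟩
  rw [lt_min_iff, lt_min_iff] at h2
  obtain ⟨hρ, hρ', A, B, w, he, hA, hB⟩ := hz ρ h1 h2.1
  refine ⟨_, _, w, A - B, fun t ht => ?_, fun u => ?_,
    (hA.mono ((sphere_subset_ball h2.2.1).trans hεC)).sub (hB.mono ((sphere_subset_ball h2.2.2).trans hεC')), he⟩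
  · change (((hcut.plot h.ne_zero).bary _ (edge t) : ℝ) : ℂ) = _
    have e : ((hcut.plot h.ne_zero).bary ![⟨ρ, hρ⟩, ⟨1 - ρ, hρ'⟩] (edge t) : ℝ) =
        edge t 0 * ρ + edge t 1 * (1 - ρ) 
      := (Fin.sum_univ_two (fun j : Fin 2 => edge t j * (((![⟨ρ, hρ⟩, ⟨1 - ρ, hρ'⟩] : Fin 2 → (hcut.plot h.ne_zero).D) j : ℝ))))
    rw [e, edge_zero_apply ht, edge_one_apply ht]
    push_cast
    ring
  · exact hcut.branch_eq h.ne_zero ((hcut.plot h.ne_zero).bary _ u).2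

/-- Take for `C` the compact set outside which cycles have no periods. For one common `ε` both
cycles contain the same segment with the same branch, so their difference is a boundary plus a cycle
off `C`, and hence a boundary. -/
theorem evalCycle_eq_of_isRegularisedInterval (h : Admissible K Q σ s) {z z' : Cycle Q σ s}
    (hz : IsRegularisedInterval z) (hz' : IsRegularisedInterval z') : evalCycle z = evalCycle z' := by
  obtain ⟨C, hC, hCL, hper⟩ := exists_compact_periods h
  obtain ⟨ε, hε, H⟩ := hz C hC hCL
  obtain ⟨ε', hε', H'⟩ := hz' C hC hCL
  set ρ := min ε ε' / 2 with hρ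
  have hm : 0 < min ε ε' := by positivity
  have hρ0 : 0 < ρ := by positivity
  have hρm : ρ < min ε ε' := by rw [hρ]; linarith
  obtain ⟨γ, g, w, r, hγ, hg, hr, e⟩ := H ρ hρ0 (hρm.trans_le (min_le_left _ _))
  obtain ⟨γ', g', w', r', hγ', hg', hr', e'⟩ := H' ρ hρ0 (hρm.trans_le (min_le_right _ _))
  have hγγ : γ = γ' := by
    refine ContinuousMap.ext fun u => Subtype.ext ?_
    obtain ⟨t, ht, rfl⟩ : ∃ t ∈ Icc (0 : ℝ) 1, edge t = u :=
      ⟨u 1, ⟨u.2.1 1, by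
        have := (Fin.sum_univ_two _).symm.trans u.2.2
        have h0 := u.2.1 0
        change u 0 + u 1 = 1 at this
        change 0 ≤ u 0 at h0
        linarith⟩, Plot.edge_apply_one u⟩
    exact (hγ t ht).trans (hγ' t ht).symm
  subst hγγ
  have hgg : g = g' := Subtype.ext (funext fun u => (hg u).trans (hg' u).symm)
  subst hgg
  have hd : ((z - z' : Cycle Q σ s) : Chain Q σ s 1) = boundary Q σ s 1 (w - w') + (r - r') := by
    rw [Submodule.coe_sub, e, e', map_sub]
    abel
  have hb : boundary Q σ s 0 (r - r') = 0 := by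
    have h1 : boundary Q σ s 0 ((z - z' : Cycle Q σ s) : Chain Q σ s 1) = 0 := (z - z').2
    rwa [hd, map_add, boundary_boundary, zero_add] at h1
  obtain ⟨v, hv⟩ := boundary_eq_of_supportedOn h hper hb
    (Chain.SupportedOn.sub (U := Cᶜ) hr hr')
  have h0 : evalCycle (z - z') = 0 :=
    (evalCycle_eq_zero_iff _).mpr ⟨w - w' + v, by rw [map_add, hv, hd]⟩
  have h1 : evalCycleₗ Q σ s (z - z') = 0 := h0
  rw [map_sub] at h1
  exact sub_eq_zero.mp h1

theorem existsUnique_isIntervalClass (h : Admissible K Q σ s) (hcut : IsCut σ) {j₁ : Fin (n + 1)}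
    (hj₁ : puncture σ j₁ = 1) : ∃! φ, IsIntervalClass Q σ s φ := by
  obtain ⟨z, ρ₀, hρ₀, hz⟩ := exists_interval_cycle h hcut hj₁
  refine ⟨evalCycle z, ⟨z, isRegularisedInterval_of h hcut hj₁ hρ₀ fun ρ h1 h2 => ?_, rfl⟩, ?_⟩
  · obtain ⟨hρ, hρ', A, B, w, e, -, -, hA, hB⟩ := hz ρ h1 h2
    exact ⟨hρ, hρ', A, B, w, e, hA, hB⟩
  · rintro φ ⟨z', hz', rfl⟩
    refine evalCycle_eq_of_isRegularisedInterval h hz' (isRegularisedInterval_of h hcut hj₁ hρ₀ fun ρ h1 h2 => ?_)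
    obtain ⟨hρ, hρ', A, B, w, e, -, -, hA, hB⟩ := hz ρ h1 h2
    exact ⟨hρ, hρ', A, B, w, e, hA, hB⟩

theorem isRealised (h : Admissible K Q σ s) (hcut : IsCut σ) {j₁ : Fin (n + 1)}
    (hj₁ : puncture σ j₁ = 1) : IsRealised K Q σ s where
  finite_dR := by
    obtain ⟨b, -⟩ := exists_dR_basis h
    exact Module.Finite.of_basis b
  finite_B := (finrank_HB_le h).1
  comparison := existsUnique_comparison h
  pairing := by
    choose t ht using h.exponent_mem
    obtain ⟨P, hP, -⟩ := exists_pairing h ht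
    exact ⟨P, hP, fun P' hP' => hP'.unique h hP⟩
  interval := existsUnique_isIntervalClass h hcut hj₁

end TwistedPeriods
end

/-! ### Morphisms shifting the exponents by integers, and non-vanishing of the beta class. -/

noncomputable section
namespace TwistedPeriods

open Complex Metric Set Filter Topology

variable {n : ℕ} {σ : Fin n → ℂ} {s : Fin (n + 1) → ℂ} {K Q : Type} [Field K] [Field Q] [Algebra K ℂ]
  [Algebra Q ℂ] {d : ℕ}

/-! ### Integral shifts of the exponents -/

variable {s' : Fin (n + 1) → ℂ} {m : Fin (n + 1) → ℤ}

/-- The function `∏ k, factor σ k x ^ m k`. -/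
def factorProd (σ : Fin n → ℂ) (m : Fin (n + 1) → ℤ) (x : ℂ) : ℂ := ∏ k, factor σ k x ^ m k

theorem hasDerivAt_factorProd (h0 : ∀ k, σ k ≠ 0) (m : Fin (n + 1) → ℤ) {x : ℂ} (hx : x ∈ Line σ) :
    HasDerivAt (factorProd σ m) (conn σ (fun k => (m k : ℂ)) x * factorProd σ m x) x := by
  have hf : ∀ k, factor σ k = fun z => factorConst σ k * (z - puncture σ k) := fun k =>
    funext fun z => factor_eq h0 k z
  have hne : ∀ k, factor σ k x ≠ 0 := fun k => by
    rw [factor_eq h0]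
    exact mul_ne_zero (factorConst_ne_zero h0 k) (sub_puncture_ne_zero hx k)
  have hd : ∀ k, DifferentiableAt ℂ (factor σ k) x := fun k => by
    rw [hf]
    fun_prop
  have hdp : ∀ k, DifferentiableAt ℂ (fun z => factor σ k z ^ m k) x := fun k => (hd k).zpow (Or.inl (hne k))
  have hdiff : DifferentiableAt ℂ (factorProd σ m) x := by
    unfold factorProd
    exact DifferentiableAt.fun_finsetProd fun k _ => hdp k
  have hlog : logDeriv (factorProd σ m) x = conn σ (fun k => (m k : ℂ)) x := by
    unfold factorProd
    rw [logDeriv_prod (f := fun k z => factor σ k z ^ m k) (fun k _ => zpow_ne_zero _ (hne k)) fun k _ => hdp k]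
    refine Finset.sum_congr rfl fun k _ => ?_
    rw [logDeriv_fun_zpow (hd k), logDeriv_apply, factor_eq h0]
    have : deriv (factor σ k) x = factorConst σ k := by
      rw [hf]
      simp
    rw [this, div_mul_eq_div_div, div_self (factorConst_ne_zero h0 k), mul_one_div]
  have hp : factorProd σ m x ≠ 0 := Finset.prod_ne_zero_iff.mpr fun k _ => zpow_ne_zero _ (hne k)
  rw [← hlog, logDeriv_apply, div_mul_cancel₀ _ hp]
  exact hdiff.hasDerivAt

/-- Multiplication of sections by `∏ k, factor σ k ^ m k`. -/
def shiftSection (Q : Type) [Field Q] [Algebra Q ℂ] (hs : ∀ k, s' k = s k + m k) (γ : Simplex σ d) :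
    sections Q σ s γ →ₗ[Q] sections Q σ s' γ :=
  (LinearMap.mulLeft Q fun t => factorProd σ m (γ t)).restrict fun g hg => by
    induction hg using Submodule.span_induction with
    | mem g hg =>
      obtain ⟨l, hl, hg⟩ := hg
      refine Submodule.subset_span ⟨l, hl, fun t => ?_⟩
      rw [LinearMap.mulLeft_apply, Pi.mul_apply, hg, factorProd]
      simp only [hs, add_mul, Finset.sum_add_distrib, exp_add]
      rw [mul_comm, exp_sum (f := fun k => (m k : ℂ) * l k t)]
      simp only [exp_int_mul, hl]
    | zero => simp
    | add g h _ _ hg hh => rw [map_add]; exact Submodule.add_mem _ hg hh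
    | smul r g _ hg => rw [map_smul]; exact Submodule.smul_mem _ r hg

theorem shiftSection_apply (hs : ∀ k, s' k = s k + m k) (γ : Simplex σ d) (g : sections Q σ s γ) (t) :
    (shiftSection Q hs γ g : stdSimplex ℝ (Fin (d + 1)) → ℂ) t =
      factorProd σ m (γ t) * (g : stdSimplex ℝ (Fin (d + 1)) → ℂ) t := rfl

/-- Multiplication of chains by `∏ k, factor σ k ^ m k`. -/
def shiftChain (Q : Type) [Field Q] [Algebra Q ℂ] (hs : ∀ k, s' k = s k + m k) :
    Chain Q σ s d →ₗ[Q] Chain Q σ s' d :=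
  DirectSum.lmap fun γ => shiftSection Q hs γ

theorem shiftChain_of (hs : ∀ k, s' k = s k + m k) (γ : Simplex σ d) (g : sections Q σ s γ) :
    shiftChain Q hs (Chain.of γ g) = Chain.of γ (shiftSection Q hs γ g) := by
  classical
  exact DirectSum.lmap_lof (M := fun γ : Simplex σ d => ↥(sections Q σ s γ))
    (N := fun γ : Simplex σ d => ↥(sections Q σ s' γ)) (f := fun γ => shiftSection Q hs γ) γ g

theorem shiftChain_coeff (hs : ∀ k, s' k = s k + m k) (z : Chain Q σ s d) (γ : Simplex σ d) :
    (shiftChain Q hs z).coeff γ = shiftSection Q hs γ (z.coeff γ) := rfl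

theorem shiftChain_coeff_ne_zero (hs : ∀ k, s' k = s k + m k) {z : Chain Q σ s d} {γ : Simplex σ d}
    (h : (shiftChain Q hs z).coeff γ ≠ 0) : z.coeff γ ≠ 0 := fun h0 => h (by
  rw [shiftChain_coeff, h0, map_zero])

theorem boundary_shiftChain (hs : ∀ k, s' k = s k + m k) (z : Chain Q σ s (d + 1)) :
    boundary Q σ s' d (shiftChain Q hs z) = shiftChain Q hs (boundary Q σ s d z) := by
  revert z
  refine LinearMap.congr_fun (f := boundary Q σ s' d ∘ₗ shiftChain Q hs)
    (g := shiftChain Q hs ∘ₗ boundary Q σ s d) (chain_hom_ext fun γ l hl => ?_)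
  rw [LinearMap.comp_apply, LinearMap.comp_apply, shiftChain_of, boundary_of, boundary_of, map_sum]
  refine Finset.sum_congr rfl fun i _ => ?_
  rw [map_smul, shiftChain_of]
  rfl

/-- Multiplication of cycles by `∏ k, factor σ k ^ m k`. -/
def shiftCycle (Q : Type) [Field Q] [Algebra Q ℂ] (hs : ∀ k, s' k = s k + m k) (z : Cycle Q σ s) :
    Cycle Q σ s' :=
  ⟨shiftChain Q hs z.1, by
    rw [LinearMap.mem_ker, boundary_shiftChain, LinearMap.mem_ker.mp z.2, map_zero]⟩

/-- The principal branches satisfy `x ^ (s + m) = x ^ s * x ^ m` for integral `m`, so multiplication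
carries the branch on the interval to the branch for the new exponents. Supports do not grow. -/
theorem IsRegularisedInterval.shift (h0 : ∀ k, σ k ≠ 0) (hs : ∀ k, s' k = s k + m k) {z : Cycle Q σ s}
    (hz : IsRegularisedInterval z) : IsRegularisedInterval (shiftCycle Q hs z) := by
  intro C hC hCL
  obtain ⟨ε₀, hε₀, H⟩ := hz C hC hCL
  refine ⟨ε₀, hε₀, fun ε h1 h2 => ?_⟩
  obtain ⟨γ, g, w, r, hγ, hg, hr, e⟩ := H ε h1 h2
  refine ⟨γ, shiftSection Q hs γ g, shiftChain Q hs w, shiftChain Q hs r, hγ, fun u => ?_,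
    fun τ hτ => hr τ (shiftChain_coeff_ne_zero hs hτ), ?_⟩
  · rw [shiftSection_apply, hg, factorProd, ← Finset.prod_mul_distrib]
    refine Finset.prod_congr rfl fun k _ => ?_
    have hne : factor σ k (γ u) ≠ 0 := by
      rw [factor_eq h0]
      exact mul_ne_zero (factorConst_ne_zero h0 k) (sub_puncture_ne_zero (γ u).2 k)
    rw [hs, cpow_add _ _ hne, cpow_intCast, mul_comm]
  · change shiftChain Q hs (z : Chain Q σ s 1) = _
    rw [e, map_add, map_add, shiftChain_of, boundary_shiftChain]

/-- Multiplication of cochains. -/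
def shiftCochain (Q : Type) [Field Q] [Algebra Q ℂ] (hs : ∀ k, s' k = s k + m k) (d : ℕ) :
    Cochain Q σ s' d →ₗ[Q] Cochain Q σ s d :=
  LinearMap.lcomp Q Q (shiftChain Q hs)

theorem eval_shiftCochain (hs : ∀ k, s' k = s k + m k) (u : Cochain Q σ s' d) (z : Chain Q σ s d) :
    Cochain.eval z (shiftCochain Q hs d u) = Cochain.eval (shiftChain Q hs z) u := rfl

theorem coboundary_shiftCochain (hs : ∀ k, s' k = s k + m k) (u : Cochain Q σ s' d) :
    coboundary Q σ s d (shiftCochain Q hs d u) = shiftCochain Q hs (d + 1) (coboundary Q σ s' d u) :=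
  LinearMap.ext fun w => congrArg (show Chain Q σ s' d →ₗ[Q] Q from u) (boundary_shiftChain hs w).symm

/-- The map on Betti cohomology defined by `∏ k, factor σ k ^ m k`. -/
def shiftHB (Q : Type) [Field Q] [Algebra Q ℂ] (hs : ∀ k, s' k = s k + m k) : HB Q σ s' →ₗ[Q] HB Q σ s :=
  Submodule.mapQ _ _ ((shiftCochain Q hs 1).restrict fun u hu => by
    rw [LinearMap.mem_ker] at hu ⊢
    rw [coboundary_shiftCochain, hu, map_zero]) (by
    rintro u ⟨v, hv⟩
    exact ⟨shiftCochain Q hs 0 v, by rw [coboundary_shiftCochain, hv]; rfl⟩)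

theorem evalCycle_comp_shiftHB (hs : ∀ k, s' k = s k + m k) (z : Cycle Q σ s) :
    evalCycle z ∘ₗ shiftHB Q hs = evalCycle (shiftCycle Q hs z) := by
  refine Submodule.linearMap_qext _ (LinearMap.ext fun u => ?_)
  simp only [LinearMap.comp_apply, shiftHB, Submodule.mkQ_apply, Submodule.mapQ_apply, evalCycle,
    Submodule.liftQ_apply, Submodule.coe_subtype, LinearMap.coe_restrict_apply]
  exact eval_shiftCochain hs u.1 z

/-- The logarithmic derivative of `η` is the connection form with residues `m_k`, whence `η ∇_{s'} f
= ∇_s (η f)`. -/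
theorem mul_mem_exactForms (h0 : ∀ k, σ k ≠ 0) (hs : ∀ k, s' k = s k + m k) {η : regular K σ}
    (hη : ∀ x : Line σ, (η : Line σ → ℂ) x = factorProd σ m x) {ω : regular K σ}
    (hω : ω ∈ exactForms K σ s') : η * ω ∈ exactForms K σ s := by
  obtain ⟨f, hf, hd⟩ := hω
  refine ⟨fun x => factorProd σ m x * f x, ?_, fun x => ?_⟩
  · have := (regular K σ).mul_mem η.2 hf
    convert this using 1
    funext x
    rw [Pi.mul_apply, hη]
    rfl
  · refine ((hasDerivAt_factorProd h0 m x.2).mul (hd x)).congr_deriv ?_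
    have e : conn σ s' x = conn σ s x + conn σ (fun k => (m k : ℂ)) x := by
      simp only [conn, ← Finset.sum_add_distrib, hs, add_div]
    rw [Subalgebra.coe_mul, Pi.mul_apply, hη, e]
    ring

/-- The map on de Rham cohomology defined by `∏ k, factor σ k ^ m k`. -/
def shiftHdR (h0 : ∀ k, σ k ≠ 0) (hs : ∀ k, s' k = s k + m k) (η : regular K σ)
    (hη : ∀ x : Line σ, (η : Line σ → ℂ) x = factorProd σ m x) : HdR K σ s' →ₗ[K] HdR K σ s :=
  Submodule.mapQ _ _ (LinearMap.mulLeft K η) fun _ hω => mul_mem_exactForms h0 hs hη hω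

theorem extendForm_baseChange {V W : Type} [AddCommGroup V] [Module Q V] [AddCommGroup W] [Module Q W]
    (φ : Module.Dual Q W) (f : V →ₗ[Q] W) (x : ℂ ⊗[Q] V) :
    extendForm φ (f.baseChange ℂ x) = extendForm (φ ∘ₗ f) x := by
  induction x using TensorProduct.induction_on with
  | zero => simp
  | tmul a v => rw [LinearMap.baseChange_tmul, extendForm_tmul, extendForm_tmul]; rfl
  | add x y hx hy => rw [map_add, map_add, map_add, hx, hy]

/-- Tested on a basis of smooth cycles, both sides are integrals of the same function: the factor
`η` multiplies either the form or the section. -/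
theorem shift_comparison (h : Admissible K Q σ s) (hs : ∀ k, s' k = s k + m k) {η : regular K σ}
    (hη : ∀ x : Line σ, (η : Line σ → ℂ) x = factorProd σ m x) {c c'} (hc : IsComparison K Q σ s c)
    (hc' : IsComparison K Q σ s' c') (x : ℂ ⊗[K] HdR K σ s') :
    c ((shiftHdR h.ne_zero hs η hη).baseChange ℂ x) = (shiftHB Q hs).baseChange ℂ (c' x) := by
  obtain ⟨z, b, hz, hb, -⟩ := exists_smooth_basis h
  have := (finrank_HB_le h).1
  obtain ⟨e, he⟩ := exists_basis_of_dual b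
  induction x using TensorProduct.induction_on with
  | zero => simp
  | add x y hx hy => simp only [map_add, hx, hy]
  | tmul a v =>
    have ha : a ⊗ₜ[K] v = a • ((1 : ℂ) ⊗ₜ[K] v) := by rw [smul_tmul', smul_eq_mul, mul_one]
    rw [ha]
    simp only [map_smul]
    congr 1
    obtain ⟨ω, rfl⟩ := Submodule.Quotient.mk_surjective _ v
    refine (e.baseChange ℂ).ext_elem fun i => ?_
    rw [← extendForm_coord, ← extendForm_coord, he, hb, extendForm_baseChange, evalCycle_comp_shiftHB,
      LinearMap.baseChange_tmul]
    refine (hc (η * ω) (z i) (hz i)).trans (Eq.trans ?_ (hc' ω (shiftCycle Q hs (z i)) fun γ hγ =>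
      hz i γ (shiftChain_coeff_ne_zero hs hγ)).symm)
    refine finsum_congr fun γ => intervalIntegral.integral_congr fun t _ => ?_
    change _ * ((η : Line σ → ℂ) _ * (ω : Line σ → ℂ) _) * _ =
      (factorProd σ m (γ (edge t)) * ((z i : Chain Q σ s 1).coeff γ : stdSimplex ℝ (Fin 2) → ℂ) (edge t)) * _ * _
    rw [hη]
    ring

variable [CharZero K] [CharZero Q]

/-- Periods for exponents that differ by integers agree up to a rational factor of the forms. -/
theorem motPeriod_shift (ha : Admissible K Q σ s) (h : IsRealised K Q σ s) (h' : IsRealised K Q σ s')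
    (hs : ∀ k, s' k = s k + m k) {η : regular K σ}
    (hη : ∀ x : Line σ, (η : Line σ → ℂ) x = factorProd σ m x) (ω : regular K σ) :
    h'.motPeriod ω = h.motPeriod (η * ω) := by
  have hφ : h.φ₁ ∘ₗ shiftHB Q hs = h'.φ₁ := by
    obtain ⟨z, hz, e⟩ := h.interval.choose_spec.1
    have e' : h.φ₁ = evalCycle z := e
    rw [e', evalCycle_comp_shiftHB]
    exact h'.interval.choose_spec.2 _ ⟨_, hz.shift ha.ne_zero hs, rfl⟩
  -- Multiplication by `η` is a morphism from `M(s')` to `M(s)`, and the interval class of `M(s)`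
  -- pulls back to that of `M(s')`.
  have hN := mot_naturality (V := h'.M) (W := h.M)
    (show Obj.Hom h'.M h.M from ⟨shiftHB Q hs, shiftHdR ha.ne_zero hs η hη,
      shift_comparison ha hs hη h.comparison.choose_spec.1 h'.comparison.choose_spec.1⟩) h.φ₁ (dRClass K σ s' ω)
  exact (congrArg (fun φ => mot h'.M φ (dRClass K σ s' ω)) hφ.symm).trans hN

end TwistedPeriods
end

noncomputable section
namespace TwistedPeriods

open Complex Metric Set Filter Topology

variable {n : ℕ} {σ : Fin n → ℂ} {s : Fin (n + 1) → ℂ} {K Q : Type} [Field K] [Field Q] [Algebra K ℂ]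
  [Algebra Q ℂ] {d : ℕ}

/-! ### The class of the interval does not vanish for two finite punctures -/

theorem IsCut.period_segment (h0 : ∀ k, σ k ≠ 0) (hcut : IsCut σ) {F : ℂ → ℂ}
    (hF : DifferentiableOn ℂ F (Line σ)) {p q : ℝ} (hp : p ∈ Ioo (0 : ℝ) 1) (hq : q ∈ Ioo (0 : ℝ) 1) :
    period Q s h0 hF ((hcut.plot h0).chain Q s ![⟨p, hp⟩, ⟨q, hq⟩]) =
      ∫ x in p..q, (∏ k, factor σ k x ^ s k) * F x := by
  obtain ⟨v, hv⟩ : ∃ v : Fin 2 → (hcut.plot h0).D, v = ![⟨p, hp⟩, ⟨q, hq⟩] := ⟨_, rfl⟩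
  rw [← hv]
  obtain ⟨G, hG⟩ := exists_pathPrim h0 hF ((hcut.plot h0).simplex v) (branchSection Q s ((hcut.plot h0).simplex v)
    ((hcut.plot h0).simplexLog v) fun k t => (hcut.plot h0).exp_log k _ ((hcut.plot h0).bary v t).2)
  have hb : ∀ t ∈ Icc (0 : ℝ) 1, ((hcut.plot h0).bary v (edge t) : ℝ) = (q - p) * t + p := fun t ht => by
    have e : ((hcut.plot h0).bary v (edge t) : ℝ) = edge t 0 * p + edge t 1 * q :=
      Fin.sum_univ_two (fun j : Fin 2 => edge t j * ((v j : (hcut.plot h0).D) : ℝ)) |>.trans (by rw [hv]; rfl)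
    rw [e, edge_zero_apply ht, edge_one_apply ht]
    ring
  have hpath : ∀ t ∈ Icc (0 : ℝ) 1, path ((hcut.plot h0).simplex v) t = (((q - p) * t + p : ℝ) : ℂ) := fun t ht =>
    congrArg ofReal (hb t ht)
  have hsm : ContDiff ℝ 1 fun t : ℝ => (((q - p) * t + p : ℝ) : ℂ) :=
    ofRealCLM.contDiff.comp ((contDiff_const.mul contDiff_id).add contDiff_const)
  have h1 := hG.integral_smooth h0 hF (hsm.contDiffOn.congr hpath)
  refine (period_of_eq h0 hF hG).trans (h1.symm.trans ?_)
  have h2 := intervalIntegral.smul_integral_comp_mul_add (a := 0) (b := 1)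
    (fun x : ℝ => (∏ k, factor σ k x ^ s k) * F x) (q - p) p
  simp only [mul_zero, zero_add, mul_one, sub_add_cancel] at h2
  rw [← h2, ← intervalIntegral.integral_smul]
  refine intervalIntegral.integral_congr_Ioo_of_le zero_le_one fun t ht => ?_
  have ht' := Ioo_subset_Icc_self ht
  have hd : deriv (path ((hcut.plot h0).simplex v)) t = ((q - p : ℝ) : ℂ) := by
    have h3 : path ((hcut.plot h0).simplex v) =ᶠ[𝓝 t] fun t : ℝ => (((q - p) * t + p : ℝ) : ℂ) := by
      filter_upwards [Icc_mem_nhds ht.1 ht.2] with x hx using hpath x hx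
    rw [h3.deriv_eq]
    refine HasDerivAt.deriv (HasDerivAt.ofReal_comp ?_)
    simpa using ((hasDerivAt_id t).const_mul (q - p)).add_const p
  have hbr : (branchSection Q s ((hcut.plot h0).simplex v) ((hcut.plot h0).simplexLog v)
      (fun k t => (hcut.plot h0).exp_log k _ ((hcut.plot h0).bary v t).2) : stdSimplex ℝ (Fin 2) → ℂ) (edge t) =
      ∏ k, factor σ k (((q - p) * t + p : ℝ) : ℂ) ^ s k := by
    rw [← hb t ht']
    exact hcut.branch_eq h0 ((hcut.plot h0).bary v (edge t)).2
  rw [hd, hbr, hpath t ht', real_smul]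
  ring

theorem isCut_one : IsCut ![1] := by
  intro k x h0 h1
  refine Fin.cases ?_ (fun k => ?_) k
  · exact ofReal_mem_slitPlane.mpr h0
  · rw [Subsingleton.elim k 0]
    change 1 - (x : ℂ) / 1 ∈ slitPlane
    rw [div_one, ← ofReal_one, ← ofReal_sub]
    exact ofReal_mem_slitPlane.mpr (by linarith)

theorem prod_factor_one (s : Fin 2 → ℂ) (x : ℝ) :
    ∏ k, factor ![1] k (x : ℂ) ^ s k = (x : ℂ) ^ s 0 * ((1 - x : ℝ) : ℂ) ^ s 1 := by
  rw [Fin.prod_univ_two]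
  have : factor ![1] 1 (x : ℂ) = ((1 - x : ℝ) : ℂ) := by
    change 1 - (x : ℂ) / 1 = _
    simp
  rw [this]
  rfl

theorem betaIntegral_ne_zero {u v : ℂ} (hu : 0 < u.re) (hv : 0 < v.re) : betaIntegral u v ≠ 0 := fun h => by
  have := Gamma_mul_Gamma_eq_betaIntegral hu hv
  rw [h, mul_zero] at this
  exact mul_ne_zero (Gamma_ne_zero_of_re_pos hu) (Gamma_ne_zero_of_re_pos hv) this

theorem tendsto_integral_Icc {f : ℝ → ℂ} (hf : IntervalIntegrable f MeasureTheory.volume 0 1) :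
    Tendsto (fun ρ : ℝ => ∫ x in ρ..(1 - ρ), f x) (𝓝[>] 0) (𝓝 (∫ x in (0 : ℝ)..1, f x)) := by
  have hc := intervalIntegral.continuousOn_primitive_interval' hf left_mem_uIcc
  rw [uIcc_of_le zero_le_one] at hc
  have hev : ∀ᶠ ρ : ℝ in 𝓝[>] 0, ρ ∈ Icc (0 : ℝ) 1 := by
    filter_upwards [Ioo_mem_nhdsGT (zero_lt_one (α := ℝ))] with ρ hρ using Ioo_subset_Icc_self hρ
  have t0 : Tendsto (fun ρ : ℝ => ∫ x in (0 : ℝ)..ρ, f x) (𝓝[>] 0) (𝓝 (∫ x in (0 : ℝ)..0, f x)) :=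
    (hc 0 ⟨le_rfl, zero_le_one⟩).tendsto.comp
      (tendsto_nhdsWithin_iff.mpr ⟨tendsto_nhdsWithin_of_tendsto_nhds tendsto_id, hev⟩)
  have t1 : Tendsto (fun ρ : ℝ => ∫ x in (0 : ℝ)..(1 - ρ), f x) (𝓝[>] 0) (𝓝 (∫ x in (0 : ℝ)..1, f x)) := by
    refine (hc 1 ⟨zero_le_one, le_rfl⟩).tendsto.comp (tendsto_nhdsWithin_iff.mpr ⟨?_, ?_⟩)
    · have : Tendsto (fun ρ : ℝ => 1 - ρ) (𝓝 0) (𝓝 (1 - 0)) := by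
        exact (continuous_const.sub continuous_id).tendsto 0
      rw [sub_zero] at this
      exact tendsto_nhdsWithin_of_tendsto_nhds this
    · filter_upwards [hev] with ρ hρ using ⟨by linarith [hρ.2], by linarith [hρ.1]⟩
  have := t1.sub t0
  rw [intervalIntegral.integral_same, sub_zero] at this
  refine this.congr' ?_
  filter_upwards [hev] with ρ hρ
  have hm : ∀ x ∈ Icc (0 : ℝ) 1, IntervalIntegrable f MeasureTheory.volume 0 x := fun x hx =>
    hf.mono_set (by rw [uIcc_of_le hx.1, uIcc_of_le zero_le_one]; exact Icc_subset_Icc le_rfl hx.2)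
  exact intervalIntegral.integral_interval_sub_left (hm _ ⟨by linarith [hρ.2], by linarith [hρ.1]⟩) (hm _ hρ)

/-- If the class were zero, the period of `dx / (x (1 - x))` would vanish, and the integral over
`[ρ, 1 - ρ]` would be expressed by local potentials at the end points. With positive real parts
these terms tend to zero, while the integral tends to an Euler beta integral, which is a non-zero
quotient of Gamma values. -/
theorem exists_interval_cycle_ne_zero {s : Fin 2 → ℂ} (h : Admissible K Q ![1] s) (hre : ∀ k, 0 < (s k).re) :
    ∃ z : Cycle Q ![1] s, IsRegularisedInterval z ∧ evalCycle z ≠ 0 := by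
  have hj₁ : puncture ![1] 1 = 1 := rfl
  have hp0 : puncture ![(1 : ℂ)] 0 = 0 := rfl
  obtain ⟨z, ρ₀, hρ₀, hz⟩ := exists_interval_cycle h isCut_one hj₁
  refine ⟨z, isRegularisedInterval_of h isCut_one hj₁ hρ₀ fun ρ h1 h2 => ?_, fun hz0 => ?_⟩
  · obtain ⟨hρ, hρ', A, B, w, e, -, -, hA, hB⟩ := hz ρ h1 h2
    exact ⟨hρ, hρ', A, B, w, e, hA, hB⟩
  obtain ⟨w₀, hw₀⟩ := (evalCycle_eq_zero_iff z).mp hz0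
  set r : Fin 2 → ℂ := ![1, -1] with hr
  have hF := differentiableOn_conn (σ := ![1]) (s := r)
  obtain ⟨R, hR0, hR⟩ := exists_isolating_radius h.inj
  obtain ⟨ψ₀, hψ₀, -, hd₀⟩ := exists_solution_near_puncture (r := r) (k := 0) (h.nonint 0) hR0 hR
  obtain ⟨ψ₁, hψ₁, -, hd₁⟩ := exists_solution_near_puncture (r := r) (k := 1) (h.nonint 1) hR0 hR
  rw [hp0] at hψ₀ hd₀
  rw [hj₁] at hψ₁ hd₁
  have hL : ∀ x ∈ Line ![(1 : ℂ)], x ≠ 0 ∧ x ≠ 1 := fun x hx => ⟨mem_Line_iff.mp hx 0, mem_Line_iff.mp hx 1⟩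
  set b : ℝ → ℂ := fun x => (x : ℂ) ^ s 0 * ((1 - x : ℝ) : ℂ) ^ s 1 with hb
  -- The loops `A` and `B` lie where `-ψ₀` and `-ψ₁` are potentials, so their periods are the values
  -- at the base points.
  have key : ∀ ρ, 0 < ρ → ρ < min ρ₀ R →
      ∫ x in ρ..(1 - ρ), (∏ k, factor ![1] k (x : ℂ) ^ s k) * conn ![1] r x =
        b ρ * ψ₀ ρ - b (1 - ρ) * ψ₁ ((1 - ρ : ℝ) : ℂ) := fun ρ h1 h2 => by
    obtain ⟨hρ, hρ', A, B, w, e, hA, hB, hAs, hBs⟩ := hz ρ h1 (h2.trans_le (min_le_left _ _))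
    have hρR := h2.trans_le (min_le_right ρ₀ R)
    have hzero : period Q s h.ne_zero hF (z : Chain Q ![1] s 1) = 0 := by
      rw [← hw₀, period_boundary]
    have hpA := period_eq_of_potential_on (Q := Q) (s := s) (f := fun x => -ψ₀ x) h.ne_zero hF
      (isOpen_ball.inter isOpen_Line)
      (fun x (hx : x ∈ ball 0 R ∩ Line ![(1 : ℂ)]) => (hd₀ x hx.1 (hL x hx.2).1).neg.congr_deriv (by ring))
      (z := A) fun γ hγ u => ⟨sphere_subset_ball hρR (hAs γ hγ u), (γ u).2⟩
    have hpB := period_eq_of_potential_on (Q := Q) (s := s) (f := fun x => -ψ₁ x) h.ne_zero hF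
      (isOpen_ball.inter isOpen_Line)
      (fun x (hx : x ∈ ball 1 R ∩ Line ![(1 : ℂ)]) => (hd₁ x hx.1 (hL x hx.2).2).neg.congr_deriv (by ring))
      (z := B) fun γ hγ u => ⟨sphere_subset_ball hρR (hBs γ hγ u), (γ u).2⟩
    have hev : ∀ (x : ℝ) (hx : x ∈ Ioo (0 : ℝ) 1) (f : ℂ → ℂ),
        evalZero Q s f ((isCut_one.plot h.ne_zero).chain Q s ![⟨x, hx⟩]) = b x * f x := fun x hx f => by
      have hbar : ((isCut_one.plot h.ne_zero).bary ![⟨x, hx⟩] default : ℝ) = x := by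
        simp [Plot.bary]
      refine (evalZero_of _ _ _).trans ?_
      change (isCut_one.plot h.ne_zero).branch s ((isCut_one.plot h.ne_zero).bary _ default : ℝ) *
        f (((isCut_one.plot h.ne_zero).bary _ default : ℝ) : ℂ) = _
      rw [hbar, isCut_one.branch_eq h.ne_zero hx, prod_factor_one]
    rw [hA, hev] at hpA
    rw [hB, hev] at hpB
    rw [e, map_add, map_add, map_sub, period_boundary, hpA, hpB, IsCut.period_segment] at hzero
    linear_combination hzero
  have hint := betaIntegral_convergent (hre 0) (hre 1)
  have hlim := tendsto_integral_Icc hint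
  have hb0 : Tendsto b (𝓝[>] 0) (𝓝 0) := by
    have c1 : ContinuousAt (fun x : ℝ => (x : ℂ) ^ s 0) 0 := continuousAt_ofReal_cpow_const 0 _ (Or.inl (hre 0))
    have c2 : ContinuousAt (fun x : ℝ => ((1 - x : ℝ) : ℂ) ^ s 1) 0 :=
      (continuousAt_ofReal_cpow_const (1 - 0) (s 1) (Or.inl (hre 1))).comp (by fun_prop)
    have := (c1.mul c2).tendsto
    have h00 : (0 : ℂ) ^ s 0 = 0 := zero_cpow fun e => by simpa [e] using hre 0
    simp only [Pi.mul_apply, ofReal_zero, h00, zero_mul] at this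
    exact tendsto_nhdsWithin_of_tendsto_nhds this
  have hb1 : Tendsto (fun x => b (1 - x)) (𝓝[>] 0) (𝓝 0) := by
    have c1 : ContinuousAt (fun x : ℝ => (x : ℂ) ^ s 1) 0 := continuousAt_ofReal_cpow_const 0 _ (Or.inl (hre 1))
    have c2 : ContinuousAt (fun x : ℝ => ((1 - x : ℝ) : ℂ) ^ s 0) 0 :=
      (continuousAt_ofReal_cpow_const (1 - 0) (s 0) (Or.inl (hre 0))).comp (by fun_prop)
    have := (c2.mul c1).tendsto
    have h00 : (0 : ℂ) ^ s 1 = 0 := zero_cpow fun e => by simpa [e] using hre 1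
    simp only [Pi.mul_apply, ofReal_zero, h00, mul_zero] at this
    refine (tendsto_nhdsWithin_of_tendsto_nhds this).congr fun x => ?_
    simp [hb]
  have hψt0 : Tendsto (fun ρ : ℝ => ψ₀ ρ) (𝓝[>] 0) (𝓝 (ψ₀ 0)) := by
    have hc : ContinuousAt (fun ρ : ℝ => ψ₀ ρ) 0 := by
      refine ContinuousAt.comp (g := ψ₀) ?_ continuous_ofReal.continuousAt
      rw [ofReal_zero]
      exact hψ₀.continuousOn.continuousAt (ball_mem_nhds _ hR0)
    have := hc.tendsto
    rw [ofReal_zero] at this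
    exact tendsto_nhdsWithin_of_tendsto_nhds this
  have hψt1 : Tendsto (fun ρ : ℝ => ψ₁ ((1 - ρ : ℝ) : ℂ)) (𝓝[>] 0) (𝓝 (ψ₁ 1)) := by
    have hc : ContinuousAt (fun ρ : ℝ => ψ₁ ((1 - ρ : ℝ) : ℂ)) 0 := by
      refine ContinuousAt.comp (g := ψ₁) (f := fun ρ : ℝ => ((1 - ρ : ℝ) : ℂ)) ?_ (by fun_prop)
      simp only [sub_zero, ofReal_one]
      exact hψ₁.continuousOn.continuousAt (ball_mem_nhds _ hR0)
    have := hc.tendsto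
    simp only [sub_zero, ofReal_one] at this
    exact tendsto_nhdsWithin_of_tendsto_nhds this
  have hlim' := (hb0.mul hψt0).sub (hb1.mul hψt1)
  rw [zero_mul, zero_mul, sub_zero] at hlim'
  refine betaIntegral_ne_zero (hre 0) (hre 1) (tendsto_nhds_unique hlim (hlim'.congr' ?_))
  filter_upwards [Ioo_mem_nhdsGT (lt_min (lt_min hρ₀ hR0) one_half_pos)] with ρ hρ
  rw [← key ρ hρ.1 (hρ.2.trans_le (min_le_left _ _))]
  have hρ2 := hρ.2.trans_le (min_le_right (min ρ₀ R) (1 / 2))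
  refine intervalIntegral.integral_congr fun x hx => ?_
  rw [uIcc_of_le (by linarith)] at hx
  have hx0 : (x : ℂ) ≠ 0 := ofReal_ne_zero.mpr (by linarith [hx.1, hρ.1])
  have hx1 : (1 : ℂ) - x ≠ 0 := by
    rw [← ofReal_one, ← ofReal_sub]
    exact ofReal_ne_zero.mpr (by linarith [hx.2, hρ.1])
  have hx1' : (x : ℂ) - 1 ≠ 0 := fun e => hx1 (by linear_combination -e)
  have hc : conn ![1] r (x : ℂ) = 1 / (x * (1 - x)) := by
    rw [conn, Fin.sum_univ_two, hp0, hj₁]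
    simp only [hr, Matrix.cons_val_zero, Matrix.cons_val_one, sub_zero]
    field_simp
    ring
  -- The form `dx / (x (1 - x))` lowers both exponents by one, as in the convention of
  -- `betaIntegral`.
  rw [prod_factor_one, hc, cpow_sub _ _ hx0, cpow_sub _ _ hx1, cpow_one, cpow_one]
  push_cast
  field_simp

theorem Admissible.shift (h : Admissible K Q σ s) {s' : Fin (n + 1) → ℂ} {m : Fin (n + 1) → ℤ}
    (hs : ∀ k, s' k = s k + m k) : Admissible K Q σ s' where
  inj := h.inj
  puncture_mem := h.puncture_mem
  exponent_mem k := by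
    obtain ⟨t, ht⟩ := h.exponent_mem k
    exact ⟨t + m k, by rw [map_add, ht, map_intCast, hs]⟩
  monodromy_mem k := by
    obtain ⟨q, hq⟩ := h.monodromy_mem k
    refine ⟨q, hq.trans ?_⟩
    rw [hs, mul_add, exp_add]
    have : exp (2 * Real.pi * I * m k) = 1 := exp_eq_one_iff.mpr ⟨m k, by ring⟩
    rw [this, mul_one]
  nonint k j e := h.nonint k (j - m k) (by
    rw [hs] at e
    push_cast
    linear_combination e)
  nonint_sum j e := h.nonint_sum (j - ∑ k, m k) (by
    simp only [hs, Finset.sum_add_distrib] at e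
    push_cast
    linear_combination e)

/-- Multiplication by `x ^ N (1 - x) ^ N` carries boundaries to boundaries and the interval class to
the interval class, so the exponents may be assumed to have positive real part. -/
theorem IsRealised.φ₁_ne_zero {s : Fin 2 → ℂ} (ha : Admissible K Q ![1] s) (h : IsRealised K Q ![1] s) :
    h.φ₁ ≠ 0 := by
  obtain ⟨z, hz, e⟩ := h.interval.choose_spec.1
  have e' : h.φ₁ = evalCycle z := e
  rw [e']
  intro h0
  obtain ⟨w, hw⟩ := (evalCycle_eq_zero_iff z).mp h0
  obtain ⟨N, hN⟩ : ∃ N : ℕ, ∀ k, -(s k).re < N := by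
    obtain ⟨N, hN⟩ := exists_nat_gt (max (-(s 0).re) (-(s 1).re))
    refine ⟨N, fun k => ?_⟩
    fin_cases k
    · exact (le_max_left _ _).trans_lt hN
    · exact (le_max_right _ _).trans_lt hN
  have hs : ∀ k, s k + ((N : ℤ) : ℂ) = s k + ((fun _ => (N : ℤ)) k : ℤ) := fun k => rfl
  have ha' := ha.shift (s' := fun k => s k + ((N : ℤ) : ℂ)) hs
  obtain ⟨z', hz', hne⟩ := exists_interval_cycle_ne_zero ha' fun k => by
    have := hN k
    simp only [add_re, natCast_re, Int.cast_natCast]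
    linarith
  refine hne ?_
  rw [evalCycle_eq_of_isRegularisedInterval ha' hz' (hz.shift ha.ne_zero hs)]
  exact (evalCycle_eq_zero_iff _).mpr ⟨shiftChain Q hs w, by rw [boundary_shiftChain, hw]; rfl⟩

end TwistedPeriods
end

/-! ### Units among the periods of rank one objects, and the coaction on `ℱ^𝔪`. -/

noncomputable section
namespace TwistedPeriods

variable {K Q : Type} [Field K] [Field Q] [Algebra K ℂ] [Algebra Q ℂ]

/-! ### Objects of rank one -/

/-- In rank one the comparison is a single non-zero number `lam`. The object on `Q` and `K` with
comparison `lam⁻¹` is inverse to `V`, and the given functionals define the morphism from the tensor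
product to the unit object. -/
theorem exists_inverse_object (V : Obj K Q) (hB : Module.finrank Q V.B = 1) (hdR : Module.finrank K V.dR = 1)
    {σ : Module.Dual Q V.B} (hσ : σ ≠ 0) {ω : V.dR} {f : Module.Dual K V.dR} (hf : f ω = 1) :
    ∃ (W : Obj K Q) (τ : Module.Dual Q W.B) (g : Module.Dual K W.dR) (η : W.dR)
      (φ : V.tensor W ⟶ Obj.unit K Q),
      Obj.Hom.B φ = dualDistrib Q V.B W.B (σ ⊗ₜ τ) ∧ Obj.Hom.dR φ = dualDistrib K V.dR W.dR (f ⊗ₜ g) ∧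
        g η = 1 := by
  obtain ⟨v₀, hv₀⟩ : ∃ v, σ v ≠ 0 := by
    by_contra! h
    exact hσ (LinearMap.ext h)
  have hv : ∀ v, v = (σ v / σ v₀) • v₀ := fun v => by
    obtain ⟨c, rfl⟩ := exists_smul_eq_of_finrank_eq_one hB (fun e => hv₀ (by rw [e, map_zero]) : v₀ ≠ 0) v
    rw [map_smul, smul_eq_mul, mul_div_cancel_right₀ _ hv₀]
  have hω : ∀ w, w = f w • ω := fun w => by
    obtain ⟨c, rfl⟩ := exists_smul_eq_of_finrank_eq_one hdR
      (fun e => one_ne_zero (hf.symm.trans (by rw [e, map_zero])) : ω ≠ 0) w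
    rw [map_smul, hf, smul_eq_mul, mul_one]
  have hσi : ∀ u : ℂ ⊗[Q] V.B, u = (extendForm σ u * (algebraMap Q ℂ (σ v₀))⁻¹) ⊗ₜ[Q] v₀ := fun u => by
    induction u using TensorProduct.induction_on with
    | zero => simp
    | add x y hx hy => rw [map_add, add_mul, add_tmul, ← hx, ← hy]
    | tmul a v =>
      conv_lhs => rw [hv v]
      rw [extendForm_tmul, tmul_smul, smul_tmul', Algebra.smul_def, map_div₀]
      congr 1
      ring
  obtain ⟨lam, hlam⟩ : ∃ lam, lam = extendForm σ (V.comp (1 ⊗ₜ ω)) := ⟨_, rfl⟩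
  have hlam0 : lam ≠ 0 := fun e => by
    have h1 := hσi (V.comp (1 ⊗ₜ ω))
    rw [← hlam, e, zero_mul, zero_tmul, LinearEquiv.map_eq_zero_iff] at h1
    have h2 := extendForm_tmul f 1 ω
    rw [h1, map_zero, hf, map_one, mul_one] at h2
    exact zero_ne_one h2
  let W : Obj K Q :=
    { B := Q
      dR := K
      comp := (AlgebraTensorModule.rid K ℂ ℂ).trans
        ((LinearEquiv.smulOfNeZero ℂ ℂ lam⁻¹ (inv_ne_zero hlam0)).trans (AlgebraTensorModule.rid Q ℂ ℂ).symm) }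
  have hbase : ∀ (u : ℂ ⊗[Q] V.B) (z : ℂ),
      LinearMap.baseChange ℂ (dualDistrib Q V.B Q (σ ⊗ₜ LinearMap.id))
        ((AlgebraTensorModule.distribBaseChange Q ℂ V.B Q).symm (u ⊗ₜ (z ⊗ₜ 1))) =
      (extendForm σ u * z) ⊗ₜ[Q] (1 : Q) := fun u z => by
    induction u using TensorProduct.induction_on with
    | zero => simp
    | add x y hx hy => rw [add_tmul, map_add, map_add, hx, hy, map_add, add_mul, add_tmul]
    | tmul a v =>
      have e : (AlgebraTensorModule.distribBaseChange Q ℂ V.B Q).symm ((a ⊗ₜ v) ⊗ₜ (z ⊗ₜ 1)) =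
          (a * z) ⊗ₜ (v ⊗ₜ 1) := by
        rw [LinearEquiv.symm_apply_eq]
        have h1 : (a * z) ⊗ₜ[Q] (v ⊗ₜ[Q] (1 : Q)) = (a * z) • ((1 : ℂ) ⊗ₜ[Q] (v ⊗ₜ[Q] (1 : Q))) := by
          rw [smul_tmul', smul_eq_mul, mul_one]
        have h2 : (a ⊗ₜ[Q] v) ⊗ₜ[ℂ] (z ⊗ₜ[Q] (1 : Q)) =
            (a * z) • (((1 : ℂ) ⊗ₜ[Q] v) ⊗ₜ[ℂ] ((1 : ℂ) ⊗ₜ[Q] (1 : Q))) := by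
          rw [← smul_tmul_smul, smul_tmul', smul_tmul', smul_eq_mul, smul_eq_mul, mul_one, mul_one]
        rw [h1, h2, map_smul]
        congr 1
      rw [e, LinearMap.baseChange_tmul, extendForm_tmul]
      have h3 : dualDistrib Q V.B Q (σ ⊗ₜ LinearMap.id) (v ⊗ₜ (1 : Q)) = σ v • (1 : Q) := by
        simp [dualDistrib_apply]
      rw [h3, tmul_smul, smul_tmul', Algebra.smul_def]
      congr 1
      ring
  refine ⟨W, LinearMap.id, LinearMap.id, (1 : K),
    (show Obj.Hom (V.tensor W) (Obj.unit K Q) from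
      ⟨dualDistrib Q V.B Q (σ ⊗ₜ LinearMap.id), dualDistrib K V.dR K (f ⊗ₜ LinearMap.id), fun x => ?_⟩),
    rfl, rfl, rfl⟩
  have hgen : ∀ x : ℂ ⊗[K] (V.dR ⊗[K] K), ∃ z : ℂ, x = z • ((1 : ℂ) ⊗ₜ[K] (ω ⊗ₜ[K] (1 : K))) := fun x => by
    induction x using TensorProduct.induction_on with
    | zero => exact ⟨0, by simp⟩
    | add x y hx hy =>
      obtain ⟨z, hz⟩ := hx
      obtain ⟨z', hz'⟩ := hy
      exact ⟨z + z', by rw [hz, hz', add_smul]⟩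
    | tmul a v =>
      have hv : ∃ k : K, v = k • (ω ⊗ₜ[K] (1 : K)) := by
        induction v using TensorProduct.induction_on with
        | zero => exact ⟨0, by simp⟩
        | add x y hx hy =>
          obtain ⟨z, hz⟩ := hx
          obtain ⟨z', hz'⟩ := hy
          exact ⟨z + z', by rw [hz, hz', add_smul]⟩
        | tmul w k =>
          refine ⟨f w * k, ?_⟩
          rw [← smul_tmul_smul, ← hω, smul_eq_mul, mul_one]
      obtain ⟨k, rfl⟩ := hv
      exact ⟨a * algebraMap K ℂ k, by rw [tmul_smul, smul_tmul', smul_tmul', Algebra.smul_def, smul_eq_mul, mul_one, mul_comm]⟩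
  obtain ⟨z, rfl⟩ := hgen x
  have e1 : (V.tensor W).comp ((1 : ℂ) ⊗ₜ[K] (ω ⊗ₜ[K] (1 : K))) =
      (AlgebraTensorModule.distribBaseChange Q ℂ V.B Q).symm (V.comp (1 ⊗ₜ ω) ⊗ₜ (lam⁻¹ ⊗ₜ 1)) := by
    have : W.comp ((1 : ℂ) ⊗ₜ[K] (1 : K)) = lam⁻¹ ⊗ₜ (1 : Q) := by
      simp [W]
    rw [← this]
    rfl
  have e2 : LinearMap.baseChange ℂ (dualDistrib Q V.B Q (σ ⊗ₜ LinearMap.id))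
      ((V.tensor W).comp ((1 : ℂ) ⊗ₜ[K] (ω ⊗ₜ[K] (1 : K)))) = (1 : ℂ) ⊗ₜ[Q] (1 : Q) := by
    rw [e1, hbase, ← hlam, mul_inv_cancel₀ hlam0]
  have e3 : (Obj.unit K Q).comp (LinearMap.baseChange ℂ (dualDistrib K V.dR K (f ⊗ₜ LinearMap.id))
      ((1 : ℂ) ⊗ₜ[K] (ω ⊗ₜ[K] (1 : K)))) = (1 : ℂ) ⊗ₜ[Q] (1 : Q) := by
    rw [LinearMap.baseChange_tmul]
    have : dualDistrib K V.dR K (f ⊗ₜ LinearMap.id) (ω ⊗ₜ (1 : K)) = 1 := by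
      simp [dualDistrib_apply, hf]
    rw [this]
    simp [Obj.unit]
  rw [map_smul, map_smul, map_smul, map_smul]
  exact congrArg (z • ·) (e3.trans e2.symm)

variable [CharZero K] [CharZero Q]

/-- Naturality along the morphism to the unit object, with the tensor relation, exhibits the matrix
coefficient of the inverse object as an inverse. -/
theorem isUnit_mot (V : Obj K Q) (hB : Module.finrank Q V.B = 1) (hdR : Module.finrank K V.dR = 1)
    {σ : Module.Dual Q V.B} (hσ : σ ≠ 0) {ω : V.dR} {f : Module.Dual K V.dR} (hf : f ω = 1) :
    IsUnit (mot V σ ω) := by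
  obtain ⟨W, τ, g, η, φ, h1, h2, h3⟩ := exists_inverse_object V hB hdR hσ hf
  have h := mot_naturality φ (LinearMap.id : Q →ₗ[Q] Q) (ω ⊗ₜ[K] η)
  have e : Obj.Hom.dR φ (ω ⊗ₜ[K] η) = (1 : K) := by
    rw [h2]
    simp [dualDistrib_apply, hf, h3]
  rw [e, mot_unit, LinearMap.id_comp, h1, mot_tensor] at h
  exact IsUnit.of_mul_eq_one _ h

/-- The same argument; the auxiliary Betti functional may be any non-zero one. -/
theorem isUnit_dr (V : Obj K Q) (hB : Module.finrank Q V.B = 1) (hdR : Module.finrank K V.dR = 1)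
    {ω : V.dR} {f : Module.Dual K V.dR} (hf : f ω = 1) : IsUnit (dr V f ω) := by
  have : Nontrivial V.B := Module.nontrivial_of_finrank_pos (R := Q) (by omega)
  obtain ⟨v, hv⟩ := exists_ne (0 : V.B)
  obtain ⟨σ, hσv⟩ := Module.Projective.exists_dual_ne_zero Q hv
  have hσ : σ ≠ 0 := fun e => hσv (by rw [e, LinearMap.zero_apply])
  obtain ⟨W, τ, g, η, φ, h1, h2, h3⟩ := exists_inverse_object V hB hdR hσ hf
  have h := dr_naturality φ (LinearMap.id : K →ₗ[K] K) (ω ⊗ₜ[K] η)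
  have e : Obj.Hom.dR φ (ω ⊗ₜ[K] η) = (1 : K) := by
    rw [h2]
    simp [dualDistrib_apply, hf, h3]
  rw [e, dr_unit, LinearMap.id_comp, h2, dr_tensor] at h
  exact IsUnit.of_mul_eq_one _ h

end TwistedPeriods
end

noncomputable section
namespace TwistedPeriods

variable {n : ℕ} {σ : Fin n → ℂ} {s : Fin (n + 1) → ℂ} {K Q : Type} [Field K] [Field Q] [Algebra K ℂ]
  [Algebra Q ℂ]

/-! ### Motivic beta and hypergeometric functions -/

theorem exists_basis_of_biorthogonal {k V : Type} [Field k] [AddCommGroup V] [Module k V] [FiniteDimensional k V]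
    (hn : Module.finrank k V = n) (e : Fin n → V) (g : Fin n → Module.Dual k V)
    (h : ∀ i j, g i (e j) = if j = i then 1 else 0) :
    ∃ b : Module.Basis (Fin n) k V, (∀ i, b i = e i) ∧ ∀ i, b.coord i = g i := by
  have hli : LinearIndependent k e := by
    rw [Fintype.linearIndependent_iff]
    intro x hx i
    have := congrArg (g i) hx
    simpa [h] using this
  have hb := coe_basisOfLinearIndependentOfCardEqFinrank' e hli (by simp [hn])
  refine ⟨basisOfLinearIndependentOfCardEqFinrank' e hli (by simp [hn]), fun i => congrFun hb i, fun i => ?_⟩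
  refine Module.Basis.ext (basisOfLinearIndependentOfCardEqFinrank' e hli (by simp [hn])) fun j => ?_
  rw [Module.Basis.coord_apply, Module.Basis.repr_self, congrFun hb j, h, Finsupp.single_apply]

theorem finrank_HdR (h : Admissible K Q σ s) : Module.finrank K (HdR K σ s) = n := by
  obtain ⟨b, -⟩ := exists_dR_basis h
  rw [Module.finrank_eq_card_basis b, Fintype.card_fin]

/-- The residue formula requires `r` to have sum zero, which fails for `η₂` because of its pole at
infinity. Subtracting a multiple of `∇_{-s} 1` from the first argument produces the correction term.
-/
theorem IsRealised.dual_logForm (ha : Admissible K Q σ s) (h : IsRealised K Q σ s) {t : Fin (n + 1) → K}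
    (ht : ∀ k, algebraMap K ℂ (t k) = s k) (r r' : Fin (n + 1) → K) :
    h.dual (logForm K σ r) (dRClass K σ s (logForm K σ r')) =
      -∑ k, r k * r' k / t k + (∑ k, r k) * (∑ k, r' k) / ∑ k, t k := by
  have ht0 : ∀ k, t k ≠ 0 := fun k e => ha.nonint k 0 (by rw [← ht, e]; simp)
  have hT : ∑ k, t k ≠ 0 := fun e => ha.nonint_sum 0 (by
    simp only [← ht]
    rw [← map_sum, e]
    simp)
  obtain ⟨P, hP, hform⟩ := exists_pairing ha ht
  have hP' : h.pairing.choose = P := IsDRPairing.unique ha h.pairing.choose_spec.1 hP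
  set q := (∑ k, r k) / ∑ k, t k with hq
  have hc : dRClass K σ (-s) (logForm K σ r) = dRClass K σ (-s) (logForm K σ (r - q • t)) := by
    refine ((Submodule.Quotient.eq _).mpr ?_)
    rw [← map_sub, sub_sub_cancel, map_smul]
    refine Submodule.smul_mem _ _ ?_
    have := nabla_one_mem (K := K) (σ := σ) (s := -s) (t := -t) fun k => by
      rw [Pi.neg_apply, Pi.neg_apply, map_neg, ht]
    rw [map_neg] at this
    simpa using Submodule.neg_mem _ this
  rw [IsRealised.dual, hP', hc, hform _ _ (by
    simp only [Pi.sub_apply, Pi.smul_apply, smul_eq_mul, Finset.sum_sub_distrib, ← Finset.mul_sum]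
    rw [hq, div_mul_cancel₀ _ hT, sub_self])]
  have e : ∀ k, (r - q • t) k * r' k / t k = r k * r' k / t k - q * r' k := fun k => by
    have := ht0 k
    simp only [Pi.sub_apply, Pi.smul_apply, smul_eq_mul]
    field_simp
  rw [Finset.sum_congr rfl fun k _ => e k, Finset.sum_sub_distrib, ← Finset.mul_sum, hq]
  ring

section forms

variable {y : K}

theorem hyp_ne (hy : y ≠ 0) (x : Line (hypPunctures (algebraMap K ℂ y))) :
    (x : ℂ) ≠ 0 ∧ (x : ℂ) - 1 ≠ 0 ∧ 1 - algebraMap K ℂ y * x ≠ 0 := by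
  refine ⟨mem_Line_iff.mp x.2 0, sub_ne_zero.mpr (mem_Line_iff.mp x.2 1), fun e => mem_Line_iff.mp x.2 2 ?_⟩
  have hy' : algebraMap K ℂ y ≠ 0 := by simpa using hy
  change (x : ℂ) = (algebraMap K ℂ y)⁻¹
  refine eq_inv_of_mul_eq_one_left ?_
  linear_combination -e

theorem hyp_logForm_apply (hy : y ≠ 0) (r : Fin 3 → K) (x : Line (hypPunctures (algebraMap K ℂ y))) :
    (logForm K (hypPunctures (algebraMap K ℂ y)) r : Line (hypPunctures (algebraMap K ℂ y)) → ℂ) x =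
      algebraMap K ℂ (r 0) / x + algebraMap K ℂ (r 1) / (x - 1) -
        algebraMap K ℂ (r 2) * algebraMap K ℂ y / (1 - algebraMap K ℂ y * x) := by
  obtain ⟨-, -, h2⟩ := hyp_ne hy x
  have hy' : algebraMap K ℂ y ≠ 0 := by simpa using hy
  have p2 : puncture (hypPunctures (algebraMap K ℂ y)) 2 = (algebraMap K ℂ y)⁻¹ := rfl
  have p1 : puncture (hypPunctures (algebraMap K ℂ y)) 1 = 1 := rfl
  have p0 : puncture (hypPunctures (algebraMap K ℂ y)) 0 = 0 := rfl
  rw [logForm_apply, conn, Fin.sum_univ_three, p0, p1, p2, sub_zero]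
  have e : (x : ℂ) - (algebraMap K ℂ y)⁻¹ = -((1 - algebraMap K ℂ y * x) / algebraMap K ℂ y) := by
    field_simp
    ring
  rw [e, div_neg, div_div_eq_mul_div, ← sub_eq_add_neg]

theorem hyp_η₁ (hy : y ≠ 0) (q : K) :
    q • η₁ K (hypPunctures (algebraMap K ℂ y)) rfl = logForm K _ ![q, -q, 0] := by
  refine regular_ext fun x => ?_
  obtain ⟨h0, h1, -⟩ := hyp_ne hy x
  have h1' : (1 : ℂ) - x ≠ 0 := fun e => h1 (by linear_combination -e)
  rw [hyp_logForm_apply hy, coe_smul_apply]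
  change _ * (1 / ((x : ℂ) * (1 - x))) = _
  simp only [Matrix.cons_val, map_neg, map_zero]
  field_simp
  ring

theorem hyp_η₂ (hy : y ≠ 0) (q : K) : q • η₂ y hy = logForm K _ ![0, 0, -(q / y)] := by
  refine regular_ext fun x => ?_
  have hy' : algebraMap K ℂ y ≠ 0 := by simpa using hy
  obtain ⟨-, -, h2⟩ := hyp_ne hy x
  rw [hyp_logForm_apply hy, coe_smul_apply]
  change _ * (1 / (1 - algebraMap K ℂ y * (x : ℂ))) = _
  simp only [Matrix.cons_val, map_neg, map_zero, map_div₀]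
  field_simp
  ring

theorem one_ne (x : Line ![(1 : ℂ)]) : (x : ℂ) ≠ 0 ∧ (x : ℂ) - 1 ≠ 0 :=
  ⟨mem_Line_iff.mp x.2 0, sub_ne_zero.mpr (mem_Line_iff.mp x.2 1)⟩

theorem one_logForm_apply (r : Fin 2 → K) (x : Line ![(1 : ℂ)]) :
    (logForm K ![(1 : ℂ)] r : Line ![(1 : ℂ)] → ℂ) x =
      algebraMap K ℂ (r 0) / x + algebraMap K ℂ (r 1) / (x - 1) := by
  have p1 : puncture ![(1 : ℂ)] 1 = 1 := rfl
  have p0 : puncture ![(1 : ℂ)] 0 = 0 := rfl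
  rw [logForm_apply, conn, Fin.sum_univ_two, p0, p1, sub_zero]

theorem one_η₁ (q : K) : q • η₁ K ![(1 : ℂ)] rfl = logForm K _ ![q, -q] := by
  refine regular_ext fun x => ?_
  obtain ⟨h0, h1⟩ := one_ne x
  have h1' : (1 : ℂ) - x ≠ 0 := fun e => h1 (by linear_combination -e)
  rw [one_logForm_apply, coe_smul_apply]
  change _ * (1 / ((x : ℂ) * (1 - x))) = _
  simp only [Matrix.cons_val, map_neg]
  field_simp
  ring

end forms

namespace HypRealised

variable [CharZero K] [CharZero Q] {a b c y : K}

/-- The coaction is computed in the basis `η₁, η₂`, whose dual basis is given by multiples of `-η₁`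
and `-y η₂` under the pairing. The coefficient of `φ₁` on `η₂` is identified with the shifted
function. -/
theorem coaction_calFMot (h : HypRealised K Q a b c y) (h' : HypRealised K Q (1 + a) (1 + b) (2 + c) y)
    (hA : Admissible K Q (hypPunctures (algebraMap K ℂ y))
      ![algebraMap K ℂ b, algebraMap K ℂ (c - b), algebraMap K ℂ (-a)])
    (hy : y ≠ 0) (ha0 : a ≠ 0) (hb0 : b ≠ 0) (hc0 : c ≠ 0) (hca0 : c - a ≠ 0) (hcb0 : c - b ≠ 0) :
    coaction K Q h.calFMot = (b * (c - b) / c) • (h.calFMot ⊗ₜ[K] h.calFDR)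
      - (y * (a * (c - a) / c)) • (h'.calFMot ⊗ₜ[K] h.calGDR hy) := by
  have ht : ∀ k, algebraMap K ℂ ((![b, c - b, -a] : Fin 3 → K) k) =
      (![algebraMap K ℂ b, algebraMap K ℂ (c - b), algebraMap K ℂ (-a)] : Fin 3 → ℂ) k := fun k => by
    fin_cases k <;> rfl
  have hp : ∀ r r' : Fin 3 → K, h.hyp.dual (logForm K _ r) (dRClass K _ _ (logForm K _ r')) =
      -(r 0 * r' 0 / b + r 1 * r' 1 / (c - b) + r 2 * r' 2 / -a) +
        (r 0 + r 1 + r 2) * (r' 0 + r' 1 + r' 2) / (b + (c - b) + -a) := fun r r' => by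
    refine (h.hyp.dual_logForm hA ht r r').trans ?_
    rw [Fin.sum_univ_three, Fin.sum_univ_three, Fin.sum_univ_three, Fin.sum_univ_three]
    rfl
  have e₁ := hyp_η₁ (K := K) hy 1
  have e₁' := hyp_η₁ (K := K) hy (-1)
  have e₂ := hyp_η₂ (K := K) hy 1
  have e₂' := hyp_η₂ (K := K) hy (-y)
  rw [one_smul] at e₁ e₂
  rw [neg_one_smul] at e₁'
  rw [neg_smul] at e₂'
  have hs : b + (c - b) + -a ≠ 0 := by
    have : b + (c - b) + -a = c - a := by ring
    rwa [this]
  -- The residues of `η₁` are `1, -1, 0`, so `⟨-η₁, η₁⟩ = 1/b + 1/(c - b) = c / (b (c - b))`.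
  have a00 : (b * (c - b) / c) * h.hyp.dual (-η₁ K (hypPunctures (algebraMap K ℂ y)) rfl)
      (dRClass K _ _ (η₁ K (hypPunctures (algebraMap K ℂ y)) rfl)) = 1 := by
    rw [e₁', e₁, hp]
    simp only [Matrix.cons_val]
    field_simp
    ring
  have a01 : (b * (c - b) / c) * h.hyp.dual (-η₁ K (hypPunctures (algebraMap K ℂ y)) rfl)
      (dRClass K _ _ (η₂ y hy)) = 0 := by
    rw [e₁', e₂, hp]
    simp
  have a10 : (-(y * (a * (c - a) / c))) * h.hyp.dual (-(y • η₂ y hy))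
      (dRClass K _ _ (η₁ K (hypPunctures (algebraMap K ℂ y)) rfl)) = 0 := by
    rw [e₂', e₁, hp]
    simp
  -- Here `-y η₂` has residue `1` and `η₂` has residue `-1/y` at `y⁻¹`. The exponent there is `-a`
  -- and the exponent sum is `c - a`, so the pairing is `-(1/y)(1/a + 1/(c - a)) = -c / (y a (c -
  -- a))`.
  have a11 : (-(y * (a * (c - a) / c))) * h.hyp.dual (-(y • η₂ y hy)) (dRClass K _ _ (η₂ y hy)) = 1 := by
    have hs' : b + (c - b) + -a = c - a := by ring
    rw [e₂', e₂, hp, hs']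
    simp only [Matrix.cons_val]
    field_simp
    ring
  have := h.hyp.finite_dR
  obtain ⟨e, he, hg⟩ := exists_basis_of_biorthogonal (finrank_HdR hA)
    ![dRClass K _ _ (η₁ K (hypPunctures (algebraMap K ℂ y)) rfl), dRClass K _ _ (η₂ y hy)]
    ![(b * (c - b) / c) • h.hyp.dual (-η₁ K (hypPunctures (algebraMap K ℂ y)) rfl),
      (-(y * (a * (c - a) / c))) • h.hyp.dual (-(y • η₂ y hy))] (fun i j => by
    fin_cases i <;> fin_cases j
    exacts [a00, a01, a10, a11])
  -- Passing to `(1+a, 1+b, 2+c)` adds `(1, 1, -1)` to the exponents, which is multiplication by `x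
  -- (1 - x) / (1 - y x)`; this factor turns `η₁` into `η₂`.
  have h2 : mot h.hyp.M h.hyp.φ₁ (dRClass K _ _ (η₂ y hy)) = h'.calFMot := by
    have hs : ∀ k, (![algebraMap K ℂ (1 + b), algebraMap K ℂ (2 + c - (1 + b)), algebraMap K ℂ (-(1 + a))] : Fin 3 → ℂ) k =
        (![algebraMap K ℂ b, algebraMap K ℂ (c - b), algebraMap K ℂ (-a)] : Fin 3 → ℂ) k +
          ((![1, 1, -1] : Fin 3 → ℤ) k : ℂ) := fun k => by
      fin_cases k
      · change algebraMap K ℂ (1 + b) = algebraMap K ℂ b + ((1 : ℤ) : ℂ)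
        rw [map_add, map_one, Int.cast_one, add_comm]
      · change algebraMap K ℂ (2 + c - (1 + b)) = algebraMap K ℂ (c - b) + ((1 : ℤ) : ℂ)
        rw [Int.cast_one, ← map_one (algebraMap K ℂ), ← map_add]
        congr 1
        ring
      · change algebraMap K ℂ (-(1 + a)) = algebraMap K ℂ (-a) + ((-1 : ℤ) : ℂ)
        rw [Int.cast_neg, Int.cast_one, ← map_one (algebraMap K ℂ), ← map_neg, ← map_add]
        congr 1
        ring
    have hsh := motPeriod_shift hA h.hyp h'.hyp hs
      (η := regX K _ * (1 - regX K _) * η₂ y hy) (fun x => by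
        obtain ⟨-, -, h2⟩ := hyp_ne hy x
        have f1 : factor (hypPunctures (algebraMap K ℂ y)) 1 (x : ℂ) = 1 - (x : ℂ) / 1 := rfl
        have f2 : factor (hypPunctures (algebraMap K ℂ y)) 2 (x : ℂ) = 1 - (x : ℂ) / (algebraMap K ℂ y)⁻¹ := rfl
        have f0 : factor (hypPunctures (algebraMap K ℂ y)) 0 (x : ℂ) = x := rfl
        rw [factorProd, Fin.prod_univ_three, f0, f1, f2]
        change (x : ℂ) * (1 - x) * (1 / (1 - algebraMap K ℂ y * x)) = _
        simp only [Matrix.cons_val, zpow_one, zpow_neg, div_one, div_inv_eq_mul, one_div, mul_comm (x : ℂ) (algebraMap K ℂ y)])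
      (η₁ K (hypPunctures (algebraMap K ℂ y)) rfl)
    have hm : regX K _ * (1 - regX K _) * η₂ y hy * η₁ K (hypPunctures (algebraMap K ℂ y)) rfl = η₂ y hy := by
      refine regular_ext fun x => ?_
      obtain ⟨h0, h1, h2⟩ := hyp_ne hy x
      have h1' : (1 : ℂ) - x ≠ 0 := fun e => h1 (by linear_combination -e)
      change (x : ℂ) * (1 - x) * (1 / (1 - algebraMap K ℂ y * x)) * (1 / (x * (1 - x))) =
        1 / (1 - algebraMap K ℂ y * x)
      field_simp
    rw [hm] at hsh
    exact hsh.symm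
  have hco := coaction_mot h.hyp.M h.hyp.φ₁ (dRClass K _ _ (η₁ K (hypPunctures (algebraMap K ℂ y)) rfl))
    (show Module.Basis (Fin 2) K h.hyp.M.dR from e)
  refine hco.trans ?_
  rw [Fin.sum_univ_two]
  have hb0 : mot h.hyp.M h.hyp.φ₁ ((show Module.Basis (Fin 2) K h.hyp.M.dR from e) 0) = h.calFMot :=
    congrArg (mot h.hyp.M h.hyp.φ₁) (he 0)
  have hb1 : mot h.hyp.M h.hyp.φ₁ ((show Module.Basis (Fin 2) K h.hyp.M.dR from e) 1) = h'.calFMot :=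
    (congrArg (mot h.hyp.M h.hyp.φ₁) (he 1)).trans h2
  have hd0 : dr h.hyp.M ((show Module.Basis (Fin 2) K h.hyp.M.dR from e).coord 0)
      (dRClass K _ _ (η₁ K (hypPunctures (algebraMap K ℂ y)) rfl)) = (b * (c - b) / c) • h.calFDR :=
    (congrArg (fun f => dr h.hyp.M f (dRClass K _ _ (η₁ K (hypPunctures (algebraMap K ℂ y)) rfl))) (hg 0)).trans
      (dr_smul_left _ _ _ _)
  have hd1 : dr h.hyp.M ((show Module.Basis (Fin 2) K h.hyp.M.dR from e).coord 1)
      (dRClass K _ _ (η₁ K (hypPunctures (algebraMap K ℂ y)) rfl)) =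
        (-(y * (a * (c - a) / c))) • h.calGDR hy :=
    (congrArg (fun f => dr h.hyp.M f (dRClass K _ _ (η₁ K (hypPunctures (algebraMap K ℂ y)) rfl))) (hg 1)).trans
      (dr_smul_left _ _ _ _)
  rw [hb0, hb1, hd0, hd1, tmul_smul, tmul_smul, neg_smul, ← sub_eq_add_neg]

end HypRealised

end TwistedPeriods
end

/-! ### The beta periods and the normalised coaction formula. -/

noncomputable section
namespace TwistedPeriods

variable {K Q : Type} [Field K] [Field Q] [Algebra K ℂ] [Algebra Q ℂ]

namespace HypRealised

variable [CharZero K] [CharZero Q] {a b c y : K}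

theorem beta_pairing (h : HypRealised K Q a b c y)
    (hB : Admissible K Q ![1] ![algebraMap K ℂ b, algebraMap K ℂ (c - b)])
    (hb0 : b ≠ 0) (hc0 : c ≠ 0) (hcb0 : c - b ≠ 0) :
    ((b * (c - b) / c) • h.beta.dual (-η₁ K ![1] rfl)) (dRClass K _ _ (η₁ K ![1] rfl)) = 1 := by
  have ht : ∀ k, algebraMap K ℂ ((![b, c - b] : Fin 2 → K) k) =
      (![algebraMap K ℂ b, algebraMap K ℂ (c - b)] : Fin 2 → ℂ) k := fun k => by
    fin_cases k <;> rfl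
  have hp : ∀ r r' : Fin 2 → K, h.beta.dual (logForm K _ r) (dRClass K _ _ (logForm K _ r')) =
      -(r 0 * r' 0 / b + r 1 * r' 1 / (c - b)) +
        (r 0 + r 1) * (r' 0 + r' 1) / (b + (c - b)) := fun r r' => by
    refine (h.beta.dual_logForm hB ht r r').trans ?_
    rw [Fin.sum_univ_two, Fin.sum_univ_two, Fin.sum_univ_two, Fin.sum_univ_two]
    rfl
  have e₁ := one_η₁ (K := K) 1
  have e₁' := one_η₁ (K := K) (-1)
  rw [one_smul] at e₁
  rw [neg_one_smul] at e₁'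
  rw [LinearMap.smul_apply, smul_eq_mul, e₁', e₁, hp, add_sub_cancel]
  simp only [Matrix.cons_val]
  field_simp
  ring

/-- The cohomology has rank one, so `η₁` alone is a basis; the constant is the inverse of `⟨-η₁, η₁⟩
= c / (b (c - b))`. -/
theorem coaction_betaMot (h : HypRealised K Q a b c y)
    (hB : Admissible K Q ![1] ![algebraMap K ℂ b, algebraMap K ℂ (c - b)])
    (hb0 : b ≠ 0) (hc0 : c ≠ 0) (hcb0 : c - b ≠ 0) :
    coaction K Q h.betaMot = (b * (c - b) / c) • (h.betaMot ⊗ₜ[K] h.betaDR) := by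
  have := h.beta.finite_dR
  obtain ⟨e, he, hg⟩ := exists_basis_of_biorthogonal (finrank_HdR hB)
    (fun _ => dRClass K _ _ (η₁ K ![1] rfl)) (fun _ => (b * (c - b) / c) • h.beta.dual (-η₁ K ![1] rfl))
    (fun i j => by
      rw [if_pos (Subsingleton.elim j i)]
      exact h.beta_pairing hB hb0 hc0 hcb0)
  obtain ⟨e', he'⟩ : ∃ e' : Module.Basis (Fin 1) K h.beta.M.dR, e' = e := ⟨e, rfl⟩
  refine (coaction_mot h.beta.M h.beta.φ₁ (dRClass K _ _ (η₁ K ![1] rfl)) e').trans ?_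
  rw [Fin.sum_univ_one]
  have hb : mot h.beta.M h.beta.φ₁ (e' 0) = h.betaMot := by
    rw [he']
    exact congrArg (mot h.beta.M h.beta.φ₁) (he 0)
  have hd : dr h.beta.M (e'.coord 0) (dRClass K _ _ (η₁ K ![1] rfl)) = (b * (c - b) / c) • h.betaDR := by
    rw [he']
    exact (congrArg (fun f => dr h.beta.M f (dRClass K _ _ (η₁ K ![1] rfl))) (hg 0)).trans (dr_smul_left _ _ _ _)
  rw [hb, hd, tmul_smul]

theorem isUnit_betaMot (h : HypRealised K Q a b c y)
    (hB : Admissible K Q ![1] ![algebraMap K ℂ b, algebraMap K ℂ (c - b)])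
    (hb0 : b ≠ 0) (hc0 : c ≠ 0) (hcb0 : c - b ≠ 0) : IsUnit h.betaMot :=
  isUnit_mot h.beta.M (finrank_HB hB) (finrank_HdR hB) (h.beta.φ₁_ne_zero hB) (h.beta_pairing hB hb0 hc0 hcb0)

theorem isUnit_betaDR (h : HypRealised K Q a b c y)
    (hB : Admissible K Q ![1] ![algebraMap K ℂ b, algebraMap K ℂ (c - b)])
    (hb0 : b ≠ 0) (hc0 : c ≠ 0) (hcb0 : c - b ≠ 0) : IsUnit h.betaDR := by
  have h1 := isUnit_dr h.beta.M (finrank_HB hB) (finrank_HdR hB) (h.beta_pairing hB hb0 hc0 hcb0)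
  have h2 : IsUnit ((b * (c - b) / c) • h.betaDR) := (congrArg IsUnit (dr_smul_left h.beta.M _ _ _)).mp h1
  rw [Algebra.smul_def] at h2
  exact isUnit_of_mul_isUnit_right h2

/-- The motivic form of the recursion of the beta function. Multiplication by `x (1 - x)` turns `η₁`
into `dx`, and `dx` is a multiple of `η₁` modulo exact forms. -/
theorem betaMot_shift (h : HypRealised K Q a b c y) (h' : HypRealised K Q (1 + a) (1 + b) (2 + c) y)
    (hB : Admissible K Q ![1] ![algebraMap K ℂ b, algebraMap K ℂ (c - b)])
    (hc0 : c ≠ 0) (hc1 : 1 + c ≠ 0) :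
    h'.betaMot = (b * (c - b) / c / (1 + c)) • h.betaMot := by
  have hs : ∀ k, (![algebraMap K ℂ (1 + b), algebraMap K ℂ (2 + c - (1 + b))] : Fin 2 → ℂ) k =
      (![algebraMap K ℂ b, algebraMap K ℂ (c - b)] : Fin 2 → ℂ) k + ((1 : Fin 2 → ℤ) k : ℂ) := fun k => by
    fin_cases k
    · change algebraMap K ℂ (1 + b) = algebraMap K ℂ b + ((1 : ℤ) : ℂ)
      rw [map_add, map_one, Int.cast_one, add_comm]
    · change algebraMap K ℂ (2 + c - (1 + b)) = algebraMap K ℂ (c - b) + ((1 : ℤ) : ℂ)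
      rw [Int.cast_one, ← map_one (algebraMap K ℂ), ← map_add]
      congr 1
      ring
  have hsh := motPeriod_shift hB h.beta h'.beta hs (η := regX K _ * (1 - regX K _)) (fun x => by
    have f1 : factor ![(1 : ℂ)] 1 (x : ℂ) = 1 - (x : ℂ) / 1 := rfl
    have f0 : factor ![(1 : ℂ)] 0 (x : ℂ) = x := rfl
    rw [factorProd, Fin.prod_univ_two, f0, f1]
    change (x : ℂ) * (1 - x) = _
    simp) (η₁ K ![1] rfl)
  have hm : regX K _ * (1 - regX K _) * η₁ K ![1] rfl = 1 := by
    refine regular_ext fun x => ?_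
    obtain ⟨h0, h1⟩ := one_ne x
    have h1' : (1 : ℂ) - x ≠ 0 := fun e => h1 (by linear_combination -e)
    change (x : ℂ) * (1 - x) * (1 / (x * (1 - x))) = 1
    field_simp
  -- The form is `∇(x - (c - b)/c)`; the constant is chosen so that the residues at `0` and `1` are
  -- opposite.
  have hex : (1 + c) • (1 : regular K ![(1 : ℂ)]) - (b * (c - b) / c) • η₁ K ![1] rfl ∈
      exactForms K ![1] ![algebraMap K ℂ b, algebraMap K ℂ (c - b)] := by
    have hc' : algebraMap K ℂ c ≠ 0 := by simpa using hc0
    refine mem_exactForms_of_hasDerivAt (f := fun x => x - algebraMap K ℂ ((c - b) / c))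
      (g := regX K _ - ((c - b) / c) • 1) (fun x => ?_) fun x => ?_
    · rw [coe_sub_apply, coe_smul_apply]
      change _ = (x : ℂ) - _ * 1
      rw [mul_one]
    · refine ((hasDerivAt_id (x : ℂ)).sub_const _).congr_deriv ?_
      obtain ⟨h0, h1⟩ := one_ne x
      have h1' : (1 : ℂ) - x ≠ 0 := fun e => h1 (by linear_combination -e)
      have p1 : puncture ![(1 : ℂ)] 1 = 1 := rfl
      have p0 : puncture ![(1 : ℂ)] 0 = 0 := rfl
      rw [coe_sub_apply, coe_smul_apply, coe_smul_apply, conn, Fin.sum_univ_two, p0, p1]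
      change _ = algebraMap K ℂ (1 + c) * 1 - _ * (1 / ((x : ℂ) * (1 - x))) - _
      simp only [Matrix.cons_val_zero, Matrix.cons_val_one, map_add, map_one, map_sub, map_mul, map_div₀, sub_zero]
      field_simp
      ring
  have hcl : dRClass K ![(1 : ℂ)] ![algebraMap K ℂ b, algebraMap K ℂ (c - b)] 1 =
      (b * (c - b) / c / (1 + c)) • dRClass K _ _ (η₁ K ![1] rfl) := by
    have h1 := (Submodule.Quotient.eq _).mpr hex
    have h2 : (1 + c) • dRClass K ![(1 : ℂ)] ![algebraMap K ℂ b, algebraMap K ℂ (c - b)] 1 =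
        (b * (c - b) / c) • dRClass K _ _ (η₁ K ![1] rfl) := by
      rw [← map_smul, ← map_smul]
      exact h1
    rw [div_eq_inv_mul, mul_smul, ← h2, smul_smul, inv_mul_cancel₀ hc1, one_smul]
  rw [hm] at hsh
  exact hsh.trans ((congrArg (mot h.beta.M h.beta.φ₁) hcl).trans (mot_smul_right _ _ _ _))

theorem coaction_FMot (h : HypRealised K Q a b c y) (h' : HypRealised K Q (1 + a) (1 + b) (2 + c) y)
    (hy : y ≠ 0) (hb0 : b ≠ 0) (hc0 : c ≠ 0) (hcb0 : c - b ≠ 0) (hc1 : 1 + c ≠ 0)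
    (hF : coaction K Q h.calFMot = (b * (c - b) / c) • (h.calFMot ⊗ₜ[K] h.calFDR)
      - (y * (a * (c - a) / c)) • (h'.calFMot ⊗ₜ[K] h.calGDR hy))
    (hβ : coaction K Q h.betaMot = (b * (c - b) / c) • (h.betaMot ⊗ₜ[K] h.betaDR))
    (hu : IsUnit h.betaMot) (hu' : IsUnit h.betaDR) (hs : h'.betaMot = (b * (c - b) / c / (1 + c)) • h.betaMot) :
    coaction K Q h.FMot
      = h.FMot ⊗ₜ[K] h.FDR - (y / (1 + c)) • (h'.FMot ⊗ₜ[K] h.GDR hy) := by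
  have hκ : b * (c - b) / c ≠ 0 := div_ne_zero (mul_ne_zero hb0 hcb0) hc0
  have hu₁ : IsUnit h'.betaMot := by
    rw [hs, Algebra.smul_def]
    exact ((IsUnit.mk0 _ (div_ne_zero hκ hc1)).map _).mul hu
  have m1 : h.betaMot * h.FMot = h.calFMot := Ring.mul_inverse_cancel_left _ _ hu
  have m2 : h.betaDR * h.FDR = h.calFDR := Ring.mul_inverse_cancel_left _ _ hu'
  have m3 : h.betaDR * h.GDR hy = (a * (c - a) / c) • h.calGDR hy := by
    rw [GDR, mul_smul_comm, Ring.mul_inverse_cancel_left _ _ hu']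
  have m4 : (b * (c - b) / c / (1 + c)) • (h.betaMot * h'.FMot) = h'.calFMot := by
    rw [← smul_mul_assoc, ← hs]
    exact Ring.mul_inverse_cancel_left _ _ hu₁
  have e1 : (h.betaMot ⊗ₜ[K] h.betaDR) * (h.FMot ⊗ₜ[K] h.FDR) = h.calFMot ⊗ₜ[K] h.calFDR := by
    rw [Algebra.TensorProduct.tmul_mul_tmul, m1, m2]
  have e2 : (h.betaMot ⊗ₜ[K] h.betaDR) * (h'.FMot ⊗ₜ[K] h.GDR hy) =
      (a * (c - a) / c) • ((h.betaMot * h'.FMot) ⊗ₜ[K] h.calGDR hy) := by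
    rw [Algebra.TensorProduct.tmul_mul_tmul, m3, tmul_smul]
  -- The coaction is a ring homomorphism, so `Δβ` is a unit and both sides may be multiplied by it.
  -- In the second term the constant `b(c-b)/c` of `Δβ` is absorbed by `betaMot_shift`, leaving
  -- `1/(1 + c)`.
  refine (hu.map (coaction K Q)).mul_left_cancel ?_
  rw [← map_mul, m1, hF, hβ, smul_mul_assoc, mul_sub (h.betaMot ⊗ₜ[K] h.betaDR), e1, mul_smul_comm, e2, ← m4,
    ← smul_tmul', smul_sub, smul_smul, smul_smul, smul_smul]
  congr 2
  ring

end HypRealised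

end TwistedPeriods
end

/-! ### Verification of the genericity conditions and conclusion. -/

noncomputable section
namespace TwistedPeriods

open Complex

/-! ### Existence of the hypergeometric and beta objects -/

section subfields

variable {K Q : Subfield ℂ} {a b c y : K}

/-- If `1 - y x` were a non-positive real number for some `0 < x < 1`, then `y` would be real and at
least `1 / x > 1`, on the excluded cut. -/
theorem isCut_hypPunctures (hycut : ∀ t : ℝ, 1 < t → (y : ℂ) ≠ t) :
    IsCut (hypPunctures (algebraMap K ℂ y)) := by
  intro k x h0 h1
  fin_cases k
  · exact ofReal_mem_slitPlane.mpr h0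
  · change 1 - (x : ℂ) / 1 ∈ slitPlane
    rw [div_one, ← ofReal_one, ← ofReal_sub]
    exact ofReal_mem_slitPlane.mpr (by linarith)
  · change 1 - (x : ℂ) / (y : ℂ)⁻¹ ∈ slitPlane
    rw [div_inv_eq_mul, mem_slitPlane_iff]
    by_contra! h
    obtain ⟨h2, h3⟩ := h
    simp only [sub_re, one_re, re_ofReal_mul, sub_im, one_im, im_ofReal_mul, zero_sub, neg_eq_zero] at h2 h3
    have h4 : (y : ℂ).im = 0 := (mul_eq_zero.mp h3).resolve_left h0.ne'
    refine hycut (y : ℂ).re ?_ (Complex.ext rfl (by rw [h4, ofReal_im]))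
    by_contra! h5
    have := mul_le_mul_of_nonneg_left h5 h0.le
    linarith

theorem admissible_beta
    (hb' : exp (2 * Real.pi * I * b) ∈ Q) (hc' : exp (2 * Real.pi * I * c) ∈ Q)
    (hb : ∀ m : ℤ, (b : ℂ) ≠ m) (hc : ∀ m : ℤ, (c : ℂ) ≠ m) (hcb : ∀ m : ℤ, (c : ℂ) - b ≠ m) :
    Admissible K Q ![1] ![algebraMap K ℂ b, algebraMap K ℂ (c - b)] where
  inj i j h := by
    fin_cases i <;> fin_cases j
    · rfl
    · exact absurd (show (0 : ℂ) = 1 from h) zero_ne_one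
    · exact absurd (show (1 : ℂ) = 0 from h) one_ne_zero
    · rfl
  puncture_mem k := by
    fin_cases k
    · exact ⟨0, map_zero _⟩
    · exact ⟨1, map_one _⟩
  exponent_mem k := by
    fin_cases k
    · exact ⟨b, rfl⟩
    · exact ⟨c - b, rfl⟩
  monodromy_mem k := by
    fin_cases k
    · exact ⟨⟨_, hb'⟩, rfl⟩
    · refine ⟨⟨_, Q.div_mem hc' hb'⟩, ?_⟩
      change exp (2 * Real.pi * I * c) / exp (2 * Real.pi * I * b) = exp (2 * Real.pi * I * ((c : ℂ) - b))
      rw [mul_sub, exp_sub]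
  nonint k m := by
    fin_cases k
    · exact hb m
    · exact hcb m
  nonint_sum m := by
    rw [Fin.sum_univ_two]
    change (b : ℂ) + ((c : ℂ) - b) ≠ m
    rw [add_sub_cancel]
    exact hc m

theorem admissible_hyp (hy0 : (y : ℂ) ≠ 0) (hy1 : (y : ℂ) ≠ 1) (ha' : exp (2 * Real.pi * I * a) ∈ Q)
    (hb' : exp (2 * Real.pi * I * b) ∈ Q) (hc' : exp (2 * Real.pi * I * c) ∈ Q)
    (ha : ∀ m : ℤ, (a : ℂ) ≠ m) (hb : ∀ m : ℤ, (b : ℂ) ≠ m) (hca : ∀ m : ℤ, (c : ℂ) - a ≠ m)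
    (hcb : ∀ m : ℤ, (c : ℂ) - b ≠ m) :
    Admissible K Q (hypPunctures (algebraMap K ℂ y))
      ![algebraMap K ℂ b, algebraMap K ℂ (c - b), algebraMap K ℂ (-a)] where
  inj i j h := by
    have hyi : (y : ℂ)⁻¹ ≠ 0 := inv_ne_zero hy0
    have hyi1 : (y : ℂ)⁻¹ ≠ 1 := fun e => hy1 (inv_eq_one.mp e)
    fin_cases i <;> fin_cases j
    · rfl
    · exact absurd (show (0 : ℂ) = 1 from h) zero_ne_one
    · exact absurd (show (0 : ℂ) = (y : ℂ)⁻¹ from h) hyi.symm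
    · exact absurd (show (1 : ℂ) = 0 from h) one_ne_zero
    · rfl
    · exact absurd (show (1 : ℂ) = (y : ℂ)⁻¹ from h) hyi1.symm
    · exact absurd (show (y : ℂ)⁻¹ = 0 from h) hyi
    · exact absurd (show (y : ℂ)⁻¹ = 1 from h) hyi1
    · rfl
  puncture_mem k := by
    fin_cases k
    · exact ⟨0, map_zero _⟩
    · exact ⟨1, map_one _⟩
    · exact ⟨y⁻¹, map_inv₀ _ _⟩
  exponent_mem k := by
    fin_cases k
    · exact ⟨b, rfl⟩
    · exact ⟨c - b, rfl⟩
    · exact ⟨-a, rfl⟩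
  monodromy_mem k := by
    fin_cases k
    · exact ⟨⟨_, hb'⟩, rfl⟩
    · refine ⟨⟨_, Q.div_mem hc' hb'⟩, ?_⟩
      change exp (2 * Real.pi * I * c) / exp (2 * Real.pi * I * b) = exp (2 * Real.pi * I * ((c : ℂ) - b))
      rw [mul_sub, exp_sub]
    · refine ⟨⟨_, Q.inv_mem ha'⟩, ?_⟩
      change (exp (2 * Real.pi * I * a))⁻¹ = exp (2 * Real.pi * I * (-(a : ℂ)))
      rw [mul_neg, exp_neg]
  nonint k m := by
    fin_cases k
    · exact hb m
    · exact hcb m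
    · intro e
      refine ha (-m) ?_
      have e' : -(a : ℂ) = m := e
      rw [Int.cast_neg, ← e', neg_neg]
  nonint_sum m := by
    rw [Fin.sum_univ_three]
    change (b : ℂ) + ((c : ℂ) - b) + -(a : ℂ) ≠ m
    rw [add_sub_cancel, ← sub_eq_add_neg]
    exact hca m

theorem hypRealised (hycut : ∀ t : ℝ, 1 < t → (y : ℂ) ≠ t)
    (hA : Admissible K Q (hypPunctures (algebraMap K ℂ y))
      ![algebraMap K ℂ b, algebraMap K ℂ (c - b), algebraMap K ℂ (-a)])
    (hB : Admissible K Q ![1] ![algebraMap K ℂ b, algebraMap K ℂ (c - b)]) : HypRealised K Q a b c y where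
  hyp := isRealised hA (isCut_hypPunctures hycut) (j₁ := 1) rfl
  beta := isRealised hB isCut_one (j₁ := 1) rfl

end subfields

end TwistedPeriods
end

theorem mainTheorem6
    (k K Q : Subfield ℂ) (a b c y : K)
    (hK : K = k ⊔ Subfield.closure {(a : ℂ), (b : ℂ), (c : ℂ)})
    (hQ : Q = Subfield.closure
      {Complex.exp (2 * Real.pi * Complex.I * a), Complex.exp (2 * Real.pi * Complex.I * b),
        Complex.exp (2 * Real.pi * Complex.I * c)})
    (hyk : (y : ℂ) ∈ k) (hy0 : y ≠ 0) (hy1 : y ≠ 1)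
    (hycut : ∀ t : ℝ, 1 < t → (y : ℂ) ≠ t)
    (ha : ∀ m : ℤ, (a : ℂ) ≠ m) (hb : ∀ m : ℤ, (b : ℂ) ≠ m) (hc : ∀ m : ℤ, (c : ℂ) ≠ m)
    (hca : ∀ m : ℤ, (c : ℂ) - a ≠ m) (hcb : ∀ m : ℤ, (c : ℂ) - b ≠ m) :
    ∃ (h : TwistedPeriods.HypRealised K Q a b c y)
      (h' : TwistedPeriods.HypRealised K Q (1 + a) (1 + b) (2 + c) y),
      TwistedPeriods.coaction K Q h.calFMot
          = (b * (c - b) / c) • (h.calFMot ⊗ₜ[K] h.calFDR)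
            - (y * (a * (c - a) / c)) • (h'.calFMot ⊗ₜ[K] h.calGDR hy0) ∧
      IsUnit h.betaMot ∧ IsUnit h.betaDR ∧ IsUnit h'.betaMot ∧
      TwistedPeriods.coaction K Q h.FMot
          = h.FMot ⊗ₜ[K] h.FDR - (y / (1 + c)) • (h'.FMot ⊗ₜ[K] h.GDR hy0) := by
  have ha' : Complex.exp (2 * Real.pi * Complex.I * a) ∈ Q := hQ ▸ Subfield.subset_closure (by simp)
  have hb' : Complex.exp (2 * Real.pi * Complex.I * b) ∈ Q := hQ ▸ Subfield.subset_closure (by simp)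
  have hc' : Complex.exp (2 * Real.pi * Complex.I * c) ∈ Q := hQ ▸ Subfield.subset_closure (by simp)
  have hy0' : (y : ℂ) ≠ 0 := fun e => hy0 (Subtype.ext e)
  have hy1' : (y : ℂ) ≠ 1 := fun e => hy1 (Subtype.ext e)
  -- Integral shifts change neither the monodromies nor non-integrality, so the parameters `(1+a,
  -- 1+b, 2+c)` are realised over the same fields.
  have shift : ∀ {x : ℂ} (j : ℤ), Complex.exp (2 * Real.pi * Complex.I * x) ∈ Q →
      Complex.exp (2 * Real.pi * Complex.I * (j + x)) ∈ Q := fun {x} j hx => by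
    have e : Complex.exp (2 * Real.pi * Complex.I * j) = 1 := Complex.exp_eq_one_iff.mpr ⟨j, by ring⟩
    rwa [mul_add, Complex.exp_add, e, one_mul]
  have nonint : ∀ {x z : ℂ} (j : ℤ), (∀ m : ℤ, x ≠ m) → z = j + x → ∀ m : ℤ, z ≠ m := fun j hx hz m e =>
    hx (m - j) (by rw [Int.cast_sub, ← e, hz, add_sub_cancel_left])
  have hA := TwistedPeriods.admissible_hyp hy0' hy1' ha' hb' hc' ha hb hca hcb
  have hB := TwistedPeriods.admissible_beta hb' hc' hb hc hcb
  have ea : ((1 + a : K) : ℂ) = (1 : ℤ) + (a : ℂ) := by simp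
  have eb : ((1 + b : K) : ℂ) = (1 : ℤ) + (b : ℂ) := by simp
  have ec : ((2 + c : K) : ℂ) = (2 : ℤ) + (c : ℂ) := by
    rw [Int.cast_ofNat]
    rfl
  have ha₁ : Complex.exp (2 * Real.pi * Complex.I * (1 + a : K)) ∈ Q := by
    rw [ea]
    exact shift 1 ha'
  have hb₁ : Complex.exp (2 * Real.pi * Complex.I * (1 + b : K)) ∈ Q := by
    rw [eb]
    exact shift 1 hb'
  have hc₁ : Complex.exp (2 * Real.pi * Complex.I * (2 + c : K)) ∈ Q := by
    rw [ec]
    exact shift 2 hc'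
  have hcb₁ := nonint (z := ((2 + c : K) : ℂ) - (1 + b : K)) 1 hcb (by
    rw [ec, eb]
    push_cast
    ring)
  have hA' := TwistedPeriods.admissible_hyp hy0' hy1' ha₁ hb₁ hc₁ (nonint 1 ha ea) (nonint 1 hb eb)
    (nonint (z := ((2 + c : K) : ℂ) - (1 + a : K)) 1 hca (by
      rw [ec, ea]
      push_cast
      ring)) hcb₁
  have hB' := TwistedPeriods.admissible_beta hb₁ hc₁ (nonint 1 hb eb) (nonint 2 hc ec) hcb₁
  have ha0 : a ≠ 0 := fun e => ha 0 (by rw [e]; simp)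
  have hb0 : b ≠ 0 := fun e => hb 0 (by rw [e]; simp)
  have hc0 : c ≠ 0 := fun e => hc 0 (by rw [e]; simp)
  have hc1 : 1 + c ≠ 0 := fun e => hc (-1) (by rw [eq_neg_of_add_eq_zero_right e]; simp)
  have hca0 : c - a ≠ 0 := fun e => hca 0 (by rw [sub_eq_zero.mp e]; simp)
  have hcb0 : c - b ≠ 0 := fun e => hcb 0 (by rw [sub_eq_zero.mp e]; simp)
  have h := TwistedPeriods.hypRealised hycut hA hB
  have h' := TwistedPeriods.hypRealised hycut hA' hB'
  have hF := h.coaction_calFMot h' hA hy0 ha0 hb0 hc0 hca0 hcb0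
  have hu := h.isUnit_betaMot hB hb0 hc0 hcb0
  have hu' := h.isUnit_betaDR hB hb0 hc0 hcb0
  have hs := h.betaMot_shift h' hB hc0 hc1
  refine ⟨h, h', hF, hu, hu', ?_,
    h.coaction_FMot h' hy0 hb0 hc0 hcb0 hc1 hF (h.coaction_betaMot hB hb0 hc0 hcb0) hu hu' hs⟩
  rw [hs, Algebra.smul_def]
  exact ((IsUnit.mk0 _ (div_ne_zero (div_ne_zero (mul_ne_zero hb0 hcb0) hc0) hc1)).map _).mul hu
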